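/- Fix integers $N\ge 1$, $M\ge 0$. Let $\widehat O$ be the algebra of power series in $b^1,\dots,b^N$ converging near $0\in\mathbb C^N$. Let $G$ be the group of $N$-tuples $g=(g^1,\dots,g^N)$, $g^i\in\widehat O$, with $g(0)=0$ and invertible Jacobian matrix $\partial g=(\partial_i g^j)$, with $(g_1g_2)^i(b)=g_2^i(g_1(b))$; write $f_g(b)=f(g(b))$. Let $H=G\ltimes GL_M(\widehat O)$, with $(g_1,A_1)(g_2,A_2)=(g_1g_2,\,A_1\,(A_2)_{g_1})$. Let $H$ act on differential forms over $\widehat O$ by $(g,A)\cdot\omega=g^*\omega$; $\Omega^{i,cl}_{\widehat O}$ denotes the closed $i$-forms. Let $D_\Lambda$ be the vertex superalgebra freely generated by even fields $b^i(z),a^i(z)$ ($1\le i\le N$) and odd fields $\phi^j(z),\psi^j(z)$ ($1\le j\le M$), of conformal weights $0,1,0,1$, with OPE $a^i(z)b^j(w)\sim\delta_{ij}/(z-w)$, $\psi^i(z)\phi^j(w)\sim\delta_{ij}/(z-w)$, the other products being trivial, and let $\widehat D_\Lambda=\widehat O\otimes_{\mathbb C[b^1,\dots,b^N]}D_\Lambda$.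 An automorphism of the vertex superalgebra $\widehat D_\Lambda$ is *admissible* if there are $(g,A)\in H$ and $h\in Mat_N(\widehat O)$ such that it acts on $\widehat O$ by $f\mapsto f_g$ (so $b^i(z)\mapsto g^i(b)(z)$) and (summing over repeated indices, with $c=((\partial g)^{-1})^t$) $$a^i\mapsto a^jc^{ji}-\psi^p\phi^qA^{qs}c^{ki}\partial_k(A^{-1})^{sp}+(b^j)'h^{ji},\qquad \phi^i\mapsto\phi^jA^{ji},\qquad \psi^i\mapsto\psi^j(A^{-1})^{ij}.$$ *Universal Chern classes.* Let $\rho$ be one of the maps $\rho(g,A)=\partial g$ (giving $c_i$) or $\rho(g,A)=A$ (giving $c_i'$); then $\rho(xy)=\rho(x)\,x^*\rho(y)$. Put $\omega_x=\rho(x)^{-1}d\rho(x)$, $\eta_{x,y}=x^*(d\rho(y)\,\rho(y)^{-1})$. The first Chern class in $H^1(H;\Omega^{1,cl}_{\widehat O})$ is the class of $x\mapsto d\log\det\rho(x)=tr\,\omega_x$; its square in $H^2(H;\Omega^{2,cl}_{\widehat O})$ is the class of $(x,y)\mapsto tr\,\omega_x\wedge tr\,\eta_{x,y}$. The second Chern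 class in $H^2(H;\Omega^{2,cl}_{\widehat O})$ is the class of $$(x,y)\mapsto\tfrac12\bigl(tr\,\omega_x\wedge tr\,\eta_{x,y}-tr(\omega_x\wedge\eta_{x,y})\bigr)+\tfrac12\bigl(x^*\kappa(y)-\kappa(xy)+\kappa(x)\bigr),$$ where $\kappa:H\to\Omega^2_{\widehat O}$ is any map with $d\kappa(x)=\tfrac13tr(\omega_x^3)$; such $\kappa$ exist, the displayed cochain is a cocycle with closed values, and its class does not depend on $\kappa$. **Proposition.** The admissible automorphisms of $\widehat D_\Lambda$ form a group $\tilde H$ under composition. It is included in a group extension $$0\longrightarrow\Omega^{2,cl}_{\widehat O}\longrightarrow\tilde H\longrightarrow H\longrightarrow 1,$$ in which the automorphism with data $(g,A,h)$ is mapped to $(g,A)$, the form $\omega=\sum_{i,j}h^{ij}db^i\wedge db^j$ ($h$ skew-symmetric) is mapped to the automorphism with data $(1,1,h)$, and conjugation induces on $\Omega^{2,cl}_{\widehat O}$ the above action of $H$. The cohomology class of this extension is $$(c_1^2-2c_2)-(c_1'^2-2c_2')\in H^2(H;\Omega^{2,cl}_{\widehat O}),$$ and its image in $H^2(H;\Omega^2_{\widehat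 O})$ is the class of the skew symmetrization of the cocycle $$\epsilon(g_1,A_1;g_2,A_2)=tr\{\partial g_1^{-1}\,d\partial g_1\otimes g_1^*(d\partial g_2\cdot\partial g_2^{-1})\}-tr\{A_1^{-1}dA_1\otimes g_1^*(dA_2\cdot A_2^{-1})\},$$ i.e. of $\epsilon$ with $\otimes$ replaced by $\wedge$. -/

import Mathlib

open scoped TensorProduct Topology Matrix MatrixGroups

noncomputable section

namespace ChiralDO

/-! ### The algebra of convergent power series and its derivations -/

/-- Functions on `ℂ^N` that are holomorphic in a neighbourhood of the origin. -/
def holo (N : ℕ) : Subalgebra ℂ ((Fin N → ℂ) → ℂ) where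
  carrier := {F | AnalyticAt ℂ F 0}
  mul_mem' hF hG := AnalyticAt.mul hF hG
  add_mem' hF hG := AnalyticAt.add hF hG
  algebraMap_mem' _ := analyticAt_const

/-- Functions that vanish in a neighbourhood of the origin. -/
def nullIdeal (N : ℕ) : Ideal (holo N) where
  carrier := {F | F.1 =ᶠ[𝓝 0] 0}
  add_mem' := by
    intro F G hF hG
    filter_upwards [hF, hG] with x h1 h2
    simp [h1, h2]
  zero_mem' := Filter.EventuallyEq.rfl
  smul_mem' := by
    intro c F hF
    filter_upwards [hF] with x h1
    simp [h1]

/-- `Ô`: the `ℂ`-algebra of germs at the origin of holomorphic functions on `ℂ^N`, i.e. of power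
series in `b^1, …, b^N` that converge in some neighbourhood of the origin. -/
def Ohat (N : ℕ) : Type := holo N ⧸ nullIdeal N

instance (N : ℕ) : CommRing (Ohat N) := inferInstanceAs (CommRing (holo N ⧸ nullIdeal N))
instance (N : ℕ) : Algebra ℂ (Ohat N) := inferInstanceAs (Algebra ℂ (holo N ⧸ nullIdeal N))

namespace Ohat

variable {N : ℕ}

/-- The germ of a holomorphic function. -/
def germ : holo N →ₐ[ℂ] Ohat N := Ideal.Quotient.mkₐ ℂ (nullIdeal N)

theorem germ_surjective : Function.Surjective (germ (N := N)) :=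
  Ideal.Quotient.mkₐ_surjective ℂ (nullIdeal N)

theorem germ_eq {F G : holo N} : germ F = germ G ↔ F.1 =ᶠ[𝓝 0] G.1 := by
  have h : germ F = germ G ↔ F - G ∈ nullIdeal N := Ideal.Quotient.eq
  rw [h]
  constructor
  · intro h
    have h' : (F - G).1 =ᶠ[𝓝 0] 0 := h
    filter_upwards [h'] with x hx
    exact sub_eq_zero.mp hx
  · intro h
    change (F - G).1 =ᶠ[𝓝 0] 0
    filter_upwards [h] with x hx
    exact sub_eq_zero.mpr hx

/-- A holomorphic function representing a germ. -/
def rep (f : Ohat N) : holo N := (germ_surjective f).choose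

@[simp] theorem germ_rep (f : Ohat N) : germ (rep f) = f := (germ_surjective f).choose_spec

theorem rep_germ (F : holo N) : (rep (germ F)).1 =ᶠ[𝓝 0] F.1 := germ_eq.mp (germ_rep _)

theorem rep_analytic (f : Ohat N) : AnalyticAt ℂ (rep f).1 0 := (rep f).2

/-- The value of a germ at the origin. -/
def eval0 : Ohat N →+* ℂ :=
  Ideal.Quotient.lift (nullIdeal N) ((Pi.evalRingHom (fun _ : Fin N → ℂ => ℂ) 0).comp
    (holo N).val.toRingHom) (fun F hF => by
      have h : F.1 =ᶠ[𝓝 0] 0 := hF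
      exact h.self_of_nhds)

@[simp] theorem eval0_germ (F : holo N) : eval0 (germ F) = F.1 0 := rfl

theorem eval0_eq (f : Ohat N) : eval0 f = (rep f).1 0 := by
  conv_lhs => rw [← germ_rep f]
  rfl

/-- The coordinate function `b^i`. -/
def coord (i : Fin N) : Ohat N :=
  germ ⟨fun x => x i, (ContinuousLinearMap.proj (R := ℂ) (φ := fun _ : Fin N => ℂ) i).analyticAt 0⟩

/-- The partial derivative of a holomorphic function. -/
def pdFun (i : Fin N) (F : holo N) : holo N :=
  ⟨fun x => fderiv ℂ F.1 x (Pi.single i 1),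
    by
      let ev : ((Fin N → ℂ) →L[ℂ] ℂ) →L[ℂ] ℂ := ContinuousLinearMap.apply ℂ ℂ (Pi.single i (1 : ℂ))
      have h : AnalyticAt ℂ (fderiv ℂ F.1) 0 := AnalyticAt.fderiv F.2
      exact (ev.analyticAt _).comp h⟩

theorem pdFun_congr (i : Fin N) {F G : holo N} (h : F.1 =ᶠ[𝓝 0] G.1) :
    (pdFun i F).1 =ᶠ[𝓝 0] (pdFun i G).1 := by
  filter_upwards [h.fderiv (𝕜 := ℂ)] with x hx
  simp [pdFun, hx]

theorem eventually_differentiableAt (F : holo N) : ∀ᶠ x in 𝓝 0, DifferentiableAt ℂ F.1 x := by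
  filter_upwards [AnalyticAt.eventually_analyticAt F.2] with x hx
  exact hx.differentiableAt

/-- The partial derivative `∂_i = ∂/∂b^i` as a derivation of `Ô`. -/
def pd (i : Fin N) : Derivation ℂ (Ohat N) (Ohat N) :=
  Derivation.mk'
    { toFun := fun f => germ (pdFun i (rep f))
      map_add' := by
        intro f g
        rw [← map_add, germ_eq]
        have h : (rep (f + g)).1 =ᶠ[𝓝 0] (rep f + rep g).1 := by
          rw [← germ_eq]; simp
        refine (pdFun_congr i h).trans ?_
        filter_upwards [eventually_differentiableAt (rep f),
          eventually_differentiableAt (rep g)] with x h1 h2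
        simp [pdFun, fderiv_add h1 h2]
      map_smul' := by
        intro c f
        simp only [RingHom.id_apply]
        rw [← map_smul, germ_eq]
        have h : (rep (c • f)).1 =ᶠ[𝓝 0] (c • rep f).1 := by
          rw [← germ_eq]; simp
        refine (pdFun_congr i h).trans ?_
        filter_upwards [eventually_differentiableAt (rep f)] with x h1
        simp [pdFun, fderiv_const_smul h1] }
    (by
      intro f g
      change germ (pdFun i (rep (f * g))) = f • germ (pdFun i (rep g)) + g • germ (pdFun i (rep f))
      have h : (rep (f * g)).1 =ᶠ[𝓝 0] (rep f * rep g).1 := by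
        rw [← germ_eq]; simp
      have e : germ (pdFun i (rep (f * g))) = germ (rep f * pdFun i (rep g) + rep g * pdFun i (rep f)) := by
        rw [germ_eq]
        refine (pdFun_congr i h).trans ?_
        filter_upwards [eventually_differentiableAt (rep f),
          eventually_differentiableAt (rep g)] with x h1 h2
        simp [pdFun, fderiv_mul h1 h2]
      rw [e]
      simp [smul_eq_mul])

theorem pd_germ (i : Fin N) (F : holo N) : pd i (germ F) = germ (pdFun i F) := by
  change germ (pdFun i (rep (germ F))) = _
  rw [germ_eq]
  exact pdFun_congr i (rep_germ F)

theorem pd_comm (i j : Fin N) (f : Ohat N) : pd i (pd j f) = pd j (pd i f) := by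
  obtain ⟨F, rfl⟩ := germ_surjective f
  rw [pd_germ, pd_germ, pd_germ, pd_germ, germ_eq]
  filter_upwards [AnalyticAt.eventually_analyticAt F.2] with x hx
  have hd : DifferentiableAt ℂ (fderiv ℂ F.1) x := hx.fderiv.differentiableAt
  have key : ∀ k l : Fin N, (pdFun k (pdFun l F)).1 x
      = fderiv ℂ (fderiv ℂ F.1) x (Pi.single k 1) (Pi.single l 1) := by
    intro k l
    change fderiv ℂ (fun y => fderiv ℂ F.1 y (Pi.single l 1)) x (Pi.single k 1) = _
    rw [fderiv_clm_apply hd (differentiableAt_const _)]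
    simp
  rw [key, key]
  have hs : IsSymmSndFDerivAt ℂ F.1 x :=
    ContDiffAt.isSymmSndFDerivAt (n := ⊤) hx.contDiffAt (by simp)
  exact hs.eq _ _

end Ohat

/-! ### The group of coordinate changes -/

open Ohat

/-- An `N`-tuple of germs `g = (g^1, …, g^N)` with `g(0) = 0`. -/
structure Subst (N : ℕ) where
  /-- The components `g^i(b)`. -/
  comp : Fin N → Ohat N
  zero : ∀ i, eval0 (comp i) = 0

namespace Subst

variable {N : ℕ}

/-- The Jacobian matrix `∂g = (∂_i g^j)`. -/
def jac (g : Subst N) : Matrix (Fin N) (Fin N) (Ohat N) := Matrix.of fun i j => pd i (g.comp j)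

/-- A holomorphic map representing `g`. -/
def repFun (g : Subst N) : (Fin N → ℂ) → (Fin N → ℂ) := fun x i => (rep (g.comp i)).1 x

theorem repFun_analytic (g : Subst N) : AnalyticAt ℂ g.repFun 0 :=
  AnalyticAt.pi fun i => rep_analytic (g.comp i)

theorem repFun_zero (g : Subst N) : g.repFun 0 = 0 := by
  funext i
  have := g.zero i
  rwa [eval0_eq] at this

theorem repFun_tendsto (g : Subst N) : Filter.Tendsto g.repFun (𝓝 0) (𝓝 0) := by
  have h := g.repFun_analytic.continuousAt
  rw [ContinuousAt, g.repFun_zero] at h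
  exact h

/-- Composition of a holomorphic function with `g`. -/
def pullFun (g : Subst N) (F : holo N) : holo N :=
  ⟨F.1 ∘ g.repFun, by
    have hF : AnalyticAt ℂ F.1 (g.repFun 0) := by rw [g.repFun_zero]; exact F.2
    exact hF.comp g.repFun_analytic⟩

/-- The substitution `h ↦ h_g`, `h_g(b) = h(g(b))`. -/
def pull (g : Subst N) : Ohat N →ₐ[ℂ] Ohat N :=
  Ideal.Quotient.liftₐ (nullIdeal N)
    { toFun := fun F => germ (g.pullFun F)
      map_one' := rfl
      map_zero' := rfl
      map_mul' := fun _ _ => rfl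
      map_add' := fun _ _ => rfl
      commutes' := fun _ => rfl }
    (fun F hF => by
      have h : F.1 =ᶠ[𝓝 0] 0 := hF
      change germ (g.pullFun F) = 0
      rw [← map_zero germ, germ_eq]
      exact g.repFun_tendsto.eventually h)

theorem pull_germ (g : Subst N) (F : holo N) : g.pull (germ F) = germ (g.pullFun F) := rfl

theorem pull_coord (g : Subst N) (i : Fin N) : g.pull (coord i) = g.comp i := by
  conv_rhs => rw [← germ_rep (g.comp i)]
  rfl

theorem eval0_pull (g : Subst N) (f : Ohat N) : eval0 (g.pull f) = eval0 f := by
  obtain ⟨F, rfl⟩ := germ_surjective f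
  rw [pull_germ, eval0_germ, eval0_germ]
  change F.1 (g.repFun 0) = _
  rw [repFun_zero]

theorem fderiv_eq_sum {L : (Fin N → ℂ) →L[ℂ] ℂ} (v : Fin N → ℂ) :
    L v = ∑ j, v j * L (Pi.single j 1) := by
  conv_lhs => rw [← Finset.univ_sum_single v]
  rw [map_sum]
  refine Finset.sum_congr rfl fun j _ => ?_
  have : (Pi.single j (v j) : Fin N → ℂ) = v j • Pi.single j (1 : ℂ) := by
    rw [← Pi.single_smul]; simp
  rw [this, map_smul, smul_eq_mul]

/-- The chain rule. -/
theorem pd_pull (g : Subst N) (i : Fin N) (f : Ohat N) :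
    pd i (g.pull f) = ∑ j, g.jac i j * g.pull (pd j f) := by
  obtain ⟨F, rfl⟩ := germ_surjective f
  have hj : ∀ j, g.jac i j = germ (pdFun i (rep (g.comp j))) := fun j => rfl
  simp only [pd_germ, pull_germ, hj]
  have e : (∑ j, germ (pdFun i (rep (g.comp j))) * germ (g.pullFun (pdFun j F)))
      = germ (∑ j, pdFun i (rep (g.comp j)) * g.pullFun (pdFun j F)) := by
    simp
  rw [e, germ_eq]
  have h2 : ∀ᶠ x in 𝓝 0, DifferentiableAt ℂ F.1 (g.repFun x) :=
    g.repFun_tendsto.eventually (eventually_differentiableAt F)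
  have h3 : ∀ᶠ x in 𝓝 0, ∀ j, DifferentiableAt ℂ (rep (g.comp j)).1 x :=
    Filter.eventually_all.mpr fun j => eventually_differentiableAt _
  filter_upwards [h2, h3] with x hx h3x
  have hg : HasFDerivAt g.repFun
      (ContinuousLinearMap.pi fun j => fderiv ℂ (rep (g.comp j)).1 x) x :=
    hasFDerivAt_pi.mpr fun j => (h3x j).hasFDerivAt
  have hc := (hx.hasFDerivAt).comp x hg
  have hL : (pdFun i (g.pullFun F)).1 x = fderiv ℂ (F.1 ∘ g.repFun) x (Pi.single i 1) := rfl
  rw [hL, hc.fderiv, ContinuousLinearMap.comp_apply, fderiv_eq_sum]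
  simp [pdFun, pullFun]

/-- The identity tuple `(b^1, …, b^N)`. -/
def id (N : ℕ) : Subst N := ⟨coord, fun _ => rfl⟩

/-- The composition `(g₁ g₂)^i(b) = g₂^i(g₁(b))`. -/
def comp' (g₁ g₂ : Subst N) : Subst N :=
  ⟨fun i => g₁.pull (g₂.comp i), fun i => by rw [eval0_pull, g₂.zero]⟩

theorem pull_congr {g : Subst N} {F : holo N} {u : (Fin N → ℂ) → (Fin N → ℂ)}
    (hu : u =ᶠ[𝓝 0] g.repFun) {G : holo N} (hG : G.1 =ᶠ[𝓝 0] F.1 ∘ u) : g.pull (germ F) = germ G := by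
  rw [pull_germ, germ_eq]
  refine Filter.EventuallyEq.trans ?_ hG.symm
  filter_upwards [hu] with x hx
  simp [pullFun, hx]

theorem repFun_comp' (g₁ g₂ : Subst N) :
    g₂.repFun ∘ g₁.repFun =ᶠ[𝓝 0] (comp' g₁ g₂).repFun := by
  have h : ∀ i, (rep ((comp' g₁ g₂).comp i)).1 =ᶠ[𝓝 0] (g₁.pullFun (rep (g₂.comp i))).1 := by
    intro i
    rw [← germ_eq, germ_rep, ← pull_germ, germ_rep]
    rfl
  filter_upwards [Filter.eventually_all.mpr h] with x hx
  funext i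
  exact (hx i).symm

theorem pull_comp' (g₁ g₂ : Subst N) (f : Ohat N) :
    (comp' g₁ g₂).pull f = g₁.pull (g₂.pull f) := by
  obtain ⟨F, rfl⟩ := germ_surjective f
  exact pull_congr (repFun_comp' g₁ g₂) (Filter.EventuallyEq.rfl)

theorem repFun_id (N : ℕ) : (fun x => x) =ᶠ[𝓝 0] (id N).repFun := by
  have h : ∀ i, (rep ((id N).comp i)).1 =ᶠ[𝓝 0] fun x => x i := fun i => rep_germ _
  filter_upwards [Filter.eventually_all.mpr h] with x hx
  funext i
  exact (hx i).symm

theorem pull_id (f : Ohat N) : (id N).pull f = f := by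
  obtain ⟨F, rfl⟩ := germ_surjective f
  exact pull_congr (repFun_id N) (Filter.EventuallyEq.rfl)

@[ext] theorem ext {g₁ g₂ : Subst N} (h : ∀ i, g₁.comp i = g₂.comp i) : g₁ = g₂ := by
  cases g₁; cases g₂
  congr
  exact funext h

/-- `∂(g₁ g₂) = ∂g₁ · (∂g₂)_{g₁}`. -/
theorem jac_comp' (g₁ g₂ : Subst N) :
    (comp' g₁ g₂).jac = g₁.jac * g₂.jac.map g₁.pull := by
  ext i j
  change pd i (g₁.pull (g₂.comp j)) = _
  rw [pd_pull, Matrix.mul_apply]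
  rfl

theorem jac_id : (id N).jac = 1 := by
  ext i j
  change pd i (coord j) = _
  rw [coord, pd_germ]
  have : pdFun i ⟨fun x : Fin N → ℂ => x j,
      (ContinuousLinearMap.proj (R := ℂ) (φ := fun _ : Fin N => ℂ) j).analyticAt 0⟩
      = algebraMap ℂ (holo N) ((1 : Matrix (Fin N) (Fin N) ℂ) i j) := by
    ext x
    change fderiv ℂ (ContinuousLinearMap.proj (R := ℂ) (φ := fun _ : Fin N => ℂ) j) x
      (Pi.single i 1) = (1 : Matrix (Fin N) (Fin N) ℂ) i j
    rw [ContinuousLinearMap.fderiv]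
    simp [Matrix.one_apply, Pi.single_apply, eq_comm]
  rw [this, AlgHom.commutes]
  by_cases h : i = j <;> simp [h, Matrix.one_apply]

/-- The inverse function theorem: a tuple with invertible Jacobian matrix has an inverse. -/
theorem exists_inv (g : Subst N) (hg : IsUnit g.jac) :
    ∃ k : Subst N, comp' k g = id N ∧ IsUnit k.jac := by
  set J : Matrix (Fin N) (Fin N) ℂ := g.jac.map eval0 with hJ
  have hJu : IsUnit J := hg.map (RingHom.mapMatrix (eval0 (N := N)))
  set L : (Fin N → ℂ) →L[ℂ] (Fin N → ℂ) := fderiv ℂ g.repFun 0 with hL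
  have hd : ∀ i, DifferentiableAt ℂ (rep (g.comp i)).1 0 :=
    fun i => (rep_analytic _).differentiableAt
  have hLJ : ∀ v j, L v j = (Jᵀ.mulVec v) j := by
    intro v j
    have h0 : L = ContinuousLinearMap.pi fun j => fderiv ℂ (rep (g.comp j)).1 0 :=
      (hasFDerivAt_pi.mpr fun j => (hd j).hasFDerivAt).fderiv
    rw [h0]
    change fderiv ℂ (rep (g.comp j)).1 0 v = _
    rw [fderiv_eq_sum]
    simp only [Matrix.mulVec, dotProduct, Matrix.transpose_apply]
    refine Finset.sum_congr rfl fun k _ => ?_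
    rw [mul_comm]
    rfl
  have hbij : Function.Bijective L := by
    have : Function.Bijective (Jᵀ.mulVec) := by
      have hT : IsUnit Jᵀ := (Matrix.isUnit_transpose J).mpr hJu
      exact ⟨Matrix.mulVec_injective_iff_isUnit.mpr hT, Matrix.mulVec_surjective_iff_isUnit.mpr hT⟩
    have h : (L : (Fin N → ℂ) → (Fin N → ℂ)) = Jᵀ.mulVec := funext fun v => funext fun j => hLJ v j
    rw [h]; exact this
  let Le : (Fin N → ℂ) ≃L[ℂ] (Fin N → ℂ) :=
    (LinearEquiv.ofBijective L.toLinearMap hbij).toContinuousLinearEquiv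
  have hLe : (Le : (Fin N → ℂ) →L[ℂ] (Fin N → ℂ)) = L := by
    ext v; rfl
  have hfd : HasFDerivAt g.repFun (Le : (Fin N → ℂ) →L[ℂ] (Fin N → ℂ)) 0 := by
    rw [hLe]; exact g.repFun_analytic.differentiableAt.hasFDerivAt
  have hcd : ContDiffAt ℂ ⊤ g.repFun 0 := g.repFun_analytic.contDiffAt
  have hn : (⊤ : WithTop ℕ∞) ≠ 0 := by simp
  set u := hcd.localInverse hfd hn with hu
  have hua : AnalyticAt ℂ u 0 := by
    have h := hcd.to_localInverse hfd hn
    rw [g.repFun_zero] at h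
    rw [← contDiffWithinAt_univ, contDiffWithinAt_omega_iff_analyticWithinAt,
      analyticWithinAt_univ] at h
    exact h
  have hst := hcd.hasStrictFDerivAt' hfd hn
  have hu0 : u 0 = 0 := by
    have h := hst.localInverse_apply_image
    rwa [g.repFun_zero] at h
  have hri : ∀ᶠ x in 𝓝 0, g.repFun (u x) = x := by
    have h := hst.eventually_right_inverse
    rwa [g.repFun_zero] at h
  have hui : ∀ i, AnalyticAt ℂ (fun x => u x i) 0 := fun i => analyticAt_pi_iff.mp hua i
  let k : Subst N := ⟨fun i => germ ⟨fun x => u x i, hui i⟩, fun i => by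
    rw [eval0_germ]; exact congrFun hu0 i⟩
  have hku : u =ᶠ[𝓝 0] k.repFun := by
    have h : ∀ i, (rep (k.comp i)).1 =ᶠ[𝓝 0] fun x => u x i := fun i => rep_germ _
    filter_upwards [Filter.eventually_all.mpr h] with x hx
    funext i
    exact (hx i).symm
  have hkg : comp' k g = id N := by
    ext i
    change k.pull (g.comp i) = coord i
    rw [← germ_rep (g.comp i)]
    refine pull_congr hku ?_
    filter_upwards [hri] with x hx
    exact (congrFun hx i).symm
  refine ⟨k, hkg, ?_⟩
  have h1 := jac_comp' k g
  rw [hkg, jac_id] at h1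
  exact IsUnit.of_mul_eq_one _ h1.symm

end Subst

/-- The group `G` of coordinate changes: `N`-tuples `g = (g^1, …, g^N)` of germs, fixing the
origin, with invertible Jacobian matrix. -/
structure CoordChange (N : ℕ) extends Subst N where
  nondeg : IsUnit toSubst.jac

namespace CoordChange

variable {N : ℕ}

theorem toSubst_injective : Function.Injective (toSubst (N := N)) := by
  intro a b h; cases a; cases b; congr

instance : Mul (CoordChange N) where
  mul g₁ g₂ := ⟨Subst.comp' g₁.toSubst g₂.toSubst, by
    rw [Subst.jac_comp']
    exact g₁.nondeg.mul (g₂.nondeg.map (RingHom.mapMatrix g₁.toSubst.pull.toRingHom))⟩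

instance : One (CoordChange N) where
  one := ⟨Subst.id N, by rw [Subst.jac_id]; exact isUnit_one⟩

instance : Inv (CoordChange N) where
  inv g := ⟨(g.toSubst.exists_inv g.nondeg).choose, (g.toSubst.exists_inv g.nondeg).choose_spec.2⟩

/-- The group law is `(g₁ g₂)^i(b) = g₂^i(g₁(b))`. -/
instance : Group (CoordChange N) :=
  Group.ofLeftAxioms
    (by
      intro a b c
      apply toSubst_injective
      ext i
      exact Subst.pull_comp' a.toSubst b.toSubst (c.comp i))
    (by
      intro a
      apply toSubst_injective
      ext i
      exact Subst.pull_id (a.comp i))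
    (by
      intro a
      apply toSubst_injective
      exact (a.toSubst.exists_inv a.nondeg).choose_spec.1)

theorem mul_comp (g₁ g₂ : CoordChange N) (i : Fin N) :
    (g₁ * g₂).comp i = g₁.pull (g₂.comp i) := rfl

theorem jac_mul (g₁ g₂ : CoordChange N) :
    (g₁ * g₂).jac = g₁.jac * g₂.jac.map g₁.pull := Subst.jac_comp' _ _

theorem jac_one : (1 : CoordChange N).jac = 1 := Subst.jac_id

theorem pull_mul (g₁ g₂ : CoordChange N) (f : Ohat N) :
    (g₁ * g₂).pull f = g₁.pull (g₂.pull f) := Subst.pull_comp' _ _ f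

theorem pull_one (f : Ohat N) : (1 : CoordChange N).pull f = f := Subst.pull_id f

/-- `G` acts on `Ô` by `g · h = h_g`. -/
def pullAut : CoordChange N →* (Ohat N ≃ₐ[ℂ] Ohat N) where
  toFun g := AlgEquiv.ofAlgHom g.pull g⁻¹.pull
    (by ext f; change g.pull (g⁻¹.pull f) = f; rw [← pull_mul, mul_inv_cancel, pull_one])
    (by ext f; change g⁻¹.pull (g.pull f) = f; rw [← pull_mul, inv_mul_cancel, pull_one])
  map_one' := by ext f; exact pull_one f
  map_mul' g₁ g₂ := by ext f; exact pull_mul g₁ g₂ f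

/-- The induced action of `G` on `GL_r(Ô)`, entry by entry. -/
def pullGL (N r : ℕ) : CoordChange N →* MulAut (GL (Fin r) (Ohat N)) where
  toFun g := Units.mapEquiv (RingEquiv.mapMatrix (pullAut g).toRingEquiv).toMulEquiv
  map_one' := by
    ext A i j
    exact pull_one (A.1 i j)
  map_mul' g₁ g₂ := by
    ext A i j
    exact pull_mul g₁ g₂ (A.1 i j)

/-- The Jacobian matrix of `g` as an element of `GL_N(Ô)`. -/
def jacGL (g : CoordChange N) : GL (Fin N) (Ohat N) := g.nondeg.unit

end CoordChange

/-- The group `H`: the semidirect product of `G` and the group of invertible `M × M` matrices over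
`Ô`. The group law is `(g₁, A₁)(g₂, A₂) = (g₁ g₂, A₁ (A₂)_{g₁})`; the components of `x` are
`x.right : G` and `x.left : GL_M(Ô)`. -/
abbrev HGroup (N M : ℕ) : Type :=
  GL (Fin M) (Ohat N) ⋊[CoordChange.pullGL N M] CoordChange N

/-! ### Differential forms

A `1`-form `Σ α_i db^i` is given by the vector `(α_i)`, and a `2`-form
`Σ_{i<j} ω_{ij} db^i ∧ db^j = (1/2) Σ_{i,j} ω_{ij} db^i ∧ db^j` by the skew-symmetric matrix
`(ω_{ij})`, `ω_{ij} = ω(∂_i, ∂_j)`. -/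

open CoordChange

variable {N M r : ℕ}

/-- The exterior derivative of a `2`-form:
`(dω)_{ijk} = ∂_i ω_{jk} + ∂_j ω_{ki} + ∂_k ω_{ij}`. -/
def extD2 (ω : Matrix (Fin N) (Fin N) (Ohat N)) (i j k : Fin N) : Ohat N :=
  pd i (ω j k) + pd j (ω k i) + pd k (ω i j)

/-- `Ω^{1,cl}`: closed `1`-forms. -/
def Omega1cl (N : ℕ) : Submodule ℂ (Fin N → Ohat N) where
  carrier := {α | ∀ i j, pd i (α j) = pd j (α i)}
  add_mem' := by
    intro α β ha hb i j
    simp [ha i j, hb i j]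
  zero_mem' := by intro i j; simp
  smul_mem' := by
    intro c α ha i j
    simp [ha i j]

/-- `Ω^2`: all `2`-forms. -/
def Omega2 (N : ℕ) : Submodule ℂ (Matrix (Fin N) (Fin N) (Ohat N)) where
  carrier := {ω | ∀ i j, ω i j = -ω j i}
  add_mem' := by
    intro α β ha hb i j
    simp only [Matrix.add_apply]
    rw [ha i j, hb i j]; ring
  zero_mem' := by intro i j; simp
  smul_mem' := by
    intro c α ha i j
    simp only [Matrix.smul_apply]
    rw [ha i j, smul_neg]

/-- `Ω^{2,cl}`: closed `2`-forms. -/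
def Omega2cl (N : ℕ) : Submodule ℂ (Matrix (Fin N) (Fin N) (Ohat N)) where
  carrier := {ω | ω ∈ Omega2 N ∧ ∀ i j k, extD2 ω i j k = 0}
  add_mem' := by
    intro α β ha hb
    refine ⟨add_mem ha.1 hb.1, fun i j k => ?_⟩
    have h1 := ha.2 i j k
    have h2 := hb.2 i j k
    simp only [extD2, Matrix.add_apply, map_add] at *
    linear_combination h1 + h2
  zero_mem' := ⟨zero_mem _, by intro i j k; simp [extD2]⟩
  smul_mem' := by
    intro c α ha
    refine ⟨Submodule.smul_mem _ c ha.1, fun i j k => ?_⟩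
    have h1 := ha.2 i j k
    simp only [extD2, Matrix.smul_apply, Derivation.map_smul] at *
    rw [← smul_add, ← smul_add, h1, smul_zero]

theorem Omega2cl_le : Omega2cl N ≤ Omega2 N := fun _ h => h.1

/-- The pullback `g^*` of `1`-forms. -/
def pull1 (g : CoordChange N) : (Fin N → Ohat N) →ₗ[ℂ] (Fin N → Ohat N) where
  toFun α := fun i => ∑ j, g.jac i j * g.pull (α j)
  map_add' α β := by
    funext i; simp [mul_add, Finset.sum_add_distrib]
  map_smul' c α := by
    funext i; simp [Finset.smul_sum]

/-- The pullback `g^*` of `2`-forms (and of all quadratic differentials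
`Σ ω_{ij} db^i ⊗ db^j`). -/
def pull2 (g : CoordChange N) :
    Matrix (Fin N) (Fin N) (Ohat N) →ₗ[ℂ] Matrix (Fin N) (Fin N) (Ohat N) where
  toFun ω := g.jac * ω.map g.pull * g.jacᵀ
  map_add' α β := by
    have : (α + β).map g.pull = α.map g.pull + β.map g.pull := by ext; simp
    rw [this, mul_add, add_mul]
  map_smul' c α := by
    have : (c • α).map g.pull = c • α.map g.pull := by ext; simp
    rw [this, Matrix.mul_smul, Matrix.smul_mul]; rfl

theorem pull2_apply (g : CoordChange N) (ω : Matrix (Fin N) (Fin N) (Ohat N)) (i j : Fin N) :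
    pull2 g ω i j = ∑ p, ∑ q, g.jac i p * g.jac j q * g.pull (ω p q) := by
  change (g.jac * ω.map g.pull * g.jacᵀ) i j = _
  simp only [Matrix.mul_apply, Matrix.transpose_apply, Matrix.map_apply, Finset.sum_mul]
  rw [Finset.sum_comm]
  refine Finset.sum_congr rfl fun p _ => Finset.sum_congr rfl fun q _ => ?_
  ring

theorem pull1_one (α : Fin N → Ohat N) : pull1 1 α = α := by
  funext i
  change ∑ j, (1 : CoordChange N).jac i j * (1 : CoordChange N).pull (α j) = α i
  simp [jac_one, pull_one, Matrix.one_apply]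

theorem pull1_mul (g h : CoordChange N) (α : Fin N → Ohat N) :
    pull1 (g * h) α = pull1 g (pull1 h α) := by
  funext i
  change ∑ j, (g * h).jac i j * (g * h).pull (α j)
    = ∑ k, g.jac i k * g.pull (∑ j, h.jac k j * h.pull (α j))
  simp only [jac_mul, pull_mul, Matrix.mul_apply, Matrix.map_apply, map_sum, map_mul,
    Finset.sum_mul, Finset.mul_sum]
  rw [Finset.sum_comm]
  refine Finset.sum_congr rfl fun p _ => Finset.sum_congr rfl fun q _ => ?_
  ring

theorem pull2_one (ω : Matrix (Fin N) (Fin N) (Ohat N)) : pull2 1 ω = ω := by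
  change (1 : CoordChange N).jac * ω.map (1 : CoordChange N).pull * (1 : CoordChange N).jacᵀ = ω
  have : ω.map (1 : CoordChange N).pull = ω := by ext i j; exact pull_one _
  rw [this, jac_one]; simp

theorem pull2_mul (g h : CoordChange N) (ω : Matrix (Fin N) (Fin N) (Ohat N)) :
    pull2 (g * h) ω = pull2 g (pull2 h ω) := by
  change (g * h).jac * ω.map (g * h).pull * (g * h).jacᵀ
    = g.jac * (h.jac * ω.map h.pull * h.jacᵀ).map g.pull * g.jacᵀ
  have h1 : ω.map (g * h).pull = (ω.map h.pull).map g.pull := by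
    ext i j; exact pull_mul g h _
  have h2 : (h.jac * ω.map h.pull * h.jacᵀ).map g.pull
      = h.jac.map g.pull * (ω.map h.pull).map g.pull * (h.jac.map g.pull)ᵀ := by
    rw [Matrix.map_mul, Matrix.map_mul, Matrix.transpose_map]
  rw [h1, h2, jac_mul, Matrix.transpose_mul]
  simp only [Matrix.mul_assoc]

theorem pd_jac (g : CoordChange N) (i j k : Fin N) : pd k (g.jac i j) = pd i (g.jac k j) :=
  pd_comm k i (g.comp j)

theorem pull1_closed (g : CoordChange N) {α : Fin N → Ohat N} (hα : α ∈ Omega1cl N) :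
    pull1 g α ∈ Omega1cl N := by
  have key : ∀ k i, pd k (pull1 g α i) = (∑ j, pd k (g.jac i j) * g.pull (α j))
      + ∑ j, ∑ l, g.jac i j * g.jac k l * g.pull (pd l (α j)) := by
    intro k i
    change pd k (∑ j, g.jac i j * g.pull (α j)) = _
    rw [map_sum, ← Finset.sum_add_distrib]
    refine Finset.sum_congr rfl fun j _ => ?_
    rw [Derivation.leibniz, Subst.pd_pull, smul_eq_mul, smul_eq_mul, Finset.mul_sum, add_comm]
    congr 1
    · ring
    · exact Finset.sum_congr rfl fun l _ => by ring
  intro k i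
  rw [key, key]
  congr 1
  · exact Finset.sum_congr rfl fun j _ => by rw [pd_jac]
  · rw [Finset.sum_comm]
    refine Finset.sum_congr rfl fun p _ => Finset.sum_congr rfl fun q _ => ?_
    rw [hα p q]; ring

theorem pull2_mem (g : CoordChange N) {ω : Matrix (Fin N) (Fin N) (Ohat N)} (hω : ω ∈ Omega2 N) :
    pull2 g ω ∈ Omega2 N := by
  intro i j
  rw [pull2_apply, pull2_apply, Finset.sum_comm, ← Finset.sum_neg_distrib]
  refine Finset.sum_congr rfl fun p _ => ?_
  rw [← Finset.sum_neg_distrib]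
  refine Finset.sum_congr rfl fun q _ => ?_
  rw [hω q p, map_neg]; ring

theorem pull2_closed (g : CoordChange N) {ω : Matrix (Fin N) (Fin N) (Ohat N)}
    (hω : ω ∈ Omega2cl N) : pull2 g ω ∈ Omega2cl N := by
  refine ⟨pull2_mem g hω.1, ?_⟩
  set A : Fin N → Fin N → Fin N → Ohat N := fun k i j =>
    ∑ p, ∑ q, pd k (g.jac i p) * g.jac j q * g.pull (ω p q) with hA
  set B : Fin N → Fin N → Fin N → Ohat N := fun k i j =>
    ∑ p, ∑ q, ∑ l, g.jac i p * g.jac j q * g.jac k l * g.pull (pd l (ω p q)) with hB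
  have hAs : ∀ k i j, A k i j = A i k j := by
    intro k i j
    simp only [hA, pd_jac g i _ k]
  have key : ∀ k i j, pd k (pull2 g ω i j) = A k i j - A k j i + B k i j := by
    intro k i j
    have hA' : A k j i = -∑ p, ∑ q, g.jac i p * pd k (g.jac j q) * g.pull (ω p q) := by
      simp only [hA]
      rw [Finset.sum_comm, ← Finset.sum_neg_distrib]
      refine Finset.sum_congr rfl fun p _ => ?_
      rw [← Finset.sum_neg_distrib]
      refine Finset.sum_congr rfl fun q _ => ?_
      rw [hω.1 q p, map_neg]; ring
    rw [pull2_apply, hA', sub_neg_eq_add, hA, hB, map_sum, ← Finset.sum_add_distrib,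
      ← Finset.sum_add_distrib]
    refine Finset.sum_congr rfl fun p _ => ?_
    rw [map_sum, ← Finset.sum_add_distrib, ← Finset.sum_add_distrib]
    refine Finset.sum_congr rfl fun q _ => ?_
    rw [Derivation.leibniz, Derivation.leibniz, Subst.pd_pull]
    simp only [smul_eq_mul, Finset.mul_sum]
    have e : ∀ l, g.jac i p * g.jac j q * (g.jac k l * g.pull (pd l (ω p q)))
        = g.jac i p * g.jac j q * g.jac k l * g.pull (pd l (ω p q)) := fun l => by ring
    simp only [e]
    ring
  intro i j k
  have hBc : B i j k + B j k i + B k i j = 0 := by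
    have e1 : B i j k = ∑ p, ∑ q, ∑ l, g.jac i p * g.jac j q * g.jac k l * g.pull (pd p (ω q l)) := by
      simp only [hB]
      rw [Finset.sum_congr rfl fun p _ => Finset.sum_comm, Finset.sum_comm]
      refine Finset.sum_congr rfl fun p _ => Finset.sum_congr rfl fun q _ =>
        Finset.sum_congr rfl fun l _ => by ring
    have e2 : B j k i = ∑ p, ∑ q, ∑ l, g.jac i p * g.jac j q * g.jac k l * g.pull (pd q (ω l p)) := by
      simp only [hB]
      rw [Finset.sum_comm]
      refine Finset.sum_congr rfl fun p _ => ?_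
      rw [Finset.sum_comm]
      refine Finset.sum_congr rfl fun q _ => Finset.sum_congr rfl fun l _ => by ring
    rw [e1, e2]
    simp only [hB, ← Finset.sum_add_distrib]
    refine Finset.sum_eq_zero fun p _ => Finset.sum_eq_zero fun q _ =>
      Finset.sum_eq_zero fun l _ => ?_
    have h := congrArg g.pull (hω.2 p q l)
    simp only [extD2, map_add, map_zero] at h
    linear_combination (g.jac i p * g.jac j q * g.jac k l) * h
  unfold extD2
  rw [key, key, key]
  linear_combination hBc + hAs i j k + hAs j k i + hAs k i j

/-- `H` acts on `Ω^{1,cl}` through `G`, by pullback. -/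
def rho1cl (N M : ℕ) : Representation ℂ (HGroup N M) (Omega1cl N) where
  toFun x := (pull1 x.right).restrict fun _ h => pull1_closed x.right h
  map_one' := by ext α : 2; exact pull1_one α.1
  map_mul' x y := by ext α : 2; exact pull1_mul x.right y.right α.1

/-- `H` acts on `Ω^2` through `G`, by pullback. -/
def rho2 (N M : ℕ) : Representation ℂ (HGroup N M) (Omega2 N) where
  toFun x := (pull2 x.right).restrict fun _ h => pull2_mem x.right h
  map_one' := by ext α : 2; exact pull2_one α.1
  map_mul' x y := by ext α : 2; exact pull2_mul x.right y.right α.1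

/-- `H` acts on `Ω^{2,cl}` through `G`, by pullback. -/
def rho2cl (N M : ℕ) : Representation ℂ (HGroup N M) (Omega2cl N) where
  toFun x := (pull2 x.right).restrict fun _ h => pull2_closed x.right h
  map_one' := by ext α : 2; exact pull2_one α.1
  map_mul' x y := by ext α : 2; exact pull2_mul x.right y.right α.1

/-- The `H`-module `Ω^{1,cl}`. -/
abbrev Om1cl (N M : ℕ) : Rep ℂ (HGroup N M) := Rep.of (rho1cl N M)
/-- The `H`-module `Ω^2`. -/
abbrev Om2 (N M : ℕ) : Rep ℂ (HGroup N M) := Rep.of (rho2 N M)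
/-- The `H`-module `Ω^{2,cl}`. -/
abbrev Om2cl (N M : ℕ) : Rep ℂ (HGroup N M) := Rep.of (rho2cl N M)

/-- The inclusion `Ω^{2,cl} → Ω^2` of `H`-modules. -/
def closedIncl (N M : ℕ) : Om2cl N M ⟶ Om2 N M :=
  Rep.ofHom ((Submodule.inclusion (Omega2cl_le (N := N))).intertwiningMap_of_isIntertwiningMap
    (rho2cl N M) (rho2 N M) (fun _ _ => rfl))

/-- The map `H^2(H; Ω^{2,cl}) → H^2(H; Ω^2)` induced by the inclusion. -/
def H2incl (N M : ℕ) : groupCohomology.H2 (Om2cl N M) ⟶ groupCohomology.H2 (Om2 N M) :=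
  groupCohomology.map (MonoidHom.id _) (closedIncl N M) 2

/-! ### The universal Chern classes -/

/-- The exterior product of two `1`-forms. -/
def wedge (α β : Fin N → Ohat N) : Matrix (Fin N) (Fin N) (Ohat N) :=
  Matrix.of fun i j => α i * β j - α j * β i

theorem wedge_closed {α β : Fin N → Ohat N} (hα : α ∈ Omega1cl N) (hβ : β ∈ Omega1cl N) :
    wedge α β ∈ Omega2cl N := by
  refine ⟨fun i j => by simp [wedge], fun i j k => ?_⟩
  simp only [extD2, wedge, Matrix.of_apply, map_sub, Derivation.leibniz, smul_eq_mul]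
  linear_combination (β k) * hα i j + (β i) * hα j k + (β j) * hα k i
    - (α k) * hβ i j - (α i) * hβ j k - (α j) * hβ k i

theorem pull2_wedge (g : CoordChange N) (α β : Fin N → Ohat N) :
    pull2 g (wedge α β) = wedge (pull1 g α) (pull1 g β) := by
  ext i j
  rw [pull2_apply]
  change _ = (∑ p, g.jac i p * g.pull (α p)) * (∑ q, g.jac j q * g.pull (β q))
    - (∑ q, g.jac j q * g.pull (α q)) * (∑ p, g.jac i p * g.pull (β p))
  rw [Finset.sum_mul_sum, Finset.sum_mul_sum,
    Finset.sum_comm (f := fun q p => g.jac j q * g.pull (α q) * (g.jac i p * g.pull (β p))),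
    ← Finset.sum_sub_distrib]
  refine Finset.sum_congr rfl fun p _ => ?_
  rw [← Finset.sum_sub_distrib]
  refine Finset.sum_congr rfl fun q _ => ?_
  simp only [wedge, Matrix.of_apply, map_sub, map_mul]
  ring

/-- The cup product `(u ∪ v)(x, y) = u(x) ∧ x^* v(y)` of `1`-cocycles of `H` with values in
`Ω^{1,cl}`. -/
def cup (u v : groupCohomology.cocycles₁ (Om1cl N M)) : groupCohomology.cocycles₂ (Om2cl N M) :=
  ⟨fun x => ⟨wedge (u x.1).1 (pull1 x.1.right (v x.2).1),
      wedge_closed (u x.1).2 (pull1_closed _ (v x.2).2)⟩, by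
    rw [groupCohomology.mem_cocycles₂_iff]
    intro x y z
    have hu := congrArg Subtype.val ((groupCohomology.mem_cocycles₁_iff u).mp u.2 x y)
    have hv := congrArg Subtype.val ((groupCohomology.mem_cocycles₁_iff v).mp v.2 y z)
    have hu' : (u (x * y)).1 = pull1 x.right (u y).1 + (u x).1 := hu
    have hv' : (v (y * z)).1 = pull1 y.right (v z).1 + (v y).1 := hv
    apply Subtype.ext
    change wedge (u (x * y)).1 (pull1 (x.right * y.right) (v z).1)
        + wedge (u x).1 (pull1 x.right (v y).1)
      = pull2 x.right (wedge (u y).1 (pull1 y.right (v z).1))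
        + wedge (u x).1 (pull1 x.right (v (y * z)).1)
    rw [hu', hv', pull2_wedge, pull1_mul, map_add]
    ext i j
    simp only [wedge, Matrix.of_apply, Matrix.add_apply, Pi.add_apply]
    ring⟩

/-- A crossed homomorphism `ρ : H → GL_r(Ô)`, `ρ(xy) = ρ(x) · x^* ρ(y)`. -/
structure CrossedHom (N M r : ℕ) where
  /-- The underlying map. -/
  toFun : HGroup N M → GL (Fin r) (Ohat N)
  map_mul : ∀ x y, toFun (x * y) = toFun x * pullGL N r x.right (toFun y)

/-- The tangent part `(g, A) ↦ ∂g`. -/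
def tangentPart (N M : ℕ) : CrossedHom N M N where
  toFun x := jacGL x.right
  map_mul x y := by
    apply Units.ext
    exact jac_mul x.right y.right

/-- The vector bundle part `(g, A) ↦ A`. -/
def bundlePart (N M : ℕ) : CrossedHom N M M where
  toFun x := x.left
  map_mul _ _ := rfl

/-- The `1`-form `(det A)⁻¹ d(det A) = tr (A⁻¹ dA)`. -/
def dlogDet (A : GL (Fin r) (Ohat N)) : Fin N → Ohat N :=
  fun i => (↑(Matrix.GeneralLinearGroup.det A)⁻¹ : Ohat N) * pd i A.1.det

theorem pd_unit_inv (u : (Ohat N)ˣ) (i : Fin N) :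
    pd i (↑u⁻¹ : Ohat N) = -(↑u⁻¹ * ↑u⁻¹ * pd i (u : Ohat N)) := by
  have h := congrArg (pd i) (u.inv_mul)
  rw [Derivation.leibniz, Derivation.map_one_eq_zero, smul_eq_mul, smul_eq_mul] at h
  have h2 := u.inv_mul
  linear_combination (↑u⁻¹ : Ohat N) * h - pd i (↑u⁻¹ : Ohat N) * h2

theorem dlogDet_closed (A : GL (Fin r) (Ohat N)) : dlogDet A ∈ Omega1cl N := by
  intro i j
  have hd : A.1.det = (Matrix.GeneralLinearGroup.det A : Ohat N) := rfl
  simp only [dlogDet, Derivation.leibniz, smul_eq_mul, hd, pd_unit_inv]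
  rw [pd_comm i j]
  ring

/-- The cocycle `x ↦ d log det ρ(x)` that represents the first Chern class
`c_1 ∈ H^1(H; Ω^{1,cl})` of `ρ`. -/
def chern1 (ρ : CrossedHom N M r) : groupCohomology.cocycles₁ (Om1cl N M) :=
  ⟨fun x => ⟨dlogDet (ρ.toFun x), dlogDet_closed _⟩, by
    rw [groupCohomology.mem_cocycles₁_iff]
    intro x y
    apply Subtype.ext
    change dlogDet (ρ.toFun (x * y))
      = pull1 x.right (dlogDet (ρ.toFun y)) + dlogDet (ρ.toFun x)
    rw [ρ.map_mul]
    set A := ρ.toFun x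
    set B := ρ.toFun y
    have hdet : (A * pullGL N r x.right B).1.det = A.1.det * x.right.pull B.1.det := by
      rw [Units.val_mul, Matrix.det_mul]
      congr 1
      exact (AlgHom.map_det x.right.pull B.1).symm
    have hAi : (↑(Matrix.GeneralLinearGroup.det A)⁻¹ : Ohat N) * A.1.det = 1 :=
      (Matrix.GeneralLinearGroup.det A).inv_mul
    have hBi : (↑(Matrix.GeneralLinearGroup.det B)⁻¹ : Ohat N) * B.1.det = 1 :=
      (Matrix.GeneralLinearGroup.det B).inv_mul
    have hBi' := congrArg x.right.pull hBi
    rw [map_mul, map_one] at hBi'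
    have hinv : (↑(Matrix.GeneralLinearGroup.det (A * pullGL N r x.right B))⁻¹ : Ohat N)
        = ↑(Matrix.GeneralLinearGroup.det A)⁻¹
          * x.right.pull (↑(Matrix.GeneralLinearGroup.det B)⁻¹ : Ohat N) := by
      have hu : Matrix.GeneralLinearGroup.det (A * pullGL N r x.right B)
          = Matrix.GeneralLinearGroup.det A * Units.map (x.right.pull : Ohat N →* Ohat N)
            (Matrix.GeneralLinearGroup.det B) := Units.ext hdet
      rw [hu, mul_inv, Units.val_mul, ← map_inv]
      rfl
    funext i
    simp only [dlogDet, hdet, hinv, Derivation.leibniz, smul_eq_mul, Subst.pd_pull, Pi.add_apply]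
    change _ = (∑ j, x.right.jac i j * x.right.pull
      (↑(Matrix.GeneralLinearGroup.det B)⁻¹ * pd j B.1.det)) + _
    have hs : (∑ j, x.right.jac i j * x.right.pull
          (↑(Matrix.GeneralLinearGroup.det B)⁻¹ * pd j B.1.det))
        = x.right.pull (↑(Matrix.GeneralLinearGroup.det B)⁻¹ : Ohat N)
          * ∑ j, x.right.jac i j * x.right.pull (pd j B.1.det) := by
      rw [Finset.mul_sum]
      refine Finset.sum_congr rfl fun j _ => ?_
      rw [map_mul]; ring
    rw [hs]
    set S := ∑ j, x.right.jac i j * x.right.pull (pd j B.1.det)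
    linear_combination (x.right.pull (↑(Matrix.GeneralLinearGroup.det B)⁻¹ : Ohat N) * S) * hAi
      + (↑(Matrix.GeneralLinearGroup.det A)⁻¹ * pd i A.1.det) * hBi'⟩

/-- The matrix-valued `1`-form `A⁻¹ dA`; this is its `db^i`-component. -/
def leftForm (A : GL (Fin r) (Ohat N)) (i : Fin N) : Matrix (Fin r) (Fin r) (Ohat N) :=
  A⁻¹.1 * A.1.map (pd i)

/-- The matrix-valued `1`-form `dA · A⁻¹`; this is its `db^i`-component. -/
def rightForm (A : GL (Fin r) (Ohat N)) (i : Fin N) : Matrix (Fin r) (Fin r) (Ohat N) :=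
  A.1.map (pd i) * A⁻¹.1

/-- The quadratic differential `tr {ρ(x)⁻¹ dρ(x) ⊗ x^*(dρ(y) · ρ(y)⁻¹)}`, given by the matrix of its
coefficients at `db^i ⊗ db^j`. -/
def traceTensor (ρ : CrossedHom N M r) (x y : HGroup N M) : Matrix (Fin N) (Fin N) (Ohat N) :=
  Matrix.of fun i j => Matrix.trace (leftForm (ρ.toFun x) i *
    ∑ k, x.right.jac j k • (rightForm (ρ.toFun y) k).map x.right.pull)

/-- The skew symmetrization `Σ t_{ij} db^i ⊗ db^j ↦ Σ t_{ij} db^i ∧ db^j`. -/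
def skew (t : Matrix (Fin N) (Fin N) (Ohat N)) : Matrix (Fin N) (Fin N) (Ohat N) := t - tᵀ

/-- The `3`-form `(1/3) tr ((A⁻¹ dA)^3)`; this is its value on `(∂_i, ∂_j, ∂_k)`. -/
def csForm (A : GL (Fin r) (Ohat N)) (i j k : Fin N) : Ohat N :=
  Matrix.trace (leftForm A i * (leftForm A j * leftForm A k - leftForm A k * leftForm A j))

/-- The square of the first Chern class, `c_1^2 ∈ H^2(H; Ω^{2,cl})`. -/
def chern1Sq (ρ : CrossedHom N M r) : groupCohomology.H2 (Om2cl N M) :=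
  groupCohomology.H2π (Om2cl N M) (cup (chern1 ρ) (chern1 ρ))

/-- `c ∈ H^2(H; Ω^{2,cl})` is the second Chern class of `ρ`.

The invariant polynomial `c_2(X) = (1/2)((tr X)^2 - tr (X^2))` gives the `2`-cocycle
`P(x, y) = (1/2)(tr ω_x ∧ tr η_y - tr (ω_x ∧ η_y))` of `H` in `Ω^2`, where `ω_x = ρ(x)⁻¹ dρ(x)` and
`η_y = x^*(dρ(y) ρ(y)⁻¹)`. Its values need not be closed: if `Q(x) = (1/3) tr (ω_x^3)`, then `-2 dP`
is the group coboundary of `Q`, so that `P` and `-Q/2` together form (up to the usual signs) a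
`2`-cocycle of `H` in the complex `Ω^2 → Ω^{3,cl}`. (This is the standard simplicial de Rham representative of the
universal class `c_2`.) By the Poincare lemma this complex is a resolution of `Ω^{2,cl}`, and the
corresponding class in `H^2(H; Ω^{2,cl})` is obtained by writing `Q = dκ` and adding to `P` one half
of the group coboundary of `κ`. -/
def IsChern2 (ρ : CrossedHom N M r) (c : groupCohomology.H2 (Om2cl N M)) : Prop :=
  ∃ (κ : HGroup N M → Omega2 N) (z : groupCohomology.cocycles₂ (Om2cl N M)),
    (∀ x i j k, extD2 (κ x).1 i j k = csForm (ρ.toFun x) i j k) ∧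
    (∀ x y, (z (x, y)).1 =
      (1 / 2 : ℂ) • (wedge (dlogDet (ρ.toFun x)) (pull1 x.right (dlogDet (ρ.toFun y)))
        - skew (traceTensor ρ x y))
      + (1 / 2 : ℂ) • (pull2 x.right (κ y).1 - (κ (x * y)).1 + (κ x).1)) ∧
    groupCohomology.H2π (Om2cl N M) z = c

/-! ### The vertex superalgebra `D̂_Λ` -/

/-- Even creation modes other than `b^i_0`: `b i n` is `b^i_{-(n+1)}`, `a i n` is `a^i_{-(n+1)}`. -/
inductive BosGen (N : ℕ) : Type
  | b (i : Fin N) (n : ℕ)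
  | a (i : Fin N) (n : ℕ)

/-- Odd creation modes: `phi j n` is `φ^j_{-n}`, `psi j n` is `ψ^j_{-(n+1)}`. -/
inductive FerGen (M : ℕ) : Type
  | phi (j : Fin M) (n : ℕ)
  | psi (j : Fin M) (n : ℕ)

/-- The polynomial algebra on the even creation modes other than `b^i_0`. -/
abbrev BosPart (N : ℕ) : Type := MvPolynomial (BosGen N) ℂ

/-- The exterior algebra on the odd creation modes. -/
abbrev FerPart (M : ℕ) : Type := ExteriorAlgebra ℂ (FerGen M →₀ ℂ)

/-- The space of states of `D̂_Λ = Ô ⊗_O D_Λ`: since `D_Λ` is the polynomial algebra in the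
`b^i_0` (that is, `O`), tensored over `ℂ` with the polynomial algebra in the other even creation
modes and with the exterior algebra in the odd creation modes, this is `Ô` tensored with the last two
factors. It is a supercommutative algebra, in which the creation modes (and the elements of `Ô`)
act on states by multiplication. -/
def Fock (N M : ℕ) : Type := Ohat N ⊗[ℂ] (BosPart N ⊗[ℂ] FerPart M)

instance (N M : ℕ) : Ring (Fock N M) :=
  inferInstanceAs (Ring (Ohat N ⊗[ℂ] (BosPart N ⊗[ℂ] FerPart M)))
instance (N M : ℕ) : Algebra ℂ (Fock N M) :=
  inferInstanceAs (Algebra ℂ (Ohat N ⊗[ℂ] (BosPart N ⊗[ℂ] FerPart M)))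

namespace Fock

/-- The space of states is, by definition, the tensor product of the three factors. -/
def equiv : Fock N M ≃ₐ[ℂ] Ohat N ⊗[ℂ] (BosPart N ⊗[ℂ] FerPart M) := AlgEquiv.refl

/-- An operator on the tensor product of the three factors as an operator on the space of states. -/
def onTensor (D : Module.End ℂ (Ohat N ⊗[ℂ] (BosPart N ⊗[ℂ] FerPart M))) :
    Module.End ℂ (Fock N M) :=
  equiv.symm.toLinearMap ∘ₗ D ∘ₗ equiv.toLinearMap

/-- An operator on the factor `Ô`, extended to the space of states. -/
def onFn (D : Ohat N →ₗ[ℂ] Ohat N) : Module.End ℂ (Fock N M) := onTensor (D.rTensor _)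

/-- An operator on the bosonic factor, extended to the space of states. -/
def onBos (D : BosPart N →ₗ[ℂ] BosPart N) : Module.End ℂ (Fock N M) :=
  onTensor ((D.rTensor _).lTensor _)

/-- An operator on the fermionic factor, extended to the space of states. -/
def onFer (D : FerPart M →ₗ[ℂ] FerPart M) : Module.End ℂ (Fock N M) :=
  onTensor ((D.lTensor _).lTensor _)

/-- `f ∈ Ô` as a state of conformal weight `0`. -/
def fn (f : Ohat N) : Fock N M := equiv.symm (f ⊗ₜ (1 ⊗ₜ 1))

/-- An even creation mode as a state. -/
def bos (x : BosGen N) : Fock N M := equiv.symm (1 ⊗ₜ (MvPolynomial.X x ⊗ₜ 1))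

/-- An odd creation mode as a state. -/
def fer (x : FerGen M) : Fock N M :=
  equiv.symm (1 ⊗ₜ (1 ⊗ₜ ExteriorAlgebra.ι ℂ (Finsupp.single x 1)))

/-- The state `a^i_{-1}`, whose field is `a^i(z)`. -/
def a (i : Fin N) : Fock N M := bos (BosGen.a i 0)
/-- The state `b^i_{-1}`, whose field is `b^i(z)'`. -/
def b' (i : Fin N) : Fock N M := bos (BosGen.b i 0)
/-- The state `φ^j_0`, whose field is `φ^j(z)`. -/
def phi (j : Fin M) : Fock N M := fer (FerGen.phi j 0)
/-- The state `ψ^j_{-1}`, whose field is `ψ^j(z)`. -/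
def psi (j : Fin M) : Fock N M := fer (FerGen.psi j 0)

/-- The parity involution: `+1` on even states and `-1` on odd states. -/
def parity : Fock N M →ₗ[ℂ] Fock N M := onFer (CliffordAlgebra.involute.toLinearMap)

/-- The derivation of the bosonic factor with `b_{-k} ↦ (k+1) b_{-k-1}`, `a_{-k} ↦ k a_{-k-1}`. -/
def transBos : BosPart N →ₗ[ℂ] BosPart N :=
  (MvPolynomial.mkDerivation ℂ (A := MvPolynomial (BosGen N) ℂ) fun
    | BosGen.b i n => ((n : ℂ) + 2) • MvPolynomial.X (BosGen.b i (n + 1))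
    | BosGen.a i n => ((n : ℂ) + 1) • MvPolynomial.X (BosGen.a i (n + 1))).toLinearMap

/-- The map `φ_{-k} ↦ (k+1) φ_{-k-1}`, `ψ_{-k} ↦ k ψ_{-k-1}` on odd creation modes. -/
def transFerGen : (FerGen M →₀ ℂ) →ₗ[ℂ] (FerGen M →₀ ℂ) :=
  Finsupp.lsum ℂ fun
    | FerGen.phi j n => ((n : ℂ) + 1) • Finsupp.lsingle (FerGen.phi j (n + 1))
    | FerGen.psi j n => ((n : ℂ) + 1) • Finsupp.lsingle (FerGen.psi j (n + 1))

/-- The algebra homomorphism `u ↦ u + ε · D u`, `ε² = 0`, where `D` is the (even) derivation of the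
exterior algebra that extends `transFerGen`. -/
def transFerHom : FerPart M →ₐ[ℂ] TrivSqZeroExt (FerPart M) (FerPart M) :=
  ExteriorAlgebra.lift ℂ
    ⟨(TrivSqZeroExt.inlAlgHom ℂ (FerPart M) (FerPart M)).toLinearMap ∘ₗ ExteriorAlgebra.ι ℂ
        + (TrivSqZeroExt.inrHom (FerPart M) (FerPart M)).restrictScalars ℂ
          ∘ₗ ExteriorAlgebra.ι ℂ ∘ₗ transFerGen, by
      intro m
      ext
      · simp
      · simp [ExteriorAlgebra.ι_add_mul_swap]⟩

/-- The derivation of the fermionic factor that extends `transFerGen`. -/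
def transFer : FerPart M →ₗ[ℂ] FerPart M :=
  (TrivSqZeroExt.sndHom (FerPart M) (FerPart M)).restrictScalars ℂ ∘ₗ transFerHom.toLinearMap

/-- The translation operator `T = L_{-1}`: the derivation of the algebra of states with
`T f = Σ_i (∂_i f) b^i_{-1}` for `f ∈ Ô`, `T b_{-k} = (k+1) b_{-k-1}`, `T a_{-k} = k a_{-k-1}`,
`T φ_{-k} = (k+1) φ_{-k-1}` and `T ψ_{-k} = k ψ_{-k-1}`. -/
def transl : Module.End ℂ (Fock N M) :=
  (∑ i, LinearMap.mulLeft ℂ (b' i) ∘ₗ onFn (pd i).toLinearMap) + onBos transBos + onFer transFer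

/-- `∂/∂b^i_{-n}`, for `n ≥ 0`. -/
def dB (i : Fin N) : ℕ → Module.End ℂ (Fock N M)
  | 0 => onFn (pd i).toLinearMap
  | n + 1 => onBos (MvPolynomial.pderiv (BosGen.b i n)).toLinearMap

/-- `∂/∂a^i_{-(m+1)}`. -/
def dA (i : Fin N) (m : ℕ) : Module.End ℂ (Fock N M) :=
  onBos (MvPolynomial.pderiv (BosGen.a i m)).toLinearMap

/-- The left derivative with respect to an odd creation mode, `x u ↦ u`. -/
def dL (x : FerGen M) : Module.End ℂ (Fock N M) :=
  onFer (CliffordAlgebra.contractLeft (Finsupp.lapply x))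

/-- The right derivative with respect to an odd creation mode, `u x ↦ u`. -/
def dR (x : FerGen M) : Module.End ℂ (Fock N M) :=
  onFer (CliffordAlgebra.contractRight.flip (Finsupp.lapply x))

/-- `D ⊗ E`. -/
def tens (D E : Module.End ℂ (Fock N M)) : Module.End ℂ (Fock N M ⊗[ℂ] Fock N M) :=
  TensorProduct.map D E

/-- The signed sum of all contractions of a mode `a_{-(m+1)}` with a mode `b_{-n}`, or of a mode
`ψ_{-(m+1)}` with a mode `φ_{-n}`, where one mode is taken from the first and the other from the
second factor. -/
def pairContr (m n : ℕ) : Module.End ℂ (Fock N M ⊗[ℂ] Fock N M) :=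
  (∑ i : Fin N, ((-1 : ℂ) ^ m • tens (N := N) (M := M) (dA i m) (dB i n)
      + (-1 : ℂ) ^ (n + 1) • tens (N := N) (M := M) (dB i n) (dA i m)))
    + ∑ j : Fin M, ((-1 : ℂ) ^ m •
        tens (N := N) (M := M) (dR (FerGen.psi j m)) (dL (FerGen.phi j n))
      + (-1 : ℂ) ^ n •
        tens (N := N) (M := M) (dR (FerGen.phi j n)) (dL (FerGen.psi j m)))

/-- The contraction operator `Δ(z) = Σ_q Δ_q z^{-q}`: the sum over all pairs (creation mode in the
first factor, creation mode in the second factor) of the product of the two derivatives and the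
contraction of the corresponding fields at `z` and `0`. The mode `b_{-n}` corresponds to the field
`∂^{(n)} b(z)`, the mode `a_{-(m+1)}` to `∂^{(m)} a(z)`, where `∂^{(k)} = ∂^k / k!`, and similarly
for `φ` and `ψ`. By the operator products `a^i(z) b^i(w) ∼ 1/(z-w)`, `b^i(z) a^i(w) ∼ -1/(z-w)`,
`ψ^j(z) φ^j(w) ∼ 1/(z-w)`, `φ^j(z) ψ^j(w) ∼ 1/(z-w)` the contraction is, up to sign,
`(m+n choose n) z^{-(m+n+1)}`. -/
def contr : ℕ → Module.End ℂ (Fock N M ⊗[ℂ] Fock N M)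
  | 0 => 0
  | s + 1 => ∑ x ∈ Finset.HasAntidiagonal.antidiagonal s,
      ((s.choose x.2 : ℕ) : ℂ) • pairContr x.1 x.2

/-- The coefficient of `z^{-q}` in `exp Δ(z)`. -/
def expContr (q : ℕ) : Module.End ℂ (Fock N M ⊗[ℂ] Fock N M) :=
  ∑ k ∈ Finset.range (q + 1), ((k.factorial : ℂ)⁻¹) •
    PowerSeries.coeff q ((PowerSeries.mk contr : PowerSeries (Module.End ℂ (Fock N M ⊗[ℂ] Fock N M))) ^ k)

/-- The `n`-th product `u_{(n)} v` of the vertex superalgebra `D̂_Λ`, i.e. the coefficient of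
`z^{-n-1}` in `Y(u, z) v`. By Wick's theorem, `Y(u, z) v` is obtained from `exp Δ(z) (u ⊗ v)` by
applying `e^{zT}` to the first factor and multiplying. (For given `u` and `v`, only finitely many
terms of the sum are non-zero.) -/
def nprod (n : ℤ) (u v : Fock N M) : Fock N M :=
  ∑ᶠ q : ℕ, if n + 1 ≤ (q : ℤ) then
    (((q - n - 1).toNat.factorial : ℂ)⁻¹) •
      LinearMap.mul' ℂ (Fock N M) (((transl ^ (q - n - 1).toNat).rTensor (Fock N M)) (expContr q (u ⊗ₜ v)))
  else 0

end Fock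

/-- The group of automorphisms of the vertex superalgebra `D̂_Λ`: even linear automorphisms of the
space of states that preserve the vacuum and all `n`-th products. -/
def vertexAut (N M : ℕ) : Subgroup (Fock N M ≃ₗ[ℂ] Fock N M) where
  carrier := {F | F 1 = 1 ∧ (∀ u, F (Fock.parity u) = Fock.parity (F u)) ∧
    ∀ (n : ℤ) (u v : Fock N M), F (Fock.nprod n u v) = Fock.nprod n (F u) (F v)}
  one_mem' := ⟨rfl, fun _ => rfl, fun _ _ _ => rfl⟩
  mul_mem' := by
    rintro F G ⟨h1, h2, h3⟩ ⟨k1, k2, k3⟩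
    refine ⟨?_, fun u => ?_, fun n u v => ?_⟩
    · rw [LinearEquiv.mul_apply, k1, h1]
    · simp only [LinearEquiv.mul_apply, k2, h2]
    · simp only [LinearEquiv.mul_apply, k3, h3]
  inv_mem' := by
    rintro F ⟨h1, h2, h3⟩
    have hF : ∀ u, F (F⁻¹ u) = u := fun u => F.apply_symm_apply u
    refine ⟨?_, fun u => ?_, fun n u v => ?_⟩
    · apply F.injective; rw [hF, h1]
    · apply F.injective; rw [hF, h2, hF]
    · apply F.injective; rw [hF, h3, hF, hF]

open Fock in
/-- `F` has the form
`b̃^i = g^i(b)`,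
`ã^i = a^j c^{ji} - ψ^p φ^q A^{qs} c^{ki} ∂_k (A⁻¹)^{sp} + (b^j)' h^{ji}`,
`φ̃^i = φ^j A^{ji}`, `ψ̃^i = ψ^j (A⁻¹)^{ij}`,
where `x = (g, A)`, `c = ((∂g)⁻¹)^t` and `h` is an `N × N` matrix over `Ô`. The first line means that
`F` acts on `Ô` as the substitution `f ↦ f_g`. -/
structure HasForm (F : vertexAut N M) (x : HGroup N M) (h : Matrix (Fin N) (Fin N) (Ohat N)) :
    Prop where
  map_fn : ∀ f : Ohat N, F.1 (fn f) = fn (x.right.pull f)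
  map_a : ∀ i : Fin N, F.1 (a i) =
    ∑ j, a j * fn ((jacGL x.right)⁻¹.1ᵀ j i)
      - ∑ p, ∑ q, psi p * phi q *
          fn (∑ s, ∑ k, x.left.1 q s * (jacGL x.right)⁻¹.1ᵀ k i * pd k (x.left⁻¹.1 s p))
      + ∑ j, b' j * fn (h j i)
  map_phi : ∀ i : Fin M, F.1 (phi i) = ∑ j, phi j * fn (x.left.1 j i)
  map_psi : ∀ i : Fin M, F.1 (psi i) = ∑ j, psi j * fn (x.left⁻¹.1 i j)

/-- Admissible automorphisms of `D̂_Λ`. -/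
def IsAdmissible (F : vertexAut N M) : Prop :=
  ∃ (x : HGroup N M) (h : Matrix (Fin N) (Fin N) (Ohat N)), HasForm F x h

/-- `γ` is the cohomology class of an extension `S` of `H` by `Ω^{2,cl}`: for every set-theoretic
section `σ`, the function `z` defined by `σ(x) σ(y) = z(x, y) σ(xy)` is a cocycle of class `γ`. -/
def IsExtensionClass {E : Type} [Group E]
    (S : GroupExtension (Multiplicative (Omega2cl N)) E (HGroup N M))
    (γ : groupCohomology.H2 (Om2cl N M)) : Prop :=
  ∀ σ : S.Section, ∃ z : groupCohomology.cocycles₂ (Om2cl N M),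
    (∀ x y, σ x * σ y = S.inl (Multiplicative.ofAdd (z (x, y))) * σ (x * y)) ∧
    groupCohomology.H2π (Om2cl N M) z = γ

end ChiralDO

end

open scoped TensorProduct Topology Matrix MatrixGroups

set_option linter.unusedSimpArgs false

open Finset (sum_congr sum_add_distrib sum_comm mul_sum sum_mul smul_sum sum_eq_single sum_const_zero sum_neg_distrib sum_sub_distrib mem_range mem_univ sum_eq_zero sum_range_succ)

noncomputable section

namespace ChiralDO

open Ohat

/-- Endomorphisms of the Fock space. -/
abbrev Op (N M : ℕ) := Module.End ℂ (Fock N M)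

/-- Square matrices of functions. -/
abbrev Mat (r N : ℕ) := Matrix (Fin r) (Fin r) (Ohat N)

namespace Fock

variable {N M : ℕ}

/-- The pure tensor `f ⊗ p ⊗ e` as a state. -/
def tp (f : Ohat N) (p : BosPart N) (e : FerPart M) : Fock N M := equiv.symm (f ⊗ₜ (p ⊗ₜ e))

theorem tp_mul (f f' : Ohat N) (p p' : BosPart N) (e e' : FerPart M) :
    tp f p e * tp f' p' e' = tp (f * f') (p * p') (e * e') := by
  unfold tp
  rw [← map_mul, Algebra.TensorProduct.tmul_mul_tmul, Algebra.TensorProduct.tmul_mul_tmul]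

theorem one_eq_tp : (1 : Fock N M) = tp 1 1 1 := rfl
theorem fn_eq_tp (f : Ohat N) : (fn f : Fock N M) = tp f 1 1 := rfl
theorem bos_eq_tp (x : BosGen N) : (bos x : Fock N M) = tp 1 (MvPolynomial.X x) 1 := rfl
theorem fer_eq_tp (x : FerGen M) :
    (fer x : Fock N M) = tp 1 1 (ExteriorAlgebra.ι ℂ (Finsupp.single x 1)) := rfl

theorem tp_add_left (f f' : Ohat N) (p : BosPart N) (e : FerPart M) :
    tp (f + f') p e = tp f p e + tp f' p e := by
  simp [tp, TensorProduct.add_tmul]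

theorem tp_add_mid (f : Ohat N) (p p' : BosPart N) (e : FerPart M) :
    tp f (p + p') e = tp f p e + tp f p' e := by
  simp [tp, TensorProduct.add_tmul, TensorProduct.tmul_add]

theorem tp_add_right (f : Ohat N) (p : BosPart N) (e e' : FerPart M) :
    tp f p (e + e') = tp f p e + tp f p e' := by
  simp [tp, TensorProduct.tmul_add]

theorem tp_smul_left (c : ℂ) (f : Ohat N) (p : BosPart N) (e : FerPart M) :
    tp (c • f) p e = c • tp f p e := by
  simp only [tp, ← TensorProduct.smul_tmul', map_smul]

theorem tp_smul_mid (c : ℂ) (f : Ohat N) (p : BosPart N) (e : FerPart M) :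
    tp f (c • p) e = c • tp f p e := by
  simp only [tp, ← TensorProduct.smul_tmul', TensorProduct.tmul_smul, map_smul]

theorem tp_smul_right (c : ℂ) (f : Ohat N) (p : BosPart N) (e : FerPart M) :
    tp f p (c • e) = c • tp f p e := by
  simp only [tp, TensorProduct.tmul_smul, map_smul]

theorem tp_induction {P : Fock N M → Prop} (htp : ∀ f p e, P (tp f p e))
    (hadd : ∀ u v, P u → P v → P (u + v)) (u : Fock N M) : P u := by
  have h0 : P 0 := by simpa [tp] using htp 0 0 0
  have key : ∀ w : Ohat N ⊗[ℂ] (BosPart N ⊗[ℂ] FerPart M), P (equiv.symm w) := by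
    intro w
    induction w using TensorProduct.induction_on with
    | zero => simpa using h0
    | add x y hx hy => rw [map_add]; exact hadd _ _ hx hy
    | tmul f w =>
      induction w using TensorProduct.induction_on with
      | zero => simpa using h0
      | add x y hx hy => rw [TensorProduct.tmul_add, map_add]; exact hadd _ _ hx hy
      | tmul p e => exact htp f p e
  simpa using key (equiv u)

theorem end_ext {A : Type*} [AddCommGroup A] [Module ℂ A] {D E : Fock N M →ₗ[ℂ] A}
    (h : ∀ f p e, D (tp f p e) = E (tp f p e)) : D = E :=
  LinearMap.ext fun u => tp_induction (P := fun u => D u = E u) h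
    (fun u v hu hv => by rw [map_add, map_add, hu, hv]) u

theorem induction {P : Fock N M → Prop} (hfn : ∀ f, P (fn f))
    (hadd : ∀ u v, P u → P v → P (u + v)) (hbos : ∀ y u, P u → P (bos y * u))
    (hfer : ∀ y u, P u → P (fer y * u)) (u : Fock N M) : P u := by
  have h0 : P 0 := by simpa [fn] using hfn 0
  refine tp_induction (fun f p e => ?_) hadd u
  induction p using MvPolynomial.induction_on generalizing f with
  | C c =>
    have : tp f (MvPolynomial.C c) e = tp (c • f) 1 e := by
      rw [tp_smul_left, ← tp_smul_mid, MvPolynomial.smul_eq_C_mul, mul_one]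
    rw [this]
    clear this
    generalize c • f = f
    clear c
    induction e using CliffordAlgebra.left_induction generalizing f with
    | algebraMap r =>
      have : tp f 1 (algebraMap ℂ (FerPart M) r) = (fn (r • f) : Fock N M) := by
        rw [fn_eq_tp, tp_smul_left, ← tp_smul_right, Algebra.algebraMap_eq_smul_one]
      rw [this]; exact hfn _
    | add x y hx hy => rw [tp_add_right]; exact hadd _ _ (hx f) (hy f)
    | ι_mul x m hx =>
      induction m using Finsupp.induction_linear generalizing f with
      | zero => simpa [tp] using h0
      | add a b ha hb =>
        rw [map_add, add_mul, tp_add_right]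
        exact hadd _ _ (ha f) (hb f)
      | single y c =>
        have e1 : tp f 1 (CliffordAlgebra.ι _ (Finsupp.single y c) * x)
            = (fer y * tp (c • f) 1 x : Fock N M) := by
          rw [fer_eq_tp, tp_mul, one_mul, one_mul, tp_smul_left, ← tp_smul_right,
            ← smul_mul_assoc, ← map_smul, Finsupp.smul_single, smul_eq_mul, mul_one]
        rw [e1]
        exact hfer _ _ (hx _)
  | add p q hp hq => rw [tp_add_mid]; exact hadd _ _ (hp f) (hq f)
  | mul_X p x hp =>
    have : tp f (p * MvPolynomial.X x) e = bos x * tp f p e := by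
      rw [bos_eq_tp, tp_mul, one_mul, one_mul, mul_comm]
    rw [this]
    exact hbos _ _ (hp f)

theorem onFn_tp (D : Ohat N →ₗ[ℂ] Ohat N) (f : Ohat N) (p : BosPart N) (e : FerPart M) :
    onFn D (tp f p e) = tp (D f) p e := rfl
theorem onBos_tp (D : BosPart N →ₗ[ℂ] BosPart N) (f : Ohat N) (p : BosPart N) (e : FerPart M) :
    onBos D (tp f p e) = tp f (D p) e := rfl
theorem onFer_tp (D : FerPart M →ₗ[ℂ] FerPart M) (f : Ohat N) (p : BosPart N) (e : FerPart M) :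
    onFer D (tp f p e) = tp f p (D e) := rfl

theorem onFn_mul (D E : Module.End ℂ (Ohat N)) :
    (onFn D * onFn E : Op N M) = onFn (D * E) := end_ext fun _ _ _ => rfl
theorem onBos_mul (D E : Module.End ℂ (BosPart N)) :
    (onBos D * onBos E : Op N M) = onBos (D * E) := end_ext fun _ _ _ => rfl
theorem onFer_mul (D E : Module.End ℂ (FerPart M)) :
    (onFer D * onFer E : Op N M) = onFer (D * E) := end_ext fun _ _ _ => rfl

theorem onFn_add (D E : Module.End ℂ (Ohat N)) :
    (onFn (D + E) : Op N M) = onFn D + onFn E :=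
  end_ext fun _ _ _ => by simp [onFn_tp, tp_add_left]
theorem onBos_add (D E : Module.End ℂ (BosPart N)) :
    (onBos (D + E) : Op N M) = onBos D + onBos E :=
  end_ext fun _ _ _ => by simp [onBos_tp, tp_add_mid]
theorem onFer_add (D E : Module.End ℂ (FerPart M)) :
    (onFer (D + E) : Op N M) = onFer D + onFer E :=
  end_ext fun _ _ _ => by simp [onFer_tp, tp_add_right]

theorem onBos_smul (c : ℂ) (D : Module.End ℂ (BosPart N)) :
    (onBos (c • D) : Op N M) = c • onBos D :=
  end_ext fun _ _ _ => by simp [onBos_tp, tp_smul_mid]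
theorem onFer_smul (c : ℂ) (D : Module.End ℂ (FerPart M)) :
    (onFer (c • D) : Op N M) = c • onFer D :=
  end_ext fun _ _ _ => by simp [onFer_tp, tp_smul_right]

theorem onFer_one : (onFer (1 : Module.End ℂ (FerPart M)) : Op N M) = 1 :=
  end_ext fun _ _ _ => rfl

theorem commute_onFn_onBos (D : Module.End ℂ (Ohat N)) (E : Module.End ℂ (BosPart N)) :
    Commute (onFn D : Op N M) (onBos E) := end_ext fun _ _ _ => rfl
theorem commute_onFn_onFer (D : Module.End ℂ (Ohat N)) (E : Module.End ℂ (FerPart M)) :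
    Commute (onFn D : Op N M) (onFer E) := end_ext fun _ _ _ => rfl
theorem commute_onBos_onFer (D : Module.End ℂ (BosPart N)) (E : Module.End ℂ (FerPart M)) :
    Commute (onBos D : Op N M) (onFer E) := end_ext fun _ _ _ => rfl

theorem commute_onBos {D E : Module.End ℂ (BosPart N)} (h : Commute D E) :
    Commute (onBos D : Op N M) (onBos E) := by
  rw [commute_iff_eq, onBos_mul, onBos_mul, h.eq]

/-- Multiplication by a function. -/
def mulFn (f : Ohat N) : Op N M := LinearMap.mulLeft ℂ (fn f)
/-- Multiplication by an even creation mode. -/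
def mulBos (y : BosGen N) : Op N M := LinearMap.mulLeft ℂ (bos y)
/-- Multiplication by an odd creation mode. -/
def mulFer (y : FerGen M) : Op N M := LinearMap.mulLeft ℂ (fer y)

theorem mulFn_apply (f : Ohat N) (u : Fock N M) : mulFn f u = fn f * u := rfl
theorem mulBos_apply (y : BosGen N) (u : Fock N M) : mulBos y u = bos y * u := rfl
theorem mulFer_apply (y : FerGen M) (u : Fock N M) : mulFer y u = fer y * u := rfl

theorem mulFn_eq (f : Ohat N) : (mulFn f : Op N M) = onFn (LinearMap.mulLeft ℂ f) :=
  end_ext fun f' p e => by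
    rw [mulFn_apply, fn_eq_tp, tp_mul, onFn_tp, one_mul, one_mul]; rfl
theorem mulBos_eq (y : BosGen N) : (mulBos y : Op N M)
    = onBos (LinearMap.mulLeft ℂ (MvPolynomial.X y)) :=
  end_ext fun f' p e => by
    rw [mulBos_apply, bos_eq_tp, tp_mul, onBos_tp, one_mul, one_mul]; rfl
theorem mulFer_eq (y : FerGen M) : (mulFer y : Op N M)
    = onFer (LinearMap.mulLeft ℂ (ExteriorAlgebra.ι ℂ (Finsupp.single y 1))) :=
  end_ext fun f' p e => by
    rw [mulFer_apply, fer_eq_tp, tp_mul, onFer_tp, one_mul, one_mul]; rfl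

theorem fn_mul (f f' : Ohat N) : (fn (f * f') : Fock N M) = fn f * fn f' := by
  simp [fn_eq_tp, tp_mul]
theorem fn_add (f f' : Ohat N) : (fn (f + f') : Fock N M) = fn f + fn f' := by
  simp [fn_eq_tp, tp_add_left]
theorem fn_smul (c : ℂ) (f : Ohat N) : (fn (c • f) : Fock N M) = c • fn f := tp_smul_left _ _ _ _
theorem fn_one : (fn 1 : Fock N M) = 1 := rfl

/-- The inclusion of functions into states. -/
def fnHom : Ohat N →ₐ[ℂ] Fock N M :=
  AlgHom.ofLinearMap ⟨⟨fn, fn_add⟩, fn_smul⟩ fn_one fn_mul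

theorem fn_zero : (fn 0 : Fock N M) = 0 := map_zero (fnHom (N := N) (M := M))
theorem fn_sub (f f' : Ohat N) : (fn (f - f') : Fock N M) = fn f - fn f' :=
  map_sub (fnHom (N := N) (M := M)) f f'
theorem fn_neg (f : Ohat N) : (fn (-f) : Fock N M) = -fn f :=
  map_neg (fnHom (N := N) (M := M)) f
theorem fn_sum {ι : Type*} (s : Finset ι) (f : ι → Ohat N) :
    (fn (∑ i ∈ s, f i) : Fock N M) = ∑ i ∈ s, fn (f i) :=
  map_sum (fnHom (N := N) (M := M)) f s

theorem fn_injective : Function.Injective (fn : Ohat N → Fock N M) := by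
  have : Function.Injective (Algebra.TensorProduct.includeLeft :
      Ohat N →ₐ[ℂ] Ohat N ⊗[ℂ] (BosPart N ⊗[ℂ] FerPart M)) := by
    apply Algebra.TensorProduct.includeLeft_injective
    exact FaithfulSMul.algebraMap_injective ℂ _
  exact this

theorem fn_mul_comm (f : Ohat N) (u : Fock N M) : fn f * u = u * fn f := by
  refine tp_induction (P := fun u => fn f * u = u * fn f) (fun f' p e => ?_)
    (fun u v hu hv => by rw [mul_add, add_mul, hu, hv]) u
  rw [fn_eq_tp, tp_mul, tp_mul, mul_comm f]; simp

theorem bos_mul_comm (y : BosGen N) (u : Fock N M) : bos y * u = u * bos y := by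
  refine tp_induction (P := fun u => bos y * u = u * bos y) (fun f' p e => ?_)
    (fun u v hu hv => by rw [mul_add, add_mul, hu, hv]) u
  rw [bos_eq_tp, tp_mul, tp_mul, mul_comm p]; simp

theorem commute_mulFn_mulBos (f : Ohat N) (y : BosGen N) :
    Commute (mulFn f : Op N M) (mulBos y) := by
  rw [mulFn_eq, mulBos_eq]; exact commute_onFn_onBos _ _
theorem commute_mulBos_mulFer (x : BosGen N) (y : FerGen M) :
    Commute (mulBos x : Op N M) (mulFer y) := by
  rw [mulBos_eq, mulFer_eq]; exact commute_onBos_onFer _ _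
theorem commute_mulBos (x y : BosGen N) :
    Commute (mulBos x : Op N M) (mulBos y) := by
  rw [mulBos_eq, mulBos_eq]
  refine commute_onBos ?_
  refine LinearMap.ext fun u => ?_
  change MvPolynomial.X x * (MvPolynomial.X y * u) = MvPolynomial.X y * (MvPolynomial.X x * u)
  ring
theorem mulFer_mulFer (x y : FerGen M) :
    (mulFer x * mulFer y : Op N M) = -(mulFer y * mulFer x) := by
  have h : (ExteriorAlgebra.ι ℂ (Finsupp.single x (1 : ℂ)) * ExteriorAlgebra.ι ℂ (Finsupp.single y 1)
      : FerPart M) = -(ExteriorAlgebra.ι ℂ (Finsupp.single y 1) *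
        ExteriorAlgebra.ι ℂ (Finsupp.single x 1)) :=
    eq_neg_of_add_eq_zero_left (ExteriorAlgebra.ι_add_mul_swap _ _)
  refine LinearMap.ext fun u => ?_
  have h2 : (fer x * fer y : Fock N M) = -(fer y * fer x) := by
    rw [fer_eq_tp, fer_eq_tp, tp_mul, tp_mul, h]
    simp [tp, TensorProduct.tmul_neg]
  change fer x * (fer y * u) = -(fer y * (fer x * u))
  rw [← mul_assoc, h2, neg_mul, mul_assoc]

/-! #### Commutation relations of the derivatives -/

instance : DecidableEq (BosGen N) := Classical.decEq _
instance : DecidableEq (FerGen M) := Classical.decEq _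

theorem pderiv_X_mul (x y : BosGen N) (p : BosPart N) :
    MvPolynomial.pderiv x (MvPolynomial.X y * p)
      = MvPolynomial.X y * MvPolynomial.pderiv x p + if y = x then p else 0 := by
  rw [Derivation.leibniz, MvPolynomial.pderiv_X, smul_eq_mul, smul_eq_mul]
  by_cases h : y = x
  · subst h; rw [Pi.single_eq_same, mul_one, if_pos rfl]
  · rw [Pi.single_eq_of_ne h, mul_zero, if_neg h]

theorem onBos_pderiv_mulBos (x y : BosGen N) :
    (onBos (MvPolynomial.pderiv x).toLinearMap * mulBos y : Op N M)
      = mulBos y * onBos (MvPolynomial.pderiv x).toLinearMap + if y = x then 1 else 0 := by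
  refine end_ext fun f p e => ?_
  have h : (onBos (MvPolynomial.pderiv x).toLinearMap * mulBos y : Op N M)
      (tp f p e) = tp f (MvPolynomial.pderiv x (MvPolynomial.X y * p)) e := by
    rw [mulBos_eq]; rfl
  have h2 : (mulBos y * onBos (MvPolynomial.pderiv x).toLinearMap : Op N M)
      (tp f p e) = tp f (MvPolynomial.X y * MvPolynomial.pderiv x p) e := by
    rw [mulBos_eq]; rfl
  rw [LinearMap.add_apply, h, h2, pderiv_X_mul, tp_add_mid]
  split_ifs
  · rfl
  · simp [tp]

theorem pderiv_commute (x y : BosGen N) :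
    Commute ((MvPolynomial.pderiv (R := ℂ) x).toLinearMap : Module.End ℂ (BosPart N))
      (MvPolynomial.pderiv (R := ℂ) y).toLinearMap := by
  have h : ⁅MvPolynomial.pderiv (R := ℂ) x, MvPolynomial.pderiv (R := ℂ) y⁆ = 0 := by
    refine MvPolynomial.derivation_ext fun i => ?_
    rw [Derivation.commutator_apply]
    simp only [MvPolynomial.pderiv_X, Pi.single_apply]
    split_ifs <;> simp
  refine LinearMap.ext fun u => ?_
  have := congrArg (fun D => D u) h
  simp only [Derivation.commutator_apply] at this
  exact sub_eq_zero.mp this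

theorem dA_mulBos (i : Fin N) (m : ℕ) (y : BosGen N) :
    (dA i m * mulBos y : Op N M)
      = mulBos y * dA i m + if y = BosGen.a i m then 1 else 0 := by
  exact onBos_pderiv_mulBos _ _

theorem dB_succ_mulBos (i : Fin N) (n : ℕ) (y : BosGen N) :
    (dB i (n + 1) * mulBos y : Op N M)
      = mulBos y * dB i (n + 1) + if y = BosGen.b i n then 1 else 0 := by
  exact onBos_pderiv_mulBos _ _

theorem dB_zero_mulBos (i : Fin N) (y : BosGen N) :
    Commute (dB i 0 : Op N M) (mulBos y) := by
  rw [mulBos_eq, dB]; exact commute_onFn_onBos _ _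

theorem dA_mulFn (i : Fin N) (m : ℕ) (f : Ohat N) :
    Commute (dA i m : Op N M) (mulFn f) := by
  rw [mulFn_eq, dA]; exact (commute_onFn_onBos _ _).symm

theorem dB_succ_mulFn (i : Fin N) (n : ℕ) (f : Ohat N) :
    Commute (dB i (n + 1) : Op N M) (mulFn f) := by
  rw [mulFn_eq, dB]; exact (commute_onFn_onBos _ _).symm

theorem dB_zero_mulFn (i : Fin N) (f : Ohat N) :
    (dB i 0 * mulFn f : Op N M) = mulFn f * dB i 0 + mulFn (pd i f) := by
  rw [mulFn_eq, mulFn_eq, dB, onFn_mul, onFn_mul, ← onFn_add]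
  congr 1
  refine LinearMap.ext fun u => ?_
  change pd i (f * u) = f * pd i u + pd i f * u
  rw [Derivation.leibniz, smul_eq_mul, smul_eq_mul, mul_comm u]

theorem dA_mulFer (i : Fin N) (m : ℕ) (y : FerGen M) :
    Commute (dA i m : Op N M) (mulFer y) := by
  rw [mulFer_eq, dA]; exact commute_onBos_onFer _ _

theorem dB_mulFer (i : Fin N) (n : ℕ) (y : FerGen M) :
    Commute (dB i n : Op N M) (mulFer y) := by
  rw [mulFer_eq]
  cases n
  · exact commute_onFn_onFer _ _
  · exact commute_onBos_onFer _ _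

theorem dA_dA (i j : Fin N) (m n : ℕ) : Commute (dA i m : Op N M) (dA j n) :=
  commute_onBos (pderiv_commute _ _)

theorem dA_dB (i j : Fin N) (m n : ℕ) : Commute (dA i m : Op N M) (dB j n) := by
  cases n
  · exact (commute_onFn_onBos _ _).symm
  · exact commute_onBos (pderiv_commute _ _)

theorem dB_dB (i j : Fin N) (m n : ℕ) : Commute (dB i m : Op N M) (dB j n) := by
  cases m <;> cases n
  · rw [commute_iff_eq, dB, dB, onFn_mul, onFn_mul]
    congr 1
    exact LinearMap.ext fun f => pd_comm i j f
  · exact commute_onFn_onBos _ _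
  · exact (commute_onFn_onBos _ _).symm
  · exact commute_onBos (pderiv_commute _ _)

theorem onFer_commute_dA (D : Module.End ℂ (FerPart M)) (i : Fin N) (m : ℕ) :
    Commute (onFer D : Op N M) (dA i m) := (commute_onBos_onFer _ _).symm
theorem onFer_commute_dB (D : Module.End ℂ (FerPart M)) (i : Fin N) (n : ℕ) :
    Commute (onFer D : Op N M) (dB i n) := by
  cases n
  · exact (commute_onFn_onFer _ _).symm
  · exact (commute_onBos_onFer _ _).symm
theorem onFer_commute_mulBos (D : Module.End ℂ (FerPart M)) (y : BosGen N) :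
    Commute (onFer D : Op N M) (mulBos y) := by
  rw [mulBos_eq]; exact (commute_onBos_onFer _ _).symm
theorem onFer_commute_mulFn (D : Module.End ℂ (FerPart M)) (f : Ohat N) :
    Commute (onFer D : Op N M) (mulFn f) := by
  rw [mulFn_eq]; exact (commute_onFn_onFer _ _).symm

theorem lapply_single (x y : FerGen M) :
    Finsupp.lapply (R := ℂ) x (Finsupp.single y (1 : ℂ)) = if y = x then 1 else 0 := by
  simp [Finsupp.single_apply]

theorem dL_mulFer (x y : FerGen M) :
    (dL x * mulFer y : Op N M)
      = -(mulFer y * dL x) + if y = x then 1 else 0 := by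
  refine end_ext fun f p e => ?_
  have h : (dL x * mulFer y : Op N M) (tp f p e) = tp f p
      (CliffordAlgebra.contractLeft (Finsupp.lapply x)
        (CliffordAlgebra.ι _ (Finsupp.single y 1) * e)) := by
    rw [mulFer_eq]; rfl
  have h2 : (mulFer y * dL x : Op N M) (tp f p e) = tp f p
      (CliffordAlgebra.ι _ (Finsupp.single y 1) *
        CliffordAlgebra.contractLeft (Finsupp.lapply x) e) := by
    rw [mulFer_eq]; rfl
  rw [LinearMap.add_apply, LinearMap.neg_apply, h, h2, CliffordAlgebra.contractLeft_ι_mul,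
    lapply_single, sub_eq_neg_add, tp_add_right, ← neg_one_smul ℂ, tp_smul_right, neg_one_smul]
  split_ifs
  · rw [one_smul]; rfl
  · simp [tp]

theorem contractRight_ι_mul (d : Module.Dual ℂ (FerGen M →₀ ℂ)) (x : FerGen M →₀ ℂ)
    (u : FerPart M) :
    CliffordAlgebra.contractRight (ExteriorAlgebra.ι ℂ x * u) d
      = ExteriorAlgebra.ι ℂ x * CliffordAlgebra.contractRight u d
        + d x • CliffordAlgebra.involute u := by
  induction u using CliffordAlgebra.right_induction with
  | algebraMap r =>
    rw [CliffordAlgebra.contractRight_mul_algebraMap, CliffordAlgebra.contractRight_algebraMap]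
    have h := CliffordAlgebra.contractRight_ι (Q := (0 : QuadraticForm ℂ (FerGen M →₀ ℂ))) d x
    change CliffordAlgebra.contractRight (ExteriorAlgebra.ι ℂ x) d = _ at h
    rw [h]
    simp [Algebra.smul_def]
  | add u v hu hv =>
    rw [mul_add, map_add, map_add, map_add]
    simp only [LinearMap.add_apply]
    rw [hu, hv, mul_add, smul_add]; abel
  | mul_ι m u hu =>
    have h1 := CliffordAlgebra.contractRight_mul_ι (Q := (0 : QuadraticForm ℂ (FerGen M →₀ ℂ))) d
      m (ExteriorAlgebra.ι ℂ x * u)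
    have h2 := CliffordAlgebra.contractRight_mul_ι (Q := (0 : QuadraticForm ℂ (FerGen M →₀ ℂ))) d
      m u
    rw [hu] at h1
    rw [← mul_assoc, map_mul CliffordAlgebra.involute, CliffordAlgebra.involute_ι]
    refine h1.trans ?_
    rw [h2]
    simp only [mul_sub, add_mul, mul_smul_comm, mul_neg, smul_neg, smul_mul_assoc, mul_assoc]
    exact (sub_sub _ _ _).symm.trans (sub_eq_add_neg _ _)

theorem dR_mulFer (x y : FerGen M) :
    (dR x * mulFer y : Op N M)
      = mulFer y * dR x + if y = x then parity else 0 := by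
  refine end_ext fun f p e => ?_
  have h : (dR x * mulFer y : Op N M) (tp f p e) = tp f p
      (CliffordAlgebra.contractRight (ExteriorAlgebra.ι ℂ (Finsupp.single y 1) * e)
        (Finsupp.lapply x)) := by
    rw [mulFer_eq]; rfl
  have h2 : (mulFer y * dR x : Op N M) (tp f p e) = tp f p
      (ExteriorAlgebra.ι ℂ (Finsupp.single y 1) *
        CliffordAlgebra.contractRight e (Finsupp.lapply x)) := by
    rw [mulFer_eq]; rfl
  rw [LinearMap.add_apply, h, h2, contractRight_ι_mul, lapply_single, tp_add_right]
  split_ifs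
  · rw [one_smul]; rfl
  · simp [tp]

theorem parity_mulFer (y : FerGen M) :
    (parity * mulFer y : Op N M) = -(mulFer y * parity) := by
  rw [mulFer_eq, parity, onFer_mul, onFer_mul, ← neg_one_smul ℂ, ← onFer_smul]
  congr 1
  refine LinearMap.ext fun u => ?_
  change CliffordAlgebra.involute (CliffordAlgebra.ι _ _ * u) = _
  rw [map_mul, CliffordAlgebra.involute_ι, neg_mul, LinearMap.smul_apply, neg_one_smul]
  rfl

theorem parity_parity : (parity * parity : Op N M) = 1 := by
  rw [parity, onFer_mul, ← onFer_one]
  congr 1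
  exact LinearMap.ext fun u => CliffordAlgebra.involute_involute u

theorem involute_contractLeft (d : Module.Dual ℂ (FerGen M →₀ ℂ)) (u : FerPart M) :
    CliffordAlgebra.involute (CliffordAlgebra.contractLeft d u)
      = -CliffordAlgebra.contractLeft d (CliffordAlgebra.involute u) := by
  induction u using CliffordAlgebra.left_induction with
  | algebraMap r => simp
  | add u v hu hv => simp only [map_add, hu, hv]; abel
  | ι_mul u m hu =>
    simp only [CliffordAlgebra.contractLeft_ι_mul, map_mul, CliffordAlgebra.involute_ι, map_sub,
      map_smul, hu, neg_mul, map_neg]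
    simp

theorem involute_contractRight (d : Module.Dual ℂ (FerGen M →₀ ℂ)) (u : FerPart M) :
    CliffordAlgebra.involute (CliffordAlgebra.contractRight u d)
      = -CliffordAlgebra.contractRight (CliffordAlgebra.involute u) d := by
  induction u using CliffordAlgebra.right_induction with
  | algebraMap r => simp
  | add u v hu hv => simp only [map_add, LinearMap.add_apply, hu, hv]; abel
  | mul_ι m u hu =>
    simp only [CliffordAlgebra.contractRight_mul_ι, map_mul, CliffordAlgebra.involute_ι, map_sub,
      map_smul, hu, mul_neg, map_neg, LinearMap.neg_apply]
    simp

theorem parity_dL (x : FerGen M) : (parity * dL x : Op N M) = -(dL x * parity) := by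
  rw [dL, parity, onFer_mul, onFer_mul, ← neg_one_smul ℂ, ← onFer_smul]
  congr 1
  refine LinearMap.ext fun u => ?_
  refine (involute_contractLeft _ u).trans ?_
  simp

theorem parity_dR (x : FerGen M) : (parity * dR x : Op N M) = -(dR x * parity) := by
  rw [dR, parity, onFer_mul, onFer_mul, ← neg_one_smul ℂ, ← onFer_smul]
  congr 1
  refine LinearMap.ext fun u => ?_
  refine (involute_contractRight _ u).trans ?_
  simp

theorem dL_dL (x y : FerGen M) : (dL x * dL y : Op N M) = -(dL y * dL x) := by
  rw [dL, dL, onFer_mul, onFer_mul, ← neg_one_smul ℂ, ← onFer_smul]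
  congr 1
  refine LinearMap.ext fun u => ?_
  refine (CliffordAlgebra.contractLeft_comm _ _ u).trans ?_
  simp

theorem dR_fn (x : FerGen M) (f : Ohat N) : dR x (fn f : Fock N M) = 0 := by
  rw [fn_eq_tp, dR, onFer_tp]
  erw [CliffordAlgebra.contractRight_one]
  simp [tp]
theorem dL_fn (x : FerGen M) (f : Ohat N) : dL x (fn f : Fock N M) = 0 := by
  rw [fn_eq_tp, dL, onFer_tp, CliffordAlgebra.contractLeft_one]
  simp [tp]
theorem dA_fn (i : Fin N) (m : ℕ) (f : Ohat N) : dA i m (fn f : Fock N M) = 0 := by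
  rw [fn_eq_tp, dA, onBos_tp]
  simp [tp]
theorem dB_succ_fn (i : Fin N) (n : ℕ) (f : Ohat N) : dB i (n + 1) (fn f : Fock N M) = 0 := by
  rw [fn_eq_tp, dB, onBos_tp]
  simp [tp]
theorem dB_zero_fn (i : Fin N) (f : Ohat N) : dB i 0 (fn f : Fock N M) = fn (pd i f) := rfl
theorem parity_fn (f : Ohat N) : parity (fn f : Fock N M) = fn f := by
  rw [fn_eq_tp, parity, onFer_tp]; simp

/-! #### The translation operator -/

theorem transl_eq : (transl : Op N M)
    = (∑ i, mulBos (BosGen.b i 0) * dB i 0) + onBos transBos + onFer transFer := rfl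

theorem transBos_commute_X (y : BosGen N) (p : BosPart N) :
    transBos (MvPolynomial.X y * p)
      = MvPolynomial.X y * transBos p + transBos (MvPolynomial.X y) * p := by
  unfold transBos
  change MvPolynomial.mkDerivation ℂ _ (MvPolynomial.X y * p) = _
  rw [Derivation.leibniz, smul_eq_mul, smul_eq_mul, mul_comm p]
  rfl

theorem transBos_b (i : Fin N) (n : ℕ) : transBos (MvPolynomial.X (BosGen.b i n))
    = ((n : ℂ) + 2) • MvPolynomial.X (BosGen.b i (n + 1)) := by
  unfold transBos
  exact MvPolynomial.mkDerivation_X ℂ _ _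
theorem transBos_a (i : Fin N) (n : ℕ) : transBos (MvPolynomial.X (BosGen.a i n))
    = ((n : ℂ) + 1) • MvPolynomial.X (BosGen.a i (n + 1)) := by
  unfold transBos
  exact MvPolynomial.mkDerivation_X ℂ _ _

theorem onBos_transBos_mulBos (y : BosGen N) :
    (onBos transBos * mulBos y : Op N M)
      = mulBos y * onBos transBos
        + onBos (LinearMap.mulLeft ℂ (transBos (MvPolynomial.X y))) := by
  rw [mulBos_eq, onBos_mul, onBos_mul, ← onBos_add]
  congr 1
  exact LinearMap.ext fun p => transBos_commute_X y p

theorem onBos_mulLeft_smul_X (c : ℂ) (y : BosGen N) :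
    (onBos (LinearMap.mulLeft ℂ (c • MvPolynomial.X y)) : Op N M)
      = c • mulBos y := by
  rw [mulBos_eq, ← onBos_smul]
  congr 1
  exact LinearMap.ext fun p => smul_mul_assoc _ _ _

theorem fst_transFerHom (e : FerPart M) : (transFerHom e).fst = e := by
  have h : (TrivSqZeroExt.fstHom ℂ (FerPart M) (FerPart M)).comp transFerHom
      = AlgHom.id ℂ (FerPart M) := by
    apply ExteriorAlgebra.hom_ext
    refine LinearMap.ext fun m => ?_
    simp [transFerHom]
  exact congrArg (fun φ => φ e) h

theorem transFer_ι_mul (x : FerGen M →₀ ℂ) (e : FerPart M) :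
    transFer (ExteriorAlgebra.ι ℂ x * e)
      = ExteriorAlgebra.ι ℂ x * transFer e + ExteriorAlgebra.ι ℂ (transFerGen x) * e := by
  have h : ∀ u : FerPart M, transFer u = (transFerHom u).snd := fun _ => rfl
  have h1 : (transFerHom (ExteriorAlgebra.ι ℂ x)).snd = ExteriorAlgebra.ι ℂ (transFerGen x) := by
    simp [transFerHom]
  rw [h, map_mul, TrivSqZeroExt.snd_mul, fst_transFerHom, fst_transFerHom, h1, h]
  simp

theorem transFer_one : transFer (1 : FerPart M) = 0 := by
  have h : transFer (1 : FerPart M) = (transFerHom (1 : FerPart M)).snd := rfl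
  rw [h, map_one]; simp

theorem onFer_transFer_mulFer (y : FerGen M) :
    (onFer transFer * mulFer y : Op N M)
      = mulFer y * onFer transFer
        + onFer (LinearMap.mulLeft ℂ (ExteriorAlgebra.ι ℂ (transFerGen (Finsupp.single y 1)))) := by
  rw [mulFer_eq, onFer_mul, onFer_mul, ← onFer_add]
  congr 1
  exact LinearMap.ext fun p => transFer_ι_mul _ p

theorem transFerGen_phi (j : Fin M) (n : ℕ) : transFerGen (Finsupp.single (FerGen.phi j n) (1 : ℂ))
    = ((n : ℂ) + 1) • Finsupp.single (FerGen.phi j (n + 1)) 1 := by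
  simp [transFerGen]
theorem transFerGen_psi (j : Fin M) (n : ℕ) : transFerGen (Finsupp.single (FerGen.psi j n) (1 : ℂ))
    = ((n : ℂ) + 1) • Finsupp.single (FerGen.psi j (n + 1)) 1 := by
  simp [transFerGen]

theorem onFer_mulLeft_smul_ι (c : ℂ) (y : FerGen M) :
    (onFer (LinearMap.mulLeft ℂ (ExteriorAlgebra.ι ℂ (c • Finsupp.single y 1))) :
      Op N M) = c • mulFer y := by
  rw [mulFer_eq, ← onFer_smul]
  congr 1
  refine LinearMap.ext fun p => ?_
  change ExteriorAlgebra.ι ℂ (c • Finsupp.single y (1 : ℂ)) * p = _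
  rw [map_smul, smul_mul_assoc]
  rfl

theorem transl_mulFn (f : Ohat N) : (transl * mulFn f : Op N M)
    = mulFn f * transl + ∑ i, mulBos (BosGen.b i 0) * mulFn (pd i f) := by
  have h1 : (onBos transBos * mulFn f : Op N M) = mulFn f * onBos transBos := by
    rw [mulFn_eq]; exact (commute_onFn_onBos _ _).symm.eq
  have h2 : (onFer transFer * mulFn f : Op N M) = mulFn f * onFer transFer :=
    (onFer_commute_mulFn _ _).eq
  rw [transl_eq, add_mul, add_mul, h1, h2, sum_mul, mul_add, mul_add, mul_sum]
  have h3 : ∀ i, (mulBos (BosGen.b i 0) * dB i 0 * mulFn f : Op N M)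
      = mulFn f * (mulBos (BosGen.b i 0) * dB i 0) + mulBos (BosGen.b i 0) * mulFn (pd i f) := by
    intro i
    rw [mul_assoc, dB_zero_mulFn, mul_add, ← mul_assoc, ← mul_assoc,
      (commute_mulFn_mulBos f (BosGen.b i 0)).eq]
  simp only [h3, sum_add_distrib]
  abel

theorem transl_mulBos (y : BosGen N) : (transl * mulBos y : Op N M)
    = mulBos y * transl + onBos (LinearMap.mulLeft ℂ (transBos (MvPolynomial.X y))) := by
  rw [transl_eq, add_mul, add_mul, onBos_transBos_mulBos, (onFer_commute_mulBos _ _).eq,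
    sum_mul, mul_add, mul_add, mul_sum]
  have h3 : ∀ i, (mulBos (BosGen.b i 0) * dB i 0 * mulBos y : Op N M)
      = mulBos y * (mulBos (BosGen.b i 0) * dB i 0) := by
    intro i
    rw [mul_assoc, (dB_zero_mulBos i y).eq, ← mul_assoc, ← mul_assoc, (commute_mulBos _ y).eq]
  simp only [h3]
  abel

theorem transl_mulBos_b (i : Fin N) (n : ℕ) :
    (transl * mulBos (BosGen.b i n) : Op N M)
      = mulBos (BosGen.b i n) * transl + ((n : ℂ) + 2) • mulBos (BosGen.b i (n + 1)) := by
  rw [transl_mulBos, transBos_b, onBos_mulLeft_smul_X]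

theorem transl_mulBos_a (i : Fin N) (n : ℕ) :
    (transl * mulBos (BosGen.a i n) : Op N M)
      = mulBos (BosGen.a i n) * transl + ((n : ℂ) + 1) • mulBos (BosGen.a i (n + 1)) := by
  rw [transl_mulBos, transBos_a, onBos_mulLeft_smul_X]

theorem transl_mulFer (y : FerGen M) : (transl * mulFer y : Op N M)
    = mulFer y * transl
      + onFer (LinearMap.mulLeft ℂ (ExteriorAlgebra.ι ℂ (transFerGen (Finsupp.single y 1)))) := by
  have h1 : (onBos transBos * mulFer y : Op N M) = mulFer y * onBos transBos := by
    rw [mulFer_eq]; exact (commute_onBos_onFer _ _).eq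
  rw [transl_eq, add_mul, add_mul, onFer_transFer_mulFer, h1,
    sum_mul, mul_add, mul_add, mul_sum]
  have h3 : ∀ i, (mulBos (BosGen.b i 0) * dB i 0 * mulFer y : Op N M)
      = mulFer y * (mulBos (BosGen.b i 0) * dB i 0) := by
    intro i
    rw [mul_assoc, (dB_mulFer i 0 y).eq, ← mul_assoc, ← mul_assoc, (commute_mulBos_mulFer _ y).eq]
  simp only [h3]
  abel

theorem transl_mulFer_phi (j : Fin M) (n : ℕ) :
    (transl * mulFer (FerGen.phi j n) : Op N M)
      = mulFer (FerGen.phi j n) * transl + ((n : ℂ) + 1) • mulFer (FerGen.phi j (n + 1)) := by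
  rw [transl_mulFer, transFerGen_phi, onFer_mulLeft_smul_ι]

theorem transl_mulFer_psi (j : Fin M) (n : ℕ) :
    (transl * mulFer (FerGen.psi j n) : Op N M)
      = mulFer (FerGen.psi j n) * transl + ((n : ℂ) + 1) • mulFer (FerGen.psi j (n + 1)) := by
  rw [transl_mulFer, transFerGen_psi, onFer_mulLeft_smul_ι]

theorem transl_one : transl (1 : Fock N M) = 0 := by
  have h1 : ∀ i, (dB i 0 : Op N M) 1 = 0 := by
    intro i
    rw [← fn_one, dB_zero_fn, Derivation.map_one_eq_zero, fn_zero]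
  have h2 : (onBos transBos : Op N M) 1 = 0 := by
    rw [one_eq_tp, onBos_tp]
    have : transBos (1 : BosPart N) = 0 := by
      unfold transBos
      exact Derivation.map_one_eq_zero _
    rw [this]; simp [tp]
  have h3 : (onFer transFer : Op N M) 1 = 0 := by
    rw [one_eq_tp, onFer_tp, transFer_one]; simp [tp]
  rw [transl_eq]
  simp [h1, h2, h3]

theorem transl_fn (f : Ohat N) : transl (fn f : Fock N M) = ∑ i, b' i * fn (pd i f) := by
  have h := congrArg (fun D => D (1 : Fock N M)) (transl_mulFn (M := M) f)
  simp only [Module.End.mul_apply, LinearMap.add_apply, LinearMap.sum_apply, transl_one, map_zero,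
    zero_add, mulFn_apply, mul_one, mulBos_apply] at h
  exact h

/-- The translation operator is a derivation. -/
theorem transl_mul (u v : Fock N M) : transl (u * v) = transl u * v + u * transl v := by
  refine induction (P := fun u => transl (u * v) = transl u * v + u * transl v)
    (fun f => ?_) (fun u w hu hw => ?_) (fun y u hu => ?_) (fun y u hu => ?_) u
  · have h := congrArg (fun D => D v) (transl_mulFn (M := M) f)
    simp only [Module.End.mul_apply, LinearMap.add_apply, LinearMap.sum_apply,
      mulFn_apply, mulBos_apply] at h
    rw [h, transl_fn, sum_mul, add_comm]
    simp only [mul_assoc]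
    rfl
  · rw [add_mul, map_add, hu, hw, map_add, add_mul, add_mul]; abel
  · have h1 := congrArg (fun D => D (u * v)) (transl_mulBos (M := M) y)
    have h2 := congrArg (fun D => D u) (transl_mulBos (M := M) y)
    have hD : ∀ w : Fock N M, onBos (LinearMap.mulLeft ℂ (transBos (MvPolynomial.X y))) w
        = tp 1 (transBos (MvPolynomial.X y)) 1 * w := fun w => by
      refine tp_induction (P := fun w : Fock N M =>
        onBos (LinearMap.mulLeft ℂ (transBos (MvPolynomial.X y))) w
        = tp 1 (transBos (MvPolynomial.X y)) 1 * w) (fun f p e => ?_)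
        (fun a b ha hb => by rw [map_add, mul_add, ha, hb]) w
      rw [tp_mul, onBos_tp, one_mul, one_mul]; rfl
    simp only [Module.End.mul_apply, LinearMap.add_apply, mulBos_apply, hD] at h1 h2
    rw [mul_assoc, h1, hu, h2, mul_add, add_mul]
    simp only [mul_assoc]
    abel
  · have h1 := congrArg (fun D => D (u * v)) (transl_mulFer (N := N) y)
    have h2 := congrArg (fun D => D u) (transl_mulFer (N := N) y)
    have hD : ∀ w : Fock N M, onFer (LinearMap.mulLeft ℂ
        (ExteriorAlgebra.ι ℂ (transFerGen (Finsupp.single y 1)))) w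
        = tp 1 1 (ExteriorAlgebra.ι ℂ (transFerGen (Finsupp.single y 1))) * w := fun w => by
      refine tp_induction (P := fun w : Fock N M => onFer (LinearMap.mulLeft ℂ
        (ExteriorAlgebra.ι ℂ (transFerGen (Finsupp.single y 1)))) w
        = tp 1 1 (ExteriorAlgebra.ι ℂ (transFerGen (Finsupp.single y 1))) * w) (fun f p e => ?_)
        (fun a b ha hb => by rw [map_add, mul_add, ha, hb]) w
      rw [tp_mul, onFer_tp, one_mul, one_mul]; rfl
    simp only [Module.End.mul_apply, LinearMap.add_apply, mulFer_apply, hD] at h1 h2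
    rw [mul_assoc, h1, hu, h2, mul_add, add_mul]
    simp only [mul_assoc]
    abel

theorem transl_bos_b (i : Fin N) (n : ℕ) :
    transl (bos (BosGen.b i n) : Fock N M) = ((n : ℂ) + 2) • bos (BosGen.b i (n + 1)) := by
  have h := congrArg (fun D => D (1 : Fock N M)) (transl_mulBos_b (M := M) i n)
  simpa [transl_one, mulBos_apply] using h
theorem transl_bos_a (i : Fin N) (n : ℕ) :
    transl (bos (BosGen.a i n) : Fock N M) = ((n : ℂ) + 1) • bos (BosGen.a i (n + 1)) := by
  have h := congrArg (fun D => D (1 : Fock N M)) (transl_mulBos_a (M := M) i n)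
  simpa [transl_one, mulBos_apply] using h
theorem transl_fer_phi (j : Fin M) (n : ℕ) :
    transl (fer (FerGen.phi j n) : Fock N M) = ((n : ℂ) + 1) • fer (FerGen.phi j (n + 1)) := by
  have h := congrArg (fun D => D (1 : Fock N M)) (transl_mulFer_phi (N := N) j n)
  simpa [transl_one, mulFer_apply] using h
theorem transl_fer_psi (j : Fin M) (n : ℕ) :
    transl (fer (FerGen.psi j n) : Fock N M) = ((n : ℂ) + 1) • fer (FerGen.psi j (n + 1)) := by
  have h := congrArg (fun D => D (1 : Fock N M)) (transl_mulFer_psi (N := N) j n)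
  simpa [transl_one, mulFer_apply] using h

theorem parity_mulFer_apply (y : FerGen M) (u : Fock N M) :
    parity (fer y * u) = -(fer y * parity u) := by
  exact congrArg (fun D => D u) (parity_mulFer (N := N) y)
theorem parity_mulBos_apply (y : BosGen N) (u : Fock N M) :
    parity (bos y * u) = bos y * parity u :=
  congrArg (fun D => D u) (onFer_commute_mulBos (M := M) CliffordAlgebra.involute.toLinearMap y).eq
theorem parity_mulFn_apply (f : Ohat N) (u : Fock N M) :
    parity (fn f * u) = fn f * parity u :=
  congrArg (fun D => D u) (onFer_commute_mulFn (M := M) CliffordAlgebra.involute.toLinearMap f).eq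
theorem parity_parity_apply (u : Fock N M) : parity (parity u) = u :=
  congrArg (fun D => D u) parity_parity
theorem parity_bos (y : BosGen N) : parity (bos y : Fock N M) = bos y := by
  have h := parity_mulBos_apply (M := M) y 1
  rwa [← fn_one, parity_fn, fn_one, mul_one] at h
theorem parity_fer (y : FerGen M) : parity (fer y : Fock N M) = -fer y := by
  have h := parity_mulFer_apply (N := N) y 1
  rwa [← fn_one, parity_fn, fn_one, mul_one] at h

theorem parity_mul (u v : Fock N M) : parity (u * v) = parity u * parity v := by
  refine induction (P := fun u => parity (u * v) = parity u * parity v)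
    (fun f => ?_) (fun u w hu hw => ?_) (fun y u hu => ?_) (fun y u hu => ?_) u
  · rw [parity_fn, parity_mulFn_apply]
  · rw [add_mul, map_add, hu, hw, map_add, add_mul]
  · rw [mul_assoc, parity_mulBos_apply, hu, parity_mulBos_apply, mul_assoc]
  · rw [mul_assoc, parity_mulFer_apply, hu, parity_mulFer_apply, neg_mul, mul_assoc]

theorem parity_transl (u : Fock N M) : parity (transl u) = transl (parity u) := by
  refine induction (P := fun u => parity (transl u) = transl (parity u))
    (fun f => ?_) (fun u w hu hw => ?_) (fun y u hu => ?_) (fun y u hu => ?_) u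
  · rw [parity_fn, transl_fn, map_sum]
    refine sum_congr rfl fun i _ => ?_
    rw [b', parity_mulBos_apply, parity_fn]
  · simp only [map_add, hu, hw]
  · have : parity (transl (bos y) : Fock N M) = transl (bos y) := by
      cases y
      · rw [transl_bos_b, map_smul, parity_bos]
      · rw [transl_bos_a, map_smul, parity_bos]
    rw [transl_mul, map_add, parity_mul, parity_mul, hu, this, parity_mul, transl_mul, parity_bos]
  · have : parity (transl (fer y) : Fock N M) = -transl (fer y) := by
      cases y
      · rw [transl_fer_phi, map_smul, parity_fer, smul_neg]
      · rw [transl_fer_psi, map_smul, parity_fer, smul_neg]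
    rw [transl_mul, map_add, parity_mul, parity_mul, hu, this, parity_mul, transl_mul, parity_fer,
      map_neg]

theorem dA_bos_mul (i : Fin N) (m : ℕ) (y : BosGen N) (u : Fock N M) :
    dA i m (bos y * u) = bos y * dA i m u + if y = BosGen.a i m then u else 0 := by
  have h := congrArg (fun D => D u) (dA_mulBos (M := M) i m y)
  refine h.trans ?_
  split_ifs <;> rfl
theorem dB_succ_bos_mul (i : Fin N) (m : ℕ) (y : BosGen N) (u : Fock N M) :
    dB i (m + 1) (bos y * u) = bos y * dB i (m + 1) u + if y = BosGen.b i m then u else 0 := by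
  have h := congrArg (fun D => D u) (dB_succ_mulBos (M := M) i m y)
  refine h.trans ?_
  split_ifs <;> rfl
theorem dB_zero_bos_mul (i : Fin N) (y : BosGen N) (u : Fock N M) :
    dB i 0 (bos y * u) = bos y * dB i 0 u := congrArg (fun D => D u) (dB_zero_mulBos (M := M) i y).eq
theorem dA_fer_mul (i : Fin N) (m : ℕ) (y : FerGen M) (u : Fock N M) :
    dA i m (fer y * u) = fer y * dA i m u := congrArg (fun D => D u) (dA_mulFer (M := M) i m y).eq
theorem dB_fer_mul (i : Fin N) (m : ℕ) (y : FerGen M) (u : Fock N M) :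
    dB i m (fer y * u) = fer y * dB i m u := congrArg (fun D => D u) (dB_mulFer (M := M) i m y).eq
theorem dA_fn_mul (i : Fin N) (m : ℕ) (f : Ohat N) (u : Fock N M) :
    dA i m (fn f * u) = fn f * dA i m u := congrArg (fun D => D u) (dA_mulFn (M := M) i m f).eq
theorem dB_succ_fn_mul (i : Fin N) (m : ℕ) (f : Ohat N) (u : Fock N M) :
    dB i (m + 1) (fn f * u) = fn f * dB i (m + 1) u :=
  congrArg (fun D => D u) (dB_succ_mulFn (M := M) i m f).eq
theorem dB_zero_fn_mul (i : Fin N) (f : Ohat N) (u : Fock N M) :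
    dB i 0 (fn f * u) = fn f * dB i 0 u + fn (pd i f) * u :=
  congrArg (fun D => D u) (dB_zero_mulFn (M := M) i f)
theorem dL_fer_mul (x y : FerGen M) (u : Fock N M) :
    dL x (fer y * u) = -(fer y * dL x u) + if y = x then u else 0 := by
  have h := congrArg (fun D => D u) (dL_mulFer (N := N) x y)
  refine h.trans ?_
  split_ifs <;> rfl
theorem dL_bos_mul (x : FerGen M) (y : BosGen N) (u : Fock N M) :
    dL x (bos y * u) = bos y * dL x u :=
  congrArg (fun D => D u) (onFer_commute_mulBos (M := M) _ y).eq
theorem dL_fn_mul (x : FerGen M) (f : Ohat N) (u : Fock N M) :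
    dL x (fn f * u) = fn f * dL x u :=
  congrArg (fun D => D u) (onFer_commute_mulFn (M := M) _ f).eq

/-! #### Commutators of the derivatives with the translation operator -/

theorem dA_transl (i : Fin N) (m : ℕ) (u : Fock N M) :
    dA i m (transl u) = transl (dA i m u) + (m : ℂ) • dA i (m - 1) u := by
  refine induction (P := fun u : Fock N M =>
    dA i m (transl u) = transl (dA i m u) + (m : ℂ) • dA i (m - 1) u)
    (fun f => ?_) (fun u w hu hw => ?_) (fun y u hu => ?_) (fun y u hu => ?_) u
  · simp [transl_fn, b', dA_bos_mul, dA_fn]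
  · simp only [map_add, hu, hw, smul_add]; abel
  · rcases y with ⟨j, n⟩ | ⟨j, n⟩
    · simp only [transl_mul, map_add, dA_bos_mul, hu, transl_bos_b, smul_mul_assoc, map_smul,
        reduceCtorEq, if_false, add_zero, mul_add, mul_smul_comm]
      abel
    · simp only [transl_mul, map_add, dA_bos_mul, hu, transl_bos_a, smul_mul_assoc, map_smul,
        mul_add, mul_smul_comm, smul_add, BosGen.a.injEq]
      rcases m with _ | m
      · by_cases h : j = i ∧ n = 0 <;> simp [h] <;> abel
      · by_cases h : j = i ∧ n = m + 1
        · obtain ⟨rfl, rfl⟩ := h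
          simp; abel
        · by_cases h' : j = i ∧ n = m
          · obtain ⟨rfl, rfl⟩ := h'
            simp; abel
          · simp [h, h']; abel
  · have : ∀ y : FerGen M, dA i m (transl (fer y) * u : Fock N M) = transl (fer y) * dA i m u := by
      rintro (_ | _) <;> simp [transl_fer_phi, transl_fer_psi, dA_fer_mul]
    simp only [transl_mul, map_add, dA_fer_mul, hu, this, mul_add, mul_smul_comm]
    abel

theorem dB_transl (i : Fin N) (m : ℕ) (u : Fock N M) :
    dB i m (transl u) = transl (dB i m u) + (m : ℂ) • dB i (m - 1) u := by
  refine induction (P := fun u : Fock N M =>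
    dB i m (transl u) = transl (dB i m u) + (m : ℂ) • dB i (m - 1) u)
    (fun f => ?_) (fun u w hu hw => ?_) (fun y u hu => ?_) (fun y u hu => ?_) u
  · rcases m with _ | _ | m
    · simp [transl_fn, b', dB_zero_bos_mul, dB_zero_fn, pd_comm i]
    · simp [transl_fn, b', dB_succ_bos_mul, dB_succ_fn, dB_zero_fn]
    · simp [transl_fn, b', dB_succ_bos_mul, dB_succ_fn]
  · simp only [map_add, hu, hw, smul_add]; abel
  · rcases m with _ | m
    · have : ∀ y : BosGen N, dB i 0 (transl (bos y) * u : Fock N M) = transl (bos y) * dB i 0 u := by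
        rintro (_ | _) <;> simp [transl_bos_b, transl_bos_a, dB_zero_bos_mul]
      simp only [transl_mul, map_add, dB_zero_bos_mul, hu, this, mul_add, mul_smul_comm]
      simp
    · rcases y with ⟨j, n⟩ | ⟨j, n⟩
      · simp only [transl_mul, map_add, dB_succ_bos_mul, hu, transl_bos_b, smul_mul_assoc, map_smul,
          mul_add, mul_smul_comm, smul_add, BosGen.b.injEq]
        rcases m with _ | m
        · by_cases h : j = i ∧ n = 0 <;> simp [h, dB_zero_bos_mul] <;> abel
        · by_cases h : j = i ∧ n = m + 1
          · obtain ⟨rfl, rfl⟩ := h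
            simp [dB_succ_bos_mul]; abel
          · by_cases h' : j = i ∧ n = m
            · obtain ⟨rfl, rfl⟩ := h'
              simp [dB_succ_bos_mul]
              rw [← sub_eq_zero]; module
            · simp [h, h', dB_succ_bos_mul]; abel
      · have e : ∀ k, dB i k (bos (BosGen.a j n) * u : Fock N M)
            = bos (BosGen.a j n) * dB i k u := by
          rintro (_ | k) <;> simp [dB_zero_bos_mul, dB_succ_bos_mul]
        have e' : ∀ k, dB i k (bos (BosGen.a j (n + 1)) * u : Fock N M)
            = bos (BosGen.a j (n + 1)) * dB i k u := by
          rintro (_ | k) <;> simp [dB_zero_bos_mul, dB_succ_bos_mul]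
        have e'' : dB i (m + 1) (bos (BosGen.a j n) * transl u : Fock N M)
            = bos (BosGen.a j n) * dB i (m + 1) (transl u) := by
          simp [dB_succ_bos_mul]
        simp only [transl_mul, map_add, e, e', e'', hu, transl_bos_a, smul_mul_assoc, map_smul,
          mul_add, mul_smul_comm]
        abel
  · have : ∀ y : FerGen M, dB i m (transl (fer y) * u : Fock N M) = transl (fer y) * dB i m u := by
      rintro (_ | _) <;> simp [transl_fer_phi, transl_fer_psi, dB_fer_mul]
    simp only [transl_mul, map_add, dB_fer_mul, hu, this, mul_add, mul_smul_comm]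
    abel

theorem dL_phi_transl (i : Fin M) (m : ℕ) (u : Fock N M) :
    dL (FerGen.phi i m) (transl u)
      = transl (dL (FerGen.phi i m) u) + (m : ℂ) • dL (FerGen.phi i (m - 1)) u := by
  refine induction (P := fun u : Fock N M => dL (FerGen.phi i m) (transl u)
      = transl (dL (FerGen.phi i m) u) + (m : ℂ) • dL (FerGen.phi i (m - 1)) u)
    (fun f => ?_) (fun u w hu hw => ?_) (fun y u hu => ?_) (fun y u hu => ?_) u
  · simp [transl_fn, b', dL_bos_mul, dL_fn]
  · simp only [map_add, hu, hw, smul_add]; abel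
  · have : ∀ y : BosGen N, dL (FerGen.phi i m) (transl (bos y) * u : Fock N M)
        = transl (bos y) * dL (FerGen.phi i m) u := by
      rintro (_ | _) <;> simp [transl_bos_b, transl_bos_a, dL_bos_mul]
    simp only [transl_mul, map_add, dL_bos_mul, hu, this, mul_add, mul_smul_comm]
    abel
  · rcases y with ⟨j, n⟩ | ⟨j, n⟩
    · simp only [transl_mul, map_add, dL_fer_mul, hu, transl_fer_phi, smul_mul_assoc, map_smul,
        mul_add, mul_smul_comm, smul_add, map_neg, FerGen.phi.injEq]
      rcases m with _ | m
      · by_cases h : j = i ∧ n = 0 <;> simp [h] <;> abel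
      · by_cases h : j = i ∧ n = m + 1
        · obtain ⟨rfl, rfl⟩ := h
          simp; abel
        · by_cases h' : j = i ∧ n = m
          · obtain ⟨rfl, rfl⟩ := h'
            simp; abel
          · simp [h, h']; abel
    · simp only [transl_mul, map_add, dL_fer_mul, hu, transl_fer_psi, smul_mul_assoc, map_smul,
        mul_add, mul_smul_comm, smul_add, map_neg, reduceCtorEq, if_false, add_zero]
      simp; abel

theorem dL_psi_transl (i : Fin M) (m : ℕ) (u : Fock N M) :
    dL (FerGen.psi i m) (transl u)
      = transl (dL (FerGen.psi i m) u) + (m : ℂ) • dL (FerGen.psi i (m - 1)) u := by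
  refine induction (P := fun u : Fock N M => dL (FerGen.psi i m) (transl u)
      = transl (dL (FerGen.psi i m) u) + (m : ℂ) • dL (FerGen.psi i (m - 1)) u)
    (fun f => ?_) (fun u w hu hw => ?_) (fun y u hu => ?_) (fun y u hu => ?_) u
  · simp [transl_fn, b', dL_bos_mul, dL_fn]
  · simp only [map_add, hu, hw, smul_add]; abel
  · have : ∀ y : BosGen N, dL (FerGen.psi i m) (transl (bos y) * u : Fock N M)
        = transl (bos y) * dL (FerGen.psi i m) u := by
      rintro (_ | _) <;> simp [transl_bos_b, transl_bos_a, dL_bos_mul]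
    simp only [transl_mul, map_add, dL_bos_mul, hu, this, mul_add, mul_smul_comm]
    abel
  · rcases y with ⟨j, n⟩ | ⟨j, n⟩
    · simp only [transl_mul, map_add, dL_fer_mul, hu, transl_fer_phi, smul_mul_assoc, map_smul,
        mul_add, mul_smul_comm, smul_add, map_neg, reduceCtorEq, if_false, add_zero]
      simp; abel
    · simp only [transl_mul, map_add, dL_fer_mul, hu, transl_fer_psi, smul_mul_assoc, map_smul,
        mul_add, mul_smul_comm, smul_add, map_neg, FerGen.psi.injEq]
      rcases m with _ | m
      · by_cases h : j = i ∧ n = 0 <;> simp [h] <;> abel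
      · by_cases h : j = i ∧ n = m + 1
        · obtain ⟨rfl, rfl⟩ := h
          simp; abel
        · by_cases h' : j = i ∧ n = m
          · obtain ⟨rfl, rfl⟩ := h'
            simp; abel
          · simp [h, h']; abel

end Fock

end ChiralDO

end

noncomputable section

namespace ChiralDO

/-! ### Coefficients of exponentials of power series with operator coefficients -/

section Exponential

variable {R : Type*} [Ring R]

theorem coeff_mk_pow_eq_zero {d : ℕ → R} (h0 : d 0 = 0) {q k : ℕ} (h : q < k) :
    PowerSeries.coeff q (PowerSeries.mk d ^ k) = 0 := by
  induction k generalizing q with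
  | zero => omega
  | succ k ih =>
    rw [pow_succ, PowerSeries.coeff_mul]
    refine sum_eq_zero fun p hp => ?_
    rw [Finset.HasAntidiagonal.mem_antidiagonal] at hp
    rcases Nat.eq_zero_or_pos p.2 with h2 | h2
    · rw [h2, PowerSeries.coeff_mk, h0, mul_zero]
    · rw [ih (by omega), zero_mul]

variable [Algebra ℂ R]

/-- The coefficient at `X^q` of `exp (Σ d_q X^q)`. -/
def pexp (d : ℕ → R) (q : ℕ) : R :=
  ∑ k ∈ Finset.range (q + 1), ((k.factorial : ℂ)⁻¹) • PowerSeries.coeff q (PowerSeries.mk d ^ k)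

theorem pexp_eq {d : ℕ → R} (h0 : d 0 = 0) {q B : ℕ} (h : q < B) :
    pexp d q = ∑ k ∈ Finset.range B, ((k.factorial : ℂ)⁻¹) •
      PowerSeries.coeff q (PowerSeries.mk d ^ k) := by
  unfold pexp
  refine Finset.sum_subset (Finset.range_mono (by omega)) fun k _ hk => ?_
  rw [mem_range, not_lt] at hk
  rw [coeff_mk_pow_eq_zero h0 (by omega), smul_zero]

theorem pexp_zero (d : ℕ → R) : pexp d 0 = 1 := by simp [pexp]

/-- If `[d_q, x] = κ_q` commutes with all `d_r`, then `exp(d) x = x exp(d) + κ exp(d)`. -/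
theorem pexp_mul {d κ : ℕ → R} (h0 : d 0 = 0) {x : R} (hx : ∀ q, d q * x = x * d q + κ q)
    (hκ : ∀ q r, Commute (d q) (κ r)) (q : ℕ) :
    pexp d q * x = x * pexp d q + ∑ p ∈ Finset.HasAntidiagonal.antidiagonal q, κ p.1 * pexp d p.2 := by
  set D : PowerSeries R := PowerSeries.mk d with hD
  set K : PowerSeries R := PowerSeries.mk κ with hK
  have h1 : D * PowerSeries.C x = PowerSeries.C x * D + K := by
    ext q
    simp [hD, hK, hx]
  have h2 : Commute D K := by
    rw [commute_iff_eq]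
    ext q
    rw [PowerSeries.coeff_mul, PowerSeries.coeff_mul, ← Finset.Nat.sum_antidiagonal_swap]
    refine sum_congr rfl fun p _ => ?_
    simp [hD, hK, (hκ p.2 p.1).eq]
  have h3 : ∀ k : ℕ, D ^ (k + 1) * PowerSeries.C x
      = PowerSeries.C x * D ^ (k + 1) + (k + 1 : ℕ) • (K * D ^ k) := by
    intro k
    induction k with
    | zero => simpa using h1
    | succ k ih =>
      rw [pow_succ D (k + 1), mul_assoc, h1, mul_add, ← mul_assoc, ih, add_mul, smul_mul_assoc,
        mul_assoc, mul_assoc, (h2.symm.pow_right (k+1)).eq, succ_nsmul _ (k + 1), add_assoc,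
        ← pow_succ, ← pow_succ, (h2.pow_left (k + 1)).eq]
  rw [pexp_eq h0 (Nat.lt_succ_of_lt (Nat.lt_succ_self q)), sum_mul, mul_sum,
    Finset.sum_range_succ' _ (q + 1), Finset.sum_range_succ' _ (q + 1)]
  have e0 : ((Nat.factorial 0 : ℂ)⁻¹ • PowerSeries.coeff q (D ^ 0)) * x
      = x * ((Nat.factorial 0 : ℂ)⁻¹ • PowerSeries.coeff q (D ^ 0)) := by
    simp only [pow_zero, PowerSeries.coeff_one]
    split_ifs <;> simp
  have e1 : ∀ k : ℕ, ((((k + 1).factorial : ℕ) : ℂ)⁻¹ • PowerSeries.coeff q (D ^ (k + 1))) * x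
      = x * ((((k + 1).factorial : ℕ) : ℂ)⁻¹ • PowerSeries.coeff q (D ^ (k + 1)))
        + ((k.factorial : ℂ)⁻¹) • PowerSeries.coeff q (K * D ^ k) := by
    intro k
    have h := congrArg (PowerSeries.coeff q) (h3 k)
    rw [PowerSeries.coeff_mul_C, map_add, PowerSeries.coeff_C_mul, map_nsmul] at h
    rw [smul_mul_assoc, h, smul_add, mul_smul_comm, ← Nat.cast_smul_eq_nsmul ℂ, smul_smul]
    congr 2
    rw [Nat.factorial_succ]
    have : ((k + 1 : ℕ) : ℂ) ≠ 0 := Nat.cast_ne_zero.mpr (by omega)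
    have : ((k.factorial : ℕ) : ℂ) ≠ 0 := Nat.cast_ne_zero.mpr (Nat.factorial_ne_zero k)
    push_cast at *
    field_simp
  simp only [← hD, e1, sum_add_distrib, e0]
  rw [add_right_comm]
  congr 1
  simp only [PowerSeries.coeff_mul, smul_sum]
  rw [sum_comm]
  refine sum_congr rfl fun p hp => ?_
  rw [Finset.HasAntidiagonal.mem_antidiagonal] at hp
  rw [pexp_eq h0 (show p.2 < q + 1 by omega), mul_sum]
  refine sum_congr rfl fun k _ => ?_
  rw [mul_smul_comm, PowerSeries.coeff_mk]

end Exponential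

/-- Exponentials are compatible with intertwining maps. -/
theorem pexp_intertwine {V W : Type*} [AddCommGroup V] [Module ℂ V] [AddCommGroup W] [Module ℂ W]
    (J : V →ₗ[ℂ] W) {d : ℕ → Module.End ℂ V} {e : ℕ → Module.End ℂ W}
    (h : ∀ q v, e q (J v) = J (d q v)) (q : ℕ) (v : V) : pexp e q (J v) = J (pexp d q v) := by
  have key : ∀ (k q : ℕ) (v : V), PowerSeries.coeff q (PowerSeries.mk e ^ k) (J v)
      = J (PowerSeries.coeff q (PowerSeries.mk d ^ k) v) := by
    intro k
    induction k with
    | zero =>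
      intro q v
      simp only [pow_zero, PowerSeries.coeff_one]
      split_ifs <;> simp
    | succ k ih =>
      intro q v
      simp [pow_succ, PowerSeries.coeff_mul, h, ih]
  simp [pexp, key]

end ChiralDO

end

noncomputable section

namespace ChiralDO

open Ohat

namespace Fock

variable {N M : ℕ}

/-! #### Creation modes and contractions -/

/-- Even or odd creation modes. -/
abbrev Gen (N M : ℕ) : Type := BosGen N ⊕ FerGen M

/-- A creation mode as a state. -/
def gen : Gen N M → Fock N M := Sum.elim bos fer

/-- The operator of multiplication by a creation mode. -/
def mulGen : Gen N M → Op N M := Sum.elim mulBos mulFer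

theorem mulGen_apply (y : Gen N M) (u : Fock N M) : mulGen y u = gen y * u := by
  cases y <;> rfl

/-- The parity involution for `p = true`, the identity for `p = false`. -/
def parityPow (p : Bool) : Op N M := if p then parity else 1

/-- `ann y s` is the mode of index `s ≥ 0` of the field of the creation mode `y`. -/
def ann : Gen N M → ℕ → Op N M
  | Sum.inl (BosGen.a i k), s =>
      if k ≤ s then ((-1 : ℂ) ^ k * (s.choose (s - k) : ℕ)) • dB i (s - k) else 0
  | Sum.inl (BosGen.b i k), s =>
      if k + 1 ≤ s then ((-1 : ℂ) ^ k * (s.choose (k + 1) : ℕ)) • dA i (s - (k + 1)) else 0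
  | Sum.inr (FerGen.phi j k), s =>
      if k ≤ s then ((-1 : ℂ) ^ k * (s.choose k : ℕ)) • dL (FerGen.psi j (s - k)) else 0
  | Sum.inr (FerGen.psi j k), s =>
      if k ≤ s then ((-1 : ℂ) ^ k * (s.choose (s - k) : ℕ)) • dL (FerGen.phi j (s - k)) else 0

theorem tens_mul (A B C D : Op N M) :
    tens A B * tens C D = tens (A * C) (B * D) := (TensorProduct.map_mul A C B D).symm

theorem tens_add_left (A B C : Op N M) :
    tens (A + B) C = tens A C + tens B C := TensorProduct.map_add_left _ _ _
theorem tens_zero_left (C : Op N M) :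
    tens (0 : Op N M) C = 0 := TensorProduct.map_zero_left _
theorem tens_zero_right (C : Op N M) :
    tens C (0 : Op N M) = 0 := TensorProduct.map_zero_right _
theorem tens_smul_right (c : ℂ) (A B : Op N M) :
    tens A (c • B) = c • tens A B := TensorProduct.map_smul_right _ _ _
theorem tens_neg_neg (A B : Op N M) : tens (-A) (-B) = tens A B := by
  apply TensorProduct.ext'
  intro u v
  change (-(A u)) ⊗ₜ[ℂ] (-(B v)) = A u ⊗ₜ B v
  rw [TensorProduct.neg_tmul, TensorProduct.tmul_neg, neg_neg]

theorem tens_commute {A B C D : Op N M} (h1 : Commute A C) (h2 : Commute B D) :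
    Commute (tens A B) (tens C D) := by
  rw [commute_iff_eq, tens_mul, tens_mul, h1.eq, h2.eq]

theorem tens_commute_of_anti {A B C D : Op N M} (h1 : A * C = -(C * A))
    (h2 : B * D = -(D * B)) : Commute (tens A B) (tens C D) := by
  rw [commute_iff_eq, tens_mul, tens_mul, h1, h2, tens_neg_neg]

theorem pairContr_eq (m n : ℕ) : (pairContr m n : Module.End ℂ (Fock N M ⊗[ℂ] Fock N M))
    = (∑ i : Fin N, ((-1 : ℂ) ^ m • tens (dA i m) (dB i n)
      + (-1 : ℂ) ^ (n + 1) • tens (dB i n) (dA i m)))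
    + ∑ j : Fin M, ((-1 : ℂ) ^ m • tens (dR (FerGen.psi j m)) (dL (FerGen.phi j n))
      + (-1 : ℂ) ^ n • tens (dR (FerGen.phi j n)) (dL (FerGen.psi j m))) := rfl

theorem pairContr_commute {X : Module.End ℂ (Fock N M ⊗[ℂ] Fock N M)} (m n : ℕ)
    (h1 : ∀ i m n, Commute (tens (dA i m) (dB i n)) X)
    (h2 : ∀ i m n, Commute (tens (dB i n) (dA i m)) X)
    (h3 : ∀ x y, Commute (tens (dR x) (dL y)) X) :
    Commute (pairContr m n) X := by
  rw [pairContr_eq]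
  refine Commute.add_left (Commute.sum_left _ _ _ fun i _ => ?_) (Commute.sum_left _ _ _ fun i _ => ?_)
  · exact ((h1 i m n).smul_left _).add_left ((h2 i m n).smul_left _)
  · exact ((h3 _ _).smul_left _).add_left ((h3 _ _).smul_left _)

theorem contr_commute {X : Module.End ℂ (Fock N M ⊗[ℂ] Fock N M)}
    (h : ∀ m n, Commute (pairContr m n) X) (q : ℕ) : Commute (contr q) X := by
  cases q with
  | zero => exact Commute.zero_left _
  | succ s => exact Commute.sum_left _ _ _ fun x _ => (h _ _).smul_left _

theorem pairContr_commute_ann (m n : ℕ) (y : Gen N M) (s : ℕ) :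
    Commute (pairContr m n) (tens (parityPow y.isRight) (ann y s)) := by
  rcases y with (⟨i, k⟩ | ⟨i, k⟩) | (⟨j, k⟩ | ⟨j, k⟩) <;> simp only [ann, parityPow,
      Sum.isRight_inl, Bool.false_eq_true, Sum.isRight_inr, if_true, if_false] <;>
    split_ifs <;>
    simp only [tens_zero_right, Commute.zero_right, tens_smul_right] <;>
    refine Commute.smul_right ?_ _
  · exact pairContr_commute _ _ (fun _ _ _ => tens_commute (Commute.one_right _) (dA_dB _ _ _ _).symm)
      (fun _ _ _ => tens_commute (Commute.one_right _) (dA_dA _ _ _ _))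
      (fun _ _ => tens_commute (Commute.one_right _) (onFer_commute_dA _ _ _))
  · exact pairContr_commute _ _ (fun _ _ _ => tens_commute (Commute.one_right _) (dB_dB _ _ _ _))
      (fun _ _ _ => tens_commute (Commute.one_right _) (dA_dB _ _ _ _))
      (fun _ _ => tens_commute (Commute.one_right _) (onFer_commute_dB _ _ _))
  · exact pairContr_commute _ _
      (fun _ _ _ => tens_commute (onFer_commute_dA _ _ _).symm (onFer_commute_dB _ _ _).symm)
      (fun _ _ _ => tens_commute (onFer_commute_dB _ _ _).symm (onFer_commute_dA _ _ _).symm)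
      (fun _ _ => tens_commute_of_anti (by rw [parity_dR, neg_neg]) (dL_dL _ _))
  · exact pairContr_commute _ _
      (fun _ _ _ => tens_commute (onFer_commute_dA _ _ _).symm (onFer_commute_dB _ _ _).symm)
      (fun _ _ _ => tens_commute (onFer_commute_dB _ _ _).symm (onFer_commute_dA _ _ _).symm)
      (fun _ _ => tens_commute_of_anti (by rw [parity_dR, neg_neg]) (dL_dL _ _))

theorem sum_antidiagonal_fst {A : Type*} [AddCommMonoid A] (s k : ℕ) (F : ℕ → A) :
    (∑ x ∈ Finset.HasAntidiagonal.antidiagonal s, if x.1 = k then F x.2 else 0)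
      = if k ≤ s then F (s - k) else 0 := by
  split_ifs with h
  · rw [sum_eq_single (k, s - k)]
    · simp
    · rintro ⟨a, b⟩ hx hne
      rw [Finset.HasAntidiagonal.mem_antidiagonal] at hx
      rw [if_neg]
      rintro rfl
      simp only at hx
      exact hne (by rw [Prod.mk.injEq]; omega)
    · intro hx
      rw [Finset.HasAntidiagonal.mem_antidiagonal] at hx
      simp only at hx
      omega
  · refine sum_eq_zero fun x hx => ?_
    rw [Finset.HasAntidiagonal.mem_antidiagonal] at hx
    rw [if_neg (by omega)]

theorem sum_antidiagonal_snd {A : Type*} [AddCommMonoid A] (s k : ℕ) (F : ℕ → A) :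
    (∑ x ∈ Finset.HasAntidiagonal.antidiagonal s, if x.2 = k then F x.1 else 0)
      = if k ≤ s then F (s - k) else 0 := by
  rw [← Finset.Nat.sum_antidiagonal_swap]
  exact sum_antidiagonal_fst s k F

theorem dR_commute_mulBos (x : FerGen M) (y : BosGen N) :
    Commute (dR x : Op N M) (mulBos y) := onFer_commute_mulBos _ _

theorem pairContr_mul_a (m n : ℕ) (i : Fin N) (k : ℕ) :
    (pairContr m n * tens (mulBos (BosGen.a i k)) 1 : Module.End ℂ (Fock N M ⊗[ℂ] Fock N M))
      = tens (mulBos (BosGen.a i k)) 1 * pairContr m n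
        + if m = k then (-1 : ℂ) ^ k • tens 1 (dB i n) else 0 := by
  have hB : ∀ i' : Fin N, (dB i' n * mulBos (BosGen.a i k) : Op N M)
      = mulBos (BosGen.a i k) * dB i' n := by
    intro i'
    cases n
    · exact (dB_zero_mulBos _ _).eq
    · simp [dB_succ_mulBos]
  rw [pairContr_eq]
  simp only [add_mul, mul_add, sum_mul, mul_sum, smul_mul_assoc, mul_smul_comm,
    tens_mul, dA_mulBos, hB, (dR_commute_mulBos _ _).eq, one_mul, mul_one, tens_add_left,
    BosGen.a.injEq, smul_add, sum_add_distrib]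
  have : (∑ x : Fin N, (-1 : ℂ) ^ m • tens (if i = x ∧ k = m then (1 : Op N M) else 0)
      (dB x n)) = if m = k then (-1 : ℂ) ^ k • tens 1 (dB i n) else 0 := by
    rw [sum_eq_single i]
    · by_cases h : m = k
      · subst h; simp
      · simp [h, Ne.symm h, tens_zero_left]
    · intro j _ hj
      simp [Ne.symm hj, tens_zero_left]
    · simp
  rw [this]
  abel

theorem pairContr_mul_b (m n : ℕ) (i : Fin N) (k : ℕ) :
    (pairContr m n * tens (mulBos (BosGen.b i k)) 1 : Module.End ℂ (Fock N M ⊗[ℂ] Fock N M))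
      = tens (mulBos (BosGen.b i k)) 1 * pairContr m n
        + if n = k + 1 then (-1 : ℂ) ^ k • tens 1 (dA i m) else 0 := by
  have hA : ∀ i' : Fin N, (dA i' m * mulBos (BosGen.b i k) : Op N M)
      = mulBos (BosGen.b i k) * dA i' m := by
    intro i'
    simp [dA_mulBos]
  have hB : ∀ i' : Fin N, (dB i' n * mulBos (BosGen.b i k) : Op N M)
      = mulBos (BosGen.b i k) * dB i' n + if i = i' ∧ n = k + 1 then 1 else 0 := by
    intro i'
    rcases n with _ | n
    · simpa using (dB_zero_mulBos _ _).eq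
    · rw [dB_succ_mulBos]
      simp [eq_comm]
  rw [pairContr_eq]
  simp only [add_mul, mul_add, sum_mul, mul_sum, smul_mul_assoc, mul_smul_comm,
    tens_mul, hA, hB, (dR_commute_mulBos _ _).eq, one_mul, mul_one, tens_add_left,
    smul_add, sum_add_distrib]
  have : (∑ x : Fin N, (-1 : ℂ) ^ (n + 1) •
      tens (if i = x ∧ n = k + 1 then (1 : Op N M) else 0)
      (dA x m)) = if n = k + 1 then (-1 : ℂ) ^ k • tens 1 (dA i m) else 0 := by
    rw [sum_eq_single i]
    · by_cases h : n = k + 1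
      · subst h; simp [pow_succ]
      · simp [h, tens_zero_left]
    · intro j _ hj
      simp [Ne.symm hj, tens_zero_left]
    · simp
  rw [this]
  abel

theorem pairContr_mul_phi (m n : ℕ) (j : Fin M) (k : ℕ) :
    (pairContr m n * tens (mulFer (FerGen.phi j k)) 1 : Module.End ℂ (Fock N M ⊗[ℂ] Fock N M))
      = tens (mulFer (FerGen.phi j k)) 1 * pairContr m n
        + if n = k then (-1 : ℂ) ^ k • tens parity (dL (FerGen.psi j m)) else 0 := by
  rw [pairContr_eq]
  simp only [add_mul, mul_add, sum_mul, mul_sum, smul_mul_assoc, mul_smul_comm,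
    tens_mul, (dA_mulFer _ _ _).eq, (dB_mulFer _ _ _).eq, dR_mulFer, one_mul, mul_one, tens_add_left,
    smul_add, sum_add_distrib, FerGen.phi.injEq, reduceCtorEq, if_false, tens_zero_left,
    smul_zero, add_zero, sum_const_zero]
  have : (∑ x : Fin M, (-1 : ℂ) ^ n •
      tens (if j = x ∧ k = n then (parity : Op N M) else 0)
      (dL (FerGen.psi x m))) = if n = k then (-1 : ℂ) ^ k • tens parity (dL (FerGen.psi j m)) else 0 := by
    rw [sum_eq_single j]
    · by_cases h : n = k
      · subst h; simp
      · simp [h, Ne.symm h, tens_zero_left]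
    · intro j' _ hj
      simp [Ne.symm hj, tens_zero_left]
    · simp
  rw [this]
  abel

theorem pairContr_mul_psi (m n : ℕ) (j : Fin M) (k : ℕ) :
    (pairContr m n * tens (mulFer (FerGen.psi j k)) 1 : Module.End ℂ (Fock N M ⊗[ℂ] Fock N M))
      = tens (mulFer (FerGen.psi j k)) 1 * pairContr m n
        + if m = k then (-1 : ℂ) ^ k • tens parity (dL (FerGen.phi j n)) else 0 := by
  rw [pairContr_eq]
  simp only [add_mul, mul_add, sum_mul, mul_sum, smul_mul_assoc, mul_smul_comm,
    tens_mul, (dA_mulFer _ _ _).eq, (dB_mulFer _ _ _).eq, dR_mulFer, one_mul, mul_one, tens_add_left,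
    smul_add, sum_add_distrib, FerGen.psi.injEq, reduceCtorEq, if_false, tens_zero_left,
    smul_zero, add_zero, sum_const_zero]
  have : (∑ x : Fin M, (-1 : ℂ) ^ m •
      tens (if j = x ∧ k = m then (parity : Op N M) else 0)
      (dL (FerGen.phi x n))) = if m = k then (-1 : ℂ) ^ k • tens parity (dL (FerGen.phi j n)) else 0 := by
    rw [sum_eq_single j]
    · by_cases h : m = k
      · subst h; simp
      · simp [h, Ne.symm h, tens_zero_left]
    · intro j' _ hj
      simp [Ne.symm hj, tens_zero_left]
    · simp
  rw [this]
  abel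

theorem contr_succ (s : ℕ) : (contr (s + 1) : Module.End ℂ (Fock N M ⊗[ℂ] Fock N M))
    = ∑ x ∈ Finset.HasAntidiagonal.antidiagonal s, ((s.choose x.2 : ℕ) : ℂ) • pairContr x.1 x.2 := rfl

theorem contr_mulGen (s : ℕ) (y : Gen N M) :
    contr (s + 1) * tens (mulGen y) 1
      = tens (mulGen y) 1 * contr (s + 1) + tens (parityPow y.isRight) (ann y s) := by
  rw [contr_succ, sum_mul, mul_sum]
  rcases y with (⟨i, k⟩ | ⟨i, k⟩) | (⟨j, k⟩ | ⟨j, k⟩) <;>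
    simp only [mulGen, Sum.elim_inl, Sum.elim_inr, smul_mul_assoc, mul_smul_comm, pairContr_mul_b,
      pairContr_mul_a, pairContr_mul_phi, pairContr_mul_psi, smul_add, sum_add_distrib,
      smul_ite, smul_zero, parityPow, ann, Sum.isRight_inl, Sum.isRight_inr, if_true,
      Bool.false_eq_true, if_false] <;>
    congr 1
  · have := sum_antidiagonal_snd s (k + 1) (fun m => ((s.choose (k + 1) : ℕ) : ℂ) • (-1 : ℂ) ^ k •
      tens (1 : Op N M) (dA i m))
    refine Eq.trans (sum_congr rfl fun x _ => ?_) (this.trans ?_)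
    · split_ifs with h
      · rw [h]
      · rfl
    · split_ifs
      · rw [tens_smul_right, smul_smul, mul_comm]
      · rw [tens_zero_right]
  · have := sum_antidiagonal_fst s k (fun n => ((s.choose n : ℕ) : ℂ) • (-1 : ℂ) ^ k •
      tens (1 : Op N M) (dB i n))
    refine this.trans ?_
    split_ifs
    · rw [tens_smul_right, smul_smul, mul_comm]
    · rw [tens_zero_right]
  · have := sum_antidiagonal_snd s k (fun m => ((s.choose k : ℕ) : ℂ) • (-1 : ℂ) ^ k •
      tens (parity : Op N M) (dL (FerGen.psi j m)))
    refine Eq.trans (sum_congr rfl fun x _ => ?_) (this.trans ?_)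
    · split_ifs with h
      · rw [h]
      · rfl
    · split_ifs
      · rw [tens_smul_right, smul_smul, mul_comm]
      · rw [tens_zero_right]
  · have := sum_antidiagonal_fst s k (fun n => ((s.choose n : ℕ) : ℂ) • (-1 : ℂ) ^ k •
      tens (parity : Op N M) (dL (FerGen.phi j n)))
    refine this.trans ?_
    split_ifs
    · rw [tens_smul_right, smul_smul, mul_comm]
    · rw [tens_zero_right]

theorem expContr_eq_pexp (q : ℕ) :
    (expContr q : Module.End ℂ (Fock N M ⊗[ℂ] Fock N M)) = pexp contr q := rfl

theorem expContr_gen_mul (q : ℕ) (y : Gen N M) (u v : Fock N M) :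
    expContr q ((gen y * u) ⊗ₜ v) = tens (mulGen y) 1 (expContr q (u ⊗ₜ v))
      + ∑ s ∈ Finset.range q, expContr (q - 1 - s) (parityPow y.isRight u ⊗ₜ ann y s v) := by
  let κ : ℕ → Module.End ℂ (Fock N M ⊗[ℂ] Fock N M) := fun r => match r with
    | 0 => 0
    | s + 1 => tens (parityPow y.isRight) (ann y s)
  have hκ : ∀ q r, Commute (contr q) (κ r) := by
    intro q r
    cases r with
    | zero => exact Commute.zero_right _
    | succ s => exact contr_commute (fun m n => pairContr_commute_ann m n y s) q
  have hx : ∀ q, contr q * tens (mulGen y) 1 = tens (mulGen y) 1 * contr q + κ q := by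
    intro q
    cases q with
    | zero => simp [contr, κ]
    | succ s => exact contr_mulGen s y
  have h := congrArg (fun D => D (u ⊗ₜ v)) (pexp_mul rfl hx hκ q)
  have h1 : (tens (mulGen y) 1 : Module.End ℂ (Fock N M ⊗[ℂ] Fock N M)) (u ⊗ₜ v)
      = (gen y * u) ⊗ₜ v := by
    rw [← mulGen_apply]; rfl
  simp only [Module.End.mul_apply, LinearMap.add_apply, LinearMap.sum_apply] at h
  rw [h1] at h
  refine h.trans ?_
  congr 1
  have hc : ∀ (r t : ℕ) (w : Fock N M ⊗[ℂ] Fock N M), κ r (pexp contr t w) = pexp contr t (κ r w) := by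
    intro r t w
    have := pexp_mul (d := contr) (κ := fun _ => 0) (x := κ r) rfl
      (fun q => by rw [(hκ q r).eq, add_zero]) (fun _ _ => Commute.zero_right _) t
    have := congrArg (fun D => D w) this
    simpa using this.symm
  simp only [hc]
  rw [Finset.Nat.sum_antidiagonal_eq_sum_range_succ (fun r t => pexp contr t (κ r (u ⊗ₜ v))) q,
    Finset.sum_range_succ']
  have h0 : κ 0 = 0 := rfl
  rw [h0, LinearMap.zero_apply, map_zero, add_zero]
  refine sum_congr rfl fun s hs => ?_
  rw [mem_range] at hs
  rw [expContr_eq_pexp, show q - (s + 1) = q - 1 - s by omega]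
  rfl

/-! #### Contractions with a function in the first factor -/

/-- The contraction operator when the first factor is a function. -/
def fnContr : ℕ → Module.End ℂ (Ohat N ⊗[ℂ] Fock N M)
  | 0 => 0
  | s + 1 => (-1 : ℂ) • ∑ i, TensorProduct.map (pd i).toLinearMap (dA i s)

/-- The inclusion of `Ô ⊗ V` into `V ⊗ V`. -/
def fnIncl : Ohat N ⊗[ℂ] Fock N M →ₗ[ℂ] Fock N M ⊗[ℂ] Fock N M :=
  TensorProduct.map (fnHom (N := N) (M := M)).toLinearMap LinearMap.id

theorem fnIncl_tmul (f : Ohat N) (v : Fock N M) : fnIncl (f ⊗ₜ v) = fn f ⊗ₜ v := rfl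

theorem tens_tmul (A B : Op N M) (u v : Fock N M) :
    tens A B (u ⊗ₜ v) = A u ⊗ₜ B v := rfl

theorem pairContr_fn (m n : ℕ) (f : Ohat N) (v : Fock N M) :
    pairContr m n (fn f ⊗ₜ v) = if n = 0 then -∑ i, fn (pd i f) ⊗ₜ dA i m v else 0 := by
  rw [pairContr_eq]
  simp only [LinearMap.add_apply, LinearMap.sum_apply, LinearMap.smul_apply, tens_tmul, dA_fn, dR_fn,
    TensorProduct.zero_tmul, smul_zero, zero_add, add_zero, sum_const_zero]
  cases n
  · simp [dB_zero_fn]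
  · simp [dB_succ_fn]

theorem contr_fnIncl (q : ℕ) (w : Ohat N ⊗[ℂ] Fock N M) :
    contr q (fnIncl w) = fnIncl (fnContr q w) := by
  cases q with
  | zero => simp [contr, fnContr]
  | succ s =>
    induction w using TensorProduct.induction_on with
    | zero => simp
    | add x y hx hy => simp only [map_add, hx, hy]
    | tmul f v =>
      rw [fnIncl_tmul, contr_succ]
      simp only [LinearMap.sum_apply, LinearMap.smul_apply, pairContr_fn, smul_ite, smul_zero]
      have := sum_antidiagonal_snd s 0 (fun m => -∑ i : Fin N, (fn (pd i f) : Fock N M) ⊗ₜ[ℂ] dA i m v)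
      refine Eq.trans (sum_congr rfl fun x _ => ?_) (this.trans ?_)
      · split_ifs with h
        · rw [h]; simp
        · rfl
      · simp [fnContr]
        rfl

theorem expContr_fnIncl (q : ℕ) (w : Ohat N ⊗[ℂ] Fock N M) :
    expContr q (fnIncl w) = fnIncl (pexp fnContr q w) :=
  pexp_intertwine fnIncl contr_fnIncl q w

theorem expContr_fn_of_dA {f : Ohat N} {v : Fock N M} (h : ∀ i m, dA i m v = 0) (q : ℕ) :
    expContr q (fn f ⊗ₜ v) = if q = 0 then fn f ⊗ₜ v else 0 := by
  have h0 : ∀ q, contr q ((fn f : Fock N M) ⊗ₜ[ℂ] v) = 0 := by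
    intro q
    rw [← fnIncl_tmul, contr_fnIncl]
    cases q <;> simp [fnContr, h]
  let J : ℂ →ₗ[ℂ] Fock N M ⊗[ℂ] Fock N M := LinearMap.toSpanSingleton ℂ _ (fn f ⊗ₜ v)
  have hJ : J 1 = fn f ⊗ₜ v := by simp [J]
  have h1 := pexp_intertwine J (d := fun _ => 0) (e := contr)
    (fun q c => by simp [J, h0]) q 1
  rw [hJ] at h1
  rw [expContr_eq_pexp, h1]
  have h2 : pexp (fun _ => (0 : Module.End ℂ ℂ)) q = if q = 0 then 1 else 0 := by
    split_ifs with hq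
    · rw [hq, pexp_zero]
    · have e : (PowerSeries.mk fun _ : ℕ => (0 : Module.End ℂ ℂ)) = 0 := by ext; simp
      unfold pexp
      rw [e]
      refine sum_eq_zero fun k _ => ?_
      rcases k with _ | k
      · simp [PowerSeries.coeff_one, hq]
      · simp
  rw [h2]
  split_ifs
  · rw [Module.End.one_apply, hJ]
  · simp

theorem expContr_fn_gen_mul (q : ℕ) (f : Ohat N) (y : Gen N M) (v : Fock N M)
    (hy : ∀ i k, y ≠ Sum.inl (BosGen.a i k)) :
    expContr q (fn f ⊗ₜ (gen y * v)) = tens 1 (mulGen y) (expContr q (fn f ⊗ₜ v)) := by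
  have hc : ∀ i m, Commute (dA i m) (mulGen y) := by
    intro i m
    rcases y with y | y
    · refine (dA_mulBos i m y).trans ?_
      rw [if_neg (fun h => hy i m (by rw [h])), add_zero]; rfl
    · exact dA_mulFer i m y
  let X : Module.End ℂ (Ohat N ⊗[ℂ] Fock N M) := TensorProduct.map 1 (mulGen y)
  have hX : ∀ q, fnContr q * X = X * fnContr q + 0 := by
    intro q
    rw [add_zero]
    cases q with
    | zero => simp [fnContr]
    | succ s =>
      simp only [fnContr, smul_mul_assoc, mul_smul_comm, sum_mul, mul_sum, X, ← TensorProduct.map_mul,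
        one_mul, mul_one, (hc _ _).eq]
  have h := congrArg (fun D => D (f ⊗ₜ v)) (pexp_mul (κ := fun _ => 0) rfl hX
    (fun _ _ => Commute.zero_right _) q)
  simp only [zero_mul, sum_const_zero, add_zero, Module.End.mul_apply] at h
  have h1 : X (f ⊗ₜ v) = f ⊗ₜ (gen y * v) := by rw [← mulGen_apply]; rfl
  rw [h1] at h
  rw [← fnIncl_tmul, ← fnIncl_tmul, expContr_fnIncl, expContr_fnIncl, h]
  generalize pexp fnContr q (f ⊗ₜ v) = w
  induction w using TensorProduct.induction_on with
  | zero => simp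
  | add x y hx hy => simp only [map_add, hx, hy]
  | tmul f v => rfl

theorem expContr_fn_a_mul (q : ℕ) (f : Ohat N) (i : Fin N) (k : ℕ) (v : Fock N M) :
    expContr q (fn f ⊗ₜ (bos (BosGen.a i k) * v))
      = tens 1 (mulBos (BosGen.a i k)) (expContr q (fn f ⊗ₜ v))
        - if k + 1 ≤ q then expContr (q - (k + 1)) (fn (pd i f) ⊗ₜ v) else 0 := by
  let X : Module.End ℂ (Ohat N ⊗[ℂ] Fock N M) := TensorProduct.map 1 (mulBos (BosGen.a i k))
  let D : Module.End ℂ (Ohat N ⊗[ℂ] Fock N M) := TensorProduct.map (pd i).toLinearMap 1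
  let κ : ℕ → Module.End ℂ (Ohat N ⊗[ℂ] Fock N M) := fun q => if q = k + 1 then (-1 : ℂ) • D else 0
  have hX : ∀ q, fnContr q * X = X * fnContr q + κ q := by
    intro q
    cases q with
    | zero => simp [fnContr, κ]
    | succ s =>
      have e : ∀ j : Fin N, TensorProduct.map (pd j).toLinearMap (dA j s) * X
          = X * TensorProduct.map (pd j).toLinearMap (dA j s)
            + if j = i then (if s = k then D else 0) else 0 := by
        intro j
        simp only [X, D, ← TensorProduct.map_mul, dA_mulBos, one_mul, mul_one,
          TensorProduct.map_add_right, BosGen.a.injEq]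
        congr 1
        by_cases hj : j = i
        · subst hj
          by_cases hs : s = k
          · simp [hs]
          · simp [hs, Ne.symm hs]
        · simp [hj, Ne.symm hj]
      simp only [fnContr, smul_mul_assoc, mul_smul_comm, sum_mul, mul_sum, e,
        sum_add_distrib, Finset.sum_ite_eq', mem_univ, if_true, κ, smul_add,
        add_left_inj]
      congr 1
      by_cases hs : s = k
      · rw [if_pos hs, if_pos (by rw [hs])]
      · rw [if_neg hs, if_neg (by omega), smul_zero]
  have hκ : ∀ q r, Commute (fnContr q) (κ r) := by
    intro q r
    simp only [κ]
    split_ifs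
    · refine Commute.smul_right ?_ _
      cases q with
      | zero => exact Commute.zero_left _
      | succ s =>
        refine Commute.smul_left (Commute.sum_left _ _ _ fun j _ => ?_) _
        rw [commute_iff_eq, ← TensorProduct.map_mul, ← TensorProduct.map_mul, one_mul, mul_one]
        congr 1
        exact LinearMap.ext fun f => pd_comm j i f
    · exact Commute.zero_right _
  have h := congrArg (fun D => D (f ⊗ₜ v)) (pexp_mul rfl hX hκ q)
  simp only [LinearMap.add_apply, LinearMap.sum_apply, Module.End.mul_apply] at h
  have h1 : X (f ⊗ₜ v) = f ⊗ₜ (bos (BosGen.a i k) * v) := rfl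
  rw [h1] at h
  have hJX : ∀ w, (fnIncl (X w) : Fock N M ⊗[ℂ] Fock N M)
      = tens 1 (mulBos (BosGen.a i k)) (fnIncl w) := by
    intro w
    induction w using TensorProduct.induction_on with
    | zero => simp
    | add x y hx hy => simp only [map_add, hx, hy]
    | tmul f v => rfl
  rw [← fnIncl_tmul, ← fnIncl_tmul, ← fnIncl_tmul, expContr_fnIncl, expContr_fnIncl,
    expContr_fnIncl, h, map_add, hJX, sub_eq_add_neg]
  congr 1
  have hc : ∀ (r t : ℕ) (w : Ohat N ⊗[ℂ] Fock N M),
      κ r (pexp fnContr t w) = pexp fnContr t (κ r w) := by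
    intro r t w
    have := pexp_mul (d := fnContr) (κ := fun _ => 0) (x := κ r) rfl
      (fun q => by rw [(hκ q r).eq, add_zero]) (fun _ _ => Commute.zero_right _) t
    have := congrArg (fun D => D w) this
    simpa using this.symm
  have h2 : ∀ r t, κ r (pexp fnContr t (f ⊗ₜ v))
      = if r = k + 1 then -pexp fnContr t ((pd i f) ⊗ₜ v) else 0 := by
    intro r t
    rw [hc]
    simp only [κ]
    split_ifs
    · rw [LinearMap.smul_apply, map_smul, neg_one_smul]; rfl
    · simp
  simp only [h2]
  rw [sum_antidiagonal_fst q (k + 1) (fun t => -pexp fnContr t ((pd i f) ⊗ₜ v))]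
  split_ifs
  · rw [map_neg]
  · simp

/-! #### Divided powers of the translation operator -/

/-- The divided power `T^k / k!`, zero for `k < 0`. -/
def Td (k : ℤ) : Op N M :=
  if 0 ≤ k then ((k.toNat.factorial : ℂ)⁻¹) • transl ^ k.toNat else 0

theorem Td_natCast (k : ℕ) : (Td (k : ℤ) : Op N M)
    = ((k.factorial : ℂ)⁻¹) • transl ^ k := by simp [Td]

theorem Td_of_neg {k : ℤ} (h : k < 0) : (Td k : Op N M) = 0 := by
  simp [Td, not_le.mpr h]

theorem Td_zero : (Td 0 : Op N M) = 1 := by simp [Td]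

theorem transl_Td (k : ℤ) (u : Fock N M) : transl (Td k u) = ((k : ℂ) + 1) • Td (k + 1) u := by
  rcases lt_or_ge k 0 with h | h
  · rw [Td_of_neg h]
    rcases eq_or_ne k (-1) with rfl | h'
    · simp
    · rw [Td_of_neg (show k + 1 < 0 by omega)]; simp
  · lift k to ℕ using h
    rw [show ((k : ℤ) + 1) = ((k + 1 : ℕ) : ℤ) by simp, Td_natCast, Td_natCast, LinearMap.smul_apply,
      LinearMap.smul_apply, map_smul, pow_succ', Module.End.mul_apply, smul_smul]
    congr 1
    rw [Nat.factorial_succ]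
    have : ((k + 1 : ℕ) : ℂ) ≠ 0 := Nat.cast_ne_zero.mpr (by omega)
    have : ((k.factorial : ℕ) : ℂ) ≠ 0 := Nat.cast_ne_zero.mpr (Nat.factorial_ne_zero k)
    push_cast at *
    field_simp

theorem Td_transl (k : ℤ) (u : Fock N M) : Td k (transl u) = transl (Td k u) := by
  unfold Td
  split_ifs
  · rw [LinearMap.smul_apply, LinearMap.smul_apply, map_smul, ← Module.End.mul_apply,
      ← Module.End.mul_apply, ← pow_succ, ← pow_succ']
  · simp

theorem Td_succ_apply (k : ℕ) (u : Fock N M) :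
    Td ((k : ℤ) + 1) u = (((k : ℂ) + 1)⁻¹) • transl (Td (k : ℤ) u) := by
  rw [transl_Td, smul_smul]
  have : ((k : ℂ) + 1) ≠ 0 := by exact_mod_cast Nat.succ_ne_zero k
  simp [inv_mul_cancel₀ this]

theorem Td_one_apply (u : Fock N M) : Td 1 u = transl u := by
  have h := Td_succ_apply 0 u
  simpa [Td_zero] using h

theorem parity_Td (k : ℤ) (u : Fock N M) : parity (Td k u) = Td k (parity u) := by
  rcases lt_or_ge k 0 with h | h
  · simp [Td_of_neg h]
  · lift k to ℕ using h
    induction k with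
    | zero => simp [Td_zero]
    | succ k ih => push_cast; rw [Td_succ_apply, Td_succ_apply, map_smul, parity_transl, ih]

theorem Td_mul_natCast (k : ℕ) (u v : Fock N M) : Td (k : ℤ) (u * v)
    = ∑ p ∈ Finset.HasAntidiagonal.antidiagonal k, Td (p.1 : ℤ) u * Td (p.2 : ℤ) v := by
  let A : Module.End ℂ (Fock N M ⊗[ℂ] Fock N M) := tens transl 1
  let B : Module.End ℂ (Fock N M ⊗[ℂ] Fock N M) := tens 1 transl
  have hAB : Commute A B := tens_commute (Commute.one_right _) (Commute.one_left _)
  have h1 : ∀ (k : ℕ) w, (transl ^ k) (LinearMap.mul' ℂ (Fock N M) w)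
      = LinearMap.mul' ℂ (Fock N M) (((A + B) ^ k) w) := by
    intro k
    induction k with
    | zero => intro w; simp
    | succ k ih =>
      intro w
      rw [pow_succ, pow_succ, Module.End.mul_apply, Module.End.mul_apply, ← ih]
      congr 1
      induction w using TensorProduct.induction_on with
      | zero => simp
      | add x y hx hy => simp only [map_add, hx, hy]
      | tmul u v =>
        rw [LinearMap.add_apply, map_add, tens_tmul, tens_tmul, LinearMap.mul'_apply,
          LinearMap.mul'_apply, LinearMap.mul'_apply, transl_mul]
        rfl
  have hA : ∀ (i : ℕ) (u v : Fock N M), (A ^ i) (u ⊗ₜ v) = (transl ^ i) u ⊗ₜ v := by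
    intro i
    induction i with
    | zero => intro u v; simp
    | succ i ih =>
      intro u v; rw [pow_succ, Module.End.mul_apply, tens_tmul, ih, pow_succ]; rfl
  have hB : ∀ (i : ℕ) (u v : Fock N M), (B ^ i) (u ⊗ₜ v) = u ⊗ₜ (transl ^ i) v := by
    intro i
    induction i with
    | zero => intro u v; simp
    | succ i ih =>
      intro u v; rw [pow_succ, Module.End.mul_apply, tens_tmul, ih, pow_succ]; rfl
  have h := h1 k (u ⊗ₜ v)
  rw [LinearMap.mul'_apply] at h
  rw [Td_natCast, LinearMap.smul_apply, h, hAB.add_pow', LinearMap.sum_apply, map_sum,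
    smul_sum]
  refine sum_congr rfl fun p hp => ?_
  rw [Finset.HasAntidiagonal.mem_antidiagonal] at hp
  rw [LinearMap.smul_apply, map_nsmul, Module.End.mul_apply, hB, hA, LinearMap.mul'_apply, Td_natCast,
    Td_natCast, LinearMap.smul_apply, LinearMap.smul_apply, smul_mul_smul_comm,
    ← Nat.cast_smul_eq_nsmul ℂ, smul_smul]
  congr 1
  have h0 := Nat.add_choose_mul_factorial_mul_factorial p.1 p.2
  rw [← hp]
  have h1 : (((p.1 + p.2).factorial : ℕ) : ℂ) ≠ 0 := Nat.cast_ne_zero.mpr (Nat.factorial_ne_zero _)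
  have h2 : ((p.1.factorial : ℕ) : ℂ) ≠ 0 := Nat.cast_ne_zero.mpr (Nat.factorial_ne_zero _)
  have h3 : ((p.2.factorial : ℕ) : ℂ) ≠ 0 := Nat.cast_ne_zero.mpr (Nat.factorial_ne_zero _)
  have h4 := congrArg (Nat.cast (R := ℂ)) h0
  push_cast at h4
  rw [inv_mul_eq_iff_eq_mul₀ h1, ← h4, Nat.choose_symm_add]
  field_simp

theorem Td_mul {k : ℤ} {B : ℕ} (hB : k < B) (u v : Fock N M) :
    Td k (u * v) = ∑ i ∈ Finset.range B, Td (i : ℤ) u * Td (k - i) v := by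
  rcases lt_or_ge k 0 with h | h
  · rw [Td_of_neg h, LinearMap.zero_apply, eq_comm]
    refine sum_eq_zero fun i _ => ?_
    rw [Td_of_neg (show k - i < 0 by omega), LinearMap.zero_apply, mul_zero]
  · lift k to ℕ using h
    rw [Td_mul_natCast, Finset.Nat.sum_antidiagonal_eq_sum_range_succ
      (fun i j => Td (i : ℤ) u * Td (j : ℤ) v) k]
    rw [← Finset.sum_subset (Finset.range_mono (show k.succ ≤ B by omega))]
    · refine sum_congr rfl fun i hi => ?_
      rw [mem_range] at hi
      rw [Nat.cast_sub (by omega)]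
    · intro i _ hi
      rw [mem_range, not_lt] at hi
      rw [Td_of_neg (show (k : ℤ) - (i : ℤ) < 0 by omega), LinearMap.zero_apply, mul_zero]

theorem Td_a (i : Fin N) (k : ℕ) : Td (k : ℤ) (a i : Fock N M) = bos (BosGen.a i k) := by
  induction k with
  | zero => simp [Td_zero, a]
  | succ k ih =>
    have : ((k : ℂ) + 1) ≠ 0 := by exact_mod_cast Nat.succ_ne_zero k
    push_cast
    rw [Td_succ_apply, ih, transl_bos_a, smul_smul, inv_mul_cancel₀ this, one_smul]
theorem Td_phi (j : Fin M) (k : ℕ) : Td (k : ℤ) (phi j : Fock N M) = fer (FerGen.phi j k) := by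
  induction k with
  | zero => simp [Td_zero, phi]
  | succ k ih =>
    have : ((k : ℂ) + 1) ≠ 0 := by exact_mod_cast Nat.succ_ne_zero k
    push_cast
    rw [Td_succ_apply, ih, transl_fer_phi, smul_smul, inv_mul_cancel₀ this, one_smul]
theorem Td_psi (j : Fin M) (k : ℕ) : Td (k : ℤ) (psi j : Fock N M) = fer (FerGen.psi j k) := by
  induction k with
  | zero => simp [Td_zero, psi]
  | succ k ih =>
    have : ((k : ℂ) + 1) ≠ 0 := by exact_mod_cast Nat.succ_ne_zero k
    push_cast
    rw [Td_succ_apply, ih, transl_fer_psi, smul_smul, inv_mul_cancel₀ this, one_smul]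

theorem pd_coord (i j : Fin N) : pd i (coord j) = (1 : Mat N N) i j :=
  congrFun (congrFun (Subst.jac_id (N := N)) i) j

theorem transl_coord (i : Fin N) : transl (fn (coord i) : Fock N M) = b' i := by
  rw [transl_fn]
  simp only [pd_coord, Matrix.one_apply]
  rw [sum_eq_single i]
  · simp [fn_one]
  · intro j _ hj; simp [hj, fn_zero]
  · simp

theorem Td_coord (i : Fin N) (k : ℕ) :
    Td ((k : ℤ) + 1) (fn (coord i) : Fock N M) = bos (BosGen.b i k) := by
  induction k with
  | zero => simp only [Nat.cast_zero, zero_add, Td_one_apply, transl_coord]; rfl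
  | succ k ih =>
    have : ((k : ℂ) + 2) ≠ 0 := by exact_mod_cast (show k + 2 ≠ 0 by omega)
    have h := Td_succ_apply (k + 1) (fn (coord i) : Fock N M)
    push_cast at h ⊢
    rw [h, ih, transl_bos_b, smul_smul, add_assoc (k : ℂ), one_add_one_eq_two, inv_mul_cancel₀ this,
      one_smul]

/-! #### Modes -/

/-- `u ⊗ v ↦ T^{(k)} u · v`. -/
def mulTd (k : ℤ) : Fock N M ⊗[ℂ] Fock N M →ₗ[ℂ] Fock N M :=
  LinearMap.mul' ℂ (Fock N M) ∘ₗ (Td k).rTensor (Fock N M)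

theorem mulTd_tmul (k : ℤ) (u v : Fock N M) : mulTd k (u ⊗ₜ v) = Td k u * v := rfl

theorem mulTd_of_neg {k : ℤ} (h : k < 0) (w : Fock N M ⊗[ℂ] Fock N M) : mulTd k w = 0 := by
  rw [mulTd, Td_of_neg h]; simp

theorem nprod_eq_finsum (n : ℤ) (u v : Fock N M) :
    nprod n u v = ∑ᶠ q : ℕ, mulTd (q - n - 1) (expContr q (u ⊗ₜ v)) := by
  unfold nprod
  refine finsum_congr fun q => ?_
  split_ifs with h
  · rw [mulTd, Td, if_pos (by omega), LinearMap.rTensor_smul]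
    simp
  · rw [mulTd_of_neg (by omega)]

theorem nprod_eq_sum (n : ℤ) {u v : Fock N M} {Q : ℕ} (hQ : ∀ q ≥ Q, expContr q (u ⊗ₜ v) = 0) :
    nprod n u v = ∑ q ∈ Finset.range Q, mulTd (q - n - 1) (expContr q (u ⊗ₜ v)) := by
  rw [nprod_eq_finsum]
  refine finsum_eq_sum_of_support_subset _ fun q hq => ?_
  rw [Finset.coe_range, Set.mem_Iio]
  by_contra h
  rw [Function.mem_support, hQ q (not_lt.mp h), map_zero] at hq
  exact hq rfl

/-- Derivatives of high order kill a given state. -/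
theorem exists_derivatives_eq_zero (v : Fock N M) : ∃ S : ℕ, ∀ s ≥ S, (∀ i, dA i s v = 0) ∧
    (∀ i, dB i s v = 0) ∧ (∀ j, dL (FerGen.phi j s) v = 0) ∧ (∀ j, dL (FerGen.psi j s) v = 0) := by
  refine induction (P := fun v : Fock N M => ∃ S : ℕ, ∀ s ≥ S, (∀ i, dA i s v = 0) ∧
    (∀ i, dB i s v = 0) ∧ (∀ j, dL (FerGen.phi j s) v = 0) ∧ (∀ j, dL (FerGen.psi j s) v = 0))
    (fun f => ⟨1, fun s hs => ?_⟩) ?_ ?_ ?_ v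
  · obtain ⟨s, rfl⟩ := Nat.exists_eq_add_of_le' hs
    simp [dA_fn, dB_succ_fn, dL_fn]
  · rintro u v ⟨S, hS⟩ ⟨S', hS'⟩
    refine ⟨max S S', fun s hs => ?_⟩
    obtain ⟨h1, h2, h3, h4⟩ := hS s (le_trans (le_max_left _ _) hs)
    obtain ⟨k1, k2, k3, k4⟩ := hS' s (le_trans (le_max_right _ _) hs)
    simp [h1, h2, h3, h4, k1, k2, k3, k4]
  · rintro y u ⟨S, hS⟩
    have hy : ∃ k, (∀ i, ∀ s > k, y ≠ BosGen.a i s) ∧ ∀ i, ∀ s > k, y ≠ BosGen.b i s := by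
      rcases y with ⟨i, k⟩ | ⟨i, k⟩
      · exact ⟨k, fun _ _ _ => by simp, fun j s hs h => by cases h; omega⟩
      · exact ⟨k, fun j s hs h => by cases h; omega, fun _ _ _ => by simp⟩
    obtain ⟨k, hk, hk'⟩ := hy
    refine ⟨max S (k + 2), fun s hs => ?_⟩
    obtain ⟨h1, h2, h3, h4⟩ := hS s (le_trans (le_max_left _ _) hs)
    have hs' := le_trans (le_max_right _ _) hs
    obtain ⟨s, rfl⟩ := Nat.exists_eq_add_of_le' (show 1 ≤ s by omega)
    refine ⟨fun i => ?_, fun i => ?_, fun j => ?_, fun j => ?_⟩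
    · rw [dA_bos_mul, h1, if_neg (hk i _ (by omega))]; simp
    · rw [dB_succ_bos_mul, h2, if_neg (hk' i _ (by omega))]; simp
    · rw [dL_bos_mul, h3, mul_zero]
    · rw [dL_bos_mul, h4, mul_zero]
  · rintro y u ⟨S, hS⟩
    have hy : ∃ k, (∀ i, ∀ s > k, y ≠ FerGen.phi i s) ∧ ∀ i, ∀ s > k, y ≠ FerGen.psi i s := by
      rcases y with ⟨i, k⟩ | ⟨i, k⟩
      · exact ⟨k, fun j s hs h => by cases h; omega, fun _ _ _ => by simp⟩
      · exact ⟨k, fun _ _ _ => by simp, fun j s hs h => by cases h; omega⟩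
    obtain ⟨k, hk, hk'⟩ := hy
    refine ⟨max S (k + 1), fun s hs => ?_⟩
    obtain ⟨h1, h2, h3, h4⟩ := hS s (le_trans (le_max_left _ _) hs)
    have hs' := le_trans (le_max_right _ _) hs
    refine ⟨fun i => ?_, fun i => ?_, fun j => ?_, fun j => ?_⟩
    · rw [dA_fer_mul, h1, mul_zero]
    · rw [dB_fer_mul, h2, mul_zero]
    · rw [dL_fer_mul, h3, if_neg (hk j _ (by omega))]; simp
    · rw [dL_fer_mul, h4, if_neg (hk' j _ (by omega))]; simp

theorem exists_ann_eq_zero (y : Gen N M) (v : Fock N M) : ∃ S : ℕ, ∀ s ≥ S, ann y s v = 0 := by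
  obtain ⟨S, hS⟩ := exists_derivatives_eq_zero v
  rcases y with (⟨i, k⟩ | ⟨i, k⟩) | (⟨j, k⟩ | ⟨j, k⟩) <;>
  · refine ⟨S + k + 1, fun s hs => ?_⟩
    simp only [ann]
    split_ifs
    · rw [LinearMap.smul_apply]
      first
        | rw [(hS _ _).1, smul_zero]; omega
        | rw [(hS _ _).2.1, smul_zero]; omega
        | rw [(hS _ _).2.2.1, smul_zero]; omega
        | rw [(hS _ _).2.2.2, smul_zero]; omega
    · rfl

theorem exists_expContr_fn_eq_zero (v : Fock N M) :
    ∀ f : Ohat N, ∃ Q : ℕ, ∀ q ≥ Q, expContr q (fn f ⊗ₜ v) = 0 := by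
  refine induction (P := fun v : Fock N M => ∀ f : Ohat N, ∃ Q : ℕ, ∀ q ≥ Q,
    expContr q (fn f ⊗ₜ v) = 0) (fun f' f => ⟨1, fun q hq => ?_⟩) ?_ ?_ ?_ v
  · rw [expContr_fn_of_dA (fun i m => dA_fn _ _ _), if_neg (by omega)]
  · intro u v hu hv f
    obtain ⟨Q, hQ⟩ := hu f
    obtain ⟨Q', hQ'⟩ := hv f
    refine ⟨max Q Q', fun q hq => ?_⟩
    rw [TensorProduct.tmul_add, map_add, hQ q (le_trans (le_max_left _ _) hq),
      hQ' q (le_trans (le_max_right _ _) hq), add_zero]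
  · rintro y u hu f
    rcases y with ⟨i, k⟩ | ⟨i, k⟩
    · obtain ⟨Q, hQ⟩ := hu f
      refine ⟨Q, fun q hq => ?_⟩
      have := expContr_fn_gen_mul q f (Sum.inl (BosGen.b i k)) u (by simp)
      refine this.trans ?_
      rw [hQ q hq, map_zero]
    · obtain ⟨Q, hQ⟩ := hu f
      obtain ⟨Q', hQ'⟩ := hu (pd i f)
      refine ⟨max Q (Q' + k + 1), fun q hq => ?_⟩
      have h2 := le_trans (le_max_right _ _) hq
      rw [expContr_fn_a_mul, hQ q (le_trans (le_max_left _ _) hq), hQ' _ (by omega)]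
      simp
  · rintro y u hu f
    obtain ⟨Q, hQ⟩ := hu f
    refine ⟨Q, fun q hq => ?_⟩
    have := expContr_fn_gen_mul q f (Sum.inr y) u (by simp)
    refine this.trans ?_
    rw [hQ q hq, map_zero]

theorem gen_induction {P : Fock N M → Prop} (hfn : ∀ f, P (fn f))
    (hadd : ∀ u v, P u → P v → P (u + v)) (hgen : ∀ y u, P u → P (gen y * u))
    (u : Fock N M) : P u :=
  induction hfn hadd (fun y u h => hgen (Sum.inl y) u h) (fun y u h => hgen (Sum.inr y) u h) u

/-- Only finitely many coefficients of `exp Δ(z) (u ⊗ v)` are non-zero. -/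
theorem exists_expContr_eq_zero (u : Fock N M) :
    ∀ v : Fock N M, ∃ Q : ℕ, ∀ q ≥ Q, expContr q (u ⊗ₜ v) = 0 ∧ expContr q (parity u ⊗ₜ v) = 0 := by
  refine gen_induction (P := fun u : Fock N M => ∀ v : Fock N M, ∃ Q : ℕ, ∀ q ≥ Q,
    expContr q (u ⊗ₜ v) = 0 ∧ expContr q (parity u ⊗ₜ v) = 0) ?_ ?_ ?_ u
  · intro f v
    obtain ⟨Q, hQ⟩ := exists_expContr_fn_eq_zero v f
    exact ⟨Q, fun q hq => ⟨hQ q hq, by rw [parity_fn, hQ q hq]⟩⟩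
  · intro u u' hu hu' v
    obtain ⟨Q, hQ⟩ := hu v
    obtain ⟨Q', hQ'⟩ := hu' v
    refine ⟨max Q Q', fun q hq => ?_⟩
    obtain ⟨h1, h2⟩ := hQ q (le_trans (le_max_left _ _) hq)
    obtain ⟨h3, h4⟩ := hQ' q (le_trans (le_max_right _ _) hq)
    simp only [map_add, TensorProduct.add_tmul, h1, h2, h3, h4, add_zero, and_self]
  · intro y u hu v
    obtain ⟨Q, hQ⟩ := hu v
    obtain ⟨S, hS⟩ := exists_ann_eq_zero y v
    choose R hR using fun s => hu (ann y s v)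
    have hcase : ∀ q ≥ Q + S + (∑ s ∈ Finset.range S, R s) + 1,
        expContr q ((gen y * u) ⊗ₜ v) = 0 ∧ expContr q ((gen y * parity u) ⊗ₜ v) = 0 := by
      intro q hq
      have hR' : ∀ s ∈ Finset.range S, R s ≤ ∑ s ∈ Finset.range S, R s := fun s hs =>
        Finset.single_le_sum (fun _ _ => Nat.zero_le _) hs
      have h0 : ∀ s, expContr (q - 1 - s) (u ⊗ₜ ann y s v) = 0 ∧
          expContr (q - 1 - s) (parity u ⊗ₜ ann y s v) = 0 := by
        intro s
        by_cases h : s < S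
        · have := hR' s (Finset.mem_range.mpr h)
          exact hR s _ (by omega)
        · rw [hS s (not_lt.mp h)]; simp
      have h1 : ∀ s, expContr (q - 1 - s) (parityPow y.isRight u ⊗ₜ ann y s v) = 0 := by
        intro s
        unfold parityPow
        split_ifs
        · exact (h0 s).2
        · exact (h0 s).1
      have h2 : ∀ s, expContr (q - 1 - s) (parityPow y.isRight (parity u) ⊗ₜ ann y s v) = 0 := by
        intro s
        unfold parityPow
        split_ifs
        · rw [parity_parity_apply]; exact (h0 s).1
        · exact (h0 s).2
      rw [expContr_gen_mul, expContr_gen_mul, (hQ q (by omega)).1, (hQ q (by omega)).2]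
      simp [h1, h2]
    refine ⟨_, fun q hq => ⟨(hcase q hq).1, ?_⟩⟩
    rcases y with y | y
    · have : parity (gen (Sum.inl y : Gen N M) * u) = gen (Sum.inl y) * parity u :=
        parity_mulBos_apply y u
      rw [this]; exact (hcase q hq).2
    · have : parity (gen (Sum.inr y : Gen N M) * u) = -(gen (Sum.inr y) * parity u) :=
        parity_mulFer_apply y u
      rw [this, TensorProduct.neg_tmul, map_neg, (hcase q hq).2, neg_zero]

theorem nprod_add_left (n : ℤ) (u u' v : Fock N M) :
    nprod n (u + u') v = nprod n u v + nprod n u' v := by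
  obtain ⟨Q, hQ⟩ := exists_expContr_eq_zero u v
  obtain ⟨Q', hQ'⟩ := exists_expContr_eq_zero u' v
  have h1 : ∀ q ≥ max Q Q', expContr q (u ⊗ₜ v) = 0 := fun q hq =>
    (hQ q (le_trans (le_max_left _ _) hq)).1
  have h2 : ∀ q ≥ max Q Q', expContr q (u' ⊗ₜ v) = 0 := fun q hq =>
    (hQ' q (le_trans (le_max_right _ _) hq)).1
  rw [nprod_eq_sum n h1, nprod_eq_sum n h2, nprod_eq_sum (Q := max Q Q') n (fun q hq => by
    rw [TensorProduct.add_tmul, map_add, h1 q hq, h2 q hq, add_zero]), ← sum_add_distrib]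
  simp only [TensorProduct.add_tmul, map_add]

theorem nprod_add_right (n : ℤ) (u v v' : Fock N M) :
    nprod n u (v + v') = nprod n u v + nprod n u v' := by
  obtain ⟨Q, hQ⟩ := exists_expContr_eq_zero u v
  obtain ⟨Q', hQ'⟩ := exists_expContr_eq_zero u v'
  have h1 : ∀ q ≥ max Q Q', expContr q (u ⊗ₜ v) = 0 := fun q hq =>
    (hQ q (le_trans (le_max_left _ _) hq)).1
  have h2 : ∀ q ≥ max Q Q', expContr q (u ⊗ₜ v') = 0 := fun q hq =>
    (hQ' q (le_trans (le_max_right _ _) hq)).1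
  rw [nprod_eq_sum n h1, nprod_eq_sum n h2, nprod_eq_sum (Q := max Q Q') n (fun q hq => by
    rw [TensorProduct.tmul_add, map_add, h1 q hq, h2 q hq, add_zero]), ← sum_add_distrib]
  simp only [TensorProduct.tmul_add, map_add]

theorem nprod_smul_left (n : ℤ) (c : ℂ) (u v : Fock N M) :
    nprod n (c • u) v = c • nprod n u v := by
  obtain ⟨Q, hQ⟩ := exists_expContr_eq_zero u v
  rw [nprod_eq_sum n (fun q hq => (hQ q hq).1), nprod_eq_sum (Q := Q) n (fun q hq => by
    rw [← TensorProduct.smul_tmul', map_smul, (hQ q hq).1, smul_zero]), smul_sum]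
  simp only [← TensorProduct.smul_tmul', map_smul]

theorem nprod_smul_right (n : ℤ) (c : ℂ) (u v : Fock N M) :
    nprod n u (c • v) = c • nprod n u v := by
  obtain ⟨Q, hQ⟩ := exists_expContr_eq_zero u v
  rw [nprod_eq_sum n (fun q hq => (hQ q hq).1), nprod_eq_sum (Q := Q) n (fun q hq => by
    rw [TensorProduct.tmul_smul, map_smul, (hQ q hq).1, smul_zero]), smul_sum]
  simp only [TensorProduct.tmul_smul, map_smul]

/-- The modes `u_{(n)}` of the field of a state. -/
def mode (n : ℤ) : Fock N M →ₗ[ℂ] Op N M :=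
  LinearMap.mk₂ ℂ (nprod n) (nprod_add_left n) (nprod_smul_left n) (nprod_add_right n)
    (nprod_smul_right n)

theorem mode_eq_sum (n : ℤ) {u v : Fock N M} {Q : ℕ} (hQ : ∀ q ≥ Q, expContr q (u ⊗ₜ v) = 0) :
    mode n u v = ∑ q ∈ Finset.range Q, mulTd (q - n - 1) (expContr q (u ⊗ₜ v)) := nprod_eq_sum n hQ

theorem exists_mode_eq_zero (u v : Fock N M) : ∃ n₀ : ℤ, ∀ n ≥ n₀, mode n u v = 0 := by
  obtain ⟨Q, hQ⟩ := exists_expContr_eq_zero u v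
  refine ⟨Q, fun n hn => ?_⟩
  rw [mode_eq_sum n (fun q hq => (hQ q hq).1)]
  refine sum_eq_zero fun q hq => ?_
  rw [mem_range] at hq
  exact mulTd_of_neg (by omega) _

theorem mulTd_tens_mulGen {k : ℤ} {B : ℕ} (hB : k < B) (y : Gen N M) (w : Fock N M ⊗[ℂ] Fock N M) :
    mulTd k (tens (mulGen y) 1 w)
      = ∑ i ∈ Finset.range B, Td (i : ℤ) (gen y) * mulTd (k - i) w := by
  induction w using TensorProduct.induction_on with
  | zero => simp
  | add x y hx hy => simp only [map_add, hx, hy, mul_add, sum_add_distrib]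
  | tmul u v =>
    rw [tens_tmul, mulTd_tmul, mulGen_apply, Td_mul hB, sum_mul]
    exact sum_congr rfl fun i _ => by rw [mulTd_tmul, mul_assoc]; rfl

/-- Wick's theorem for the product with a creation mode. -/
theorem exists_mode_gen_mul (n : ℤ) (y : Gen N M) (u v : Fock N M) :
    ∃ B₀ : ℕ, ∀ B ≥ B₀, mode n (gen y * u) v
      = ∑ i ∈ Finset.range B, Td (i : ℤ) (gen y) * mode (n + i) u v
        + ∑ s ∈ Finset.range B, mode (n - 1 - s) (parityPow y.isRight u) (ann y s v) := by
  obtain ⟨Q₁, hQ₁⟩ := exists_expContr_eq_zero (gen y * u) v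
  obtain ⟨Q₂, hQ₂⟩ := exists_expContr_eq_zero u v
  obtain ⟨S, hS⟩ := exists_ann_eq_zero y v
  choose R hR using fun s => exists_expContr_eq_zero (parityPow y.isRight u) (ann y s v)
  set Q : ℕ := Q₁ + Q₂ + S + (∑ s ∈ Finset.range S, R s) + 1 with hQ
  refine ⟨Q + (-n).toNat, fun B hB => ?_⟩
  rw [mode_eq_sum n (Q := Q) (fun q hq => (hQ₁ q (by omega)).1)]
  simp only [expContr_gen_mul, map_add, map_sum, sum_add_distrib]
  congr 1
  · have h1 : ∀ q ∈ Finset.range Q, mulTd ((q : ℤ) - n - 1) (tens (mulGen y) 1 (expContr q (u ⊗ₜ v)))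
        = ∑ i ∈ Finset.range B, Td (i : ℤ) (gen y) * mulTd ((q : ℤ) - (n + i) - 1)
          (expContr q (u ⊗ₜ v)) := by
      intro q hq
      rw [mem_range] at hq
      rw [mulTd_tens_mulGen (B := B) (by omega)]
      refine sum_congr rfl fun i _ => ?_
      congr 2
      congr 1
      ring
    rw [sum_congr rfl h1, sum_comm]
    refine sum_congr rfl fun i _ => ?_
    rw [mode_eq_sum _ (Q := Q) (fun q hq => (hQ₂ q (by omega)).1), mul_sum]
  · have hR' : ∀ s ∈ Finset.range S, R s ≤ ∑ s ∈ Finset.range S, R s := fun s hs =>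
        Finset.single_le_sum (fun _ _ => Nat.zero_le _) hs
    rw [Finset.sum_comm' (s := Finset.range Q) (t := fun q => Finset.range q) (t' := Finset.range Q)
      (s' := fun s => Finset.Ico (s + 1) Q) (by
        intro x y
        simp only [mem_range, Finset.mem_Ico]
        omega)]
    have hQB : Q ≤ B := by omega
    rw [← Finset.sum_subset (Finset.range_mono hQB) (f := fun s : ℕ => mode (n - 1 - (s : ℤ))
      (parityPow y.isRight u) (ann y s v)) (fun s _ hs => by
        rw [mem_range, not_lt] at hs
        rw [hS s (by omega), map_zero])]
    refine sum_congr rfl fun s hs => ?_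
    rw [mem_range] at hs
    by_cases h : s < S
    · have := hR' s (Finset.mem_range.mpr h)
      rw [Finset.sum_Ico_eq_sum_range, mode_eq_sum _ (Q := Q - (s + 1))
        (fun q hq => (hR s q (by omega)).1)]
      refine sum_congr rfl fun r _ => ?_
      rw [show s + 1 + r - 1 - s = r by omega]
      congr 1
      push_cast
      congr 1
      ring
    · simp [hS s (not_lt.mp h)]

/-! #### The fields of functions -/

theorem mode_fn_of_dA (n : ℤ) (f : Ohat N) {v : Fock N M} (h : ∀ i m, dA i m v = 0) :
    mode n (fn f) v = Td (-n - 1) (fn f) * v := by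
  rw [mode_eq_sum n (Q := 1) (fun q hq => by rw [expContr_fn_of_dA h, if_neg (by omega)])]
  rw [Finset.sum_range_one, expContr_fn_of_dA h, if_pos rfl, mulTd_tmul]
  congr 2
  push_cast
  congr 1
  ring

theorem fer_mul_eq (y : FerGen M) (u : Fock N M) : fer y * u = parity u * fer y := by
  refine induction (P := fun u : Fock N M => fer y * u = parity u * fer y)
    (fun f => ?_) (fun u w hu hw => ?_) (fun x u hu => ?_) (fun x u hu => ?_) u
  · rw [parity_fn, fn_mul_comm]
  · rw [map_add, mul_add, add_mul, hu, hw]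
  · rw [parity_mulBos_apply, mul_assoc, ← hu, ← mul_assoc, ← bos_mul_comm, mul_assoc]
  · have h := congrArg (fun D => D (1 : Fock N M)) (mulFer_mulFer (N := N) y x)
    have h' : (fer y * fer x : Fock N M) = -(fer x * fer y) := by
      simpa [mulFer_apply] using h
    rw [parity_mulFer_apply, ← mul_assoc, h', neg_mul, neg_mul, mul_assoc, mul_assoc, hu]

theorem mul_gen_of_parity {u : Fock N M} (h : parity u = u) (y : Gen N M) :
    u * gen y = gen y * u := by
  rcases y with y | y
  · exact (bos_mul_comm y u).symm
  · exact ((fer_mul_eq y u).trans (by rw [h]; rfl)).symm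

theorem mulTd_tens_fnIncl (k : ℤ) (y : Gen N M) (w : Ohat N ⊗[ℂ] Fock N M) :
    mulTd k (tens 1 (mulGen y) (fnIncl w)) = gen y * mulTd k (fnIncl w) := by
  induction w using TensorProduct.induction_on with
  | zero => simp
  | add x y hx hy => simp only [map_add, hx, hy, mul_add]
  | tmul f v =>
    rw [fnIncl_tmul, tens_tmul, mulTd_tmul, mulTd_tmul, mulGen_apply, Module.End.one_apply,
      ← mul_assoc, mul_gen_of_parity (by rw [parity_Td, parity_fn]), mul_assoc]

theorem mode_fn_gen_mul (n : ℤ) (f : Ohat N) (y : Gen N M) (v : Fock N M)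
    (hy : ∀ i k, y ≠ Sum.inl (BosGen.a i k)) :
    mode n (fn f) (gen y * v) = gen y * mode n (fn f) v := by
  obtain ⟨Q, hQ⟩ := exists_expContr_fn_eq_zero v f
  rw [mode_eq_sum n hQ, mode_eq_sum (Q := Q) n (fun q hq => by
    rw [expContr_fn_gen_mul _ _ _ _ hy, hQ q hq, map_zero]), mul_sum]
  refine sum_congr rfl fun q _ => ?_
  rw [expContr_fn_gen_mul _ _ _ _ hy, ← fnIncl_tmul, expContr_fnIncl, mulTd_tens_fnIncl]

theorem mode_fn_a_mul (n : ℤ) (f : Ohat N) (i : Fin N) (k : ℕ) (v : Fock N M) :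
    mode n (fn f) (bos (BosGen.a i k) * v)
      = bos (BosGen.a i k) * mode n (fn f) v - mode (n - k - 1) (fn (pd i f)) v := by
  obtain ⟨Q₁, hQ₁⟩ := exists_expContr_fn_eq_zero v f
  obtain ⟨Q₂, hQ₂⟩ := exists_expContr_fn_eq_zero v (pd i f)
  set Q := Q₁ + Q₂ with hQ
  rw [mode_eq_sum (Q := Q + (k + 1)) n (u := fn f) (v := v) (fun q hq => hQ₁ q (by omega)),
    mode_eq_sum (Q := Q) _ (u := fn (pd i f)) (fun q hq => hQ₂ q (by omega)),
    mode_eq_sum (Q := Q + (k + 1)) n (fun q hq => by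
    rw [expContr_fn_a_mul, hQ₁ q (by omega), hQ₂ _ (by omega)]; simp), mul_sum]
  have h1 : ∀ q : ℕ, mulTd ((q : ℤ) - n - 1) (expContr q (fn f ⊗ₜ (bos (BosGen.a i k) * v)))
      = bos (BosGen.a i k) * mulTd ((q : ℤ) - n - 1) (expContr q (fn f ⊗ₜ v))
        - if k + 1 ≤ q then mulTd ((q : ℤ) - n - 1)
          (expContr (q - (k + 1)) (fn (pd i f) ⊗ₜ v)) else 0 := by
    intro q
    rw [expContr_fn_a_mul, map_sub, ← fnIncl_tmul, expContr_fnIncl]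
    have := mulTd_tens_fnIncl ((q : ℤ) - n - 1) (Sum.inl (BosGen.a i k)) (pexp fnContr q (f ⊗ₜ v))
    refine congrArg₂ _ this ?_
    split_ifs <;> simp
  simp only [h1, sum_sub_distrib]
  congr 1
  rw [add_comm Q, Finset.sum_range_add]
  have h2 : ∑ q ∈ Finset.range (k + 1), (if k + 1 ≤ q then mulTd ((q : ℤ) - n - 1)
          (expContr (q - (k + 1)) ((fn (pd i f) : Fock N M) ⊗ₜ v)) else 0) = 0 :=
    sum_eq_zero fun q hq => by
      rw [mem_range] at hq
      rw [if_neg (by omega)]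
  rw [h2, zero_add]
  refine sum_congr rfl fun q _ => ?_
  rw [if_pos (by omega), show k + 1 + q - (k + 1) = q by omega]
  congr 1
  push_cast
  congr 1
  ring

end Fock

end ChiralDO

end

noncomputable section

set_option linter.unusedSectionVars false

namespace ChiralDO

section Locality

variable {V W : Type*} [AddCommGroup V] [Module ℂ V] [AddCommGroup W] [Module ℂ W]

/-- Multiplication of the distribution `∑ F m n z^{-m-1} w^{-n-1}` by `z - w`. -/
def zw (V : Type*) [AddCommGroup V] [Module ℂ V] : Module.End ℂ (ℤ → ℤ → V) where
  toFun F m n := F (m + 1) n - F m (n + 1)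
  map_add' F G := by funext m n; simp only [Pi.add_apply]; abel
  map_smul' c F := by funext m n; simp only [Pi.smul_apply, RingHom.id_apply, smul_sub]

theorem zw_apply (F : ℤ → ℤ → V) (m n : ℤ) : zw V F m n = F (m + 1) n - F m (n + 1) := rfl

theorem zw_pow_succ (k : ℕ) (F : ℤ → ℤ → V) : (zw V ^ (k + 1)) F = (zw V ^ k) (zw V F) := by
  rw [pow_succ, Module.End.mul_apply]

theorem zw_pow_succ' (k : ℕ) (F : ℤ → ℤ → V) : (zw V ^ (k + 1)) F = zw V ((zw V ^ k) F) := by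
  rw [pow_succ', Module.End.mul_apply]

theorem zw_pow_map (L : V →ₗ[ℂ] W) (k : ℕ) : ∀ (F : ℤ → ℤ → V),
    (zw W ^ k) (fun m n => L (F m n)) = fun m n => L ((zw V ^ k) F m n) := by
  induction k with
  | zero => intro F; rfl
  | succ k ih =>
    intro F
    rw [zw_pow_succ, zw_pow_succ, ← ih]
    congr 1
    funext m n
    rw [zw_apply, zw_apply, map_sub]

theorem zw_pow_swap (k : ℕ) : ∀ (F : ℤ → ℤ → V),
    (zw V ^ k) (fun m n => F n m) = fun m n => (-1 : ℂ) ^ k • (zw V ^ k) F n m := by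
  induction k with
  | zero => intro F; simp
  | succ k ih =>
    intro F
    rw [zw_pow_succ', zw_pow_succ', ih]
    funext m n
    rw [zw_apply, zw_apply, pow_succ]
    simp only [mul_neg, mul_one, neg_smul, smul_sub]
    abel

theorem zw_pow_eq_zero_of_le {F : ℤ → ℤ → V} {k l : ℕ} (h : k ≤ l) (hF : (zw V ^ k) F = 0) :
    (zw V ^ l) F = 0 := by
  obtain ⟨j, rfl⟩ := Nat.exists_eq_add_of_le' h
  rw [pow_add, Module.End.mul_apply, hF, map_zero]

theorem zw_pow_vac {F : ℤ → ℤ → V} (hF : ∀ m n, 0 ≤ n → F m n = 0) (k : ℕ) :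
    (∀ m n, 0 ≤ n → (zw V ^ k) F m n = 0) ∧ ∀ m, (zw V ^ k) F m (-1) = F (m + k) (-1) := by
  induction k with
  | zero => exact ⟨hF, fun m => by simp⟩
  | succ k ih =>
    rw [zw_pow_succ']
    refine ⟨fun m n hn => ?_, fun m => ?_⟩
    · rw [zw_apply, ih.1 _ _ hn, ih.1 _ _ (by omega), sub_zero]
    · rw [zw_apply, ih.2, ih.1 _ _ (by omega), sub_zero]
      congr 1; push_cast; ring

theorem eq_of_zw_eq_zero {F : ℤ → ℤ → V} (hF : zw V F = 0) (m n : ℤ) : F m n = F 0 (m + n) := by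
  have h : ∀ m n, F (m + 1) n = F m (n + 1) := fun m n =>
    sub_eq_zero.mp (congrFun (congrFun hF m) n)
  induction m using Int.induction_on generalizing n with
  | zero => simp
  | succ i ih => rw [h, ih]; congr 1; ring
  | pred i ih =>
    have := h (-(i : ℤ) - 1) (n - 1)
    rw [sub_add_cancel, sub_add_cancel] at this
    rw [← this, ih]; congr 1; ring

/-- The derivative of a formal distribution in the first variable. -/
def dz (F : ℤ → ℤ → V) : ℤ → ℤ → V := fun m n => -(m : ℂ) • F (m - 1) n

theorem zw_dz (F : ℤ → ℤ → V) : zw V (dz F) = dz (zw V F) - F := by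
  funext m n
  simp only [zw_apply, dz, Pi.sub_apply, add_sub_cancel_right, sub_add_cancel, smul_sub]
  push_cast
  rw [neg_add, add_smul, neg_one_smul]
  abel

theorem dz_zero : dz (0 : ℤ → ℤ → V) = 0 := by
  funext m n; simp [dz]

theorem zw_pow_dz (k : ℕ) (F : ℤ → ℤ → V) :
    (zw V ^ (k + 1)) (dz F) = dz ((zw V ^ (k + 1)) F) - ((k : ℂ) + 1) • (zw V ^ k) F := by
  induction k with
  | zero => simp [zw_dz]
  | succ k ih =>
    rw [zw_pow_succ' (k + 1), ih, map_sub, zw_dz, map_smul, ← zw_pow_succ', ← zw_pow_succ',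
      add_smul (((k + 1 : ℕ) : ℂ)), one_smul, sub_sub, Nat.cast_succ]
    congr 1
    abel

/-- Two fields are local if their (anti-)commutator is killed by a power of `z - w`. The scalar `s`
is the sign. -/
def IsLocal (s : ℂ) (A B : ℤ → Module.End ℂ V) : Prop :=
  ∃ k : ℕ, ∀ v : V, (zw V ^ k) (fun m n => A m (B n v) - s • B n (A m v)) = 0

theorem IsLocal.symm {s : ℂ} {A B : ℤ → Module.End ℂ V} (hs : s * s = 1) (h : IsLocal s A B) :
    IsLocal s B A := by
  obtain ⟨k, hk⟩ := h
  refine ⟨k, fun v => ?_⟩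
  have h1 : (fun m n => B m (A n v) - s • A n (B m v))
      = fun m n => -s • (fun m n => A m (B n v) - s • B n (A m v)) n m := by
    funext m n
    simp only [smul_sub, smul_smul, neg_smul, neg_mul, hs, one_smul, sub_neg_eq_add]
    abel
  have h2 := zw_pow_map (-s • (LinearMap.id : V →ₗ[ℂ] V)) k
    (fun m n => (fun m n => A m (B n v) - s • B n (A m v)) n m)
  have h3 := zw_pow_swap k (fun m n => A m (B n v) - s • B n (A m v))
  rw [h1]
  refine Eq.trans h2 ?_
  rw [h3, hk]
  funext m n
  simp

theorem IsLocal.sub {s : ℂ} {A A' B : ℤ → Module.End ℂ V} (h : IsLocal s A B)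
    (h' : IsLocal s A' B) : IsLocal s (fun n => A n - A' n) B := by
  obtain ⟨k, hk⟩ := h
  obtain ⟨k', hk'⟩ := h'
  refine ⟨max k k', fun v => ?_⟩
  have h1 : (fun m n => (A m - A' m) (B n v) - s • B n ((A m - A' m) v))
      = (fun m n => A m (B n v) - s • B n (A m v)) - fun m n => A' m (B n v) - s • B n (A' m v) := by
    funext m n
    simp only [LinearMap.sub_apply, map_sub, smul_sub, Pi.sub_apply]
    abel
  rw [h1, map_sub, zw_pow_eq_zero_of_le (le_max_left _ _) (hk v),
    zw_pow_eq_zero_of_le (le_max_right _ _) (hk' v), sub_zero]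

theorem IsLocal.add {s : ℂ} {A A' B : ℤ → Module.End ℂ V} (h : IsLocal s A B)
    (h' : IsLocal s A' B) : IsLocal s (fun n => A n + A' n) B := by
  obtain ⟨k, hk⟩ := h
  obtain ⟨k', hk'⟩ := h'
  refine ⟨max k k', fun v => ?_⟩
  have h1 : (fun m n => (A m + A' m) (B n v) - s • B n ((A m + A' m) v))
      = (fun m n => A m (B n v) - s • B n (A m v)) + fun m n => A' m (B n v) - s • B n (A' m v) := by
    funext m n
    simp only [LinearMap.add_apply, map_add, smul_add, Pi.add_apply]
    abel
  rw [h1, map_add, zw_pow_eq_zero_of_le (le_max_left _ _) (hk v),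
    zw_pow_eq_zero_of_le (le_max_right _ _) (hk' v), add_zero]

theorem IsLocal.smul {s : ℂ} {A B : ℤ → Module.End ℂ V} (c : ℂ) (h : IsLocal s A B) :
    IsLocal s (fun n => c • A n) B := by
  obtain ⟨k, hk⟩ := h
  refine ⟨k, fun v => ?_⟩
  have h1 : (fun m n => (c • A m) (B n v) - s • B n ((c • A m) v))
      = c • (fun m n => A m (B n v) - s • B n (A m v)) := by
    funext m n
    simp only [LinearMap.smul_apply, map_smul, Pi.smul_apply, smul_sub, smul_comm c s]
  rw [h1, map_smul, hk, smul_zero]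

theorem IsLocal.deriv {s : ℂ} {A B : ℤ → Module.End ℂ V} (h : IsLocal s A B) :
    IsLocal s (fun n : ℤ => -(n : ℂ) • A (n - 1)) B := by
  obtain ⟨k, hk⟩ := h
  refine ⟨k + 1, fun v => ?_⟩
  have h1 : (fun m n : ℤ => (-(m : ℂ) • A (m - 1)) (B n v) - s • B n ((-(m : ℂ) • A (m - 1)) v))
      = dz (fun m n => A m (B n v) - s • B n (A m v)) := by
    funext m n
    simp only [dz, LinearMap.smul_apply, map_smul, smul_sub, smul_comm (-(m : ℂ)) s]
  rw [h1, zw_pow_dz, zw_pow_succ', hk]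
  simp [dz_zero]

theorem isLocal_of_commute {s : ℂ} {A B : ℤ → Module.End ℂ V}
    (h : ∀ m n v, A m (B n v) = s • B n (A m v)) : IsLocal s A B :=
  ⟨0, fun v => by funext m n; simp [h]⟩

theorem isLocal_of_comm_eq {s : ℂ} {A B : ℤ → Module.End ℂ V} (C : ℤ → Module.End ℂ V)
    (h : ∀ m n v, A m (B n v) - s • B n (A m v) = C (m + n) v) : IsLocal s A B :=
  ⟨1, fun v => by
    funext m n
    rw [pow_one, zw_apply, h, h, show m + 1 + n = m + (n + 1) by ring]
    simp⟩

/-! Distributions in three variables. -/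

/-- Formal distributions in three variables. -/
abbrev Dist₃ (V : Type*) := ℤ → ℤ → ℤ → V

/-- Multiplication by `z - w`. -/
def opZW : Module.End ℂ (Dist₃ V) where
  toFun F m n p := F (m + 1) n p - F m (n + 1) p
  map_add' F G := by funext m n p; simp only [Pi.add_apply]; abel
  map_smul' c F := by funext m n p; simp only [Pi.smul_apply, RingHom.id_apply, smul_sub]
/-- Multiplication by `z - x`. -/
def opZX : Module.End ℂ (Dist₃ V) where
  toFun F m n p := F (m + 1) n p - F m n (p + 1)
  map_add' F G := by funext m n p; simp only [Pi.add_apply]; abel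
  map_smul' c F := by funext m n p; simp only [Pi.smul_apply, RingHom.id_apply, smul_sub]
/-- Multiplication by `w - x`. -/
def opWX : Module.End ℂ (Dist₃ V) := opZX - opZW

theorem opZW_apply (F : Dist₃ V) (m n p : ℤ) : opZW F m n p = F (m + 1) n p - F m (n + 1) p := rfl
theorem opZX_apply (F : Dist₃ V) (m n p : ℤ) : opZX F m n p = F (m + 1) n p - F m n (p + 1) := rfl
theorem opWX_apply (F : Dist₃ V) (m n p : ℤ) : opWX F m n p = F m (n + 1) p - F m n (p + 1) :=
  sub_sub_sub_cancel_left _ _ _ |>.trans (by abel)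

theorem opZW_pow (k : ℕ) (F : Dist₃ V) (m n p : ℤ) :
    (opZW ^ k) F m n p = (zw V ^ k) (fun m n => F m n p) m n := by
  induction k generalizing m n with
  | zero => rfl
  | succ k ih => rw [pow_succ', Module.End.mul_apply, zw_pow_succ', opZW_apply, ih, ih, zw_apply]

theorem opZX_pow (k : ℕ) (F : Dist₃ V) (m n p : ℤ) :
    (opZX ^ k) F m n p = (zw V ^ k) (fun m p => F m n p) m p := by
  induction k generalizing m p with
  | zero => rfl
  | succ k ih => rw [pow_succ', Module.End.mul_apply, zw_pow_succ', opZX_apply, ih, ih, zw_apply]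

theorem opWX_pow (k : ℕ) (F : Dist₃ V) (m n p : ℤ) :
    (opWX ^ k) F m n p = (zw V ^ k) (fun n p => F m n p) n p := by
  induction k generalizing n p with
  | zero => rfl
  | succ k ih => rw [pow_succ', Module.End.mul_apply, zw_pow_succ', opWX_apply, ih, ih, zw_apply]

theorem commute_opZW_opZX : Commute (opZW (V := V)) opZX := LinearMap.ext fun F => by
  funext m n p; simp only [Module.End.mul_apply, opZW_apply, opZX_apply]; abel
theorem commute_opZW_opWX : Commute (opZW (V := V)) opWX :=
  commute_opZW_opZX.sub_right (Commute.refl _)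
theorem commute_opZX_opWX : Commute (opZX (V := V)) opWX :=
  (Commute.refl _).sub_right commute_opZW_opZX.symm

/-- The truncation conditions on a pair of distributions for which the residue below exists. -/
def IsTrunc (F G : Dist₃ V) : Prop :=
  ∀ p, ∃ r : ℤ, (∀ m n, r ≤ n → F m n p = 0) ∧ ∀ m n, r ≤ m → G m n p = 0

theorem IsTrunc.map {F G : Dist₃ V} (h : IsTrunc F G) :
    IsTrunc (opZW F) (opZW G) ∧ IsTrunc (opZX F) (opZX G) ∧ IsTrunc (opWX F) (opWX G) := by
  have key : ∀ p, ∃ r : ℤ, (∀ m n, r ≤ n → F m n p = 0 ∧ F m n (p + 1) = 0) ∧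
      ∀ m n, r ≤ m → G m n p = 0 ∧ G m n (p + 1) = 0 := by
    intro p
    obtain ⟨r, h1, h2⟩ := h p
    obtain ⟨r', h1', h2'⟩ := h (p + 1)
    exact ⟨max r r', fun m n hn => ⟨h1 m n (le_trans (le_max_left _ _) hn),
      h1' m n (le_trans (le_max_right _ _) hn)⟩, fun m n hn => ⟨h2 m n (le_trans (le_max_left _ _) hn),
      h2' m n (le_trans (le_max_right _ _) hn)⟩⟩
  refine ⟨fun p => ?_, fun p => ?_, fun p => ?_⟩ <;>
  · obtain ⟨r, h1, h2⟩ := key p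
    refine ⟨r, fun m n hn => ?_, fun m n hm => ?_⟩
    · simp [opZW_apply, opZX_apply, opWX_apply, (h1 (m + 1) n hn).1, (h1 m (n + 1) (by omega)).1, (h1 m n hn).1,
        (h1 m n hn).2]
    · simp [opZW_apply, opZX_apply, opWX_apply, (h2 (m + 1) n (by omega)).1, (h2 m (n + 1) hm).1, (h2 m n hm).1,
        (h2 m n hm).2]

theorem IsTrunc.pow {F G : Dist₃ V} (h : IsTrunc F G) (k : ℕ) :
    IsTrunc ((opWX ^ k) F) ((opWX ^ k) G) ∧ IsTrunc ((opZW ^ k) F) ((opZW ^ k) G) := by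
  induction k with
  | zero => exact ⟨h, h⟩
  | succ k ih => simp only [pow_succ', Module.End.mul_apply]; exact ⟨ih.1.map.2.2, ih.2.map.1⟩

/-- `H` is the residue at `z = w` of `F / (z - w)` (expanded for `|z| > |w|`) minus that of
`s G / (z - w)` (expanded for `|z| < |w|`). -/
def IsRes (s : ℂ) (F G : ℤ → ℤ → V) (H : ℤ → V) : Prop :=
  ∀ n, ∃ J₀ : ℕ, ∀ J ≥ J₀, H n = ∑ j ∈ Finset.range J, F (-1 - j) (n + j)
    + s • ∑ j ∈ Finset.range J, G j (n - 1 - j)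

theorem IsRes.sub {s : ℂ} {F G F' G' : ℤ → ℤ → V} {H H' : ℤ → V} (h : IsRes s F G H)
    (h' : IsRes s F' G' H') : IsRes s (F - F') (G - G') (H - H') := by
  intro n
  obtain ⟨J, hJ⟩ := h n
  obtain ⟨J', hJ'⟩ := h' n
  refine ⟨max J J', fun K hK => ?_⟩
  rw [Pi.sub_apply, hJ K (le_trans (le_max_left _ _) hK), hJ' K (le_trans (le_max_right _ _) hK)]
  simp only [Pi.sub_apply, sum_sub_distrib, smul_sub]
  abel

theorem IsRes.map {s : ℂ} {F G : ℤ → ℤ → V} {H : ℤ → V} (L : V →ₗ[ℂ] W) (h : IsRes s F G H) :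
    IsRes s (fun m n => L (F m n)) (fun m n => L (G m n)) (fun n => L (H n)) := by
  intro n
  obtain ⟨J, hJ⟩ := h n
  refine ⟨J, fun K hK => ?_⟩
  simp only
  rw [hJ K hK, map_add, map_smul, map_sum, map_sum]

theorem IsRes.unique {s : ℂ} {F G : ℤ → ℤ → V} {H H' : ℤ → V} (h : IsRes s F G H)
    (h' : IsRes s F G H') : H = H' := by
  funext n
  obtain ⟨J, hJ⟩ := h n
  obtain ⟨J', hJ'⟩ := h' n
  rw [hJ (max J J') (le_max_left _ _), hJ' (max J J') (le_max_right _ _)]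

theorem isRes_zw {s : ℂ} {F G : ℤ → ℤ → V} {r : ℤ} (hF : ∀ m n, r ≤ n → F m n = 0)
    (hG : ∀ m n, r ≤ m → G m n = 0) :
    IsRes s (zw V F) (zw V G) (fun n => F 0 n - s • G 0 n) := by
  intro n
  refine ⟨(r - n).toNat + r.toNat, fun J hJ => ?_⟩
  have h1 : ∀ J : ℕ, ∑ j ∈ Finset.range J, zw V F (-1 - j) (n + j) = F 0 n - F (-J) (n + J) := by
    intro J
    induction J with
    | zero => simp
    | succ J ih =>
      rw [sum_range_succ, ih, zw_apply]
      push_cast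
      rw [show (-1 - (J : ℤ) + 1) = -J by ring, show (-1 - (J : ℤ)) = -(J + 1) by ring,
        show n + (J : ℤ) + 1 = n + (J + 1) by ring]
      abel
  have h2 : ∀ J : ℕ, ∑ j ∈ Finset.range J, zw V G j (n - 1 - j) = G J (n - J) - G 0 n := by
    intro J
    induction J with
    | zero => simp
    | succ J ih =>
      rw [sum_range_succ, ih, zw_apply]
      push_cast
      rw [show n - 1 - (J : ℤ) + 1 = n - J by ring, show n - 1 - (J : ℤ) = n - (J + 1) by ring]
      abel
  rw [h1, h2, hF (-J) (n + J) (by omega), hG J (n - J) (by omega), smul_sub]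
  simp [sub_eq_add_neg]

/-- The algebraic core of Dong's lemma. -/
theorem isRes_opWX_pow {s : ℂ} (i : ℕ) : ∀ (k : ℕ) (F G : Dist₃ V), IsTrunc F G →
    (opZX ^ i) F = 0 → (opZX ^ i) G = 0 → (opZW ^ k) (F - s • G) = 0 → ∀ p,
    IsRes s (fun m n => (opWX ^ (i + k)) F m n p) (fun m n => (opWX ^ (i + k)) G m n p) 0 := by
  induction i with
  | zero =>
    intro k F G _ hF hG _ p n
    rw [pow_zero, Module.End.one_apply] at hF hG
    refine ⟨0, fun J _ => ?_⟩
    simp [hF, hG]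
  | succ i ih =>
    have hcomm : ∀ F : Dist₃ V, (opZX ^ (i + 1)) F = 0 → (opZX ^ (i + 1)) (opZW F) = 0 := by
      intro F hF
      rw [← Module.End.mul_apply, ← (commute_opZW_opZX.pow_right (i + 1)).eq, Module.End.mul_apply,
        hF, map_zero]
    have split : ∀ (l : ℕ) (F : Dist₃ V),
        (opWX ^ (l + 1)) F = (opWX ^ l) (opZX F) - (opWX ^ l) (opZW F) := fun l F => by
      rw [pow_succ, Module.End.mul_apply, ← map_sub]; rfl
    intro k
    induction k with
    | zero =>
      intro F G hT hF hG hFG p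
      rw [pow_zero, Module.End.one_apply] at hFG
      have e1 := ih 0 (opZX F) (opZX G) hT.map.2.1 hF hG
        (by rw [← map_smul, ← map_sub, hFG]; simp) p
      obtain ⟨r, h1, h2⟩ := (hT.pow i).1 p
      have e2 := isRes_zw (s := s) h1 h2
      have e3 : (fun n => (opWX ^ i) F 0 n p - s • (opWX ^ i) G 0 n p) = 0 := by
        rw [sub_eq_zero.mp hFG, map_smul]
        funext n
        exact sub_self _
      rw [e3] at e2
      have e4 := e1.sub e2
      rw [sub_zero] at e4
      have e5 : ∀ E : Dist₃ V, (fun m n => (opWX ^ (i + 1)) E m n p)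
          = (fun m n => (opWX ^ i) (opZX E) m n p) - zw V (fun m n => (opWX ^ i) E m n p) := by
        intro E
        rw [split, ← Module.End.mul_apply _ opZW, ← (commute_opZW_opWX.pow_right i).eq]
        rfl
      rw [Nat.add_zero, e5, e5]
      exact e4
    | succ k ihk =>
      intro F G hT hF hG hFG p
      have e1 := ih (k + 1) (opZX F) (opZX G) hT.map.2.1 hF hG (by
        rw [← map_smul, ← map_sub, ← Module.End.mul_apply, (commute_opZW_opZX.pow_left (k + 1)).eq,
          Module.End.mul_apply, hFG, map_zero]) p
      have e2 := ihk (opZW F) (opZW G) hT.map.1 (hcomm F hF) (hcomm G hG) (by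
        rw [← map_smul, ← map_sub]; exact hFG) p
      have e3 := e1.sub e2
      rw [sub_zero] at e3
      have e5 : ∀ E : Dist₃ V, (fun m n => (opWX ^ (i + 1 + (k + 1))) E m n p)
          = (fun m n => (opWX ^ (i + (k + 1))) (opZX E) m n p)
            - fun m n => (opWX ^ (i + 1 + k)) (opZW E) m n p := by
        intro E
        rw [show i + 1 + (k + 1) = (i + (k + 1)) + 1 by ring, split,
          show i + (k + 1) = i + 1 + k by ring]
        rfl
      rw [e5, e5]
      exact e3

/-- Every vector is killed by the modes of large index. -/
def IsField (A : ℤ → Module.End ℂ V) : Prop := ∀ v, ∃ r : ℤ, ∀ n ≥ r, A n v = 0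

/-- `D` is the product of index `l - 1` of the fields `A` and `B`; for `l = 0`, it is the normally
ordered product. -/
def IsProd (s : ℂ) (l : ℕ) (A B D : ℤ → Module.End ℂ V) : Prop :=
  ∀ v, IsRes s ((zw V ^ l) fun m n => A m (B n v)) ((zw V ^ l) fun m n => B n (A m v))
    (fun n => D n v)

/-- Dong's lemma. -/
theorem IsProd.isLocal {s s₁ s₂ : ℂ} {l : ℕ} {A B C D : ℤ → Module.End ℂ V} (hA : IsField A)
    (hB : IsField B) (hAB : IsLocal s A B) (hAC : IsLocal s₁ A C) (hBC : IsLocal s₂ B C)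
    (hD : IsProd s l A B D) : IsLocal (s₁ * s₂) D C := by
  obtain ⟨k, hk⟩ := hAB
  obtain ⟨k₁, hk₁⟩ := hAC
  obtain ⟨k₂, hk₂⟩ := hBC
  set K := k₁ + k₂ with hK
  refine ⟨(k₁ + k) + k₂, fun v => ?_⟩
  set F : Dist₃ V := fun m n p => A m (B n (C p v)) - (s₁ * s₂) • C p (A m (B n v)) with hF
  set G : Dist₃ V := fun m n p => B n (A m (C p v)) - (s₁ * s₂) • C p (B n (A m v)) with hG
  set H : ℤ → ℤ → V := fun n p => D n (C p v) - (s₁ * s₂) • C p (D n v) with hH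
  have hT : IsTrunc F G := by
    intro p
    obtain ⟨r1, h1⟩ := hB (C p v)
    obtain ⟨r2, h2⟩ := hB v
    obtain ⟨r3, h3⟩ := hA (C p v)
    obtain ⟨r4, h4⟩ := hA v
    refine ⟨max (max r1 r2) (max r3 r4), fun m n hn => ?_, fun m n hn => ?_⟩
    · simp only [hF]
      rw [h1 n (by omega), h2 n (by omega)]; simp
    · simp only [hG]
      rw [h3 m (by omega), h4 m (by omega)]; simp
  have comm {S T : Module.End ℂ (Dist₃ V)} (h : Commute S T) (i j : ℕ) (E : Dist₃ V) :
      (S ^ i) ((T ^ j) E) = (T ^ j) ((S ^ i) E) := LinearMap.congr_fun (h.pow_pow i j).eq E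
  have hadd : ∀ (i j : ℕ) (E E' : Dist₃ V), (opZX ^ i) E = 0 → (opWX ^ j) E' = 0 →
      (opZX ^ i) ((opWX ^ j) (E + E')) = 0 := by
    intro i j E E' hE hE'
    rw [map_add, hE', add_zero, comm commute_opZX_opWX, hE, map_zero]
  have hFz : (opZX ^ k₁) ((opWX ^ k₂) F) = 0 := by
    have e : F = (fun m n p => s₂ • (A m (C p (B n v)) - s₁ • C p (A m (B n v))))
        + fun m n p => A m (B n (C p v) - s₂ • C p (B n v)) := by
      funext m n p
      simp only [hF, Pi.add_apply, map_sub, map_smul, smul_sub, smul_smul, mul_comm s₂ s₁]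
      abel
    rw [e]
    apply hadd
    · funext m n p
      rw [opZX_pow]
      have h2 := zw_pow_map (s₂ • (LinearMap.id : V →ₗ[ℂ] V)) k₁
        (fun m p => A m (C p (B n v)) - s₁ • C p (A m (B n v)))
      refine (congrFun (congrFun h2 m) p).trans ?_
      rw [hk₁]; simp
    · funext m n p
      rw [opWX_pow]
      have h2 := zw_pow_map (A m) k₂ (fun n p => B n (C p v) - s₂ • C p (B n v))
      refine (congrFun (congrFun h2 n) p).trans ?_
      rw [hk₂]; simp
  have hGz : (opZX ^ k₁) ((opWX ^ k₂) G) = 0 := by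
    have e : G = (fun m n p => B n (A m (C p v) - s₁ • C p (A m v)))
        + fun m n p => s₁ • (B n (C p (A m v)) - s₂ • C p (B n (A m v))) := by
      funext m n p
      simp only [hG, Pi.add_apply, map_sub, map_smul, smul_sub, smul_smul]
      abel
    rw [e]
    apply hadd
    · funext m n p
      rw [opZX_pow]
      have h2 := zw_pow_map (B n) k₁ (fun m p => A m (C p v) - s₁ • C p (A m v))
      refine (congrFun (congrFun h2 m) p).trans ?_
      rw [hk₁]; simp
    · funext m n p
      rw [opWX_pow]
      have h2 := zw_pow_map (s₁ • (LinearMap.id : V →ₗ[ℂ] V)) k₂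
        (fun n p => B n (C p (A m v)) - s₂ • C p (B n (A m v)))
      refine (congrFun (congrFun h2 n) p).trans ?_
      rw [hk₂]; simp
  have hFG : (opZW ^ k) (F - s • G) = 0 := by
    funext m n p
    rw [opZW_pow]
    have e : (fun m n => (F - s • G) m n p) = (fun m n => A m (B n (C p v)) - s • B n (A m (C p v)))
        - fun m n => ((s₁ * s₂) • C p) (A m (B n v) - s • B n (A m v)) := by
      funext m n
      simp only [hF, hG, Pi.sub_apply, Pi.smul_apply, LinearMap.smul_apply, map_sub, map_smul, smul_sub,
        smul_comm s (s₁ * s₂)]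
      abel
    rw [e, map_sub, hk, zw_pow_map, hk]
    simp
  have key := fun p => isRes_opWX_pow (s := s) k₁ k ((opZW ^ l) ((opWX ^ k₂) F))
    ((opZW ^ l) ((opWX ^ k₂) G)) (((hT.pow k₂).1.pow l).2)
    (by rw [comm commute_opZW_opZX.symm, hFz, map_zero])
    (by rw [comm commute_opZW_opZX.symm, hGz, map_zero]) (by
      rw [← map_smul, ← map_smul, ← map_sub, ← map_sub, comm (Commute.refl _),
        comm commute_opZW_opWX, hFG, map_zero, map_zero]) p
  have hres : ∀ p, IsRes s (fun m n => (opZW ^ l) F m n p) (fun m n => (opZW ^ l) G m n p)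
      (fun n => H n p) := by
    intro p
    have e := (hD (C p v)).sub ((hD v).map ((s₁ * s₂) • C p))
    have eF : (fun m n => (opZW ^ l) F m n p) = ((zw V ^ l) fun m n => A m (B n (C p v)))
        - fun m n => ((s₁ * s₂) • C p) ((zw V ^ l) (fun m n => A m (B n v)) m n) := by
      rw [← zw_pow_map, ← map_sub]
      funext m n
      rw [opZW_pow]
      rfl
    have eG : (fun m n => (opZW ^ l) G m n p) = ((zw V ^ l) fun m n => B n (A m (C p v)))
        - fun m n => ((s₁ * s₂) • C p) ((zw V ^ l) (fun m n => B n (A m v)) m n) := by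
      rw [← zw_pow_map, ← map_sub]
      funext m n
      rw [opZW_pow]
      rfl
    rw [eF, eG]
    exact e
  have hshift : ∀ (q : ℕ) (p : ℤ), IsRes s (fun m n => (opWX ^ q) ((opZW ^ l) F) m n p)
      (fun m n => (opWX ^ q) ((opZW ^ l) G) m n p) (fun n => (zw V ^ q) H n p) := by
    intro q
    induction q with
    | zero => exact hres
    | succ q ih =>
      intro p n
      obtain ⟨J1, h1⟩ := ih p (n + 1)
      obtain ⟨J2, h2⟩ := ih (p + 1) n
      refine ⟨max J1 J2, fun J hJ => ?_⟩
      simp only at h1 h2 ⊢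
      rw [zw_pow_succ', zw_apply, h1 J (le_trans (le_max_left _ _) hJ),
        h2 J (le_trans (le_max_right _ _) hJ)]
      simp only [pow_succ', Module.End.mul_apply, opWX_apply, sum_sub_distrib, smul_sub]
      have e1 : ∀ j : ℕ, n + 1 + (j : ℤ) = n + j + 1 := fun j => by ring
      have e2 : ∀ j : ℕ, n + 1 - 1 - (j : ℤ) = n - 1 - j + 1 := fun j => by ring
      simp only [e1, e2]
      abel
  funext n p
  have h1 := hshift (k₁ + k + k₂) p
  have h2 := key p
  have e : ∀ E : Dist₃ V, (opWX ^ (k₁ + k)) ((opZW ^ l) ((opWX ^ k₂) E))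
      = (opWX ^ (k₁ + k + k₂)) ((opZW ^ l) E) := fun E => by
    rw [comm commute_opZW_opWX, ← Module.End.mul_apply, ← pow_add]
  rw [e, e] at h2
  exact congrFun (h1.unique h2) n

/-- The products of non-negative index of two fields. -/
theorem isProd_succ {s : ℂ} {A B : ℤ → Module.End ℂ V} (hA : IsField A) (hB : IsField B) (l : ℕ)
    {D : ℤ → Module.End ℂ V}
    (hD : ∀ n v, D n v = (zw V ^ l) (fun m n => A m (B n v) - s • B n (A m v)) 0 n) :
    IsProd s (l + 1) A B D := by
  intro v
  have trunc : ∀ l : ℕ, ∃ r : ℤ, (∀ m n, r ≤ n → (zw V ^ l) (fun m n => A m (B n v)) m n = 0) ∧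
      ∀ m n, r ≤ m → (zw V ^ l) (fun m n => B n (A m v)) m n = 0 := by
    obtain ⟨r1, h1⟩ := hA v
    obtain ⟨r2, h2⟩ := hB v
    intro l
    refine ⟨max r1 r2, ?_⟩
    induction l with
    | zero =>
      refine ⟨fun m n hn => ?_, fun m n hn => ?_⟩
      · simp [h2 n (by omega)]
      · simp [h1 m (by omega)]
    | succ l ih =>
      rw [zw_pow_succ', zw_pow_succ']
      refine ⟨fun m n hn => ?_, fun m n hn => ?_⟩
      · rw [zw_apply, ih.1 _ _ hn, ih.1 _ _ (by omega), sub_zero]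
      · rw [zw_apply, ih.2 _ _ hn, ih.2 _ _ (by omega), sub_zero]
  obtain ⟨r, h1, h2⟩ := trunc l
  have h := isRes_zw (s := s) h1 h2
  rw [zw_pow_succ', zw_pow_succ']
  refine cast ?_ h
  congr 1
  funext n
  have e : (fun m n => A m (B n v) - s • B n (A m v))
      = (fun m n => A m (B n v)) - s • fun m n => B n (A m v) := rfl
  rw [hD, e, map_sub, map_smul]
  rfl

/-- A field that kills the vacuum and is local with respect to a field that creates `v` kills `v`. -/
theorem IsLocal.apply_eq_zero {s : ℂ} {D B : ℤ → Module.End ℂ V} {vac v : V} (h : IsLocal s D B)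
    (hD : ∀ n, D n vac = 0) (hB : ∀ n, 0 ≤ n → B n vac = 0) (hv : B (-1) vac = v) (n : ℤ) :
    D n v = 0 := by
  obtain ⟨k, hk⟩ := h
  have h0 := hk vac
  simp only [hD, map_zero, smul_zero, sub_zero] at h0
  have h1 := (zw_pow_vac (F := fun m n => D m (B n vac)) (fun m n hn => by simp [hB n hn]) k).2
    (n - k)
  rw [h0] at h1
  simpa [hv] using h1.symm

end Locality

end ChiralDO

end

noncomputable section

namespace ChiralDO

open Ohat

namespace Fock

variable {N M : ℕ}

/-! #### The modes of the generating fields -/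

theorem mode_one (n : ℤ) (v : Fock N M) : mode n (1 : Fock N M) v = if n = -1 then v else 0 := by
  have hTd : ∀ k : ℤ, Td k (1 : Fock N M) = if k = 0 then 1 else 0 := by
    intro k
    rcases lt_or_ge k 0 with h | h
    · rw [Td_of_neg h, if_neg (by omega)]; rfl
    · lift k to ℕ using h
      rcases k with _ | k
      · simp [Td_zero]
      · push_cast
        rw [Td_succ_apply, if_neg (by omega), ← Td_transl, transl_one, map_zero, smul_zero]
  refine gen_induction (P := fun v => mode n (1 : Fock N M) v = if n = -1 then v else 0)
    (fun f => ?_) (fun u v hu hv => ?_) (fun y u hu => ?_) v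
  · rw [← fn_one, mode_fn_of_dA n 1 (fun i m => dA_fn i m f), fn_one, hTd]
    by_cases h : n = -1
    · simp [h]
    · rw [if_neg (by omega), if_neg h, zero_mul]
  · rw [map_add, hu, hv]; split_ifs <;> simp
  · by_cases hy : ∀ i k, y ≠ Sum.inl (BosGen.a i k)
    · rw [← fn_one, mode_fn_gen_mul n 1 y u hy, fn_one, hu]; split_ifs <;> simp
    · push Not at hy
      obtain ⟨i, k, rfl⟩ := hy
      have := mode_fn_a_mul (M := M) n 1 i k u
      rw [Derivation.map_one_eq_zero, fn_zero, map_zero, fn_one, hu, LinearMap.zero_apply,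
        sub_zero] at this
      refine this.trans ?_
      split_ifs
      · rfl
      · exact mul_zero _

theorem ann_fn_of_succ (y : Gen N M) (s : ℕ) : ann y s (1 : Fock N M) = 0 := by
  have hdB : ∀ i s, dB i s (1 : Fock N M) = 0 := fun i s => by
    rcases s with _ | s
    · rw [← fn_one, dB_zero_fn, Derivation.map_one_eq_zero, fn_zero]
    · rw [← fn_one, dB_succ_fn]
  have hdA : ∀ i s, dA i s (1 : Fock N M) = 0 := fun i s => by rw [← fn_one, dA_fn]
  have hdL : ∀ x, dL x (1 : Fock N M) = 0 := fun x => by rw [← fn_one, dL_fn]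
  rcases y with (⟨i, k⟩ | ⟨i, k⟩) | (⟨j, k⟩ | ⟨j, k⟩) <;> simp only [ann] <;> split_ifs <;>
    simp [hdA, hdB, hdL]

theorem mode_vac (n : ℤ) (u : Fock N M) : mode n u 1 = Td (-n - 1) u := by
  refine gen_induction (P := fun u => ∀ n, mode n u 1 = Td (-n - 1) u) (fun f n => ?_)
    (fun u v hu hv n => ?_) (fun y u hu n => ?_) u n
  · rw [mode_fn_of_dA n f (fun i m => by rw [← fn_one, dA_fn]), mul_one]
  · rw [map_add, map_add, LinearMap.add_apply, hu, hv]
  · obtain ⟨B, hB⟩ := exists_mode_gen_mul n y u 1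
    rw [hB (B + (-n).toNat) (by omega), Td_mul (B := B + (-n).toNat) (by omega)]
    simp only [ann_fn_of_succ, map_zero, sum_const_zero, add_zero]
    refine sum_congr rfl fun i _ => ?_
    rw [hu]
    congr 2
    congr 1
    ring

theorem mode_vac_of_nonneg {n : ℤ} (hn : 0 ≤ n) (u : Fock N M) : mode n u 1 = 0 := by
  rw [mode_vac, Td_of_neg (by omega)]; rfl

theorem mode_vac_neg_one (u : Fock N M) : mode (-1) u 1 = u := by
  rw [mode_vac]; simp [Td_zero]

theorem parityPow_one (b : Bool) : parityPow b (1 : Fock N M) = 1 := by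
  unfold parityPow
  split_ifs
  · rw [← fn_one, parity_fn]
  · rfl

theorem mode_gen (n : ℤ) (y : Gen N M) (v : Fock N M) :
    mode n (gen y) v = if n < 0 then Td (-n - 1) (gen y) * v else ann y n.toNat v := by
  obtain ⟨B, hB⟩ := exists_mode_gen_mul n y 1 v
  have h := hB (B + n.natAbs + 1) (by omega)
  rw [mul_one, parityPow_one] at h
  rw [h]
  simp only [mode_one, mul_ite, mul_zero]
  split_ifs with hn
  · rw [sum_eq_single (-n - 1).toNat, if_pos (by omega), sum_eq_zero, add_zero,
      Int.toNat_of_nonneg (by omega)]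
    · intro s _; rw [if_neg (by omega)]
    · intro i _ hi; rw [if_neg (by omega)]
    · intro h'; rw [mem_range] at h'; omega
  · rw [sum_eq_zero, zero_add, sum_eq_single n.toNat, if_pos (by omega)]
    · intro s _ hs; rw [if_neg (by omega)]
    · intro h'; rw [mem_range] at h'; omega
    · intro i _; rw [if_neg (by omega)]

theorem mode_gen_neg (k : ℕ) (y : Gen N M) (v : Fock N M) :
    mode (-1 - k) (gen y) v = Td (k : ℤ) (gen y) * v := by
  rw [mode_gen, if_pos (by omega)]
  congr 2; congr 1; ring

theorem mode_gen_natCast (s : ℕ) (y : Gen N M) (v : Fock N M) : mode s (gen y) v = ann y s v := by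
  rw [mode_gen, if_neg (by omega)]; simp

theorem isField_mode (u : Fock N M) : IsField (fun n => mode n u) := exists_mode_eq_zero u

/-- The sign of a parity. -/
def sgn (b : Bool) : ℂ := if b then -1 else 1

/-- Homogeneous states. -/
def IsHom (b : Bool) (u : Fock N M) : Prop := parity u = sgn b • u

theorem sgn_mul_self (b : Bool) : sgn b * sgn b = 1 := by cases b <;> simp [sgn]

theorem sgn_xor_and (b b' c : Bool) : sgn (b && c) * sgn (b' && c) = sgn ((b ^^ b') && c) := by
  cases b <;> cases b' <;> cases c <;> simp [sgn]

theorem sgn_xor (b b' : Bool) : sgn (b ^^ b') = sgn b * sgn b' := by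
  cases b <;> cases b' <;> simp [sgn]

theorem IsHom.parityPow {b : Bool} {u : Fock N M} (h : IsHom b u) (c : Bool) :
    parityPow c u = sgn (c && b) • u := by
  unfold Fock.parityPow
  cases c
  · simp [sgn]
  · exact h

theorem isHom_fn (f : Ohat N) : IsHom false (fn f : Fock N M) := by simp [IsHom, sgn, parity_fn]
theorem isHom_gen (y : Gen N M) : IsHom y.isRight (gen y) := by
  rcases y with y | y
  · simp [IsHom, sgn, gen, parity_bos]
  · simp [IsHom, sgn, gen, parity_fer]
theorem IsHom.mul {b c : Bool} {u v : Fock N M} (hu : IsHom b u) (hv : IsHom c v) :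
    IsHom (b ^^ c) (u * v) := by
  rw [IsHom, parity_mul, hu, hv, smul_mul_smul_comm, sgn_xor]
theorem IsHom.add {b : Bool} {u v : Fock N M} (hu : IsHom b u) (hv : IsHom b v) :
    IsHom b (u + v) := by rw [IsHom, map_add, hu, hv, smul_add]
theorem IsHom.sub {b : Bool} {u v : Fock N M} (hu : IsHom b u) (hv : IsHom b v) :
    IsHom b (u - v) := by rw [IsHom, map_sub, hu, hv, smul_sub]
theorem IsHom.zero (b : Bool) : IsHom b (0 : Fock N M) := by simp [IsHom]
theorem IsHom.sum {b : Bool} {ι : Type*} {s : Finset ι} {u : ι → Fock N M}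
    (hu : ∀ i ∈ s, IsHom b (u i)) : IsHom b (∑ i ∈ s, u i) := by
  rw [IsHom, map_sum, smul_sum]; exact sum_congr rfl hu
theorem IsHom.transl {b : Bool} {u : Fock N M} (hu : IsHom b u) : IsHom b (transl u) := by
  rw [IsHom, parity_transl, hu, map_smul]

/-- Induction over homogeneous states. -/
theorem hom_induction {P : Bool → Fock N M → Prop} (hfn : ∀ f, P false (fn f))
    (hzero : P true 0) (hadd : ∀ b u v, P b u → P b v → P b (u + v))
    (hgen : ∀ b y u, IsHom b u → P b u → P (y.isRight ^^ b) (gen y * u))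
    {b : Bool} {u : Fock N M} (h : IsHom b u) : P b u := by
  have key : ∀ u : Fock N M, ∃ u₀ u₁, u = u₀ + u₁ ∧ (IsHom false u₀ ∧ P false u₀) ∧
      (IsHom true u₁ ∧ P true u₁) := by
    intro u
    refine gen_induction (P := fun u : Fock N M => ∃ u₀ u₁, u = u₀ + u₁ ∧
      (IsHom false u₀ ∧ P false u₀) ∧ (IsHom true u₁ ∧ P true u₁)) (fun f => ?_)
      (fun u v hu hv => ?_) (fun y u hu => ?_) u
    · exact ⟨fn f, 0, by simp, ⟨isHom_fn f, hfn f⟩, IsHom.zero _, hzero⟩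
    · obtain ⟨u₀, u₁, rfl, ⟨h1, h2⟩, h3, h4⟩ := hu
      obtain ⟨v₀, v₁, rfl, ⟨k1, k2⟩, k3, k4⟩ := hv
      exact ⟨u₀ + v₀, u₁ + v₁, by abel, ⟨h1.add k1, hadd _ _ _ h2 k2⟩, h3.add k3, hadd _ _ _ h4 k4⟩
    · obtain ⟨u₀, u₁, rfl, ⟨h1, h2⟩, h3, h4⟩ := hu
      have e0 := hgen _ y _ h1 h2
      have e1 := hgen _ y _ h3 h4
      have f0 := (isHom_gen y).mul h1
      have f1 := (isHom_gen y).mul h3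
      rcases y with y | y
      · exact ⟨_, _, mul_add _ _ _, ⟨f0, e0⟩, f1, e1⟩
      · exact ⟨_, _, (mul_add _ _ _).trans (add_comm _ _), ⟨f1, e1⟩, f0, e0⟩
  obtain ⟨u₀, u₁, rfl, ⟨h1, h2⟩, h3, h4⟩ := key u
  have two : (2 : ℂ) ≠ 0 := two_ne_zero
  rw [IsHom, map_add, h1, h3] at h
  cases b
  · have : (2 : ℂ) • u₁ = 0 := by
      simp only [sgn, Bool.false_eq_true, if_true, if_false, one_smul, neg_smul] at h
      rw [two_smul]
      have := congrArg (fun x => u₀ + u₁ - x) h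
      simpa using this
    rw [smul_eq_zero_iff_right two] at this
    rw [this, add_zero]; exact h2
  · have : (2 : ℂ) • u₀ = 0 := by
      simp only [sgn, Bool.false_eq_true, if_true, if_false, one_smul, neg_smul, neg_add] at h
      have := congrArg (fun x => u₀ + u₁ + x) h
      rw [two_smul]
      simpa [add_eq_zero_iff_eq_neg] using this
    rw [smul_eq_zero_iff_right two] at this
    rw [this, zero_add]; exact h4

/-- Wick's theorem: multiplication by a creation mode is a normally ordered product. -/
theorem isProd_gen_mul {b : Bool} {u : Fock N M} (y : Gen N M) (hu : IsHom b u) :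
    IsProd (sgn (y.isRight && b)) 0 (fun n => mode n (gen y)) (fun n => mode n u)
      (fun n => mode n (gen y * u)) := by
  intro v n
  obtain ⟨B, hB⟩ := exists_mode_gen_mul n y u v
  refine ⟨B, fun J hJ => ?_⟩
  simp only [pow_zero, Module.End.one_apply]
  rw [hB J hJ, hu.parityPow, smul_sum]
  congr 1
  · exact sum_congr rfl fun i _ => by rw [mode_gen_neg]
  · exact sum_congr rfl fun i _ => by rw [mode_gen_natCast, map_smul, LinearMap.smul_apply]

/-! #### Derivatives of the generating fields -/

theorem mode_transl_of_ann {y y' : Gen N M} {c : ℂ} (h : transl (gen y) = c • gen y')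
    (h0 : ∀ v, c • ann y' 0 v = 0)
    (hs : ∀ s v, c • ann y' (s + 1) v = -((s : ℂ) + 1) • ann y s v) (n : ℤ) (v : Fock N M) :
    mode n (transl (gen y)) v = -(n : ℂ) • mode (n - 1) (gen y) v := by
  rcases lt_trichotomy n 0 with hn | rfl | hn
  · obtain ⟨k, rfl⟩ : ∃ k : ℕ, n = -1 - k := ⟨(-1 - n).toNat, by omega⟩
    rw [h, map_smul, LinearMap.smul_apply, mode_gen_neg,
      show (-1 - (k : ℤ) - 1) = -1 - ((k + 1 : ℕ) : ℤ) by push_cast; ring, mode_gen_neg,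
      ← smul_mul_assoc, ← map_smul, ← h, Td_transl, transl_Td, smul_mul_assoc]
    push_cast
    congr 1
    ring
  · rw [h, map_smul, LinearMap.smul_apply]
    have := mode_gen_natCast 0 y' v
    rw [Nat.cast_zero] at this
    rw [this, h0]; simp
  · obtain ⟨k, rfl⟩ : ∃ k : ℕ, n = (k + 1 : ℕ) := ⟨n.toNat - 1, by omega⟩
    rw [h, map_smul, LinearMap.smul_apply, mode_gen_natCast, hs,
      show ((k + 1 : ℕ) : ℤ) - 1 = (k : ℕ) by push_cast; ring, mode_gen_natCast]
    push_cast
    rfl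

theorem choose_succ_smul (s k : ℕ) :
    ((k : ℂ) + 1) * ((s + 1).choose (k + 1) : ℕ) = ((s : ℂ) + 1) * (s.choose k : ℕ) := by
  have := Nat.add_one_mul_choose_eq s k
  have h := congrArg (Nat.cast (R := ℂ)) this
  push_cast at h
  rw [h]; ring

theorem mode_transl_gen (n : ℤ) (y : Gen N M) (v : Fock N M) :
    mode n (transl (gen y)) v = -(n : ℂ) • mode (n - 1) (gen y) v := by
  have key : ∀ (c c' : ℂ) (k s : ℕ) (D D' : Op N M) (v : Fock N M), c' = -c →
      (k ≤ s → D = D') →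
      ((k : ℂ) + 1) • (if k + 1 ≤ s + 1 then (c' * ((s + 1).choose (k + 1) : ℕ)) • D else 0) v
        = -((s : ℂ) + 1) • (if k ≤ s then (c * (s.choose k : ℕ)) • D' else 0) v := by
    rintro c _ k s D D' v rfl h
    by_cases hk : k ≤ s
    · rw [if_pos (by omega), if_pos hk, h hk, LinearMap.smul_apply, LinearMap.smul_apply, smul_smul,
        smul_smul]
      congr 1
      linear_combination -c * choose_succ_smul s k
    · rw [if_neg (by omega), if_neg hk]; simp
  have symm : ∀ (c : ℂ) (k s : ℕ) (D : Op N M),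
      (if k ≤ s then (c * (s.choose (s - k) : ℕ)) • D else 0)
        = if k ≤ s then (c * (s.choose k : ℕ)) • D else 0 := by
    intro c k s D
    split_ifs with hk
    · rw [Nat.choose_symm hk]
    · rfl
  have hpow : ∀ k : ℕ, (-1 : ℂ) ^ (k + 1) = -(-1) ^ k := fun k => by rw [pow_succ]; ring
  rcases y with (⟨i, k⟩ | ⟨i, k⟩) | (⟨j, k⟩ | ⟨j, k⟩)
  · refine mode_transl_of_ann (y := Sum.inl (BosGen.b i k)) (y' := Sum.inl (BosGen.b i (k + 1)))
      (transl_bos_b i k) (fun v => ?_) (fun s v => ?_) n v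
    · simp [ann]
    · have := key _ _ (k + 1) s (dA i (s + 1 - (k + 1 + 1))) (dA i (s - (k + 1))) v (hpow k)
        (fun h => by rw [show s + 1 - (k + 1 + 1) = s - (k + 1) by omega])
      rw [show (((k + 1 : ℕ) : ℂ) + 1) = k + 2 by push_cast; ring] at this
      exact this
  · refine mode_transl_of_ann (y := Sum.inl (BosGen.a i k)) (y' := Sum.inl (BosGen.a i (k + 1)))
      (transl_bos_a i k) (fun v => ?_) (fun s v => ?_) n v
    · simp [ann]
    · simp only [ann, symm]
      exact key _ _ k s _ _ v (hpow k)
        (fun h => by rw [show s + 1 - (k + 1) = s - k by omega])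
  · refine mode_transl_of_ann (y := Sum.inr (FerGen.phi j k)) (y' := Sum.inr (FerGen.phi j (k + 1)))
      (transl_fer_phi j k) (fun v => ?_) (fun s v => ?_) n v
    · simp [ann]
    · exact key _ _ k s _ _ v (hpow k)
        (fun h => by rw [show s + 1 - (k + 1) = s - k by omega])
  · refine mode_transl_of_ann (y := Sum.inr (FerGen.psi j k)) (y' := Sum.inr (FerGen.psi j (k + 1)))
      (transl_fer_psi j k) (fun v => ?_) (fun s v => ?_) n v
    · simp [ann]
    · simp only [ann, symm]
      exact key _ _ k s _ _ v (hpow k)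
        (fun h => by rw [show s + 1 - (k + 1) = s - k by omega])

/-! #### The modes of functions -/

theorem dA_mul (i : Fin N) (m : ℕ) (u v : Fock N M) :
    dA i m (u * v) = dA i m u * v + u * dA i m v := by
  refine induction (P := fun u => dA i m (u * v) = dA i m u * v + u * dA i m v)
    (fun f => ?_) (fun u w hu hw => ?_) (fun y u hu => ?_) (fun y u hu => ?_) u
  · rw [dA_fn_mul, dA_fn, zero_mul, zero_add]
  · simp only [add_mul, map_add, hu, hw]; abel
  · rw [mul_assoc, dA_bos_mul, hu, dA_bos_mul]
    split_ifs <;> simp only [add_mul, mul_add, mul_assoc, zero_mul] <;> abel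
  · rw [mul_assoc, dA_fer_mul, hu, dA_fer_mul]
    simp only [add_mul, mul_add, mul_assoc]

theorem dB_mul (i : Fin N) (m : ℕ) (u v : Fock N M) :
    dB i m (u * v) = dB i m u * v + u * dB i m v := by
  refine induction (P := fun u => dB i m (u * v) = dB i m u * v + u * dB i m v)
    (fun f => ?_) (fun u w hu hw => ?_) (fun y u hu => ?_) (fun y u hu => ?_) u
  · rcases m with _ | m
    · rw [dB_zero_fn_mul, dB_zero_fn, add_comm]
    · rw [dB_succ_fn_mul, dB_succ_fn, zero_mul, zero_add]
  · simp only [add_mul, map_add, hu, hw]; abel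
  · rcases m with _ | m
    · rw [mul_assoc, dB_zero_bos_mul, hu, dB_zero_bos_mul]
      simp only [add_mul, mul_add, mul_assoc]
    · rw [mul_assoc, dB_succ_bos_mul, hu, dB_succ_bos_mul]
      split_ifs <;> simp only [add_mul, mul_add, mul_assoc, zero_mul] <;> abel
  · rw [mul_assoc, dB_fer_mul, hu, dB_fer_mul]
    simp only [add_mul, mul_add, mul_assoc]

theorem dL_mul {u : Fock N M} (hu : parity u = u) (x : FerGen M) (v : Fock N M) :
    dL x (u * v) = dL x u * v + u * dL x v := by
  have key : ∀ u : Fock N M, dL x (u * v) = dL x u * v + parity u * dL x v := by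
    intro u
    refine induction (P := fun u : Fock N M => dL x (u * v) = dL x u * v + parity u * dL x v)
      (fun f => ?_) (fun u w hu hw => ?_) (fun y u hu => ?_) (fun y u hu => ?_) u
    · rw [dL_fn_mul, dL_fn, parity_fn, zero_mul, zero_add]
    · simp only [add_mul, map_add, hu, hw]; abel
    · rw [mul_assoc, dL_bos_mul, hu, dL_bos_mul, parity_mulBos_apply]
      simp only [add_mul, mul_add, mul_assoc]
    · rw [mul_assoc, dL_fer_mul, hu, dL_fer_mul, parity_mulFer_apply]
      split_ifs <;> simp only [add_mul, mul_add, mul_assoc, zero_mul, neg_mul, neg_add] <;> abel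
  rw [key, hu]

theorem dA_Td_fn (i : Fin N) (m : ℕ) (k : ℤ) (f : Ohat N) : dA i m (Td k (fn f : Fock N M)) = 0 := by
  rcases lt_or_ge k 0 with h | h
  · rw [Td_of_neg h]; simp
  · lift k to ℕ using h
    induction k generalizing m with
    | zero => simp [Td_zero, dA_fn]
    | succ k ih =>
      push_cast
      rw [Td_succ_apply, map_smul, dA_transl, ih, ih, map_zero, smul_zero, add_zero, smul_zero]

theorem dL_Td_fn (x : FerGen M) (k : ℤ) (f : Ohat N) : dL x (Td k (fn f : Fock N M)) = 0 := by
  rcases lt_or_ge k 0 with h | h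
  · rw [Td_of_neg h]; simp
  · lift k to ℕ using h
    induction k generalizing x with
    | zero => simp [Td_zero, dL_fn]
    | succ k ih =>
      push_cast
      rcases x with ⟨j, m⟩ | ⟨j, m⟩
      · rw [Td_succ_apply, map_smul, dL_phi_transl, ih, ih, map_zero, smul_zero, add_zero, smul_zero]
      · rw [Td_succ_apply, map_smul, dL_psi_transl, ih, ih, map_zero, smul_zero, add_zero, smul_zero]

theorem dB_Td_fn (i : Fin N) (m : ℕ) (k : ℤ) (f : Ohat N) :
    dB i m (Td k (fn f : Fock N M)) = Td (k - m) (fn (pd i f)) := by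
  rcases lt_or_ge k 0 with h | h
  · rw [Td_of_neg h, Td_of_neg (by omega)]; simp
  · lift k to ℕ using h
    induction k generalizing m with
    | zero =>
      rcases m with _ | m
      · simp [Td_zero, dB_zero_fn]
      · rw [Nat.cast_zero, Td_zero, Td_of_neg (by omega)]
        exact dB_succ_fn i m f
    | succ k ih =>
      have hk : ((k : ℂ) + 1) ≠ 0 := by exact_mod_cast Nat.succ_ne_zero k
      push_cast
      rw [Td_succ_apply, map_smul, dB_transl, ih, transl_Td, inv_smul_eq_iff₀ hk,
        show (k : ℤ) + 1 - m = k - m + 1 by ring]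
      rcases m with _ | m
      · simp
      · rw [ih, Nat.add_sub_cancel, show (k : ℤ) - m = k - ((m + 1 : ℕ) : ℤ) + 1 by push_cast; ring,
          ← add_smul]
        congr 1
        push_cast; ring

theorem mode_fn_dL (n : ℤ) (f : Ohat N) (x : FerGen M) (v : Fock N M) :
    dL x (mode n (fn f) v) = mode n (fn f) (dL x v) := by
  refine gen_induction (P := fun v : Fock N M => ∀ n f,
    dL x (mode n (fn f) v) = mode n (fn f) (dL x v))
    (fun f' n f => ?_) (fun u w hu hw n f => ?_) (fun y u hu n f => ?_) v n f
  · rw [mode_fn_of_dA n f (fun i m => dA_fn i m f'), dL_mul (by rw [parity_Td, parity_fn]), dL_fn,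
      dL_Td_fn]; simp
  · simp only [map_add, hu, hw]
  · rcases y with (⟨j, k⟩ | ⟨j, k⟩) | y
    · rw [mode_fn_gen_mul n f _ _ (by simp)]
      refine (dL_bos_mul x _ _).trans ?_
      refine Eq.trans ?_ (congrArg (mode n (fn f)) (dL_bos_mul x _ _)).symm
      rw [hu]
      exact (mode_fn_gen_mul n f (Sum.inl _) _ (by simp)).symm
    · have e1 := mode_fn_a_mul n f j k u
      refine (congrArg (dL x) e1).trans ?_
      refine Eq.trans ?_ (congrArg (mode n (fn f)) (dL_bos_mul x _ _)).symm
      rw [map_sub, dL_bos_mul, mode_fn_a_mul, hu, hu]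
    · rw [mode_fn_gen_mul n f _ _ (by simp)]
      refine (dL_fer_mul x _ _).trans ?_
      refine Eq.trans ?_ (congrArg (mode n (fn f)) (dL_fer_mul x _ _)).symm
      rw [hu, map_add, map_neg]
      have e1 := mode_fn_gen_mul n f (Sum.inr y) (dL x u) (by simp)
      refine congrArg₂ _ (congrArg _ e1.symm) ?_
      split_ifs <;> simp

theorem mode_fn_dB (n : ℤ) (f : Ohat N) (i : Fin N) (m : ℕ) (v : Fock N M) :
    dB i m (mode n (fn f) v) = mode n (fn f) (dB i m v) + mode (m + n) (fn (pd i f)) v := by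
  refine gen_induction (P := fun v : Fock N M => ∀ n f,
    dB i m (mode n (fn f) v) = mode n (fn f) (dB i m v) + mode (m + n) (fn (pd i f)) v)
    (fun f' n f => ?_) (fun u w hu hw n f => ?_) (fun y u hu n f => ?_) v n f
  · have h : ∀ j l, dA j l (dB i m (fn f' : Fock N M)) = 0 := fun j l => by
      rcases m with _ | m
      · rw [dB_zero_fn, dA_fn]
      · rw [dB_succ_fn, map_zero]
    rw [mode_fn_of_dA n f (fun i m => dA_fn i m f'), mode_fn_of_dA n f h,
      mode_fn_of_dA _ _ (fun i m => dA_fn i m f'), dB_mul, dB_Td_fn, add_comm,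
      show -n - 1 - (m : ℤ) = -(m + n) - 1 by ring]
  · simp only [map_add, hu, hw]; abel
  · have hbos : ∀ y : BosGen N, ∃ c : ℂ, ∀ u : Fock N M, dB i m (bos y * u) = bos y * dB i m u + c • u := by
      intro y
      rcases m with _ | m
      · exact ⟨0, fun u => by rw [dB_zero_bos_mul, zero_smul, add_zero]⟩
      · by_cases hy : y = BosGen.b i m
        · exact ⟨1, fun u => by rw [dB_succ_bos_mul, if_pos hy, one_smul]⟩
        · exact ⟨0, fun u => by rw [dB_succ_bos_mul, if_neg hy, zero_smul]⟩
    rcases y with y | y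
    · obtain ⟨c, hc⟩ := hbos y
      have e2 := congrArg (mode n (fn f)) (hc u)
      rw [map_add, map_smul] at e2
      rcases y with ⟨j, k⟩ | ⟨j, k⟩
      · rw [mode_fn_gen_mul n f _ _ (by simp), mode_fn_gen_mul _ _ _ _ (by simp)]
        refine (hc _).trans ?_
        refine Eq.trans ?_ (congrArg (· + _) e2).symm
        have e1 := mode_fn_gen_mul n f (Sum.inl (BosGen.b j k)) (dB i m u) (by simp)
        have e3 : mode n (fn f) (bos (BosGen.b j k) * dB i m u) = bos (BosGen.b j k) * _ := e1
        rw [e3, hu, mul_add]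
        simp only [gen, Sum.elim_inl]
        abel
      · have e1 := mode_fn_a_mul n f j k u
        refine (congrArg (dB i m) e1).trans ?_
        refine Eq.trans ?_ (congrArg₂ (· + ·) e2 (mode_fn_a_mul _ _ j k u)).symm
        rw [map_sub, hc, mode_fn_a_mul, hu, hu, mul_add, pd_comm j i, 
          show (m : ℤ) + (n - k - 1) = m + n - k - 1 by ring]
        abel
    · rw [mode_fn_gen_mul n f _ _ (by simp), mode_fn_gen_mul _ _ _ _ (by simp)]
      refine (dB_fer_mul i m _ _).trans ?_
      refine Eq.trans ?_ (congrArg (fun w => mode n (fn f) w + _) (dB_fer_mul i m _ _)).symm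
      have e3 : mode n (fn f) (fer y * dB i m u) = fer y * _ :=
        mode_fn_gen_mul n f (Sum.inr y) (dB i m u) (by simp)
      rw [hu, mul_add, e3]
      rfl

theorem mul_comm_of_parity {u : Fock N M} (h : parity u = u) (v : Fock N M) : u * v = v * u := by
  refine gen_induction (P := fun v => u * v = v * u) (fun f => (fn_mul_comm f u).symm)
    (fun v w hv hw => by rw [mul_add, add_mul, hv, hw]) (fun y v hv => ?_) v
  rw [← mul_assoc, mul_gen_of_parity h, mul_assoc, hv, mul_assoc]

theorem commute_mode_fn (m n : ℤ) (f f' : Ohat N) (v : Fock N M) :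
    mode m (fn f) (mode n (fn f') v) = mode n (fn f') (mode m (fn f) v) := by
  refine gen_induction (P := fun v : Fock N M => ∀ m n f f',
    mode m (fn f) (mode n (fn f') v) = mode n (fn f') (mode m (fn f) v))
    (fun f₀ m n f f' => ?_) (fun u w hu hw m n f f' => ?_) (fun y u hu m n f f' => ?_) v m n f f'
  · have h : ∀ (k : ℤ) (f : Ohat N) i m, dA i m (Td k (fn f) * fn f₀ : Fock N M) = 0 := by
      intro k f i m
      rw [dA_mul, dA_Td_fn, dA_fn]; simp
    rw [mode_fn_of_dA n f' (fun i m => dA_fn i m f₀), mode_fn_of_dA m f (fun i m => dA_fn i m f₀),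
      mode_fn_of_dA _ _ (h _ _), mode_fn_of_dA _ _ (h _ _), ← mul_assoc, ← mul_assoc]
    rw [mul_comm_of_parity (by rw [parity_Td, parity_fn]) (Td (-n - 1) (fn f'))]
  · simp only [map_add, hu, hw]
  · by_cases hy : ∀ i k, y ≠ Sum.inl (BosGen.a i k)
    · rw [mode_fn_gen_mul n f' y u hy, mode_fn_gen_mul m f y _ hy, mode_fn_gen_mul m f y u hy,
        mode_fn_gen_mul n f' y _ hy, hu]
    · push Not at hy
      obtain ⟨i, k, rfl⟩ := hy
      have e : ∀ n (f : Ohat N) (w : Fock N M), mode n (fn f) (gen (Sum.inl (BosGen.a i k)) * w)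
          = gen (Sum.inl (BosGen.a i k)) * mode n (fn f) w - mode (n - k - 1) (fn (pd i f)) w :=
        fun n f w => mode_fn_a_mul n f i k w
      rw [e, e, map_sub, map_sub, e, e, hu m n, hu m (n - k - 1), hu (m - k - 1) n]
      abel

theorem mode_coord (n : ℤ) (i : Fin N) (v : Fock N M) :
    mode n (fn (coord i)) v
      = Td (-n - 1) (fn (coord i)) * v - if 0 ≤ n then dA i n.toNat v else 0 := by
  refine gen_induction (P := fun v => mode n (fn (coord i)) v
      = Td (-n - 1) (fn (coord i)) * v - if 0 ≤ n then dA i n.toNat v else 0)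
    (fun f => ?_) (fun u w hu hw => ?_) (fun y u hu => ?_) v
  · rw [mode_fn_of_dA n _ (fun i m => dA_fn i m f), dA_fn]; simp
  · simp only [map_add, hu, hw, mul_add]; split_ifs <;> abel
  · have hcomm : ∀ y : Gen N M, Td (-n - 1) (fn (coord i)) * gen y
        = gen y * Td (-n - 1) (fn (coord i) : Fock N M) := fun y =>
      mul_gen_of_parity (by rw [parity_Td, parity_fn]) y
    rcases y with (⟨j, k⟩ | ⟨j, k⟩) | y
    · rw [mode_fn_gen_mul n _ _ _ (by simp), hu, mul_sub, ← mul_assoc, ← mul_assoc, hcomm]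
      congr 1
      split_ifs
      · refine Eq.trans ?_ (dA_bos_mul i _ _ _).symm
        rw [if_neg (by simp), add_zero]; rfl
      · exact mul_zero _
    · refine (mode_fn_a_mul n _ j k u).trans ?_
      have e : pd j (coord i) = if j = i then 1 else 0 := by
        rw [pd_coord, Matrix.one_apply]
      have e2 : mode (n - k - 1) (fn (pd j (coord i))) u
          = if 0 ≤ n ∧ BosGen.a j k = BosGen.a i n.toNat then u else 0 := by
        rw [e]
        by_cases hj : j = i
        · rw [if_pos hj, fn_one, mode_one, hj]
          by_cases hn : n = k
          · rw [if_pos (by omega), if_pos (by subst hn; simp)]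
          · rw [if_neg (by omega), if_neg]
            rintro ⟨h1, h2⟩
            injection h2 with _ h3
            omega
        · rw [if_neg hj, fn_zero, map_zero, if_neg]
          · rfl
          · rintro ⟨_, h2⟩
            injection h2 with h3
            exact hj h3
      have hc := hcomm (Sum.inl (BosGen.a j k))
      have hc' : Td (-n - 1) (fn (coord i)) * bos (BosGen.a j k)
        = bos (BosGen.a j k) * Td (-n - 1) (fn (coord i) : Fock N M) := hc
      rw [e2, hu, mul_sub, ← mul_assoc, ← hc', mul_assoc]
      have e3 : ∀ w : Fock N M, gen (Sum.inl (BosGen.a j k)) * w = bos (BosGen.a j k) * w := fun _ => rfl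
      rw [e3]
      by_cases h0 : 0 ≤ n
      · simp only [h0, true_and, if_true]
        rw [dA_bos_mul]
        abel
      · simp [h0]
    · rw [mode_fn_gen_mul n _ _ _ (by simp), hu, mul_sub, ← mul_assoc, ← mul_assoc, hcomm]
      congr 1
      split_ifs
      · exact (dA_fer_mul i _ _ _).symm
      · exact mul_zero _

/-! #### Translation covariance, parity and locality of all fields -/

/-- Induction over the creation modes. -/
theorem gen_rec {P : Gen N M → Prop} (ha : ∀ i, P (Sum.inl (BosGen.a i 0)))
    (hb : ∀ i, P (Sum.inl (BosGen.b i 0))) (hphi : ∀ j, P (Sum.inr (FerGen.phi j 0)))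
    (hpsi : ∀ j, P (Sum.inr (FerGen.psi j 0)))
    (hT : ∀ (y y' : Gen N M) (c : ℂ), c ≠ 0 → y'.isRight = y.isRight →
      transl (gen y) = c • gen y' → P y → P y') (y : Gen N M) : P y := by
  have h1 : ∀ k : ℕ, (k : ℂ) + 1 ≠ 0 := fun k => by exact_mod_cast Nat.succ_ne_zero k
  have h2 : ∀ k : ℕ, (k : ℂ) + 2 ≠ 0 := fun k => by exact_mod_cast (show k + 2 ≠ 0 by omega)
  rcases y with (⟨i, k⟩ | ⟨i, k⟩) | (⟨j, k⟩ | ⟨j, k⟩)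
  · induction k with
    | zero => exact hb i
    | succ k ih => exact hT (Sum.inl (BosGen.b i k)) _ _ (h2 k) rfl (transl_bos_b i k) ih
  · induction k with
    | zero => exact ha i
    | succ k ih => exact hT (Sum.inl (BosGen.a i k)) _ _ (h1 k) rfl (transl_bos_a i k) ih
  · induction k with
    | zero => exact hphi j
    | succ k ih => exact hT (Sum.inr (FerGen.phi j k)) _ _ (h1 k) rfl (transl_fer_phi j k) ih
  · induction k with
    | zero => exact hpsi j
    | succ k ih => exact hT (Sum.inr (FerGen.psi j k)) _ _ (h1 k) rfl (transl_fer_psi j k) ih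

theorem int_cases (n : ℤ) : (∃ k : ℕ, n = -1 - k) ∨ ∃ k : ℕ, n = k := by
  rcases lt_or_ge n 0 with h | h
  · exact Or.inl ⟨(-1 - n).toNat, by omega⟩
  · exact Or.inr ⟨n.toNat, by omega⟩

theorem mode_a_natCast (s : ℕ) (i : Fin N) (v : Fock N M) : mode s (a i) v = dB i s v := by
  have := mode_gen_natCast s (Sum.inl (BosGen.a i 0)) v
  refine this.trans ?_
  simp [ann]
theorem mode_phi_natCast (s : ℕ) (j : Fin M) (v : Fock N M) :
    mode s (phi j) v = dL (FerGen.psi j s) v := by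
  have := mode_gen_natCast s (Sum.inr (FerGen.phi j 0)) v
  refine this.trans ?_
  simp [ann]
theorem mode_psi_natCast (s : ℕ) (j : Fin M) (v : Fock N M) :
    mode s (psi j) v = dL (FerGen.phi j s) v := by
  have := mode_gen_natCast s (Sum.inr (FerGen.psi j 0)) v
  refine this.trans ?_
  simp [ann]
theorem mode_a_neg (k : ℕ) (i : Fin N) (v : Fock N M) :
    mode (-1 - k) (a i) v = bos (BosGen.a i k) * v := by
  rw [← Td_a]; exact mode_gen_neg k (Sum.inl (BosGen.a i 0)) v
theorem mode_phi_neg (k : ℕ) (j : Fin M) (v : Fock N M) :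
    mode (-1 - k) (phi j) v = fer (FerGen.phi j k) * v := by
  rw [← Td_phi]; exact mode_gen_neg k (Sum.inr (FerGen.phi j 0)) v
theorem mode_psi_neg (k : ℕ) (j : Fin M) (v : Fock N M) :
    mode (-1 - k) (psi j) v = fer (FerGen.psi j k) * v := by
  rw [← Td_psi]; exact mode_gen_neg k (Sum.inr (FerGen.psi j 0)) v

theorem mode_b' (n : ℤ) (i : Fin N) (v : Fock N M) :
    mode n (b' i) v = -(n : ℂ) • mode (n - 1) (fn (coord i)) v := by
  rw [mode_coord]
  rcases int_cases n with ⟨k, rfl⟩ | ⟨k, rfl⟩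
  · have := mode_gen_neg k (Sum.inl (BosGen.b i 0)) v
    refine this.trans ?_
    rw [if_neg (by omega), sub_zero, ← smul_mul_assoc]
    congr 1
    have h : (gen (Sum.inl (BosGen.b i 0)) : Fock N M) = transl (fn (coord i)) := (transl_coord i).symm
    rw [h, Td_transl, transl_Td, show -(-1 - (k : ℤ) - 1) - 1 = k + 1 by ring]
    congr 1
    push_cast; ring
  · have := mode_gen_natCast k (Sum.inl (BosGen.b i 0)) v
    refine this.trans ?_
    rcases k with _ | k
    · simp [ann]
    · rw [if_pos (by omega), Td_of_neg (by omega), LinearMap.zero_apply, zero_mul, zero_sub]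
      simp only [ann, Nat.cast_succ, add_sub_cancel_right, Int.toNat_natCast, smul_neg, neg_smul,
        neg_neg]
      simp

/-- Translation covariance. -/
def TCov (u : Fock N M) : Prop :=
  ∀ n v, transl (mode n u v) = mode n u (transl v) - (n : ℂ) • mode (n - 1) u v

theorem TCov.smul {u : Fock N M} (h : TCov u) (c : ℂ) : TCov (c • u) := fun n v => by
  simp only [map_smul, LinearMap.smul_apply, h n v, smul_sub, smul_comm c]

theorem TCov.transl {u : Fock N M} (h : TCov u)
    (h' : ∀ n v, mode n (transl u) v = -(n : ℂ) • mode (n - 1) u v) : TCov (transl u) := fun n v => by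
  rw [h', h', h', map_smul, h, smul_sub, smul_smul, smul_smul]
  congr 2
  push_cast; ring

theorem transl_gen (y : Gen N M) : ∃ (c : ℂ) (y' : Gen N M), transl (gen y) = c • gen y' ∧
    ((∀ i k, y ≠ Sum.inl (BosGen.a i k)) → ∀ i k, y' ≠ Sum.inl (BosGen.a i k)) := by
  rcases y with (⟨i, k⟩ | ⟨i, k⟩) | (⟨j, k⟩ | ⟨j, k⟩)
  · exact ⟨_, Sum.inl (BosGen.b i (k + 1)), transl_bos_b i k, by simp⟩
  · exact ⟨_, Sum.inl (BosGen.a i (k + 1)), transl_bos_a i k, fun h => absurd rfl (h i k)⟩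
  · exact ⟨_, Sum.inr (FerGen.phi j (k + 1)), transl_fer_phi j k, by simp⟩
  · exact ⟨_, Sum.inr (FerGen.psi j (k + 1)), transl_fer_psi j k, by simp⟩

theorem tCov_fn (f : Ohat N) : TCov (fn f : Fock N M) := by
  intro n v
  refine gen_induction (P := fun v : Fock N M => ∀ n f, transl (mode n (fn f) v)
      = mode n (fn f) (transl v) - (n : ℂ) • mode (n - 1) (fn f) v)
    (fun f' n f => ?_) (fun u w hu hw n f => ?_) (fun y u hu n f => ?_) v n f
  · have h : ∀ i m, dA i m (transl (fn f' : Fock N M)) = 0 := fun i m => by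
      rw [← Td_one_apply, dA_Td_fn]
    rw [mode_fn_of_dA n f (fun i m => dA_fn i m f'), mode_fn_of_dA _ f (fun i m => dA_fn i m f'),
      mode_fn_of_dA _ f h, transl_mul, transl_Td, smul_mul_assoc,
      show -(n - 1) - 1 = -n - 1 + 1 by ring, show (((-n - 1 : ℤ) : ℂ) + 1) = -n by push_cast; ring,
      neg_smul]
    abel
  · simp only [map_add, hu, hw, smul_add]; abel
  · by_cases hy : ∀ i k, y ≠ Sum.inl (BosGen.a i k)
    · obtain ⟨c, y', h1, h2⟩ := transl_gen y
      rw [mode_fn_gen_mul _ _ _ _ hy, transl_mul, hu, transl_mul, map_add, h1, smul_mul_assoc,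
        smul_mul_assoc, map_smul, mode_fn_gen_mul _ _ _ _ (h2 hy), mode_fn_gen_mul _ _ _ _ hy,
        mode_fn_gen_mul _ _ _ _ hy, mul_sub, mul_smul_comm]
      abel
    · push Not at hy
      obtain ⟨i, k, rfl⟩ := hy
      have e : ∀ n (f : Ohat N) (w : Fock N M), mode n (fn f) (gen (Sum.inl (BosGen.a i k)) * w)
          = gen (Sum.inl (BosGen.a i k)) * mode n (fn f) w - mode (n - k - 1) (fn (pd i f)) w :=
        fun n f w => mode_fn_a_mul n f i k w
      have h1 : transl (gen (Sum.inl (BosGen.a i k)) : Fock N M)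
        = ((k : ℂ) + 1) • bos (BosGen.a i (k + 1)) := transl_bos_a i k
      rw [e, map_sub, transl_mul, hu, transl_mul, map_add, h1, smul_mul_assoc, smul_mul_assoc,
        map_smul, mode_fn_a_mul, e, e, hu, mul_sub, mul_smul_comm,
        show n - ((k + 1 : ℕ) : ℤ) - 1 = n - k - 1 - 1 by push_cast; ring,
        show n - 1 - (k : ℤ) - 1 = n - k - 1 - 1 by ring]
      push_cast
      simp only [smul_sub, sub_smul, add_smul, one_smul]
      abel

theorem tCov_of {w : Fock N M} (x : ℕ → Fock N M) (D : ℕ → Op N M)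
    (hx : ∀ (k : ℕ) v, mode (-1 - k) w v = x k * v) (hD : ∀ (k : ℕ) v, mode k w v = D k v)
    (hx' : ∀ k : ℕ, transl (x k) = ((k : ℂ) + 1) • x (k + 1))
    (hD' : ∀ (k : ℕ) v, D k (transl v) = transl (D k v) + (k : ℂ) • D (k - 1) v) : TCov w := by
  intro n v
  rcases int_cases n with ⟨k, rfl⟩ | ⟨k, rfl⟩
  · rw [hx, hx, transl_mul, hx', smul_mul_assoc,
      show (-1 - (k : ℤ) - 1) = -1 - ((k + 1 : ℕ) : ℤ) by push_cast; ring, hx,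
      sub_eq_add_neg, ← neg_smul, add_comm]
    congr 2
    push_cast; ring
  · rw [hD, hD, hD']
    rcases k with _ | k
    · simp
    · rw [show (((k + 1 : ℕ) : ℤ) - 1) = (k : ℕ) by push_cast; ring, hD]
      simp

theorem tCov_gen (y : Gen N M) : TCov (gen y) := by
  refine gen_rec (P := fun y => TCov (gen y)) (fun i => ?_) (fun i => ?_) (fun j => ?_) (fun j => ?_)
    (fun y y' c hc _ h1 h2 => ?_) y
  · exact tCov_of (w := a i) (fun k => bos (BosGen.a i k)) (dB i) (mode_a_neg · i) (mode_a_natCast · i)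
      (transl_bos_a i) (dB_transl i)
  · have h : (gen (Sum.inl (BosGen.b i 0)) : Fock N M) = transl (fn (coord i)) := (transl_coord i).symm
    rw [h]
    refine (tCov_fn _).transl fun n v => ?_
    rw [transl_coord, mode_b']
  · exact tCov_of (w := phi j) (fun k => fer (FerGen.phi j k)) (fun k => dL (FerGen.psi j k))
      (mode_phi_neg · j) (mode_phi_natCast · j) (transl_fer_phi j) (dL_psi_transl j)
  · exact tCov_of (w := psi j) (fun k => fer (FerGen.psi j k)) (fun k => dL (FerGen.phi j k))
      (mode_psi_neg · j) (mode_psi_natCast · j) (transl_fer_psi j) (dL_phi_transl j)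
  · have h3 : (gen y' : Fock N M) = c⁻¹ • transl (gen y) := by
      rw [h1, smul_smul, inv_mul_cancel₀ hc, one_smul]
    rw [h3]
    exact (h2.transl fun n v => mode_transl_gen n y v).smul _

end Fock

section

variable {V W : Type*} [AddCommGroup V] [Module ℂ V] [AddCommGroup W] [Module ℂ W]

/-- The normally ordered product of translation covariant fields is translation covariant. -/
theorem IsProd.translation {s : ℂ} {A B D : ℤ → Module.End ℂ V} {T : V →ₗ[ℂ] V}
    (hFA : IsField A) (hFB : IsField B)
    (hA : ∀ n v, T (A n v) = A n (T v) - (n : ℂ) • A (n - 1) v)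
    (hB : ∀ n v, T (B n v) = B n (T v) - (n : ℂ) • B (n - 1) v) (hD : IsProd s 0 A B D)
    (n : ℤ) (v : V) : T (D n v) = D n (T v) - (n : ℂ) • D (n - 1) v := by
  obtain ⟨J1, h1⟩ := hD v n
  obtain ⟨J2, h2⟩ := hD (T v) n
  obtain ⟨J3, h3⟩ := hD v (n - 1)
  obtain ⟨r1, k1⟩ := hFA v
  obtain ⟨r2, k2⟩ := hFB v
  set J := J1 + J2 + J3 + r1.natAbs + r2.natAbs + n.natAbs + 2 with hJ
  simp only [pow_zero, Module.End.one_apply] at h1 h2 h3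
  rw [h1 J (by omega), h2 J (by omega), h3 J (by omega)]
  have e1 : ∀ K : ℕ, T (∑ j ∈ Finset.range K, A (-1 - j) (B (n + j) v))
      = ∑ j ∈ Finset.range K, A (-1 - j) (B (n + j) (T v))
        - (n : ℂ) • ∑ j ∈ Finset.range K, A (-1 - j) (B (n - 1 + j) v)
        + (K : ℂ) • A (-1 - K) (B (n - 1 + K) v) := by
    intro K
    induction K with
    | zero => simp
    | succ K ih =>
      rw [sum_range_succ, map_add, ih, sum_range_succ, sum_range_succ, hA, hB,
        show (-1 - (K : ℤ) - 1) = -1 - ((K + 1 : ℕ) : ℤ) by push_cast; ring,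
        show n + (K : ℤ) = n - 1 + ((K + 1 : ℕ) : ℤ) by push_cast; ring,
        show n - 1 + ((K + 1 : ℕ) : ℤ) - 1 = n - 1 + K by push_cast; ring]
      push_cast
      simp only [map_sub, map_add, map_smul, smul_add, add_smul, sub_smul, one_smul, neg_smul]
      abel
  have e2 : ∀ K : ℕ, T (∑ j ∈ Finset.range K, B (n - 1 - j) (A j v))
      = ∑ j ∈ Finset.range K, B (n - 1 - j) (A j (T v))
        - (n : ℂ) • ∑ j ∈ Finset.range K, B (n - 1 - 1 - j) (A j v)
        + (K : ℂ) • B (n - 1 - K) (A (K - 1) v) := by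
    intro K
    induction K with
    | zero => simp
    | succ K ih =>
      rw [sum_range_succ, map_add, ih, sum_range_succ, sum_range_succ, hB, hA,
        show n - 1 - ((K + 1 : ℕ) : ℤ) = n - 1 - 1 - K by push_cast; ring,
        show n - 1 - (K : ℤ) - 1 = n - 1 - 1 - K by ring,
        show ((K + 1 : ℕ) : ℤ) - 1 = K by push_cast; ring]
      push_cast
      simp only [map_sub, map_add, map_smul, smul_add, add_smul, sub_smul, one_smul, neg_smul]
      abel
  rw [map_add, map_smul, e1, e2, k2 (n - 1 + J) (by omega), k1 (J - 1) (by omega)]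
  simp only [map_zero, smul_zero, add_zero, smul_add, smul_sub, smul_comm s (n : ℂ)]
  abel

/-- Maps that intertwine fields intertwine their products. -/
theorem IsProd.intertwine {s ε δ : ℂ} {A B D : ℤ → Module.End ℂ V} {A' B' D' : ℤ → Module.End ℂ W}
    {S : V →ₗ[ℂ] W} (hA : ∀ n v, S (A n v) = ε • A' n (S v)) (hB : ∀ n v, S (B n v) = δ • B' n (S v))
    (hD : IsProd s 0 A B D) (hD' : IsProd s 0 A' B' D') (n : ℤ) (v : V) :
    S (D n v) = (ε * δ) • D' n (S v) := by
  obtain ⟨J1, h1⟩ := hD v n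
  obtain ⟨J2, h2⟩ := hD' (S v) n
  simp only [pow_zero, Module.End.one_apply] at h1 h2
  rw [h1 _ (le_max_left J1 J2), h2 _ (le_max_right J1 J2)]
  simp only [map_add, map_sum, map_smul, hA, hB, smul_add, smul_sum, smul_smul]
  congr 1
  refine sum_congr rfl fun j _ => ?_
  congr 1; ring

end

namespace Fock

variable {N M : ℕ}

theorem tCov_of_isHom {b : Bool} {u : Fock N M} (hu : IsHom b u) : TCov u := by
  refine hom_induction (P := fun _ u => TCov u) tCov_fn ?_ (fun b u v hu hv n w => ?_)
    (fun b y u hu h => ?_) hu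
  · intro n v; simp
  · simp only [map_add, LinearMap.add_apply, hu n w, hv n w, smul_add]; abel
  · exact (isProd_gen_mul y hu).translation (isField_mode _) (isField_mode _) (tCov_gen y) h

theorem parity_dB (i : Fin N) (m : ℕ) (v : Fock N M) : parity (dB i m v) = dB i m (parity v) := by
  rcases m with _ | m
  · exact congrArg (fun D => D v) (onFer_commute_dB (N := N) (M := M) _ i 0).eq
  · exact congrArg (fun D => D v) (onFer_commute_dB (N := N) (M := M) _ i (m + 1)).eq

theorem parity_dL_apply (x : FerGen M) (v : Fock N M) : parity (dL x v) = -dL x (parity v) :=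
  congrArg (fun D => D v) (parity_dL (N := N) x)

theorem parity_mode_fn (n : ℤ) (f : Ohat N) (v : Fock N M) :
    parity (mode n (fn f) v) = mode n (fn f) (parity v) := by
  refine gen_induction (P := fun v : Fock N M => ∀ n f, parity (mode n (fn f) v)
      = mode n (fn f) (parity v))
    (fun f' n f => ?_) (fun u w hu hw n f => ?_) (fun y u hu n f => ?_) v n f
  · rw [mode_fn_of_dA n f (fun i m => dA_fn i m f'), parity_mul, parity_Td, parity_fn, parity_fn,
      mode_fn_of_dA n f (fun i m => dA_fn i m f')]
  · simp only [map_add, hu, hw]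
  · by_cases hy : ∀ i k, y ≠ Sum.inl (BosGen.a i k)
    · rw [mode_fn_gen_mul _ _ _ _ hy, parity_mul, parity_mul, isHom_gen y, smul_mul_assoc,
        smul_mul_assoc, map_smul, mode_fn_gen_mul _ _ _ _ hy, hu]
    · push Not at hy
      obtain ⟨i, k, rfl⟩ := hy
      have e : ∀ n (f : Ohat N) (w : Fock N M), mode n (fn f) (gen (Sum.inl (BosGen.a i k)) * w)
          = gen (Sum.inl (BosGen.a i k)) * mode n (fn f) w - mode (n - k - 1) (fn (pd i f)) w :=
        fun n f w => mode_fn_a_mul n f i k w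
      have e2 : ∀ w : Fock N M, parity (gen (Sum.inl (BosGen.a i k)) * w)
          = gen (Sum.inl (BosGen.a i k)) * parity w := fun w => parity_mulBos_apply _ w
      rw [e, map_sub, e2, e2, e, hu, hu]

theorem parity_mode_gen (n : ℤ) (y : Gen N M) (v : Fock N M) :
    parity (mode n (gen y) v) = sgn y.isRight • mode n (gen y) (parity v) := by
  refine gen_rec (P := fun y => ∀ n v, parity (mode n (gen y) v)
    = sgn y.isRight • mode n (gen y) (parity v)) (fun i n v => ?_) (fun i n v => ?_)
    (fun j n v => ?_) (fun j n v => ?_) (fun y y' c hc hp h1 h2 n v => ?_) y n v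
  · simp only [Sum.isRight_inl, sgn, Bool.false_eq_true, if_false, one_smul]
    change parity (mode n (a i) v) = mode n (a i) _
    rcases int_cases n with ⟨k, rfl⟩ | ⟨k, rfl⟩
    · rw [mode_a_neg, mode_a_neg, parity_mulBos_apply]
    · rw [mode_a_natCast, mode_a_natCast, parity_dB]
  · simp only [Sum.isRight_inl, sgn, Bool.false_eq_true, if_false, one_smul]
    change parity (mode n (b' i) v) = mode n (b' i) _
    rw [mode_b', mode_b', map_smul, parity_mode_fn]
  · simp only [Sum.isRight_inr, sgn, if_true, neg_smul, one_smul]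
    change parity (mode n (phi j) v) = -mode n (phi j) _
    rcases int_cases n with ⟨k, rfl⟩ | ⟨k, rfl⟩
    · rw [mode_phi_neg, mode_phi_neg, parity_mulFer_apply]
    · rw [mode_phi_natCast, mode_phi_natCast, parity_dL_apply]
  · simp only [Sum.isRight_inr, sgn, if_true, neg_smul, one_smul]
    change parity (mode n (psi j) v) = -mode n (psi j) _
    rcases int_cases n with ⟨k, rfl⟩ | ⟨k, rfl⟩
    · rw [mode_psi_neg, mode_psi_neg, parity_mulFer_apply]
    · rw [mode_psi_natCast, mode_psi_natCast, parity_dL_apply]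
  · have h3 : (gen y' : Fock N M) = c⁻¹ • transl (gen y) := by
      rw [h1, smul_smul, inv_mul_cancel₀ hc, one_smul]
    rw [h3, map_smul, LinearMap.smul_apply, LinearMap.smul_apply, mode_transl_gen, mode_transl_gen,
      map_smul, map_smul, h2, hp, smul_comm (sgn _), smul_comm (sgn _)]

theorem IsHom.parity_mode {b : Bool} {u : Fock N M} (hu : IsHom b u) (n : ℤ) (v : Fock N M) :
    parity (mode n u v) = sgn b • mode n u (parity v) := by
  refine hom_induction (P := fun b u => ∀ n v, parity (mode n u v) = sgn b • mode n u (parity v))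
    (fun f n v => ?_) (fun n v => by simp) (fun b u w hu hw n v => ?_)
    (fun b y u hu h n v => ?_) hu n v
  · rw [parity_mode_fn]; simp [sgn]
  · simp only [map_add, LinearMap.add_apply, hu, hw, smul_add]
  · rw [sgn_xor]
    exact (isProd_gen_mul y hu).intertwine (fun n v => parity_mode_gen n y v) h (isProd_gen_mul y hu) n v

theorem IsHom.mode {b c : Bool} {u v : Fock N M} (hu : IsHom b u) (hv : IsHom c v) (n : ℤ) :
    IsHom (b ^^ c) (mode n u v) := by
  rw [IsHom, hu.parity_mode, hv, map_smul, smul_smul, sgn_xor]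

/-- Mutual locality of the fields of two states, of the indicated parities. -/
def Loc (b : Bool) (u : Fock N M) (c : Bool) (w : Fock N M) : Prop :=
  IsLocal (sgn (b && c)) (fun n => mode n u) (fun n => mode n w)

theorem Loc.symm {b c : Bool} {u w : Fock N M} (h : Loc b u c w) : Loc c w b u := by
  unfold Loc
  rw [Bool.and_comm]
  exact IsLocal.symm (sgn_mul_self _) h

theorem Loc.gen_mul {b c : Bool} {y : Gen N M} {u w : Fock N M} (hu : IsHom b u)
    (hy : Loc y.isRight (gen y) b u) (h1 : Loc y.isRight (gen y) c w) (h2 : Loc b u c w) :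
    Loc (y.isRight ^^ b) (gen y * u) c w := by
  unfold Loc
  rw [← sgn_xor_and]
  exact (isProd_gen_mul y hu).isLocal (isField_mode _) (isField_mode _) hy h1 h2

theorem loc_gen {c : Bool} {w : Fock N M} (ha : ∀ i, Loc false (a i) c w)
    (hf : ∀ f, Loc false (fn f) c w) (hphi : ∀ j, Loc true (phi j) c w)
    (hpsi : ∀ j, Loc true (psi j) c w) (y : Gen N M) : Loc y.isRight (gen y) c w := by
  refine gen_rec (P := fun y => Loc y.isRight (gen y) c w) ha (fun i => ?_) hphi hpsi
    (fun y y' r hr hp h1 h2 => ?_) y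
  · have e : (fun n => mode n ((gen (Sum.inl (BosGen.b i 0)) : Fock N M)))
        = fun n : ℤ => -(n : ℂ) • mode (n - 1) (fn (coord i)) := by
      funext n
      exact LinearMap.ext fun v => mode_b' n i v
    unfold Loc
    rw [e]
    exact IsLocal.deriv (A := fun n => mode n (fn (coord i))) (hf (coord i))
  · have e : (fun n => mode n ((gen y' : Fock N M)))
        = fun n : ℤ => r⁻¹ • (-(n : ℂ) • mode (n - 1) (gen y)) := by
      funext n
      have h3 : (gen y' : Fock N M) = r⁻¹ • transl (gen y) := by
        rw [h1, smul_smul, inv_mul_cancel₀ hr, one_smul]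
      rw [h3, map_smul]
      congr 1
      exact LinearMap.ext fun v => mode_transl_gen n y v
    unfold Loc
    rw [e, hp]
    exact (IsLocal.deriv (A := fun n => mode n (gen y)) h2).smul r⁻¹

/-- The states that generate the vertex algebra, with their parities. -/
inductive IsBase : Bool → Fock N M → Prop
  | fn (f : Ohat N) : IsBase false (fn f)
  | a (i : Fin N) : IsBase false (a i)
  | phi (j : Fin M) : IsBase true (phi j)
  | psi (j : Fin M) : IsBase true (psi j)

theorem dB_commute_bos_a (i j : Fin N) (m k : ℕ) (v : Fock N M) :
    dB i m (bos (BosGen.a j k) * v) = bos (BosGen.a j k) * dB i m v := by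
  rcases m with _ | m
  · rw [dB_zero_bos_mul]
  · rw [dB_succ_bos_mul, if_neg (by simp), add_zero]

theorem dL_anticomm (x y : FerGen M) (v : Fock N M) : dL x (dL y v) = -dL y (dL x v) :=
  congrArg (fun D => D v) (dL_dL (N := N) x y)

theorem fer_mul_anticomm (x y : FerGen M) (v : Fock N M) :
    fer x * (fer y * v) = -(fer y * (fer x * v)) :=
  congrArg (fun D => D v) (mulFer_mulFer (N := N) x y)

theorem bos_mul_left_comm (x : BosGen N) (u v : Fock N M) : bos x * (u * v) = u * (bos x * v) := by
  rw [← mul_assoc, bos_mul_comm, mul_assoc]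

theorem loc_base {b c : Bool} {u w : Fock N M} (hu : IsBase b u) (hw : IsBase c w) : Loc b u c w := by
  have hff : ∀ f f' : Ohat N, Loc false (fn f : Fock N M) false (fn f') := fun f f' =>
    isLocal_of_commute fun m n v => by simpa [sgn] using commute_mode_fn m n f f' v
  have haf : ∀ i (f : Ohat N), Loc false (a i : Fock N M) false (fn f) := fun i f =>
    isLocal_of_comm_eq (fun n => mode n (fn (pd i f))) fun m n v => by
      simp only [sgn, Bool.and_false, Bool.false_eq_true, if_false, one_smul]
      rcases int_cases m with ⟨k, rfl⟩ | ⟨k, rfl⟩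
      · rw [mode_a_neg, mode_a_neg, mode_fn_a_mul, sub_sub_cancel,
          show -1 - (k : ℤ) + n = n - k - 1 by ring]
      · rw [mode_a_natCast, mode_a_natCast, mode_fn_dB]; abel
  have haa : ∀ i j, Loc false (a i : Fock N M) false (a j) := fun i j =>
    isLocal_of_commute fun m n v => by
      simp only [sgn, Bool.and_false, Bool.false_eq_true, if_false, one_smul]
      rcases int_cases m with ⟨k, rfl⟩ | ⟨k, rfl⟩ <;> rcases int_cases n with ⟨l, rfl⟩ | ⟨l, rfl⟩
      · simp only [mode_a_neg]; exact bos_mul_left_comm _ _ _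
      · simp only [mode_a_neg, mode_a_natCast, dB_commute_bos_a]
      · simp only [mode_a_neg, mode_a_natCast, dB_commute_bos_a]
      · simp only [mode_a_natCast]
        exact congrArg (fun D => D v) (dB_dB (M := M) i j k l).eq
  have hf : ∀ j (f : Ohat N), Loc true (phi j : Fock N M) false (fn f)
      ∧ Loc true (psi j : Fock N M) false (fn f) := fun j f => by
    refine ⟨isLocal_of_commute fun m n v => ?_, isLocal_of_commute fun m n v => ?_⟩
    all_goals
      simp only [sgn, Bool.and_false, Bool.false_eq_true, if_false, one_smul]
      rcases int_cases m with ⟨k, rfl⟩ | ⟨k, rfl⟩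
      · simp only [mode_phi_neg, mode_psi_neg]
        exact (mode_fn_gen_mul n f (Sum.inr _) v (by simp)).symm
      · simp only [mode_phi_natCast, mode_psi_natCast, mode_fn_dL]
  have ha : ∀ i j, Loc false (a i : Fock N M) true (phi j)
      ∧ Loc false (a i : Fock N M) true (psi j) := fun i j => by
    refine ⟨isLocal_of_commute fun m n v => ?_, isLocal_of_commute fun m n v => ?_⟩
    all_goals
      simp only [sgn, Bool.false_and, Bool.false_eq_true, if_false, one_smul]
      rcases int_cases m with ⟨k, rfl⟩ | ⟨k, rfl⟩ <;> rcases int_cases n with ⟨l, rfl⟩ | ⟨l, rfl⟩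
      · simp only [mode_a_neg, mode_phi_neg, mode_psi_neg]; exact bos_mul_left_comm _ _ _
      · simp only [mode_a_neg, mode_phi_natCast, mode_psi_natCast, dL_bos_mul]
      · simp only [mode_a_natCast, mode_phi_neg, mode_psi_neg, dB_fer_mul]
      · simp only [mode_a_natCast, mode_phi_natCast, mode_psi_natCast]
        exact congrArg (fun D => D v) (onFer_commute_dB (N := N) (M := M) _ i k).eq.symm
  have he : ∀ i j, Loc true (phi i : Fock N M) true (phi j)
      ∧ Loc true (psi i : Fock N M) true (psi j) := fun i j => by
    refine ⟨isLocal_of_commute fun m n v => ?_, isLocal_of_commute fun m n v => ?_⟩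
    all_goals
      simp only [sgn, Bool.true_and, if_true, neg_smul, one_smul]
      rcases int_cases m with ⟨k, rfl⟩ | ⟨k, rfl⟩ <;> rcases int_cases n with ⟨l, rfl⟩ | ⟨l, rfl⟩
      · simp only [mode_phi_neg, mode_psi_neg]; exact fer_mul_anticomm _ _ _
      · simp [mode_phi_neg, mode_phi_natCast, mode_psi_neg, mode_psi_natCast, dL_fer_mul]
      · simp [mode_phi_neg, mode_phi_natCast, mode_psi_neg, mode_psi_natCast, dL_fer_mul]
      · simp only [mode_phi_natCast, mode_psi_natCast]; exact dL_anticomm _ _ _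
  have hphipsi : ∀ i j, Loc true (phi i : Fock N M) true (psi j) := fun i j =>
    isLocal_of_comm_eq (fun n => if i = j then mode n 1 else 0) fun m n v => by
      simp only [sgn, Bool.true_and, if_true, neg_smul, one_smul, sub_neg_eq_add]
      have hd : ∀ p q : ℤ, (if i = j then mode (p + q) (1 : Fock N M) else 0) v
          = if i = j ∧ p + q = -1 then v else 0 := by
        intro p q
        by_cases hij : i = j
        · simp [hij, mode_one]
        · simp [hij]
      rw [hd]
      rcases int_cases m with ⟨k, rfl⟩ | ⟨k, rfl⟩ <;> rcases int_cases n with ⟨l, rfl⟩ | ⟨l, rfl⟩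
      · rw [if_neg (by omega)]
        simp only [mode_phi_neg, mode_psi_neg]; rw [fer_mul_anticomm]; abel
      · simp only [mode_phi_neg, mode_psi_natCast, dL_fer_mul, FerGen.phi.injEq]
        by_cases h : i = j ∧ k = l
        · rw [if_pos h, if_pos ⟨h.1, by omega⟩]; abel
        · rw [if_neg h, if_neg (fun h' => h ⟨h'.1, by omega⟩)]; abel
      · simp only [mode_psi_neg, mode_phi_natCast, dL_fer_mul, FerGen.psi.injEq]
        by_cases h : j = i ∧ l = k
        · rw [if_pos h, if_pos ⟨h.1.symm, by omega⟩]; abel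
        · rw [if_neg h, if_neg (fun h' => h ⟨h'.1.symm, by omega⟩)]; abel
      · rw [if_neg (by omega)]
        simp only [mode_phi_natCast, mode_psi_natCast]; rw [dL_anticomm]; abel
  cases hu <;> cases hw
  · exact hff _ _
  · exact (haf _ _).symm
  · exact (hf _ _).1.symm
  · exact (hf _ _).2.symm
  · exact haf _ _
  · exact haa _ _
  · exact (ha _ _).1
  · exact (ha _ _).2
  · exact (hf _ _).1
  · exact (ha _ _).1.symm
  · exact (he _ _).1
  · exact hphipsi _ _
  · exact (hf _ _).2
  · exact (ha _ _).2.symm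
  · exact (hphipsi _ _).symm
  · exact (he _ _).2

theorem loc_gen_of_base {c : Bool} {w : Fock N M} (h : ∀ b (u : Fock N M), IsBase b u → Loc b u c w)
    (y : Gen N M) : Loc y.isRight (gen y) c w :=
  loc_gen (fun i => h _ _ (.a i)) (fun f => h _ _ (.fn f)) (fun j => h _ _ (.phi j))
    (fun j => h _ _ (.psi j)) y

theorem Loc.add {b c : Bool} {u u' w : Fock N M} (h : Loc b u c w) (h' : Loc b u' c w) :
    Loc b (u + u') c w := by
  unfold Loc
  simp only [map_add]
  exact IsLocal.add h h'

theorem loc_zero (b c : Bool) (w : Fock N M) : Loc b 0 c w :=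
  isLocal_of_commute fun m n v => by simp

theorem loc_hom_base {b : Bool} {u : Fock N M} (hu : IsHom b u) :
    ∀ c (w : Fock N M), IsBase c w → Loc b u c w := by
  refine hom_induction (P := fun b u => ∀ c (w : Fock N M), IsBase c w → Loc b u c w)
    (fun f c w hw => loc_base (.fn f) hw) (fun c w _ => loc_zero _ _ _)
    (fun b u v hu hv c w hw => (hu c w hw).add (hv c w hw)) (fun b y u hu h c w hw => ?_) hu
  exact Loc.gen_mul hu (loc_gen_of_base (fun c w hw => (h c w hw).symm) y)
    (loc_gen_of_base (fun c' w' hw' => loc_base hw' hw) y) (h c w hw)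

/-- The fields of any two homogeneous states are mutually local. -/
theorem loc {b c : Bool} {u w : Fock N M} (hu : IsHom b u) (hw : IsHom c w) : Loc b u c w := by
  refine hom_induction (P := fun b u => Loc b u c w)
    (fun f => (loc_hom_base hw _ _ (.fn f)).symm) (loc_zero _ _ _)
    (fun b u v hu hv => hu.add hv) (fun b y u hu h => ?_) hu
  exact Loc.gen_mul hu (loc_gen_of_base (fun c w hw => (loc_hom_base hu c w hw).symm) y)
    (loc_gen_of_base (fun c' w' hw' => (loc_hom_base hw _ _ hw').symm) y) h

end Fock

end ChiralDO

end

noncomputable section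

namespace ChiralDO

open Ohat

section

variable {V : Type*} [AddCommGroup V] [Module ℂ V]

theorem isRes_sum_eventually {s : ℂ} {A B : ℤ → Module.End ℂ V} (hA : IsField A) (hB : IsField B)
    (n : ℤ) (v : V) : ∃ x : V, ∃ J₀ : ℕ, ∀ J ≥ J₀, x = ∑ j ∈ Finset.range J, A (-1 - j) (B (n + j) v)
    + s • ∑ j ∈ Finset.range J, B (n - 1 - j) (A j v) := by
  obtain ⟨r1, h1⟩ := hA v
  obtain ⟨r2, h2⟩ := hB v
  set J₀ := r1.natAbs + r2.natAbs + n.natAbs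
  refine ⟨∑ j ∈ Finset.range J₀, A (-1 - j) (B (n + j) v)
      + s • ∑ j ∈ Finset.range J₀, B (n - 1 - j) (A j v), J₀, fun J hJ => ?_⟩
  rw [Finset.sum_subset (Finset.range_mono hJ), Finset.sum_subset (Finset.range_mono hJ)]
  · intro j _ hj
    rw [mem_range, not_lt] at hj
    rw [h1 j (by omega), map_zero]
  · intro j _ hj
    rw [mem_range, not_lt] at hj
    rw [h2 (n + j) (by omega), map_zero]

/-- Normally ordered products exist. -/
theorem exists_isProd (s : ℂ) {A B : ℤ → Module.End ℂ V} (hA : IsField A) (hB : IsField B) :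
    ∃ D, IsProd s 0 A B D := by
  choose x J hx using isRes_sum_eventually (s := s) hA hB
  refine ⟨fun n => ⟨⟨x n, fun v w => ?_⟩, fun c v => ?_⟩, fun v n => ⟨J n v, fun K hK => ?_⟩⟩
  · set K := max (J n v) (max (J n w) (J n (v + w)))
    rw [hx n v K (by omega), hx n w K (by omega), hx n (v + w) K (by omega)]
    simp only [map_add, sum_add_distrib, smul_add]
    abel
  · simp only [RingHom.id_apply]
    set K := max (J n v) (J n (c • v))
    rw [hx n v K (by omega), hx n (c • v) K (by omega)]
    simp only [map_smul, smul_sum, smul_add, smul_comm s c]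
  · exact hx n v K hK

theorem zw_pow_translation {K K' : ℤ → ℤ → V} {T : V →ₗ[ℂ] V}
    (h : ∀ m n, T (K m n) = K' m n - (m : ℂ) • K (m - 1) n - (n : ℂ) • K m (n - 1)) (l : ℕ) :
    ∀ m n, T ((zw V ^ l) K m n) = (zw V ^ l) K' m n - (m : ℂ) • (zw V ^ l) K (m - 1) n
      - (n : ℂ) • (zw V ^ l) K m (n - 1) := by
  induction l with
  | zero => exact h
  | succ l ih =>
    intro m n
    simp only [zw_pow_succ', zw_apply, map_sub, ih, add_sub_cancel_right, sub_add_cancel,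
      show ∀ a : ℤ, a + 1 - 1 = a from fun a => by ring]
    push_cast
    simp only [add_smul, one_smul, smul_sub]
    abel

end

namespace Fock

variable {N M : ℕ}

theorem exists_isHom_add (v : Fock N M) : ∃ v₀ v₁, v = v₀ + v₁ ∧ IsHom false v₀ ∧ IsHom true v₁ := by
  refine ⟨(2 : ℂ)⁻¹ • (v + parity v), (2 : ℂ)⁻¹ • (v - parity v), ?_, ?_, ?_⟩
  · rw [← smul_add, add_add_sub_cancel, ← two_smul ℂ v, smul_smul, inv_mul_cancel₀ two_ne_zero,
      one_smul]
  · simp only [IsHom, sgn, map_smul, map_add, parity_parity_apply]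
    simp [add_comm]
  · simp only [IsHom, sgn, map_smul, map_sub, parity_parity_apply]
    simp [← smul_neg]

theorem isHom_induction {P : Fock N M → Prop} (hadd : ∀ u v, P u → P v → P (u + v))
    (h : ∀ b v, IsHom b v → P v) (v : Fock N M) : P v := by
  obtain ⟨v₀, v₁, rfl, h0, h1⟩ := exists_isHom_add v
  exact hadd _ _ (h _ _ h0) (h _ _ h1)

/-- Goddard's uniqueness theorem: a translation covariant field that is local with respect to all
fields is determined by the state it creates. -/
theorem field_eq_zero {b : Bool} {D : ℤ → Op N M}
    (hloc : ∀ c w, IsHom c w → IsLocal (sgn (b && c)) D (fun n => mode n w))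
    (hT : ∀ n v, transl (D n v) = D n (transl v) - (n : ℂ) • D (n - 1) v)
    (h0 : ∀ n, -1 ≤ n → D n 1 = 0) (n : ℤ) (v : Fock N M) : D n v = 0 := by
  have hneg : ∀ k : ℕ, D (-1 - k) 1 = 0 := by
    intro k
    induction k with
    | zero => exact h0 _ (by omega)
    | succ k ih =>
      have h := hT (-1 - k) 1
      rw [ih, map_zero, transl_one, map_zero, zero_sub, eq_comm, neg_eq_zero, smul_eq_zero] at h
      rcases h with h | h
      · exfalso
        have h' : (-1 - (k : ℤ) : ℤ) = 0 := by exact_mod_cast h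
        omega
      · rw [← h]; congr 2; push_cast; ring
  have hvac : ∀ n, D n 1 = 0 := by
    intro n
    rcases int_cases n with ⟨k, rfl⟩ | ⟨k, rfl⟩
    · exact hneg k
    · exact h0 _ (by omega)
  refine isHom_induction (P := fun v => D n v = 0) (fun u v hu hv => by rw [map_add, hu, hv, add_zero])
    (fun c v hv => ?_) v
  exact (hloc c v hv).apply_eq_zero hvac (fun n hn => mode_vac_of_nonneg hn v) (mode_vac_neg_one v) n

/-- The field of `u_{(-1)} v` is the normally ordered product of the fields of `u` and `v`. -/
theorem isProd_mode {b c : Bool} {u v : Fock N M} (hu : IsHom b u) (hv : IsHom c v) :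
    IsProd (sgn (b && c)) 0 (fun n => mode n u) (fun n => mode n v)
      (fun n => mode n (mode (-1) u v)) := by
  obtain ⟨D, hD⟩ := exists_isProd (sgn (b && c)) (isField_mode u) (isField_mode v)
  have hDT := hD.translation (isField_mode u) (isField_mode v) (tCov_of_isHom hu) (tCov_of_isHom hv)
  have huv := hu.mode hv (-1)
  have hDv : ∀ n, -1 ≤ n → D n 1 = mode n (mode (-1) u v) 1 := by
    intro n hn
    obtain ⟨J, hJ⟩ := hD 1 n
    simp only [pow_zero, Module.End.one_apply] at hJ
    rw [hJ (J + 1) (by omega)]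
    have h2 : ∀ j : ℕ, mode (n - 1 - j) v (mode j u 1) = 0 := fun j => by
      rw [mode_vac_of_nonneg (by omega), map_zero]
    simp only [h2, sum_const_zero, smul_zero, add_zero]
    have h1 : ∀ j : ℕ, j ≠ 0 → mode (-1 - j) u (mode (n + j) v 1) = 0 := fun j hj => by
      rw [mode_vac_of_nonneg (by omega), map_zero]
    rw [sum_eq_single 0 (fun j _ hj => h1 j hj) (fun h => by simp at h)]
    rcases eq_or_ne n (-1) with rfl | hn'
    · simp only [Nat.cast_zero, add_zero, sub_zero, mode_vac_neg_one]
    · rw [mode_vac_of_nonneg (by omega), map_zero, mode_vac_of_nonneg (by omega)]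
  have key := field_eq_zero (b := b ^^ c) (D := fun n => D n - mode n (mode (-1) u v))
    (fun e w hw => IsLocal.sub (by
      rw [← sgn_xor_and]
      exact hD.isLocal (isField_mode _) (isField_mode _) (loc hu hv) (loc hu hw) (loc hv hw))
      (loc huv hw))
    (fun n w => by
      simp only [LinearMap.sub_apply, map_sub]
      rw [hDT, tCov_of_isHom huv n w, smul_sub]
      abel)
    (fun n hn => by simp only [LinearMap.sub_apply]; rw [hDv n hn, sub_self])
  have hDe : D = fun n => mode n (mode (-1) u v) := by
    funext n
    exact LinearMap.ext fun w => sub_eq_zero.mp (key n w)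
  rw [← hDe]; exact hD

theorem mode_transl (n : ℤ) (u v : Fock N M) :
    mode n (transl u) v = -(n : ℂ) • mode (n - 1) u v := by
  refine isHom_induction (P := fun u => mode n (transl u) v = -(n : ℂ) • mode (n - 1) u v)
    (fun u w hu hw => by simp only [map_add, LinearMap.add_apply, hu, hw, smul_add])
    (fun b u hu => ?_) u
  have key := field_eq_zero (b := b)
    (D := fun n => mode n (transl u) - -(n : ℂ) • mode (n - 1) u)
    (fun c w hw => IsLocal.sub (loc hu.transl hw)
      (IsLocal.deriv (A := fun n => mode n u) (loc hu hw)))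
    (fun n w => by
      simp only [LinearMap.sub_apply, LinearMap.smul_apply, map_sub, map_smul]
      rw [tCov_of_isHom hu.transl n w, tCov_of_isHom hu (n - 1) w]
      push_cast
      simp only [smul_sub, sub_smul, smul_smul, neg_smul, one_smul, smul_neg, mul_sub, neg_mul, mul_one,
        neg_sub, mul_neg]
      abel)
    (fun n hn => by
      simp only [LinearMap.sub_apply, LinearMap.smul_apply]
      rw [mode_vac, mode_vac]
      rcases eq_or_ne n (-1) with rfl | hn'
      · simp [Td_zero, Td_one_apply]
      · rw [Td_of_neg (show -n - 1 < 0 by omega)]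
        rcases eq_or_ne n 0 with rfl | hn''
        · simp
        · rw [Td_of_neg (show -(n - 1) - 1 < 0 by omega)]; simp)
  exact sub_eq_zero.mp (key n v)

/-- The products of non-negative index, in terms of commutators. -/
theorem zw_pow_comm {b c : Bool} {u v : Fock N M} (hu : IsHom b u) (hv : IsHom c v) (k : ℕ) (n : ℤ)
    (w : Fock N M) :
    (zw (Fock N M) ^ k) (fun m n => mode m u (mode n v w) - sgn (b && c) • mode n v (mode m u w)) 0 n
      = mode n (mode k u v) w := by
  set s := sgn (b && c) with hs
  set K : ℤ → ℤ → Op N M := fun m n =>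
    mode m u * mode n v - s • (mode n v * mode m u) with hK
  set D : ℤ → Op N M := fun n => (zw _ ^ k) K 0 n with hDdef
  have hDv : ∀ n w, D n w = (zw (Fock N M) ^ k) (fun m n => mode m u (mode n v w)
      - s • mode n v (mode m u w)) 0 n := by
    intro n w
    have h := zw_pow_map (LinearMap.applyₗ (R := ℂ) (M := Fock N M) (M₂ := Fock N M) w) k K
    exact (congrFun (congrFun h 0) n).symm
  have hD : IsProd s (k + 1) (fun n => mode n u) (fun n => mode n v) D :=
    isProd_succ (isField_mode u) (isField_mode v) k hDv
  have hT : ∀ n w, transl (D n w) = D n (transl w) - (n : ℂ) • D (n - 1) w := by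
    intro n w
    rw [hDv, hDv, hDv]
    have h := zw_pow_translation (T := transl)
      (K := fun m n => mode m u (mode n v w) - s • mode n v (mode m u w))
      (K' := fun m n => mode m u (mode n v (transl w)) - s • mode n v (mode m u (transl w)))
      (fun m n => by
        simp only [map_sub, map_smul]
        rw [tCov_of_isHom hu, tCov_of_isHom hv, tCov_of_isHom hv, tCov_of_isHom hu]
        simp only [map_sub, map_smul, smul_sub, smul_comm s (m : ℂ), smul_comm s (n : ℂ)]
        abel) k 0 n
    rw [h]; simp
  have hvac : ∀ n, -1 ≤ n → D n 1 = mode n (mode k u v) 1 := by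
    intro n hn
    have e : (fun m n => mode m u (mode n v (1 : Fock N M)) - s • mode n v (mode m u (1 : Fock N M)))
        = (fun m n => mode m u (mode n v (1 : Fock N M)))
          - s • fun m n => mode n v (mode m u (1 : Fock N M)) := rfl
    have h1 := zw_pow_vac (F := fun m n => mode m u (mode n v (1 : Fock N M)))
      (fun m n hn => by rw [mode_vac_of_nonneg hn, map_zero]) k
    have h2 := zw_pow_vac (F := fun n m => mode n v (mode m u (1 : Fock N M)))
      (fun m n hn => by rw [mode_vac_of_nonneg hn, map_zero]) k
    have h3 := zw_pow_swap k (fun n m => mode n v (mode m u (1 : Fock N M)))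
    rw [hDv, e, map_sub, map_smul, h3]
    simp only [Pi.sub_apply, Pi.smul_apply, h2.1 _ _ le_rfl, smul_zero, sub_zero]
    rcases eq_or_ne n (-1) with rfl | hn'
    · rw [h1.2, mode_vac_neg_one, mode_vac_neg_one, zero_add]
    · rw [h1.1 _ _ (by omega), mode_vac_of_nonneg (by omega)]
  have hkv := hu.mode hv k
  have key := field_eq_zero (b := b ^^ c) (D := fun n => D n - mode n (mode k u v))
    (fun e w hw => IsLocal.sub (by
      rw [← sgn_xor_and]
      exact hD.isLocal (isField_mode _) (isField_mode _) (loc hu hv) (loc hu hw) (loc hv hw))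
      (loc hkv hw))
    (fun n w => by
      simp only [LinearMap.sub_apply, map_sub]
      rw [hT, tCov_of_isHom hkv n w, smul_sub]
      abel)
    (fun n hn => by simp only [LinearMap.sub_apply]; rw [hvac n hn, sub_self])
  rw [← hDv]
  exact sub_eq_zero.mp (key n w)

/-- The commutator formula for two fields whose operator product has at most a simple pole. -/
theorem comm_mode {b c : Bool} {u v : Fock N M} (hu : IsHom b u) (hv : IsHom c v)
    (h : ∀ j : ℕ, 1 ≤ j → mode j u v = 0) (m n : ℤ) (w : Fock N M) :
    mode m u (mode n v w) - sgn (b && c) • mode n v (mode m u w) = mode (m + n) (mode 0 u v) w := by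
  set K : ℤ → ℤ → Fock N M :=
    fun m n => mode m u (mode n v w) - sgn (b && c) • mode n v (mode m u w) with hK
  have hdesc : ∀ k : ℕ, (zw _ ^ (k + 1)) K = 0 → (zw _ ^ 1) K = 0 := by
    intro k
    induction k with
    | zero => exact fun h => h
    | succ k ih =>
      intro h'
      refine ih ?_
      rw [zw_pow_succ'] at h'
      funext m n
      rw [eq_of_zw_eq_zero h', zw_pow_comm hu hv, h _ (by omega)]
      simp
  obtain ⟨k, hk⟩ := loc hu hv
  have h1 := hdesc k (zw_pow_eq_zero_of_le (Nat.le_succ k) (hk w))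
  have h2 := eq_of_zw_eq_zero (by simpa using h1) m n
  have h3 := zw_pow_comm hu hv 0 (m + n) w
  exact h2.trans h3

theorem transl_eq_mode (u : Fock N M) : transl u = mode (-2) u 1 := by
  rw [mode_vac]; exact (Td_one_apply u).symm

/-- Endomorphisms of the vertex superalgebra. -/
structure IsVHom (F : Fock N M →ₗ[ℂ] Fock N M) : Prop where
  map_one : F 1 = 1
  map_parity : ∀ u, F (parity u) = parity (F u)
  map_mode : ∀ (n : ℤ) (u v : Fock N M), F (mode n u v) = mode n (F u) (F v)

namespace IsVHom

variable {F G : Fock N M →ₗ[ℂ] Fock N M}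

theorem id : IsVHom (LinearMap.id : Fock N M →ₗ[ℂ] Fock N M) := ⟨rfl, fun _ => rfl, fun _ _ _ => rfl⟩

theorem comp (hF : IsVHom F) (hG : IsVHom G) : IsVHom (F ∘ₗ G) :=
  ⟨by simp [hG.map_one, hF.map_one], fun u => by simp [hG.map_parity, hF.map_parity],
    fun n u v => by simp [hG.map_mode, hF.map_mode]⟩

theorem map_transl (hF : IsVHom F) (u : Fock N M) : F (transl u) = transl (F u) := by
  rw [transl_eq_mode, transl_eq_mode, hF.map_mode, hF.map_one]

theorem map_gen_mul (hF : IsVHom F) (y : Gen N M) (u : Fock N M) :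
    F (gen y * u) = mode (-1) (F (gen y)) (F u) := by
  rw [← hF.map_mode]
  congr 1
  have := mode_gen_neg 0 y u
  simp only [Nat.cast_zero, sub_zero, Td_zero, Module.End.one_apply] at this
  exact this.symm

/-- An endomorphism is determined by the images of the generators. -/
theorem ext (hF : IsVHom F) (hG : IsVHom G) (hfn : ∀ f, F (fn f) = G (fn f))
    (ha : ∀ i, F (a i) = G (a i)) (hphi : ∀ j, F (phi j) = G (phi j))
    (hpsi : ∀ j, F (psi j) = G (psi j)) : F = G := by
  have hgen : ∀ y, F (gen y) = G (gen y) := by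
    refine gen_rec (P := fun y => F (gen y) = G (gen y)) ha (fun i => ?_) hphi hpsi
      (fun y y' c hc _ h1 h2 => ?_)
    · have h : (gen (Sum.inl (BosGen.b i 0)) : Fock N M) = transl (fn (coord i)) :=
        (transl_coord i).symm
      rw [h, hF.map_transl, hG.map_transl, hfn]
    · have h3 : (gen y' : Fock N M) = c⁻¹ • transl (gen y) := by
        rw [h1, smul_smul, inv_mul_cancel₀ hc, one_smul]
      rw [h3, map_smul, map_smul, hF.map_transl, hG.map_transl, h2]
  refine LinearMap.ext fun u => gen_induction (P := fun u => F u = G u) hfn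
    (fun u v hu hv => by rw [map_add, map_add, hu, hv]) (fun y u hu => ?_) u
  rw [hF.map_gen_mul, hG.map_gen_mul, hgen, hu]

end IsVHom

/-- States whose fields have the operator products of the generating fields, with the functions
replaced by their images under `g`. -/
structure IsSystem (g : Subst N) (α : Fin N → Fock N M) (φ ψ : Fin M → Fock N M) : Prop where
  hom_α : ∀ i, IsHom false (α i)
  hom_φ : ∀ j, IsHom true (φ j)
  hom_ψ : ∀ j, IsHom true (ψ j)
  α_f : ∀ i (f : Ohat N) m n w, mode m (α i) (mode n (fn (g.pull f)) w)
    = mode n (fn (g.pull f)) (mode m (α i) w) + mode (m + n) (fn (g.pull (pd i f))) w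
  α_α : ∀ i j m n w, mode m (α i) (mode n (α j) w) = mode n (α j) (mode m (α i) w)
  α_φ : ∀ i j m n w, mode m (α i) (mode n (φ j) w) = mode n (φ j) (mode m (α i) w)
  α_ψ : ∀ i j m n w, mode m (α i) (mode n (ψ j) w) = mode n (ψ j) (mode m (α i) w)
  φ_f : ∀ j (f : Ohat N) m n w, mode m (φ j) (mode n (fn (g.pull f)) w)
    = mode n (fn (g.pull f)) (mode m (φ j) w)
  ψ_f : ∀ j (f : Ohat N) m n w, mode m (ψ j) (mode n (fn (g.pull f)) w)
    = mode n (fn (g.pull f)) (mode m (ψ j) w)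
  φ_φ : ∀ i j m n w, mode m (φ i) (mode n (φ j) w) = -mode n (φ j) (mode m (φ i) w)
  ψ_ψ : ∀ i j m n w, mode m (ψ i) (mode n (ψ j) w) = -mode n (ψ j) (mode m (ψ i) w)
  ψ_φ : ∀ i j m n w, mode m (ψ i) (mode n (φ j) w) = -mode n (φ j) (mode m (ψ i) w)
    + if i = j ∧ m + n = -1 then w else 0

theorem isSystem_base : IsSystem (M := M) (Subst.id N) a phi psi where
  hom_α i := isHom_gen (Sum.inl (BosGen.a i 0))
  hom_φ j := isHom_gen (Sum.inr (FerGen.phi j 0))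
  hom_ψ j := isHom_gen (Sum.inr (FerGen.psi j 0))
  α_f i f m n w := by
    rw [Subst.pull_id, Subst.pull_id]
    rcases int_cases m with ⟨k, rfl⟩ | ⟨k, rfl⟩
    · rw [mode_a_neg, mode_a_neg, mode_fn_a_mul, show -1 - (k : ℤ) + n = n - k - 1 by ring,
        sub_add_cancel]
    · rw [mode_a_natCast, mode_a_natCast, mode_fn_dB]
  α_α i j m n v := by
      rcases int_cases m with ⟨k, rfl⟩ | ⟨k, rfl⟩ <;> rcases int_cases n with ⟨l, rfl⟩ | ⟨l, rfl⟩
      · simp only [mode_a_neg]; exact bos_mul_left_comm _ _ _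
      · simp only [mode_a_neg, mode_a_natCast, dB_commute_bos_a]
      · simp only [mode_a_neg, mode_a_natCast, dB_commute_bos_a]
      · simp only [mode_a_natCast]
        exact congrArg (fun D => D v) (dB_dB (M := M) i j k l).eq
  α_φ i j m n v := by
      rcases int_cases m with ⟨k, rfl⟩ | ⟨k, rfl⟩ <;> rcases int_cases n with ⟨l, rfl⟩ | ⟨l, rfl⟩
      · simp only [mode_a_neg, mode_phi_neg]; exact bos_mul_left_comm _ _ _
      · simp only [mode_a_neg, mode_phi_natCast, dL_bos_mul]
      · simp only [mode_a_natCast, mode_phi_neg, dB_fer_mul]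
      · simp only [mode_a_natCast, mode_phi_natCast]
        exact congrArg (fun D => D v) (onFer_commute_dB (N := N) (M := M) _ i k).eq.symm
  α_ψ i j m n v := by
      rcases int_cases m with ⟨k, rfl⟩ | ⟨k, rfl⟩ <;> rcases int_cases n with ⟨l, rfl⟩ | ⟨l, rfl⟩
      · simp only [mode_a_neg, mode_psi_neg]; exact bos_mul_left_comm _ _ _
      · simp only [mode_a_neg, mode_psi_natCast, dL_bos_mul]
      · simp only [mode_a_natCast, mode_psi_neg, dB_fer_mul]
      · simp only [mode_a_natCast, mode_psi_natCast]
        exact congrArg (fun D => D v) (onFer_commute_dB (N := N) (M := M) _ i k).eq.symm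
  φ_f j f m n v := by
      rcases int_cases m with ⟨k, rfl⟩ | ⟨k, rfl⟩
      · simp only [mode_phi_neg]
        exact (mode_fn_gen_mul n _ (Sum.inr _) v (by simp)).symm
      · simp only [mode_phi_natCast, mode_fn_dL]
  ψ_f j f m n v := by
      rcases int_cases m with ⟨k, rfl⟩ | ⟨k, rfl⟩
      · simp only [mode_psi_neg]
        exact (mode_fn_gen_mul n _ (Sum.inr _) v (by simp)).symm
      · simp only [mode_psi_natCast, mode_fn_dL]
  φ_φ i j m n v := by
      rcases int_cases m with ⟨k, rfl⟩ | ⟨k, rfl⟩ <;> rcases int_cases n with ⟨l, rfl⟩ | ⟨l, rfl⟩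
      · simp only [mode_phi_neg]; exact fer_mul_anticomm _ _ _
      · simp [mode_phi_neg, mode_phi_natCast, dL_fer_mul]
      · simp [mode_phi_neg, mode_phi_natCast, dL_fer_mul]
      · simp only [mode_phi_natCast]; exact dL_anticomm _ _ _
  ψ_ψ i j m n v := by
      rcases int_cases m with ⟨k, rfl⟩ | ⟨k, rfl⟩ <;> rcases int_cases n with ⟨l, rfl⟩ | ⟨l, rfl⟩
      · simp only [mode_psi_neg]; exact fer_mul_anticomm _ _ _
      · simp [mode_psi_neg, mode_psi_natCast, dL_fer_mul]
      · simp [mode_psi_neg, mode_psi_natCast, dL_fer_mul]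
      · simp only [mode_psi_natCast]; exact dL_anticomm _ _ _
  ψ_φ i j m n v := by
      rcases int_cases m with ⟨k, rfl⟩ | ⟨k, rfl⟩ <;> rcases int_cases n with ⟨l, rfl⟩ | ⟨l, rfl⟩
      · rw [if_neg (by omega), add_zero]
        simp only [mode_phi_neg, mode_psi_neg]; rw [fer_mul_anticomm]
      · simp only [mode_psi_neg, mode_phi_natCast, dL_fer_mul, FerGen.psi.injEq]
        by_cases h : i = j ∧ k = l
        · rw [if_pos h, if_pos ⟨h.1, by omega⟩]; abel
        · rw [if_neg h, if_neg (fun h' => h ⟨h'.1, by omega⟩)]; abel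
      · simp only [mode_phi_neg, mode_psi_natCast, dL_fer_mul, FerGen.phi.injEq]
        by_cases h : j = i ∧ l = k
        · rw [if_pos h, if_pos ⟨h.1.symm, by omega⟩]
        · rw [if_neg h, if_neg (fun h' => h ⟨h'.1.symm, by omega⟩)]
      · rw [if_neg (by omega)]
        simp only [mode_phi_natCast, mode_psi_natCast]; rw [dL_anticomm]; abel

/-- Multiplication by an even creation mode, as a mode of a generating field. -/
theorem mode_coord_neg (k : ℕ) (i : Fin N) (v : Fock N M) :
    mode (-1 - (k + 1)) (fn (coord i)) v = bos (BosGen.b i k) * v := by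
  rw [mode_coord, if_neg (by omega), sub_zero, show -(-1 - ((k : ℤ) + 1)) - 1 = k + 1 by ring, Td_coord]

/-- The image of multiplication by an even creation mode. -/
def creBos (g : Subst N) (α : Fin N → Fock N M) : BosGen N → Op N M
  | BosGen.a i k => mode (-1 - k) (α i)
  | BosGen.b i k => mode (-1 - (k + 1)) (fn (g.comp i))

/-- The image of multiplication by an odd creation mode. -/
def creFer (φ ψ : Fin M → Fock N M) : FerGen M → Op N M
  | FerGen.phi j k => mode (-1 - k) (φ j)
  | FerGen.psi j k => mode (-1 - k) (ψ j)

section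

variable {g : Subst N} {α : Fin N → Fock N M} {φ ψ : Fin M → Fock N M}

theorem commute_creBos (h : IsSystem g α φ ψ) (x y : BosGen N) :
    Commute (creBos g α x) (creBos g α y) := by
  have hc : ∀ i j (k l : ℕ), Commute (creBos g α (BosGen.a i k)) (creBos g α (BosGen.b j l)) := by
    intro i j k l
    refine LinearMap.ext fun v => ?_
    have e2 : mode (-1 - k + (-1 - (l + 1))) (fn (g.pull (pd i (coord j)))) v = 0 := by
      have e3 : pd i (coord j) = if i = j then (1 : Ohat N) else 0 := pd_coord i j
      rw [e3]
      split_ifs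
      · rw [map_one, fn_one, mode_one, if_neg (by omega)]
      · rw [map_zero, fn_zero]; simp
    have e : mode (-1 - k) (α i) (mode (-1 - (l + 1)) (fn (g.comp j)) v)
        = mode (-1 - (l + 1)) (fn (g.comp j)) (mode (-1 - k) (α i) v) := by
      rw [← Subst.pull_coord, h.α_f, e2, add_zero]
    exact e
  rcases x with ⟨i, k⟩ | ⟨i, k⟩ <;> rcases y with ⟨j, l⟩ | ⟨j, l⟩
  · refine LinearMap.ext fun v => ?_
    change mode (-1 - (k + 1)) (fn (g.comp i)) (mode (-1 - (l + 1)) (fn (g.comp j)) v)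
      = mode (-1 - (l + 1)) (fn (g.comp j)) (mode (-1 - (k + 1)) (fn (g.comp i)) v)
    exact commute_mode_fn _ _ _ _ v
  · exact (hc _ _ _ _).symm
  · exact hc _ _ _ _
  · exact LinearMap.ext fun v => h.α_α i j _ _ v

theorem creFer_mul_creFer (h : IsSystem g α φ ψ) (x y : FerGen M) :
    creFer φ ψ x * creFer φ ψ y = -(creFer φ ψ y * creFer φ ψ x) := by
  refine LinearMap.ext fun v => ?_
  rcases x with ⟨i, k⟩ | ⟨i, k⟩ <;> rcases y with ⟨j, l⟩ | ⟨j, l⟩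
  · exact h.φ_φ i j _ _ v
  · have e := h.ψ_φ j i (-1 - l) (-1 - k) v
    rw [if_neg (by omega), add_zero] at e
    change mode _ (φ i) (mode _ (ψ j) v) = -mode _ (ψ j) (mode _ (φ i) v)
    rw [e, neg_neg]
  · have e := h.ψ_φ i j (-1 - k) (-1 - l) v
    rw [if_neg (by omega), add_zero] at e
    exact e
  · exact h.ψ_ψ i j _ _ v

theorem commute_creBos_creFer (h : IsSystem g α φ ψ) (x : BosGen N) (y : FerGen M) :
    Commute (creBos g α x) (creFer φ ψ y) := by
  refine LinearMap.ext fun v => ?_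
  rcases x with ⟨i, k⟩ | ⟨i, k⟩ <;> rcases y with ⟨j, l⟩ | ⟨j, l⟩
  · have e := h.φ_f j (coord i) (-1 - l) (-1 - (k + 1)) v
    rw [Subst.pull_coord] at e
    exact e.symm
  · have e := h.ψ_f j (coord i) (-1 - l) (-1 - (k + 1)) v
    rw [Subst.pull_coord] at e
    exact e.symm
  · exact h.α_φ i j _ _ v
  · exact h.α_ψ i j _ _ v

/-- The operators by which even creation modes act, as a commutative algebra. -/
theorem exists_bosHom (h : IsSystem g α φ ψ) : ∃ P : BosPart N →ₐ[ℂ] Op N M,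
    ∀ x, P (MvPolynomial.X x) = creBos g α x := by
  let S : Set (Op N M) := Set.range (creBos g α)
  letI : CommRing (Algebra.adjoin ℂ S) := Algebra.adjoinCommRingOfComm ℂ (by
    rintro _ ⟨x, rfl⟩ _ ⟨y, rfl⟩
    exact commute_creBos h x y)
  refine ⟨(Algebra.adjoin ℂ S).val.comp (MvPolynomial.aeval fun x =>
    (⟨creBos g α x, Algebra.subset_adjoin ⟨x, rfl⟩⟩ : Algebra.adjoin ℂ S)), fun x => ?_⟩
  rw [AlgHom.comp_apply, MvPolynomial.aeval_X]
  rfl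

theorem exists_ferHom (h : IsSystem g α φ ψ) : ∃ Q : FerPart M →ₐ[ℂ] Op N M,
    ∀ x, Q (ExteriorAlgebra.ι ℂ (Finsupp.single x 1)) = creFer φ ψ x := by
  let L : (FerGen M →₀ ℂ) →ₗ[ℂ] Op N M := Finsupp.linearCombination ℂ (creFer φ ψ)
  have hanti : ∀ u v, L u * L v = -(L v * L u) := by
    intro u v
    induction u using Finsupp.induction_linear with
    | zero => simp
    | add u u' hu hu' => rw [map_add, add_mul, mul_add, hu, hu', neg_add]
    | single x c =>
      induction v using Finsupp.induction_linear with
      | zero => simp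
      | add v v' hv hv' => rw [map_add, add_mul, mul_add, hv, hv', neg_add]
      | single y d =>
        simp only [L, Finsupp.linearCombination_single, smul_mul_smul_comm]
        rw [creFer_mul_creFer h x y, smul_neg, mul_comm c d]
  refine ⟨ExteriorAlgebra.lift ℂ ⟨L, fun m => ?_⟩, fun x => ?_⟩
  · have h1 := hanti m m
    have h2 : (2 : ℂ) • (L m * L m) = 0 := by
      rw [two_smul]; nth_rewrite 1 [h1]; exact neg_add_cancel _
    exact (smul_eq_zero_iff_right two_ne_zero).mp h2
  · rw [ExteriorAlgebra.lift_ι_apply]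
    simp [L]

/-- The linear map that intertwines the creation operators. -/
theorem exists_linearMap (h : IsSystem g α φ ψ) : ∃ F : Fock N M →ₗ[ℂ] Fock N M,
    (∀ f, F (fn f) = fn (g.pull f)) ∧ (∀ x u, F (bos x * u) = creBos g α x (F u)) ∧
    ∀ x u, F (fer x * u) = creFer φ ψ x (F u) := by
  obtain ⟨P, hP⟩ := exists_bosHom h
  obtain ⟨Q, hQ⟩ := exists_ferHom h
  let B : BosPart N ⊗[ℂ] FerPart M →ₗ[ℂ] Op N M :=
    TensorProduct.lift ((LinearMap.mul ℂ _).compl₁₂ P.toLinearMap Q.toLinearMap)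
  let fnL : Ohat N →ₗ[ℂ] Fock N M := (fnHom (N := N) (M := M)).toLinearMap ∘ₗ g.pull.toLinearMap
  let F : Fock N M →ₗ[ℂ] Fock N M :=
    (TensorProduct.lift (LinearMap.flip
      ((LinearMap.lcomp ℂ (Fock N M) fnL) ∘ₗ B)) :
      Ohat N ⊗[ℂ] (BosPart N ⊗[ℂ] FerPart M) →ₗ[ℂ] Fock N M) ∘ₗ equiv.toLinearMap
  have hF : ∀ f p e, F (tp f p e) = P p (Q e (fn (g.pull f))) := fun f p e => rfl
  have hPQ : ∀ (p : BosPart N) (x : FerGen M), Commute (P p) (creFer φ ψ x) := by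
    intro p x
    induction p using MvPolynomial.induction_on with
    | C c =>
      have : P (MvPolynomial.C c) = algebraMap ℂ _ c := P.commutes c
      rw [this]
      exact Algebra.commutes c _
    | add p q hp hq => rw [map_add]; exact hp.add_left hq
    | mul_X p y hp =>
      rw [map_mul, hP]
      exact hp.mul_left (commute_creBos_creFer h y x)
  refine ⟨F, fun f => ?_, fun x u => ?_, fun x u => ?_⟩
  · rw [fn_eq_tp, hF, map_one, map_one]; rfl
  · refine tp_induction (P := fun u => F (bos x * u) = creBos g α x (F u)) (fun f p e => ?_)
      (fun u v hu hv => by rw [mul_add, map_add, hu, hv, map_add, map_add]) u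
    rw [bos_eq_tp, tp_mul, hF, hF, one_mul, one_mul, map_mul, hP]
    rfl
  · refine tp_induction (P := fun u => F (fer x * u) = creFer φ ψ x (F u)) (fun f p e => ?_)
      (fun u v hu hv => by rw [mul_add, map_add, hu, hv, map_add, map_add]) u
    rw [fer_eq_tp, tp_mul, hF, hF, one_mul, one_mul, map_mul, hQ]
    exact congrArg (fun D => D (Q e (fn (g.pull f)))) (hPQ p x).eq

end

theorem transl_fn_pull (g : Subst N) (f : Ohat N) : transl (fn (g.pull f) : Fock N M)
    = ∑ j, transl (fn (g.comp j)) * fn (g.pull (pd j f)) := by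
  simp only [transl_fn, Subst.pd_pull, fn_sum, mul_sum, sum_mul]
  rw [sum_comm]
  refine sum_congr rfl fun j _ => sum_congr rfl fun i _ => ?_
  rw [fn_mul, mul_assoc]
  rfl

/-- The divided power of the translation operator on a function, from lower divided powers. -/
theorem Td_succ_fn_pull (g : Subst N) (f : Ohat N) (k : ℕ) : Td ((k : ℤ) + 1) (fn (g.pull f) : Fock N M)
    = ((k : ℂ) + 1)⁻¹ • ∑ j, ∑ p ∈ Finset.HasAntidiagonal.antidiagonal k,
      ((p.1 : ℂ) + 1) • (Td ((p.1 : ℤ) + 1) (fn (g.comp j)) * Td (p.2 : ℤ) (fn (g.pull (pd j f)))) := by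
  rw [Td_succ_apply, ← Td_transl, transl_fn_pull, map_sum]
  congr 1
  refine sum_congr rfl fun j _ => ?_
  rw [Td_mul_natCast]
  refine sum_congr rfl fun p _ => ?_
  rw [Td_transl, transl_Td, smul_mul_assoc]
  push_cast
  rfl

namespace IsSystem

variable {g : Subst N} {α : Fin N → Fock N M} {φ ψ : Fin M → Fock N M}

theorem φ_ψ (h : IsSystem g α φ ψ) (i j : Fin M) (m n : ℤ) (w : Fock N M) :
    mode m (φ i) (mode n (ψ j) w) = -mode n (ψ j) (mode m (φ i) w)
      + if i = j ∧ m + n = -1 then w else 0 := by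
  have e := h.ψ_φ j i n m w
  rw [e]
  by_cases hc : i = j ∧ m + n = -1
  · rw [if_pos hc, if_pos ⟨hc.1.symm, by omega⟩]; abel
  · rw [if_neg hc, if_neg (fun h' => hc ⟨h'.1.symm, by omega⟩)]; abel

variable {F : Fock N M →ₗ[ℂ] Fock N M}

theorem map_Td_fn_mul (hf : ∀ f, F (fn f) = fn (g.pull f))
    (hb : ∀ x u, F (bos x * u) = creBos g α x (F u)) (f₀ : Ohat N) (k : ℕ) (f : Ohat N) :
    F (Td (k : ℤ) (fn f) * fn f₀) = Td (k : ℤ) (fn (g.pull f)) * fn (g.pull f₀) := by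
  induction k using Nat.strong_induction_on generalizing f with
  | _ k ih =>
    rcases k with _ | k
    · rw [Nat.cast_zero, Td_zero, Module.End.one_apply, Module.End.one_apply, ← fn_mul, ← fn_mul, hf,
        map_mul]
    · have e := Td_succ_fn_pull (M := M) (Subst.id N) f k
      simp only [Subst.pull_id] at e
      push_cast
      rw [e, Td_succ_fn_pull, smul_mul_assoc, smul_mul_assoc, map_smul, sum_mul, sum_mul,
        map_sum]
      congr 1
      refine sum_congr rfl fun j _ => ?_
      rw [sum_mul, sum_mul, map_sum]
      refine sum_congr rfl fun p hp => ?_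
      have hp' := Finset.HasAntidiagonal.mem_antidiagonal.mp hp
      rw [smul_mul_assoc, smul_mul_assoc, map_smul, mul_assoc, mul_assoc]
      congr 1
      rw [show (Subst.id N).comp j = coord j from rfl, Td_coord, hb, ih _ (by omega)]
      change mode _ _ _ = _
      rw [mode_fn_of_dA]
      · congr 2; congr 1; ring
      · intro i m
        rw [dA_mul, dA_Td_fn, zero_mul]
        have := dA_Td_fn (M := M) i m 0 (g.pull f₀)
        rw [Td_zero, Module.End.one_apply] at this
        rw [this, mul_zero, zero_add]

theorem map_mode_fn (h : IsSystem g α φ ψ) (hf : ∀ f, F (fn f) = fn (g.pull f))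
    (hb : ∀ x u, F (bos x * u) = creBos g α x (F u)) (hr : ∀ x u, F (fer x * u) = creFer φ ψ x (F u))
    (u : Fock N M) : ∀ (n : ℤ) f, F (mode n (fn f) u) = mode n (fn (g.pull f)) (F u) := by
  have hdA : ∀ f i m, dA i m (fn f : Fock N M) = 0 := fun f i m => by
    simpa only [Td_zero, Module.End.one_apply] using dA_Td_fn (M := M) i m 0 f
  refine gen_induction (P := fun u => ∀ (n : ℤ) f, F (mode n (fn f) u) = mode n (fn (g.pull f)) (F u))
    (fun f₀ n f => ?_) (fun u v hu hv n f => by rw [map_add, map_add, hu, hv, map_add, map_add])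
    (fun y u hu n f => ?_) u
  · rw [hf, mode_fn_of_dA _ _ (hdA _), mode_fn_of_dA _ _ (hdA _)]
    rcases lt_or_ge (-n - 1) 0 with h0 | h0
    · rw [Td_of_neg h0]; simp
    · generalize -n - 1 = k at h0
      lift k to ℕ using h0
      exact map_Td_fn_mul hf hb f₀ k f
  · rcases y with x | x
    · rcases x with ⟨i, k⟩ | ⟨i, k⟩
      · rw [mode_fn_gen_mul _ _ _ _ (by simp)]
        change F (bos _ * _) = mode _ _ (F (bos _ * _))
        rw [hb, hb, hu]
        exact commute_mode_fn _ _ _ _ _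
      · change F (mode n (fn f) (bos _ * _)) = mode _ _ (F (bos _ * _))
        rw [mode_fn_a_mul, map_sub, hb, hb, hu, hu]
        change mode _ (α i) _ - _ = mode _ _ (mode _ (α i) _)
        rw [h.α_f, show -1 - (k : ℤ) + n = n - k - 1 by ring, add_sub_cancel_right]
    · rw [mode_fn_gen_mul _ _ _ _ (by simp)]
      change F (fer _ * _) = mode _ _ (F (fer _ * _))
      rw [hr, hr, hu]
      rcases x with ⟨i, k⟩ | ⟨i, k⟩
      · exact h.φ_f _ _ _ _ _
      · exact h.ψ_f _ _ _ _ _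

theorem map_mode_α (h : IsSystem g α φ ψ) (hf : ∀ f, F (fn f) = fn (g.pull f))
    (hb : ∀ x u, F (bos x * u) = creBos g α x (F u)) (hr : ∀ x u, F (fer x * u) = creFer φ ψ x (F u))
    (i : Fin N) (n : ℤ) (u : Fock N M) : F (mode n (a i) u) = mode n (α i) (F u) := by
  have h0 := isSystem_base (N := N) (M := M)
  have hF := map_mode_fn h hf hb hr
  rcases int_cases n with ⟨k, rfl⟩ | ⟨k, rfl⟩
  · rw [mode_a_neg, hb]; rfl
  refine gen_induction (P := fun u => F (mode k (a i) u) = mode k (α i) (F u))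
    (fun f => ?_) (fun u v hu hv => by rw [map_add, map_add, hu, hv, map_add, map_add])
    (fun y u hu => ?_) u
  · have e := h0.α_f i f k (-1) 1
    rw [mode_vac_neg_one, mode_vac_of_nonneg (Int.natCast_nonneg k) (a i), map_zero, zero_add,
      Subst.pull_id, Subst.pull_id] at e
    have e' := h.α_f i f k (-1) 1
    rw [mode_vac_neg_one, mode_vac_of_nonneg (Int.natCast_nonneg k) (α i), map_zero, zero_add] at e'
    rw [hf, e, e', hF, ← fn_one, hf, map_one]
  · rcases y with (⟨j, l⟩ | ⟨j, l⟩) | (⟨j, l⟩ | ⟨j, l⟩)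
    · change F (mode _ _ (bos _ * _)) = mode _ _ (F (bos _ * _))
      have e := h0.α_f i (coord j) k (-1 - (l + 1)) u
      have e' := h.α_f i (coord j) k (-1 - (l + 1)) (F u)
      rw [Subst.pull_id, Subst.pull_id] at e
      rw [← mode_coord_neg, e, map_add, hF, hF, hF, hu, ← e']
    · change F (mode _ _ (bos _ * _)) = mode _ _ (F (bos _ * _))
      rw [← mode_a_neg, h0.α_α, mode_a_neg, mode_a_neg, hb, hb, hu]
      exact (h.α_α _ _ _ _ _).symm
    · change F (mode _ _ (fer _ * _)) = mode _ _ (F (fer _ * _))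
      rw [← mode_phi_neg, h0.α_φ, mode_phi_neg, mode_phi_neg, hr, hr, hu]
      exact (h.α_φ _ _ _ _ _).symm
    · change F (mode _ _ (fer _ * _)) = mode _ _ (F (fer _ * _))
      rw [← mode_psi_neg, h0.α_ψ, mode_psi_neg, mode_psi_neg, hr, hr, hu]
      exact (h.α_ψ _ _ _ _ _).symm

theorem map_mode_φ (h : IsSystem g α φ ψ) (hf : ∀ f, F (fn f) = fn (g.pull f))
    (hb : ∀ x u, F (bos x * u) = creBos g α x (F u)) (hr : ∀ x u, F (fer x * u) = creFer φ ψ x (F u))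
    (i : Fin M) (n : ℤ) (u : Fock N M) : F (mode n (phi i) u) = mode n (φ i) (F u) := by
  have h0 := isSystem_base (N := N) (M := M)
  have hF := map_mode_fn h hf hb hr
  rcases int_cases n with ⟨k, rfl⟩ | ⟨k, rfl⟩
  · rw [mode_phi_neg, hr]; rfl
  refine gen_induction (P := fun u => F (mode k (phi i) u) = mode k (φ i) (F u))
    (fun f => ?_) (fun u v hu hv => by rw [map_add, map_add, hu, hv, map_add, map_add])
    (fun y u hu => ?_) u
  · have e := h0.φ_f i f k (-1) 1
    rw [mode_vac_neg_one, mode_vac_of_nonneg (Int.natCast_nonneg k) (phi i), map_zero, Subst.pull_id] at e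
    have e' := h.φ_f i f k (-1) 1
    rw [mode_vac_neg_one, mode_vac_of_nonneg (Int.natCast_nonneg k) (φ i), map_zero] at e'
    rw [hf, e, e', map_zero]
  · rcases y with (⟨j, l⟩ | ⟨j, l⟩) | (⟨j, l⟩ | ⟨j, l⟩)
    · change F (mode _ _ (bos _ * _)) = mode _ _ (F (bos _ * _))
      have e := h0.φ_f i (coord j) k (-1 - (l + 1)) u
      have e' := h.φ_f i (coord j) k (-1 - (l + 1)) (F u)
      rw [Subst.pull_id] at e
      rw [← mode_coord_neg, e, hF, hF, hu, ← e']
    · change F (mode _ _ (bos _ * _)) = mode _ _ (F (bos _ * _))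
      rw [← mode_a_neg, ← h0.α_φ, mode_a_neg, mode_a_neg, hb, hb, hu]
      exact h.α_φ _ _ _ _ _
    · change F (mode _ _ (fer _ * _)) = mode _ _ (F (fer _ * _))
      rw [← mode_phi_neg, h0.φ_φ, mode_phi_neg, mode_phi_neg, map_neg, hr, hr, hu]
      exact (h.φ_φ _ _ _ _ _).symm
    · change F (mode _ _ (fer _ * _)) = mode _ _ (F (fer _ * _))
      rw [← mode_psi_neg, h0.φ_ψ, mode_psi_neg, mode_psi_neg, map_add, map_neg, hr, hr, hu]
      refine Eq.trans ?_ (h.φ_ψ _ _ _ _ _).symm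
      split_ifs
      · rfl
      · rw [map_zero]; rfl

theorem map_mode_ψ (h : IsSystem g α φ ψ) (hf : ∀ f, F (fn f) = fn (g.pull f))
    (hb : ∀ x u, F (bos x * u) = creBos g α x (F u)) (hr : ∀ x u, F (fer x * u) = creFer φ ψ x (F u))
    (i : Fin M) (n : ℤ) (u : Fock N M) : F (mode n (psi i) u) = mode n (ψ i) (F u) := by
  have h0 := isSystem_base (N := N) (M := M)
  have hF := map_mode_fn h hf hb hr
  rcases int_cases n with ⟨k, rfl⟩ | ⟨k, rfl⟩
  · rw [mode_psi_neg, hr]; rfl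
  refine gen_induction (P := fun u => F (mode k (psi i) u) = mode k (ψ i) (F u))
    (fun f => ?_) (fun u v hu hv => by rw [map_add, map_add, hu, hv, map_add, map_add])
    (fun y u hu => ?_) u
  · have e := h0.ψ_f i f k (-1) 1
    rw [mode_vac_neg_one, mode_vac_of_nonneg (Int.natCast_nonneg k) (psi i), map_zero, Subst.pull_id] at e
    have e' := h.ψ_f i f k (-1) 1
    rw [mode_vac_neg_one, mode_vac_of_nonneg (Int.natCast_nonneg k) (ψ i), map_zero] at e'
    rw [hf, e, e', map_zero]
  · rcases y with (⟨j, l⟩ | ⟨j, l⟩) | (⟨j, l⟩ | ⟨j, l⟩)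
    · change F (mode _ _ (bos _ * _)) = mode _ _ (F (bos _ * _))
      have e := h0.ψ_f i (coord j) k (-1 - (l + 1)) u
      have e' := h.ψ_f i (coord j) k (-1 - (l + 1)) (F u)
      rw [Subst.pull_id] at e
      rw [← mode_coord_neg, e, hF, hF, hu, ← e']
    · change F (mode _ _ (bos _ * _)) = mode _ _ (F (bos _ * _))
      rw [← mode_a_neg, ← h0.α_ψ, mode_a_neg, mode_a_neg, hb, hb, hu]
      exact h.α_ψ _ _ _ _ _
    · change F (mode _ _ (fer _ * _)) = mode _ _ (F (fer _ * _))
      rw [← mode_phi_neg, h0.ψ_φ, mode_phi_neg, mode_phi_neg, map_add, map_neg, hr, hr, hu]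
      refine Eq.trans ?_ (h.ψ_φ _ _ _ _ _).symm
      split_ifs
      · rfl
      · rw [map_zero]; rfl
    · change F (mode _ _ (fer _ * _)) = mode _ _ (F (fer _ * _))
      rw [← mode_psi_neg, h0.ψ_ψ, mode_psi_neg, mode_psi_neg, map_neg, hr, hr, hu]
      exact (h.ψ_ψ _ _ _ _ _).symm

/-- A system of states with the operator products of the generating fields is the image of the
generating states under an endomorphism. -/
theorem exists_isVHom (h : IsSystem g α φ ψ) : ∃ F : Fock N M →ₗ[ℂ] Fock N M, IsVHom F ∧
    (∀ f, F (fn f) = fn (g.pull f)) ∧ (∀ i, F (a i) = α i) ∧ (∀ j, F (phi j) = φ j) ∧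
    ∀ j, F (psi j) = ψ j := by
  obtain ⟨F, hf, hb, hr⟩ := exists_linearMap h
  have hF := map_mode_fn h hf hb hr
  have hα := map_mode_α h hf hb hr
  have hφ := map_mode_φ h hf hb hr
  have hψ := map_mode_ψ h hf hb hr
  have h1 : F 1 = 1 := by rw [← fn_one, hf, map_one]
  have ha : ∀ i, F (a i) = α i := fun i => by
    rw [← mode_vac_neg_one (a i), hα, h1, mode_vac_neg_one]
  have hphi : ∀ i, F (phi i) = φ i := fun i => by
    rw [← mode_vac_neg_one (phi i), hφ, h1, mode_vac_neg_one]
  have hpsi : ∀ i, F (psi i) = ψ i := fun i => by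
    rw [← mode_vac_neg_one (psi i), hψ, h1, mode_vac_neg_one]
  have hgen : ∀ (y : Gen N M) n u, F (mode n (gen y) u) = mode n (F (gen y)) (F u) := by
    refine gen_rec (P := fun y => ∀ n u, F (mode n (gen y) u) = mode n (F (gen y)) (F u))
      (fun i n u => ?_) (fun i n u => ?_) (fun i n u => ?_) (fun i n u => ?_)
      (fun y y' c hc _ h2 ih n u => ?_)
    · change F (mode n (a i) u) = mode n (F (a i)) (F u)
      rw [ha, hα]
    · change F (mode n (b' i) u) = mode n (F (b' i)) (F u)
      have e : F (b' i) = transl (fn (g.comp i)) := by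
        rw [← transl_coord, transl_eq_mode, hF, h1, ← transl_eq_mode, Subst.pull_coord]
      rw [mode_b', map_smul, hF, e, mode_transl, Subst.pull_coord]
    · change F (mode n (phi i) u) = mode n (F (phi i)) (F u)
      rw [hphi, hφ]
    · change F (mode n (psi i) u) = mode n (F (psi i)) (F u)
      rw [hpsi, hψ]
    · have h3 : (gen y' : Fock N M) = c⁻¹ • transl (gen y) := by
        rw [h2, smul_smul, inv_mul_cancel₀ hc, one_smul]
      have h4 : F (transl (gen y)) = transl (F (gen y)) := by
        rw [transl_eq_mode, ih, h1, ← transl_eq_mode]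
      rw [h3, map_smul, map_smul, map_smul, h4, LinearMap.smul_apply, LinearMap.smul_apply, map_smul,
        mode_transl, mode_transl, map_smul, ih]
  have hmul : ∀ (y : Gen N M) u, F (gen y * u) = mode (-1) (F (gen y)) (F u) := fun y u => by
    rw [← hgen]
    congr 1
    have := mode_gen_neg 0 y u
    simp only [Nat.cast_zero, sub_zero, Td_zero, Module.End.one_apply] at this
    exact this.symm
  have hhom : ∀ y : Gen N M, IsHom y.isRight (F (gen y)) := by
    refine gen_rec (P := fun y => IsHom y.isRight (F (gen y)))
      (fun i => ?_) (fun i => ?_) (fun i => ?_) (fun i => ?_) (fun y y' c hc hy h2 ih => ?_)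
    · change IsHom false (F (a i)); rw [ha]; exact h.hom_α i
    · change IsHom false (F (b' i))
      rw [← transl_coord, transl_eq_mode, hF, h1, ← transl_eq_mode]
      exact (isHom_fn _).transl
    · change IsHom true (F (phi i)); rw [hphi]; exact h.hom_φ i
    · change IsHom true (F (psi i)); rw [hpsi]; exact h.hom_ψ i
    · have h3 : (gen y' : Fock N M) = c⁻¹ • transl (gen y) := by
        rw [h2, smul_smul, inv_mul_cancel₀ hc, one_smul]
      have h4 : F (transl (gen y)) = transl (F (gen y)) := by
        rw [transl_eq_mode, hgen, h1, ← transl_eq_mode]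
      have h5 := ih.transl
      rw [hy, h3, map_smul, h4, IsHom, map_smul, h5, smul_comm]
  have hom : ∀ {b : Bool} {u : Fock N M}, IsHom b u → IsHom b (F u) := by
    intro b u hu
    refine hom_induction (P := fun b u => IsHom b (F u)) (fun f => ?_) ?_ (fun b u v hu hv => ?_)
      (fun b y u _ hu => ?_) hu
    · rw [hf]; exact isHom_fn _
    · rw [map_zero]; exact IsHom.zero _
    · rw [map_add]; exact hu.add hv
    · rw [hmul]; exact (hhom y).mode hu (-1)
  refine ⟨F, ⟨h1, fun u => ?_, fun n u v => ?_⟩, hf, ha, hphi, hpsi⟩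
  · refine isHom_induction (P := fun u => F (parity u) = parity (F u)) (fun u v hu hv => ?_)
      (fun b u hu => ?_) u
    · rw [map_add, map_add, hu, hv, map_add, map_add]
    · rw [hu, map_smul, hom hu]
  · refine isHom_induction (P := fun u => ∀ v, F (mode n u v) = mode n (F u) (F v))
      (fun u w hu hw v => ?_) (fun b u hu v => ?_) u v
    · rw [map_add, map_add, LinearMap.add_apply, map_add, hu, hw, map_add, LinearMap.add_apply]
    · refine (hom_induction (P := fun b u => IsHom b u ∧ ∀ n v, F (mode n u v) = mode n (F u) (F v))
        (fun f => ⟨isHom_fn f, fun n v => ?_⟩) ⟨IsHom.zero _, fun n v => by simp⟩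
        (fun b u w hu hw => ⟨hu.1.add hw.1, fun n v => ?_⟩)
        (fun b y u hu h2 => ⟨(isHom_gen y).mul hu, fun n v => ?_⟩) hu).2 n v
      · rw [hF, hf]
      · rw [map_add, map_add, LinearMap.add_apply, map_add, hu.2, hw.2, map_add, LinearMap.add_apply]
      · have e := (isProd_gen_mul y hu).intertwine (ε := 1) (δ := 1) (S := F)
          (fun n v => by rw [one_smul]; exact hgen y n v) (fun n v => by rw [one_smul]; exact h2.2 n v)
          (isProd_mode (hhom y) (hom hu)) n v
        rw [one_mul, one_smul] at e
        rw [e, hmul]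

end IsSystem

/-- Wick's theorem with at most two contractions. -/
theorem mode_gen_mul_of_eq_zero {n : ℤ} {y : Gen N M} {u v : Fock N M} (hu : ∀ m > n, mode m u v = 0)
    (hs : ∀ s : ℕ, ann y (s + 2) v = 0) : mode n (gen y * u) v = gen y * mode n u v
      + mode (n - 1) (parityPow y.isRight u) (ann y 0 v)
      + mode (n - 2) (parityPow y.isRight u) (ann y 1 v) := by
  obtain ⟨B, hB⟩ := exists_mode_gen_mul n y u v
  rw [hB (B + 2) (by omega), Finset.sum_range_succ', Finset.sum_range_succ', Finset.sum_range_succ',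
    Finset.sum_range_succ']
  rw [sum_eq_zero (fun i _ => by rw [hu _ (by push_cast; omega), mul_zero]),
    sum_eq_zero (fun s _ => by rw [hs, map_zero]), hu _ (by push_cast; omega)]
  simp only [mul_zero, zero_add, Nat.cast_zero, Td_zero, Module.End.one_apply, add_zero, sub_zero,
    Nat.cast_one]
  rw [show n - 1 - 1 = n - 2 by ring]
  abel

theorem mode_a_mul {n : ℤ} {k : Fin N} {u v : Fock N M} (hu : ∀ m > n, mode m u v = 0)
    (hs : ∀ s : ℕ, dB k (s + 2) v = 0) : mode n (a k * u) v = a k * mode n u v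
      + mode (n - 1) u (dB k 0 v) + mode (n - 2) u (dB k 1 v) := by
  refine (mode_gen_mul_of_eq_zero (y := Sum.inl (BosGen.a k 0)) hu
    (fun s => by simp [ann, hs])).trans ?_
  simp [ann, parityPow, gen, a]

theorem mode_b'_mul {n : ℤ} {k : Fin N} {u v : Fock N M} (hu : ∀ m > n, mode m u v = 0)
    (hs : ∀ s : ℕ, dA k (s + 1) v = 0) : mode n (b' k * u) v = b' k * mode n u v
      + mode (n - 2) u (dA k 0 v) := by
  refine (mode_gen_mul_of_eq_zero (y := Sum.inl (BosGen.b k 0)) hu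
    (fun s => by simp [ann, hs])).trans ?_
  simp [ann, parityPow, gen, b']

theorem mode_phi_mul {n : ℤ} {q : Fin M} {u v : Fock N M} (hu : ∀ m > n, mode m u v = 0)
    (hs : ∀ s : ℕ, dL (FerGen.psi q (s + 1)) v = 0) : mode n (phi q * u) v = phi q * mode n u v
      + mode (n - 1) (parity u) (dL (FerGen.psi q 0) v) := by
  refine (mode_gen_mul_of_eq_zero (y := Sum.inr (FerGen.phi q 0)) hu
    (fun s => by simp [ann, hs])).trans ?_
  simp [ann, parityPow, gen, phi, hs 0]

theorem mode_psi_mul {n : ℤ} {q : Fin M} {u v : Fock N M} (hu : ∀ m > n, mode m u v = 0)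
    (hs : ∀ s : ℕ, dL (FerGen.phi q (s + 1)) v = 0) : mode n (psi q * u) v = psi q * mode n u v
      + mode (n - 1) (parity u) (dL (FerGen.phi q 0) v) := by
  refine (mode_gen_mul_of_eq_zero (y := Sum.inr (FerGen.psi q 0)) hu
    (fun s => by simp [ann, hs])).trans ?_
  simp [ann, parityPow, gen, psi, hs 0]

section

variable {f : Ohat N} {v : Fock N M}

theorem mode_fn_neg_one (h : ∀ i m, dA i m v = 0) : mode (-1) (fn f) v = fn f * v := by
  rw [mode_fn_of_dA _ _ h]; simp [Td_zero]

theorem mode_fn_neg_two (h : ∀ i m, dA i m v = 0) : mode (-2) (fn f) v = transl (fn f) * v := by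
  rw [mode_fn_of_dA _ _ h]
  norm_num [Td_one_apply]

theorem mode_fn_natCast (h : ∀ i m, dA i m v = 0) {n : ℤ} (hn : 0 ≤ n) : mode n (fn f) v = 0 := by
  rw [mode_fn_of_dA _ _ h, Td_of_neg (by omega)]; simp

end

theorem dA_bos_b_mul (i k : Fin N) (m s : ℕ) (u : Fock N M) :
    dA i m (bos (BosGen.b k s) * u) = bos (BosGen.b k s) * dA i m u := by
  rw [dA_bos_mul]; simp
theorem dA_a_mul (i k : Fin N) (u : Fock N M) :
    dA i 0 (a k * u) = a k * dA i 0 u + if k = i then u else 0 := by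
  rw [a, dA_bos_mul]; simp
theorem dA_succ_a_mul (i k : Fin N) (m : ℕ) (u : Fock N M) :
    dA i (m + 1) (a k * u) = a k * dA i (m + 1) u := by
  rw [a, dA_bos_mul]; simp
theorem dB_a_mul (i k : Fin N) (m : ℕ) (u : Fock N M) : dB i m (a k * u) = a k * dB i m u := by
  cases m
  · exact dB_zero_bos_mul _ _ _
  · rw [a, dB_succ_bos_mul]; simp
theorem dB_zero_b'_mul (i k : Fin N) (u : Fock N M) : dB i 0 (b' k * u) = b' k * dB i 0 u :=
  dB_zero_bos_mul _ _ _
theorem dB_one_b'_mul (i k : Fin N) (u : Fock N M) :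
    dB i 1 (b' k * u) = b' k * dB i 1 u + if k = i then u else 0 := by
  rw [b', dB_succ_bos_mul]; simp
theorem dB_succ_b'_mul (i k : Fin N) (m : ℕ) (u : Fock N M) :
    dB i (m + 2) (b' k * u) = b' k * dB i (m + 2) u := by
  rw [b', dB_succ_bos_mul]; simp
theorem dL_phi_phi_mul (p q : Fin M) (u : Fock N M) : dL (FerGen.phi p 0) (phi q * u)
    = -(phi q * dL (FerGen.phi p 0) u) + if q = p then u else 0 := by
  rw [phi, dL_fer_mul]; simp
theorem dL_succ_phi_mul (p q : Fin M) (s : ℕ) (u : Fock N M) : dL (FerGen.phi p (s + 1)) (phi q * u)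
    = -(phi q * dL (FerGen.phi p (s + 1)) u) := by
  rw [phi, dL_fer_mul]; simp
theorem dL_phi_psi_mul (p q : Fin M) (s : ℕ) (u : Fock N M) : dL (FerGen.phi p s) (psi q * u)
    = -(psi q * dL (FerGen.phi p s) u) := by
  rw [psi, dL_fer_mul]; simp
theorem dL_psi_psi_mul (p q : Fin M) (u : Fock N M) : dL (FerGen.psi p 0) (psi q * u)
    = -(psi q * dL (FerGen.psi p 0) u) + if q = p then u else 0 := by
  rw [psi, dL_fer_mul]; simp
theorem dL_succ_psi_mul (p q : Fin M) (s : ℕ) (u : Fock N M) : dL (FerGen.psi p (s + 1)) (psi q * u)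
    = -(psi q * dL (FerGen.psi p (s + 1)) u) := by
  rw [psi, dL_fer_mul]; simp
theorem dL_psi_phi_mul (p q : Fin M) (s : ℕ) (u : Fock N M) : dL (FerGen.psi p s) (phi q * u)
    = -(phi q * dL (FerGen.psi p s) u) := by
  rw [phi, dL_fer_mul]; simp
theorem dL_a_mul (x : FerGen M) (k : Fin N) (u : Fock N M) : dL x (a k * u) = a k * dL x u :=
  dL_bos_mul _ _ _
theorem dL_b'_mul (x : FerGen M) (k : Fin N) (u : Fock N M) : dL x (b' k * u) = b' k * dL x u :=
  dL_bos_mul _ _ _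
theorem dA_b'_mul (i k : Fin N) (m : ℕ) (u : Fock N M) : dA i m (b' k * u) = b' k * dA i m u :=
  dA_bos_b_mul _ _ _ _ _
theorem dA_phi_mul (i : Fin N) (m : ℕ) (q : Fin M) (u : Fock N M) :
    dA i m (phi q * u) = phi q * dA i m u := dA_fer_mul _ _ _ _
theorem dA_psi_mul (i : Fin N) (m : ℕ) (q : Fin M) (u : Fock N M) :
    dA i m (psi q * u) = psi q * dA i m u := dA_fer_mul _ _ _ _
theorem dB_phi_mul (i : Fin N) (m : ℕ) (q : Fin M) (u : Fock N M) :
    dB i m (phi q * u) = phi q * dB i m u := dB_fer_mul _ _ _ _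
theorem dB_psi_mul (i : Fin N) (m : ℕ) (q : Fin M) (u : Fock N M) :
    dB i m (psi q * u) = psi q * dB i m u := dB_fer_mul _ _ _ _
theorem dB_one_fn (i : Fin N) (f : Ohat N) : dB i 1 (fn f : Fock N M) = 0 := dB_succ_fn i 0 f
theorem parity_phi_mul (q : Fin M) (u : Fock N M) : parity (phi q * u) = -(phi q * parity u) :=
  parity_mulFer_apply _ _
theorem parity_psi_mul (q : Fin M) (u : Fock N M) : parity (psi q * u) = -(psi q * parity u) :=
  parity_mulFer_apply _ _

/-- Modes of functions on a state without modes of the fields `a`. -/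
theorem dA_phi_fn (i : Fin N) (m : ℕ) (q : Fin M) (f : Ohat N) : dA i m (phi q * fn f : Fock N M) = 0 := by
  rw [dA_phi_mul, dA_fn, mul_zero]
theorem dA_psi_fn (i : Fin N) (m : ℕ) (q : Fin M) (f : Ohat N) : dA i m (psi q * fn f : Fock N M) = 0 := by
  rw [dA_psi_mul, dA_fn, mul_zero]
theorem dA_b'_fn (i : Fin N) (m : ℕ) (k : Fin N) (f : Ohat N) : dA i m (b' k * fn f : Fock N M) = 0 := by
  rw [dA_b'_mul, dA_fn, mul_zero]
theorem dA_psi_phi_fn (i : Fin N) (m : ℕ) (p q : Fin M) (f : Ohat N) :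
    dA i m (psi p * (phi q * fn f) : Fock N M) = 0 := by
  rw [dA_psi_mul, dA_phi_fn, mul_zero]

theorem mode_fn_a_fn (n : ℤ) (f f' : Ohat N) (l : Fin N) : mode n (fn f) (a l * fn f' : Fock N M)
    = a l * mode n (fn f) (fn f') - mode (n - 1) (fn (pd l f)) (fn f') := by
  have h := mode_fn_a_mul (M := M) n f l 0 (fn f')
  rw [Nat.cast_zero, sub_zero] at h
  exact h

/-! ### Products of the states `a f`, `b' f`, `φ f`, `ψ f`, `ψ φ f` -/

theorem neg_one_a_fn (k : Fin N) (f f' : Ohat N) : mode (-1) (a k * fn f) (fn f' : Fock N M)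
    = a k * fn (f * f') + transl (fn f) * fn (pd k f') := by
  rw [mode_a_mul (fun m hm => mode_fn_natCast (fun i m => dA_fn i m f') (by omega))
    (fun s => dB_succ_fn _ _ _), dB_one_fn, map_zero, dB_zero_fn, mode_fn_neg_one (fun i m => dA_fn i m _)]
  rw [show (-1 - 1 : ℤ) = -2 by norm_num, mode_fn_neg_two (fun i m => dA_fn i m _), fn_mul, add_zero]

theorem prod_a_fn (n : ℕ) (k : Fin N) (f f' : Ohat N) : mode n (a k * fn f) (fn f' : Fock N M)
    = if n = 0 then fn (f * pd k f') else 0 := by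
  rw [mode_a_mul (fun m hm => mode_fn_natCast (fun i m => dA_fn i m f') (by omega))
    (fun s => dB_succ_fn _ _ _), dB_one_fn, map_zero, dB_zero_fn,
    mode_fn_natCast (fun i m => dA_fn i m f') (by omega), mul_zero, zero_add, add_zero]
  rcases n with _ | n
  · rw [if_pos rfl, fn_mul]
    exact mode_fn_neg_one (fun i m => dA_fn i m _)
  · rw [if_neg (by omega)]
    exact mode_fn_natCast (fun i m => dA_fn i m _) (by push_cast; omega)

/-- The modes `0`, `1` and higher of a state. -/
def threeCases (n : ℕ) (x y : Fock N M) : Fock N M := if n = 0 then x else if n = 1 then y else 0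

theorem threeCases_zero (x y : Fock N M) : threeCases 0 x y = x := rfl
theorem threeCases_one (x y : Fock N M) : threeCases (0 + 1) x y = y := rfl
theorem threeCases_add_two (n : ℕ) (x y : Fock N M) : threeCases (n + 1 + 1) x y = 0 := by
  simp [threeCases]

theorem prod_a_a (n : ℕ) (k l : Fin N) (f f' : Ohat N) : mode n (a k * fn f) (a l * fn f' : Fock N M)
    = threeCases n (a l * fn (f * pd k f') - a k * fn (pd l f * f')
        - transl (fn (pd l f)) * fn (pd k f')) (-fn (pd l f * pd k f')) := by
  have h0 : ∀ m : ℤ, 0 < m → ∀ f'', mode m (fn f) (a l * fn f'' : Fock N M) = 0 := fun m hm f'' => by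
    rw [mode_fn_a_fn, mode_fn_natCast (fun i m => dA_fn i m _) (by omega),
      mode_fn_natCast (fun i m => dA_fn i m _) (by omega), mul_zero, sub_zero]
  rw [mode_a_mul (fun m hm => h0 m (by omega) _)
    (fun s => by rw [dB_a_mul, dB_succ_fn, mul_zero]), dB_a_mul, dB_a_mul, dB_one_fn, mul_zero,
    map_zero, dB_zero_fn, add_zero]
  rcases n with _ | _ | n
  · rw [threeCases_zero]
    rw [mode_fn_a_fn, mode_fn_a_fn, mode_fn_natCast (fun i m => dA_fn i m _) (by simp)]
    norm_num only [Nat.cast_zero]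
    rw [mode_fn_neg_one (fun i m => dA_fn i m _), mode_fn_neg_one (fun i m => dA_fn i m _),
      mode_fn_neg_two (fun i m => dA_fn i m _), ← fn_mul, ← fn_mul, mul_sub, mul_zero, mul_zero]
    abel
  · rw [threeCases_one, h0 _ (by norm_num), mode_fn_a_fn,
      mode_fn_natCast (fun i m => dA_fn i m _) (by simp)]
    norm_num only [Nat.cast_one]
    rw [mode_fn_neg_one (fun i m => dA_fn i m _), ← fn_mul, mul_zero, mul_zero, zero_add, zero_sub]
  · rw [threeCases_add_two, h0 _ (by push_cast; omega),
      h0 _ (by push_cast; omega), mul_zero, add_zero]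

theorem prod_a_b (n : ℕ) (k l : Fin N) (f f' : Ohat N) : mode n (a k * fn f) (b' l * fn f' : Fock N M)
    = threeCases n (b' l * fn (f * pd k f') + if l = k then transl (fn f) * fn f' else 0)
        (if l = k then fn (f * f') else 0) := by
  rw [mode_a_mul (fun m hm => mode_fn_natCast (fun i m => dA_b'_fn i m l f') (by omega))
    (fun s => by rw [dB_succ_b'_mul, dB_succ_fn, mul_zero]), dB_one_b'_mul, dB_one_fn, dB_zero_b'_mul,
    dB_zero_fn, mode_fn_natCast (fun i m => dA_b'_fn i m l f') (by omega), mul_zero, mul_zero, zero_add,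
    zero_add]
  have hd : ∀ i m, dA i m (if l = k then fn f' else 0 : Fock N M) = 0 := fun i m => by
    split_ifs
    · exact dA_fn _ _ _
    · exact map_zero _
  rcases n with _ | _ | n
  · rw [threeCases_zero]
    norm_num only [Nat.cast_zero]
    rw [mode_fn_neg_one (fun i m => dA_b'_fn i m _ _), mode_fn_neg_two hd, fn_mul_comm, mul_assoc,
      fn_mul, fn_mul_comm f]
    split_ifs <;> simp
  · rw [threeCases_one,
      mode_fn_natCast (fun i m => dA_b'_fn i m _ _) (by simp), zero_add]
    norm_num only [Nat.cast_one]
    rw [mode_fn_neg_one hd, fn_mul]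
    split_ifs <;> simp
  · rw [threeCases_add_two, mode_fn_natCast hd (by push_cast; omega),
      mode_fn_natCast (fun i m => dA_b'_fn i m _ _) (by push_cast; omega), add_zero]

theorem prod_b_a (n : ℕ) (k l : Fin N) (f f' : Ohat N) : mode n (b' k * fn f) (a l * fn f' : Fock N M)
    = threeCases n ((if l = k then transl (fn f) * fn f' else 0) - b' k * fn (pd l f * f'))
        (if l = k then fn (f * f') else 0) := by
  have h0 : ∀ m : ℤ, 0 < m → ∀ f'', mode m (fn f) (a l * fn f'' : Fock N M) = 0 := fun m hm f'' => by
    rw [mode_fn_a_fn, mode_fn_natCast (fun i m => dA_fn i m _) (by omega),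
      mode_fn_natCast (fun i m => dA_fn i m _) (by omega), mul_zero, sub_zero]
  rw [mode_b'_mul (fun m hm => h0 m (by omega) _)
    (fun s => by rw [dA_succ_a_mul, dA_fn, mul_zero]), dA_a_mul, dA_fn, mul_zero, zero_add]
  have hd : ∀ i m, dA i m (if l = k then fn f' else 0 : Fock N M) = 0 := fun i m => by
    split_ifs
    · exact dA_fn _ _ _
    · exact map_zero _
  rcases n with _ | _ | n
  · rw [threeCases_zero]
    rw [mode_fn_a_fn, mode_fn_natCast (fun i m => dA_fn i m _) (by simp)]
    norm_num only [Nat.cast_zero]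
    rw [mode_fn_neg_one (fun i m => dA_fn i m _), mode_fn_neg_two hd, ← fn_mul, mul_zero, zero_sub,
      mul_neg]
    split_ifs <;> simp [sub_eq_add_neg, add_comm]
  · rw [threeCases_one, h0 _ (by norm_num), mul_zero, zero_add]
    norm_num only [Nat.cast_one]
    rw [mode_fn_neg_one hd, fn_mul]
    split_ifs <;> simp
  · rw [threeCases_add_two, h0 _ (by push_cast; omega),
      mode_fn_natCast hd (by push_cast; omega), mul_zero, add_zero]

/-- A state `b' f` has trivial products with the states without modes of the fields `a`. -/
theorem prod_b_of_dA (n : ℕ) (k : Fin N) (f : Ohat N) {v : Fock N M} (h : ∀ i m, dA i m v = 0) :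
    mode n (b' k * fn f) v = 0 := by
  rw [mode_b'_mul (fun m hm => mode_fn_natCast h (by omega)) (fun s => h _ _), h,
    mode_fn_natCast h (by omega)]
  simp

/-- The products of a state `a f` with a state with constant fermionic factor. -/
theorem prod_a_of_dA (n : ℕ) (k : Fin N) (f f' : Ohat N) {v : Fock N M} (hA : ∀ f i m, dA i m (v * fn f) = 0)
    (hB : ∀ m f, dB k m (v * fn f) = v * dB k m (fn f)) :
    mode n (a k * fn f) (v * fn f') = if n = 0 then v * fn (f * pd k f') else 0 := by
  rw [mode_a_mul (fun m hm => mode_fn_natCast (hA _) (by omega))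
    (fun s => by rw [hB, dB_succ_fn, mul_zero]), hB, hB, dB_one_fn, dB_zero_fn,
    mode_fn_natCast (hA _) (by omega), mul_zero, mul_zero, map_zero, zero_add, add_zero]
  rcases n with _ | n
  · rw [if_pos rfl]
    norm_num only [Nat.cast_zero]
    rw [mode_fn_neg_one (hA _), fn_mul_comm, mul_assoc, fn_mul, fn_mul_comm f]
  · rw [if_neg (by omega)]
    exact mode_fn_natCast (hA _) (by push_cast; omega)

theorem prod_a_phi (n : ℕ) (k : Fin N) (q : Fin M) (f f' : Ohat N) :
    mode n (a k * fn f) (phi q * fn f' : Fock N M) = if n = 0 then phi q * fn (f * pd k f') else 0 :=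
  prod_a_of_dA n k f f' (fun f i m => dA_phi_fn i m q f) (fun _ _ => dB_phi_mul _ _ _ _)

theorem prod_a_psi (n : ℕ) (k : Fin N) (q : Fin M) (f f' : Ohat N) :
    mode n (a k * fn f) (psi q * fn f' : Fock N M) = if n = 0 then psi q * fn (f * pd k f') else 0 :=
  prod_a_of_dA n k f f' (fun f i m => dA_psi_fn i m q f) (fun _ _ => dB_psi_mul _ _ _ _)

theorem prod_a_psi_phi (n : ℕ) (k : Fin N) (p q : Fin M) (f f' : Ohat N) :
    mode n (a k * fn f) (psi p * (phi q * fn f') : Fock N M)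
      = if n = 0 then psi p * (phi q * fn (f * pd k f')) else 0 := by
  simp only [← mul_assoc]
  exact prod_a_of_dA n k f f' (fun f i m => by rw [mul_assoc, dA_psi_phi_fn])
    (fun m f => by rw [mul_assoc, dB_psi_mul, dB_phi_mul, mul_assoc])

/-- `φ f` acts by contraction. -/
theorem mode_phi_fn_of_dA {n : ℤ} (q : Fin M) (f : Ohat N) {v : Fock N M} (hn : -1 ≤ n)
    (h : ∀ i m, dA i m v = 0) (hs : ∀ s : ℕ, dL (FerGen.psi q (s + 1)) v = 0) :
    mode n (phi q * fn f) v = phi q * mode n (fn f) v + mode (n - 1) (fn f) (dL (FerGen.psi q 0) v) := by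
  rw [mode_phi_mul (fun m hm => mode_fn_natCast h (by omega)) hs, parity_fn]

theorem mode_psi_fn_of_dA {n : ℤ} (q : Fin M) (f : Ohat N) {v : Fock N M} (hn : -1 ≤ n)
    (h : ∀ i m, dA i m v = 0) (hs : ∀ s : ℕ, dL (FerGen.phi q (s + 1)) v = 0) :
    mode n (psi q * fn f) v = psi q * mode n (fn f) v + mode (n - 1) (fn f) (dL (FerGen.phi q 0) v) := by
  rw [mode_psi_mul (fun m hm => mode_fn_natCast h (by omega)) hs, parity_fn]

theorem neg_one_phi_fn (q : Fin M) (f f' : Ohat N) :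
    mode (-1) (phi q * fn f) (fn f' : Fock N M) = phi q * fn (f * f') := by
  rw [mode_phi_fn_of_dA _ _ le_rfl (fun i m => dA_fn i m _) (fun s => dL_fn _ _), dL_fn, map_zero,
    mode_fn_neg_one (fun i m => dA_fn i m _), fn_mul, add_zero]

theorem neg_one_psi_fn (q : Fin M) (f f' : Ohat N) :
    mode (-1) (psi q * fn f) (fn f' : Fock N M) = psi q * fn (f * f') := by
  rw [mode_psi_fn_of_dA _ _ le_rfl (fun i m => dA_fn i m _) (fun s => dL_fn _ _), dL_fn, map_zero,
    mode_fn_neg_one (fun i m => dA_fn i m _), fn_mul, add_zero]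

theorem neg_one_psi_phi_fn (p q : Fin M) (f f' : Ohat N) :
    mode (-1) (psi p * fn f) (phi q * fn f' : Fock N M) = psi p * (phi q * fn (f * f'))
      + if q = p then transl (fn f) * fn f' else 0 := by
  rw [mode_psi_fn_of_dA _ _ le_rfl (fun i m => dA_phi_fn i m _ _)
    (fun s => by rw [dL_succ_phi_mul, dL_fn]; simp), dL_phi_phi_mul, dL_fn,
    mode_fn_neg_one (fun i m => dA_phi_fn i m _ _), fn_mul_comm f, mul_assoc, ← fn_mul, mul_comm f']
  norm_num only
  split_ifs
  · rw [mul_zero, neg_zero, zero_add, mode_fn_neg_two (fun i m => dA_fn i m _)]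
  · simp

theorem prod_phi_fn (n : ℕ) (q : Fin M) (f f' : Ohat N) :
    mode n (phi q * fn f) (fn f' : Fock N M) = 0 := by
  rw [mode_phi_fn_of_dA _ _ (by omega) (fun i m => dA_fn i m _) (fun s => dL_fn _ _), dL_fn, map_zero,
    mode_fn_natCast (fun i m => dA_fn i m _) (by omega), mul_zero, add_zero]

theorem prod_psi_fn (n : ℕ) (q : Fin M) (f f' : Ohat N) :
    mode n (psi q * fn f) (fn f' : Fock N M) = 0 := by
  rw [mode_psi_fn_of_dA _ _ (by omega) (fun i m => dA_fn i m _) (fun s => dL_fn _ _), dL_fn, map_zero,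
    mode_fn_natCast (fun i m => dA_fn i m _) (by omega), mul_zero, add_zero]

theorem prod_phi_phi (n : ℕ) (q r : Fin M) (f f' : Ohat N) :
    mode n (phi q * fn f) (phi r * fn f' : Fock N M) = 0 := by
  have hL : ∀ s, dL (FerGen.psi q s) (phi r * fn f' : Fock N M) = 0 := fun s => by
    rw [dL_psi_phi_mul, dL_fn]; simp
  rw [mode_phi_fn_of_dA _ _ (by omega) (fun i m => dA_phi_fn i m _ _) (fun s => hL _), hL, map_zero,
    mode_fn_natCast (fun i m => dA_phi_fn i m _ _) (by omega), mul_zero, add_zero]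

theorem prod_psi_psi (n : ℕ) (q r : Fin M) (f f' : Ohat N) :
    mode n (psi q * fn f) (psi r * fn f' : Fock N M) = 0 := by
  have hL : ∀ s, dL (FerGen.phi q s) (psi r * fn f' : Fock N M) = 0 := fun s => by
    rw [dL_phi_psi_mul, dL_fn]; simp
  rw [mode_psi_fn_of_dA _ _ (by omega) (fun i m => dA_psi_fn i m _ _) (fun s => hL _), hL, map_zero,
    mode_fn_natCast (fun i m => dA_psi_fn i m _ _) (by omega), mul_zero, add_zero]

theorem prod_psi_phi (n : ℕ) (q r : Fin M) (f f' : Ohat N) :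
    mode n (psi q * fn f) (phi r * fn f' : Fock N M) = if n = 0 ∧ r = q then fn (f * f') else 0 := by
  rw [mode_psi_fn_of_dA _ _ (by omega) (fun i m => dA_phi_fn i m _ _)
    (fun s => by rw [dL_succ_phi_mul, dL_fn]; simp), dL_phi_phi_mul, dL_fn,
    mode_fn_natCast (fun i m => dA_phi_fn i m _ _) (by omega), mul_zero, mul_zero, neg_zero, zero_add,
    zero_add]
  by_cases h : r = q
  · rw [if_pos h]
    rcases n with _ | n
    · rw [if_pos ⟨rfl, h⟩, fn_mul]
      exact mode_fn_neg_one (fun i m => dA_fn i m _)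
    · rw [if_neg (by omega)]
      exact mode_fn_natCast (fun i m => dA_fn i m _) (by push_cast; omega)
  · rw [if_neg h, if_neg (fun h' => h h'.2), map_zero]

/-- A current `ψ φ f` applied to a state. -/
theorem mode_psi_phi_fn {n : ℤ} (p q : Fin M) (f : Ohat N) {v : Fock N M} (hn : 0 ≤ n)
    (hu : ∀ m > n, mode m (phi q * fn f) v = 0)
    (hs : ∀ s : ℕ, dL (FerGen.phi p (s + 1)) v = 0) :
    mode n (psi p * (phi q * fn f)) v = psi p * mode n (phi q * fn f) v
      - mode (n - 1) (phi q * fn f) (dL (FerGen.phi p 0) v) := by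
  rw [mode_psi_mul hu hs, parity_phi_mul, parity_fn, map_neg, LinearMap.neg_apply]
  exact (sub_eq_add_neg _ _).symm

theorem prod_psi_phi_fn (n : ℕ) (p q : Fin M) (f f' : Ohat N) :
    mode n (psi p * (phi q * fn f)) (fn f' : Fock N M) = 0 := by
  have h : ∀ m : ℤ, 0 ≤ m → mode m (phi q * fn f) (fn f' : Fock N M) = 0 := fun m hm => by
    lift m to ℕ using hm; exact prod_phi_fn _ _ _ _
  rw [mode_psi_phi_fn _ _ _ (by omega) (fun m hm => h m (by omega)) (fun s => dL_fn _ _), dL_fn, map_zero,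
    h _ (by omega), mul_zero, sub_zero]

theorem prod_psi_phi_b (n : ℕ) (p q : Fin M) (k : Fin N) (f f' : Ohat N) :
    mode n (psi p * (phi q * fn f)) (b' k * fn f' : Fock N M) = 0 := by
  have hL : ∀ x, dL x (b' k * fn f' : Fock N M) = 0 := fun x => by rw [dL_b'_mul, dL_fn, mul_zero]
  have h : ∀ m : ℤ, 0 ≤ m → mode m (phi q * fn f) (b' k * fn f' : Fock N M) = 0 := fun m hm => by
    rw [mode_phi_fn_of_dA _ _ (by omega) (fun i m => dA_b'_fn i m _ _) (fun s => hL _), hL, map_zero,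
      mode_fn_natCast (fun i m => dA_b'_fn i m _ _) (by omega), mul_zero, add_zero]
  rw [mode_psi_phi_fn _ _ _ (by omega) (fun m hm => h m (by omega)) (fun s => hL _), hL, map_zero,
    h _ (by omega), mul_zero, sub_zero]

theorem prod_psi_phi_phi (n : ℕ) (p q r : Fin M) (f f' : Ohat N) :
    mode n (psi p * (phi q * fn f)) (phi r * fn f' : Fock N M)
      = if n = 0 ∧ r = p then -(phi q * fn (f * f')) else 0 := by
  have h : ∀ m : ℤ, 0 ≤ m → mode m (phi q * fn f) (phi r * fn f' : Fock N M) = 0 := fun m hm => by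
    lift m to ℕ using hm; exact prod_phi_phi _ _ _ _ _
  rw [mode_psi_phi_fn _ _ _ (by omega) (fun m hm => h m (by omega))
    (fun s => by rw [dL_succ_phi_mul, dL_fn]; simp), dL_phi_phi_mul, dL_fn, h _ (by omega), mul_zero,
    mul_zero, neg_zero, zero_add, zero_sub]
  by_cases hr : r = p
  · rw [if_pos hr]
    rcases n with _ | n
    · rw [if_pos ⟨rfl, hr⟩]
      exact congrArg _ (neg_one_phi_fn _ _ _)
    · rw [if_neg (by omega), neg_eq_zero]
      have := prod_phi_fn n q f f'
      push_cast
      rwa [add_sub_cancel_right]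
  · rw [if_neg hr, if_neg (fun h' => hr h'.2), map_zero, neg_zero]

theorem mode_phi_fn_psi {n : ℤ} (hn : 0 ≤ n) (q r : Fin M) (f f' : Ohat N) :
    mode n (phi q * fn f) (psi r * fn f' : Fock N M) = if n = 0 ∧ r = q then fn (f * f') else 0 := by
  rw [mode_phi_fn_of_dA _ _ (by omega) (fun i m => dA_psi_fn i m _ _)
    (fun s => by rw [dL_succ_psi_mul, dL_fn]; simp), dL_psi_psi_mul, dL_fn,
    mode_fn_natCast (fun i m => dA_psi_fn i m _ _) (by omega), mul_zero, mul_zero, neg_zero, zero_add,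
    zero_add]
  by_cases h : r = q
  · rw [if_pos h]
    rcases hn.eq_or_lt with rfl | hn
    · rw [if_pos ⟨rfl, h⟩, fn_mul]
      exact mode_fn_neg_one (fun i m => dA_fn i m _)
    · rw [if_neg (by omega)]
      exact mode_fn_natCast (fun i m => dA_fn i m _) (by omega)
  · rw [if_neg h, if_neg (fun h' => h h'.2), map_zero]

theorem prod_psi_phi_psi (n : ℕ) (p q r : Fin M) (f f' : Ohat N) :
    mode n (psi p * (phi q * fn f)) (psi r * fn f' : Fock N M)
      = if n = 0 ∧ r = q then psi p * fn (f * f') else 0 := by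
  rw [mode_psi_phi_fn _ _ _ (by omega) (fun m hm => by
      rw [mode_phi_fn_psi (by omega), if_neg (by omega)])
    (fun s => by rw [dL_phi_psi_mul, dL_fn]; simp), dL_phi_psi_mul, dL_fn, mode_phi_fn_psi (by omega),
    mul_zero, neg_zero, map_zero, sub_zero]
  by_cases h : n = 0 ∧ r = q
  · rw [if_pos h, if_pos ⟨by omega, h.2⟩]
  · rw [if_neg h, if_neg (fun h' => h ⟨by omega, h'.2⟩), mul_zero]

theorem prod_psi_phi_a (n : ℕ) (p q : Fin M) (l : Fin N) (f f' : Ohat N) :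
    mode n (psi p * (phi q * fn f)) (a l * fn f' : Fock N M)
      = if n = 0 then -(psi p * (phi q * fn (pd l f * f'))) else 0 := by
  have hL : ∀ x, dL x (a l * fn f' : Fock N M) = 0 := fun x => by rw [dL_a_mul, dL_fn, mul_zero]
  have h1 : ∀ m : ℤ, 0 < m → mode m (fn f) (a l * fn f' : Fock N M) = 0 := fun m hm => by
    rw [mode_fn_a_fn, mode_fn_natCast (fun i m => dA_fn i m _) (by omega),
      mode_fn_natCast (fun i m => dA_fn i m _) (by omega), mul_zero, sub_zero]
  have h : ∀ m : ℤ, 0 ≤ m → mode m (phi q * fn f) (a l * fn f' : Fock N M)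
      = phi q * mode m (fn f) (a l * fn f') := fun m hm => by
    rw [mode_phi_mul (fun m hm => h1 m (by omega)) (fun s => hL _), hL, map_zero, add_zero]
  rw [mode_psi_phi_fn _ _ _ (by omega) (fun m hm => by rw [h m (by omega), h1 m (by omega), mul_zero])
    (fun s => hL _), hL, map_zero, sub_zero, h _ (by omega)]
  rcases n with _ | n
  · rw [if_pos rfl, mode_fn_a_fn, mode_fn_natCast (fun i m => dA_fn i m _) (by simp)]
    norm_num only [Nat.cast_zero]
    rw [mode_fn_neg_one (fun i m => dA_fn i m _), ← fn_mul, mul_zero, zero_sub, mul_neg, mul_neg]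
  · rw [if_neg (by omega), h1 _ (by push_cast; omega), mul_zero, mul_zero]

theorem prod_psi_phi_psi_phi (n : ℕ) (p q r s : Fin M) (f f' : Ohat N) :
    mode n (psi p * (phi q * fn f)) (psi r * (phi s * fn f') : Fock N M)
      = threeCases n ((if r = q then psi p * (phi s * fn (f * f')) else 0)
          - (if s = p then psi r * (phi q * fn (f * f')) else 0)
          + if s = p ∧ r = q then transl (fn f) * fn f' else 0)
        (if s = p ∧ r = q then fn (f * f') else 0) := by
  have hd : ∀ i m, dA i m (if r = q then phi s * fn f' else 0 : Fock N M) = 0 := fun i m => by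
    split_ifs
    · exact dA_phi_fn _ _ _ _
    · exact map_zero _
  have h : ∀ m : ℤ, 0 ≤ m → mode m (phi q * fn f) (psi r * (phi s * fn f') : Fock N M)
      = if m = 0 ∧ r = q then phi s * fn (f * f') else 0 := fun m hm => by
    rw [mode_phi_fn_of_dA _ _ (by omega) (fun i m => dA_psi_phi_fn i m _ _ _)
      (fun s => by rw [dL_succ_psi_mul, dL_psi_phi_mul, dL_fn]; simp), dL_psi_psi_mul, dL_psi_phi_mul,
      dL_fn, mode_fn_natCast (fun i m => dA_psi_phi_fn i m _ _ _) (by omega), mul_zero, mul_zero, neg_zero,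
      mul_zero, neg_zero, zero_add, zero_add]
    rcases hm.eq_or_lt with rfl | hm
    · rw [zero_sub, mode_fn_neg_one hd]
      by_cases hr : r = q
      · rw [if_pos hr, if_pos ⟨rfl, hr⟩, fn_mul_comm, mul_assoc, fn_mul, fn_mul_comm f]
      · rw [if_neg hr, if_neg (fun h' => hr h'.2), mul_zero]
    · rw [if_neg (show ¬(m = 0 ∧ r = q) by omega), mode_fn_natCast hd (by omega)]
  rw [mode_psi_phi_fn _ _ _ (by omega) (fun m hm => by rw [h m (by omega), if_neg (by omega)])
    (fun s => by rw [dL_phi_psi_mul, dL_succ_phi_mul, dL_fn]; simp), h _ (by omega), dL_phi_psi_mul,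
    dL_phi_phi_mul, dL_fn, mul_zero, neg_zero, zero_add]
  have hps : (phi q * psi r : Fock N M) = -(psi r * phi q) := by
    have := fer_mul_anticomm (N := N) (FerGen.phi q 0) (FerGen.psi r 0) 1
    rwa [mul_one, mul_one] at this
  have hz : mode ((n : ℤ) - 1) (phi q * fn f) (-(psi r * if s = p then fn f' else 0) : Fock N M)
      = threeCases n ((if s = p then psi r * (phi q * fn (f * f')) else 0)
          - if s = p ∧ r = q then transl (fn f) * fn f' else 0)
        (-if s = p ∧ r = q then fn (f * f') else 0) := by
    by_cases hs : s = p
    swap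
    · simp [hs, threeCases]
    rw [if_pos hs, map_neg, if_pos hs]
    simp only [hs, true_and]
    rcases n with _ | _ | n
    · rw [threeCases_zero]
      norm_num only [Nat.cast_zero]
      rw [mode_phi_fn_of_dA _ _ (by omega) (fun i m => dA_psi_fn i m _ _)
        (fun s => by rw [dL_succ_psi_mul, dL_fn]; simp), dL_psi_psi_mul, dL_fn, mul_zero, neg_zero, zero_add,
        mode_fn_neg_one (fun i m => dA_psi_fn i m _ _), fn_mul_comm f, mul_assoc, ← fn_mul,
        ← mul_assoc (phi q), hps, mul_comm f']
      norm_num only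
      by_cases hr : r = q
      · rw [if_pos hr, if_pos hr, mode_fn_neg_two (fun i m => dA_fn i m _)]
        simp only [neg_mul, mul_assoc]; abel
      · rw [if_neg hr, if_neg hr, map_zero]; simp only [neg_mul, mul_assoc]; abel
    · rw [threeCases_one]
      norm_num only [Nat.cast_one]
      rw [mode_phi_fn_psi (by omega)]
      simp
    · rw [threeCases_add_two, mode_phi_fn_psi (by push_cast; omega),
        if_neg (by push_cast; omega), neg_zero]
  rw [hz]
  rcases n with _ | _ | n
  · simp only [threeCases, if_true, Nat.cast_zero, true_and, mul_ite, mul_zero]; abel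
  · simp [threeCases]
  · rw [threeCases_add_two, threeCases_add_two,
      if_neg (show ¬(((n + 1 + 1 : ℕ) : ℤ) = 0 ∧ r = q) by push_cast; omega), mul_zero, sub_zero]

/-! ### Currents -/

/-- The state `Σ a^k v_k`. -/
def curA (v : Fin N → Ohat N) : Fock N M := ∑ k, a k * fn (v k)

/-- The state `Σ ψ^p φ^q B_{pq}`. -/
def curP (B : Mat M N) : Fock N M := ∑ p, ∑ q, psi p * (phi q * fn (B p q))

/-- The state `Σ (b^k)' h_k`. -/
def curH (h : Fin N → Ohat N) : Fock N M := ∑ k, b' k * fn (h k)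

/-- The state `Σ φ^j A_j`. -/
def linPhi (A : Fin M → Ohat N) : Fock N M := ∑ j, phi j * fn (A j)

/-- The state `Σ ψ^j A_j`. -/
def linPsi (A : Fin M → Ohat N) : Fock N M := ∑ j, psi j * fn (A j)

theorem curP_zero : (curP 0 : Fock N M) = 0 := by simp [curP, fn_zero]
theorem curP_add (B B' : Mat M N) : (curP (B + B') : Fock N M) = curP B + curP B' := by
  simp only [curP, Matrix.add_apply, fn_add, mul_add, sum_add_distrib]
theorem curP_neg (B : Mat M N) : (curP (-B) : Fock N M) = -curP B := by
  simp only [curP, Matrix.neg_apply, fn_neg, mul_neg, sum_neg_distrib]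
theorem curP_sub (B B' : Mat M N) : (curP (B - B') : Fock N M) = curP B - curP B' := by
  rw [sub_eq_add_neg, curP_add, curP_neg, sub_eq_add_neg]
theorem curA_zero : (curA 0 : Fock N M) = 0 := by simp [curA, fn_zero]
theorem curH_zero : (curH 0 : Fock N M) = 0 := by simp [curH, fn_zero]
theorem curH_add (h h' : Fin N → Ohat N) : (curH (h + h') : Fock N M) = curH h + curH h' := by
  simp only [curH, Pi.add_apply, fn_add, mul_add, sum_add_distrib]
theorem curH_neg (h : Fin N → Ohat N) : (curH (-h) : Fock N M) = -curH h := by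
  simp only [curH, Pi.neg_apply, fn_neg, mul_neg, sum_neg_distrib]
theorem curH_sub (h h' : Fin N → Ohat N) : (curH (h - h') : Fock N M) = curH h - curH h' := by
  rw [sub_eq_add_neg, curH_add, curH_neg, sub_eq_add_neg]

theorem IsHom.mul_fn {b : Bool} {u : Fock N M} (h : IsHom b u) (f : Ohat N) : IsHom b (u * fn f) := by
  rw [IsHom, parity_mul, parity_fn, h, smul_mul_assoc]

theorem isHom_curA (v : Fin N → Ohat N) : IsHom false (curA v : Fock N M) :=
  IsHom.sum fun k _ => IsHom.mul_fn (isHom_gen (Sum.inl (BosGen.a k 0))) _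
theorem isHom_curH (v : Fin N → Ohat N) : IsHom false (curH v : Fock N M) :=
  IsHom.sum fun k _ => IsHom.mul_fn (isHom_gen (Sum.inl (BosGen.b k 0))) _
theorem isHom_curP (B : Mat M N) : IsHom false (curP B : Fock N M) :=
  IsHom.sum fun p _ => IsHom.sum fun q _ => by
    simp [IsHom, parity_psi_mul, parity_phi_mul, parity_fn, sgn]
theorem isHom_linPhi (A : Fin M → Ohat N) : IsHom true (linPhi A : Fock N M) :=
  IsHom.sum fun j _ => IsHom.mul_fn (isHom_gen (Sum.inr (FerGen.phi j 0))) _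
theorem isHom_linPsi (A : Fin M → Ohat N) : IsHom true (linPsi A : Fock N M) :=
  IsHom.sum fun j _ => IsHom.mul_fn (isHom_gen (Sum.inr (FerGen.psi j 0))) _

/-- The derivative of `f` along the vector field `Σ v_k ∂_k`. -/
def lieD (v : Fin N → Ohat N) (f : Ohat N) : Ohat N := ∑ k, v k * pd k f

theorem sum_ite_left {ι A : Type*} [AddCommMonoid A] [DecidableEq ι] [Fintype ι] (k : ι) (F : ι → A) :
    (∑ l, if l = k then F l else 0) = F k := by simp

theorem transl_fn_mul (f f' : Ohat N) : (transl (fn f) * fn f' : Fock N M)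
    = curH fun m => pd m f * f' := by
  rw [transl_fn, sum_mul]
  exact sum_congr rfl fun m _ => by rw [mul_assoc, ← fn_mul]

theorem curH_sum {ι : Type*} (s : Finset ι) (h : ι → Fin N → Ohat N) :
    (curH (fun m => ∑ i ∈ s, h i m) : Fock N M) = ∑ i ∈ s, curH (h i) := by
  simp only [curH, fn_sum, mul_sum]
  exact sum_comm

theorem prod_curA_fn (n : ℕ) (v : Fin N → Ohat N) (f : Ohat N) :
    mode n (curA v) (fn f : Fock N M) = if n = 0 then fn (lieD v f) else 0 := by
  simp only [curA, map_sum, LinearMap.sum_apply, prod_a_fn, lieD]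
  split_ifs
  · rw [fn_sum]
  · simp

theorem neg_one_curA_fn (v : Fin N → Ohat N) (f : Ohat N) : mode (-1) (curA v) (fn f : Fock N M)
    = curA (fun k => v k * f) + curH fun m => ∑ k, pd m (v k) * pd k f := by
  simp only [curH_sum, ← transl_fn_mul]
  simp only [curA, map_sum, LinearMap.sum_apply, neg_one_a_fn, sum_add_distrib]

theorem prod_curA_curA (n : ℕ) (v v' : Fin N → Ohat N) : mode n (curA v) (curA v' : Fock N M)
    = threeCases n (curA (fun l => lieD v (v' l) - lieD v' (v l))
        - curH (fun m => ∑ k, ∑ l, pd m (pd l (v k)) * pd k (v' l)))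
      (-fn (∑ k, ∑ l, pd l (v k) * pd k (v' l))) := by
  simp only [curA, map_sum, LinearMap.sum_apply, prod_a_a]
  rcases n with _ | _ | n
  · simp only [threeCases_zero, curH_sum, ← transl_fn_mul, sum_sub_distrib, lieD, fn_sub, fn_sum,
      mul_sub, mul_sum]
    refine congrArg₂ _ (congrArg₂ _ rfl ?_) sum_comm
    rw [sum_comm]
    exact sum_congr rfl fun k _ => sum_congr rfl fun l _ => by rw [mul_comm (v' l)]
  · simp only [threeCases_one, fn_sum, sum_neg_distrib]
    rw [sum_comm]
  · simp only [threeCases_add_two, sum_const_zero]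

theorem prod_curA_curP (n : ℕ) (v : Fin N → Ohat N) (B : Mat M N) :
    mode n (curA v) (curP B : Fock N M) = if n = 0 then curP (B.map (lieD v)) else 0 := by
  simp only [curA, curP, map_sum, LinearMap.sum_apply, prod_a_psi_phi]
  split_ifs
  · simp only [Matrix.map_apply, lieD, fn_sum, mul_sum]
  · simp

theorem prod_curA_curH (n : ℕ) (v h : Fin N → Ohat N) : mode n (curA v) (curH h : Fock N M)
    = threeCases n (curH fun m => lieD v (h m) + ∑ k, pd m (v k) * h k) (fn (∑ k, v k * h k)) := by
  have e : ∀ k l, mode n (a k * fn (v k)) (b' l * fn (h l) : Fock N M)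
      = (if n = 0 then b' l * fn (v k * pd k (h l)) else 0)
        + if l = k then (threeCases n (transl (fn (v k)) * fn (h k)) (fn (v k * h k))) else 0 := by
    intro k l
    rw [prod_a_b]
    by_cases hl : l = k
    · subst hl; rcases n with _ | _ | n
      · simp [threeCases_zero]
      · simp [threeCases_one]
      · simp [threeCases_add_two]
    · simp only [if_neg hl, add_zero]
      rcases n with _ | _ | n
      · simp [threeCases_zero]
      · simp [threeCases_one]
      · simp [threeCases_add_two]
  rw [curA, curH]
  simp only [map_sum, LinearMap.sum_apply, e, sum_add_distrib]
  rw [sum_comm (f := fun l k => if l = k then _ else _)]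
  simp only [sum_ite_left]
  rcases n with _ | _ | n
  · simp only [threeCases_zero, transl_fn_mul, ← curH_sum, if_true]
    refine Eq.trans ?_ (curH_add _ _).symm
    congr 1
    simp only [curH, lieD, fn_sum, mul_sum]
  · simp [threeCases_one, fn_sum]
  · simp [threeCases_add_two]

theorem prod_curH_curA (n : ℕ) (h v : Fin N → Ohat N) : mode n (curH h) (curA v : Fock N M)
    = threeCases n (curH fun m => (∑ k, pd m (h k) * v k) - lieD v (h m)) (fn (∑ k, h k * v k)) := by
  have e : ∀ k l, mode n (b' k * fn (h k)) (a l * fn (v l) : Fock N M)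
      = (if l = k then (threeCases n (transl (fn (h k)) * fn (v k)) (fn (h k * v k))) else 0)
        - if n = 0 then b' k * fn (v l * pd l (h k)) else 0 := by
    intro k l
    rw [prod_b_a, mul_comm (v l)]
    by_cases hl : l = k
    · subst hl; rcases n with _ | _ | n
      · simp [threeCases_zero]
      · simp [threeCases_one]
      · simp [threeCases_add_two]
    · simp only [if_neg hl, zero_sub]
      rcases n with _ | _ | n
      · simp [threeCases_zero]
      · simp [threeCases_one]
      · simp [threeCases_add_two]
  rw [curA, curH]
  simp only [map_sum, LinearMap.sum_apply, e, sum_sub_distrib]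
  rw [sum_comm (f := fun l k => if l = k then _ else _)]
  simp only [sum_ite_left]
  rcases n with _ | _ | n
  · simp only [threeCases_zero, transl_fn_mul, ← curH_sum, if_true]
    refine Eq.trans ?_ (curH_sub _ _).symm
    congr 1
    rw [sum_comm]
    simp only [curH, lieD, fn_sum, mul_sum]
  · simp [threeCases_one, fn_sum]
  · simp [threeCases_add_two]

theorem prod_curH_of_dA (n : ℕ) (h : Fin N → Ohat N) {v : Fock N M} (hv : ∀ i m, dA i m v = 0) :
    mode n (curH h) v = 0 := by
  simp only [curH, map_sum, LinearMap.sum_apply]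
  exact sum_eq_zero fun k _ => prod_b_of_dA n k _ hv

theorem prod_curP_curA (n : ℕ) (B : Mat M N) (v : Fin N → Ohat N) :
    mode n (curP B) (curA v : Fock N M) = if n = 0 then -curP (B.map (lieD v)) else 0 := by
  simp only [curA, curP, map_sum, LinearMap.sum_apply, prod_psi_phi_a]
  split_ifs
  · simp only [Matrix.map_apply, lieD, fn_sum, mul_sum, sum_neg_distrib]
    rw [sum_comm]
    congr 1
    refine sum_congr rfl fun p _ => ?_
    rw [sum_comm]
    exact sum_congr rfl fun q _ => sum_congr rfl fun l _ => by rw [mul_comm (v l)]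
  · simp

theorem prod_curP_curH (n : ℕ) (B : Mat M N) (h : Fin N → Ohat N) :
    mode n (curP B) (curH h : Fock N M) = 0 := by
  simp [curH, curP, map_sum, LinearMap.sum_apply, prod_psi_phi_b]

theorem prod_curP_fn (n : ℕ) (B : Mat M N) (f : Ohat N) :
    mode n (curP B) (fn f : Fock N M) = 0 := by
  simp [curP, map_sum, LinearMap.sum_apply, prod_psi_phi_fn]

theorem prod_curP_curP (n : ℕ) (B B' : Mat M N) :
    mode n (curP B) (curP B' : Fock N M)
      = threeCases n (curP (B * B' - B' * B) + curH fun m => ∑ p, ∑ q, pd m (B p q) * B' q p)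
        (fn (∑ p, ∑ q, B p q * B' q p)) := by
  have hand : ∀ (P Q : Prop) [Decidable P] [Decidable Q] (x : Fock N M),
      (if P ∧ Q then x else 0) = if P then if Q then x else 0 else 0 := fun P Q _ _ x => by
    by_cases hP : P <;> by_cases hQ : Q <;> simp [hP, hQ]
  simp only [curP, map_sum, LinearMap.sum_apply, prod_psi_phi_psi_phi]
  have hsum : ∀ (X : Fin M → Fin M → Fin M → Fin M → Fock N M),
      (∑ r, ∑ s, ∑ p, ∑ q, X p q r s) = ∑ p, ∑ q, ∑ r, ∑ s, X p q r s := by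
    intro X
    rw [sum_congr rfl fun r _ => sum_comm, sum_comm]
    refine sum_congr rfl fun p _ => ?_
    rw [sum_congr rfl fun r _ => sum_comm, sum_comm]
  rw [hsum]
  rcases n with _ | _ | n
  · simp only [threeCases_zero, transl_fn_mul, sum_add_distrib, sum_sub_distrib, hand]
    congr 1
    · simp only [Matrix.sub_apply, fn_sub, mul_sub, sum_sub_distrib, Matrix.mul_apply, fn_sum,
        mul_sum]
      congr 1
      · refine sum_congr rfl fun p _ => Eq.trans ?_ sum_comm
        refine sum_congr rfl fun q _ => ?_
        rw [sum_comm]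
        exact sum_congr rfl fun s _ => by simp
      · simp only [Finset.sum_ite_eq', mem_univ, if_true]
        rw [sum_congr rfl fun p _ => sum_comm, sum_comm]
        refine sum_congr rfl fun r _ => ?_
        rw [sum_comm]
        exact sum_congr rfl fun q _ => sum_congr rfl fun p _ => by rw [mul_comm (B' r p)]
    · simp only [curH_sum, Finset.sum_ite_eq', mem_univ, if_true]
  · simp only [threeCases_one, hand, Finset.sum_ite_eq', mem_univ, if_true, fn_sum]
  · simp [threeCases_add_two]

theorem prod_curA_linPhi (n : ℕ) (v : Fin N → Ohat N) (A : Fin M → Ohat N) :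
    mode n (curA v) (linPhi A : Fock N M) = if n = 0 then linPhi fun j => lieD v (A j) else 0 := by
  simp only [curA, linPhi, map_sum, LinearMap.sum_apply, prod_a_phi]
  split_ifs
  · simp only [lieD, fn_sum, mul_sum]
  · simp

theorem prod_curA_linPsi (n : ℕ) (v : Fin N → Ohat N) (A : Fin M → Ohat N) :
    mode n (curA v) (linPsi A : Fock N M) = if n = 0 then linPsi fun j => lieD v (A j) else 0 := by
  simp only [curA, linPsi, map_sum, LinearMap.sum_apply, prod_a_psi]
  split_ifs
  · simp only [lieD, fn_sum, mul_sum]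
  · simp

theorem prod_curP_linPhi (n : ℕ) (B : Mat M N) (A : Fin M → Ohat N) :
    mode n (curP B) (linPhi A : Fock N M) = if n = 0 then -linPhi (fun q => ∑ p, B p q * A p) else 0 := by
  simp only [curP, linPhi, map_sum, LinearMap.sum_apply, prod_psi_phi_phi]
  split_ifs with h
  · simp only [h, true_and, fn_sum, mul_sum, ← sum_neg_distrib]
    rw [sum_comm, sum_comm (s := Finset.univ (α := Fin M)) (t := Finset.univ)
      (f := fun q p => -(phi q * fn (B p q * A p)))]
    refine sum_congr rfl fun p _ => ?_
    rw [sum_comm]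
    exact sum_congr rfl fun q _ => by simp
  · simp [h]

theorem prod_curP_linPsi (n : ℕ) (B : Mat M N) (A : Fin M → Ohat N) :
    mode n (curP B) (linPsi A : Fock N M) = if n = 0 then linPsi (fun p => ∑ q, B p q * A q) else 0 := by
  simp only [curP, linPsi, map_sum, LinearMap.sum_apply, prod_psi_phi_psi]
  split_ifs with h
  · simp only [h, true_and, fn_sum, mul_sum]
    rw [sum_comm]
    refine sum_congr rfl fun p _ => ?_
    rw [sum_comm]
    exact sum_congr rfl fun q _ => by simp
  · simp [h]

theorem dA_linPhi (A : Fin M → Ohat N) (i : Fin N) (m : ℕ) : dA i m (linPhi A : Fock N M) = 0 := by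
  simp [linPhi, dA_phi_fn]
theorem dA_linPsi (A : Fin M → Ohat N) (i : Fin N) (m : ℕ) : dA i m (linPsi A : Fock N M) = 0 := by
  simp [linPsi, dA_psi_fn]
theorem dA_curP (B : Mat M N) (i : Fin N) (m : ℕ) :
    dA i m (curP B : Fock N M) = 0 := by
  simp [curP, dA_psi_phi_fn]
theorem dA_curH (h : Fin N → Ohat N) (i : Fin N) (m : ℕ) : dA i m (curH h : Fock N M) = 0 := by
  simp [curH, dA_b'_fn]

/-! ### Systems of currents -/

/-- The image of `a^i` under an admissible automorphism. -/
def current (v : Fin N → Ohat N) (B : Mat M N) (h : Fin N → Ohat N) : Fock N M :=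
  curA v - curP B + curH h

theorem prod_current_fn (n : ℕ) (v h : Fin N → Ohat N) (B : Mat M N) (f : Ohat N) :
    mode n (current v B h) (fn f : Fock N M) = if n = 0 then fn (lieD v f) else 0 := by
  rw [current, map_add, map_sub, LinearMap.add_apply, LinearMap.sub_apply, prod_curA_fn, prod_curP_fn,
    prod_curH_of_dA n h (fun i m => dA_fn i m f), sub_zero, add_zero]

theorem prod_current_current (n : ℕ) (v h v' h' : Fin N → Ohat N)
    (B B' : Mat M N) :
    mode n (current v B h) (current v' B' h' : Fock N M) = threeCases n
      (current (fun l => lieD v (v' l) - lieD v' (v l))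
        (B'.map (lieD v) - B.map (lieD v') - (B * B' - B' * B))
        (fun m => lieD v (h' m) - lieD v' (h m) + (∑ k, (pd m (v k) * h' k + pd m (h k) * v' k))
          - (∑ k, ∑ l, pd m (pd l (v k)) * pd k (v' l)) + ∑ p, ∑ q, pd m (B p q) * B' q p))
      (fn ((∑ k, (v k * h' k + h k * v' k)) - (∑ k, ∑ l, pd l (v k) * pd k (v' l))
        + ∑ p, ∑ q, B p q * B' q p)) := by
  simp only [current, map_add, map_sub, LinearMap.add_apply, LinearMap.sub_apply, prod_curA_curA,
    prod_curA_curP, prod_curA_curH, prod_curP_curA, prod_curP_curP, prod_curP_curH, prod_curH_curA,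
    prod_curH_of_dA n h (dA_curP B'), prod_curH_of_dA n h (dA_curH h')]
  rcases n with _ | _ | n
  · simp only [threeCases_zero, if_true, curP_sub]
    have e : (curH (fun m => lieD v (h' m) - lieD v' (h m) + (∑ k, (pd m (v k) * h' k + pd m (h k) * v' k))
          - (∑ k, ∑ l, pd m (pd l (v k)) * pd k (v' l)) + ∑ p, ∑ q, pd m (B p q) * B' q p) : Fock N M)
        = curH (fun m => lieD v (h' m) + ∑ k, pd m (v k) * h' k)
          + curH (fun m => (∑ k, pd m (h k) * v' k) - lieD v' (h m))
          - curH (fun m => ∑ k, ∑ l, pd m (pd l (v k)) * pd k (v' l))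
          + curH (fun m => ∑ p, ∑ q, pd m (B p q) * B' q p) := by
      rw [← curH_add, ← curH_sub, ← curH_add]
      congr 1
      funext m
      simp only [Pi.add_apply, Pi.sub_apply, sum_add_distrib]
      ring
    rw [e]
    abel
  · simp only [threeCases_one, fn_add, fn_sub, sum_add_distrib]
    simp
    abel
  · simp [threeCases_add_two]

theorem prod_current_linPhi (n : ℕ) (v h : Fin N → Ohat N) (B : Mat M N)
    (A : Fin M → Ohat N) : mode n (current v B h) (linPhi A : Fock N M)
      = if n = 0 then linPhi (fun q => lieD v (A q) + ∑ p, B p q * A p) else 0 := by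
  rw [current, map_add, map_sub, LinearMap.add_apply, LinearMap.sub_apply, prod_curA_linPhi,
    prod_curP_linPhi, prod_curH_of_dA n h (dA_linPhi A), add_zero]
  split_ifs
  · simp only [linPhi, fn_add, mul_add, sum_add_distrib]; abel
  · simp

theorem prod_current_linPsi (n : ℕ) (v h : Fin N → Ohat N) (B : Mat M N)
    (A : Fin M → Ohat N) : mode n (current v B h) (linPsi A : Fock N M)
      = if n = 0 then linPsi (fun p => lieD v (A p) - ∑ q, B p q * A q) else 0 := by
  rw [current, map_add, map_sub, LinearMap.add_apply, LinearMap.sub_apply, prod_curA_linPsi,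
    prod_curP_linPsi, prod_curH_of_dA n h (dA_linPsi A), add_zero]
  split_ifs
  · simp only [linPsi, fn_sub, mul_sub, sum_sub_distrib]
  · simp

theorem isHom_current (v h : Fin N → Ohat N) (B : Mat M N) :
    IsHom false (current v B h : Fock N M) :=
  ((isHom_curA v).sub (isHom_curP B)).add (isHom_curH h)

theorem linPhi_zero : (linPhi 0 : Fock N M) = 0 := by simp [linPhi, fn_zero]
theorem linPsi_zero : (linPsi 0 : Fock N M) = 0 := by simp [linPsi, fn_zero]

/-- The modes of homogeneous states without products commute in the graded sense. -/
theorem comm_mode_of_prod {b c : Bool} {u v x : Fock N M} (hu : IsHom b u) (hv : IsHom c v)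
    (h : ∀ n : ℕ, mode n u v = if n = 0 then x else 0) (m n : ℤ) (w : Fock N M) :
    mode m u (mode n v w) = sgn (b && c) • mode n v (mode m u w) + mode (m + n) x w := by
  have e := comm_mode hu hv (fun j hj => by rw [h, if_neg (by omega)]) m n w
  have e0 : mode 0 u v = x := by have := h 0; simpa using this
  rw [← e0, ← e, add_sub_cancel]

/-- A criterion for a system of currents to have the operator products of the generators. -/
theorem isSystem_current {g : Subst N} {v h : Fin N → Fin N → Ohat N}
    {B : Fin N → Mat M N} {A A' : Mat M N}
    (hf : ∀ i f, lieD (v i) (g.pull f) = g.pull (pd i f))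
    (hv : ∀ i j l, lieD (v i) (v j l) = lieD (v j) (v i l))
    (hB : ∀ i j, (B j).map (lieD (v i)) - (B i).map (lieD (v j)) = B i * B j - B j * B i)
    (h1 : ∀ i j, (∑ k, (v i k * h j k + h i k * v j k)) - (∑ k, ∑ l, pd l (v i k) * pd k (v j l))
        + ∑ p, ∑ q, B i p q * B j q p = 0)
    (h0 : ∀ i j m, lieD (v i) (h j m) - lieD (v j) (h i m)
        + (∑ k, (pd m (v i k) * h j k + pd m (h i k) * v j k))
        - (∑ k, ∑ l, pd m (pd l (v i k)) * pd k (v j l)) + ∑ p, ∑ q, pd m (B i p q) * B j q p = 0)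
    (hA : A' * A = 1) (hφ : ∀ i q r, lieD (v i) (A q r) + ∑ p, B i p q * A p r = 0)
    (hψ : ∀ i r p, lieD (v i) (A' r p) = ∑ q, B i p q * A' r q) :
    IsSystem g (fun i => (current (v i) (B i) (h i) : Fock N M)) (fun i => linPhi fun j => A j i)
      (fun i => linPsi fun j => A' i j) where
  hom_α i := isHom_current _ _ _
  hom_φ i := isHom_linPhi _
  hom_ψ i := isHom_linPsi _
  α_f i f m n w := by
    rw [comm_mode_of_prod (isHom_current _ _ _) (isHom_fn _) (fun n => prod_current_fn n _ _ _ _), hf]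
    simp [sgn]
  α_α i j m n w := by
    rw [comm_mode_of_prod (x := 0) (isHom_current _ _ _) (isHom_current _ _ _) fun n => ?_]
    · simp [sgn]
    rw [prod_current_current, ite_self]
    have e0 : (fun l => lieD (v i) (v j l) - lieD (v j) (v i l)) = 0 := by
      funext l; rw [hv, sub_self]; rfl
    have e1 : (fun m => lieD (v i) (h j m) - lieD (v j) (h i m)
        + (∑ k, (pd m (v i k) * h j k + pd m (h i k) * v j k))
        - (∑ k, ∑ l, pd m (pd l (v i k)) * pd k (v j l)) + ∑ p, ∑ q, pd m (B i p q) * B j q p) = 0 :=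
      funext fun m => h0 i j m
    rw [e0, e1, hB, sub_self, h1, fn_zero, current, curA_zero, curP_zero, curH_zero]
    simp [threeCases]
  α_φ i j m n w := by
    rw [comm_mode_of_prod (x := 0) (isHom_current _ _ _) (isHom_linPhi _) fun n => ?_]
    · simp [sgn]
    rw [prod_current_linPhi, ite_self]
    simp only [hφ]
    split_ifs
    · exact linPhi_zero
    · rfl
  α_ψ i j m n w := by
    rw [comm_mode_of_prod (x := 0) (isHom_current _ _ _) (isHom_linPsi _) fun n => ?_]
    · simp [sgn]
    rw [prod_current_linPsi, ite_self]
    simp only [hψ, sub_self]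
    split_ifs
    · exact linPsi_zero
    · rfl
  φ_f j f m n w := by
    rw [comm_mode_of_prod (x := 0) (isHom_linPhi _) (isHom_fn _) fun n => ?_]
    · simp [sgn]
    simp [linPhi, prod_phi_fn]
  ψ_f j f m n w := by
    rw [comm_mode_of_prod (x := 0) (isHom_linPsi _) (isHom_fn _) fun n => ?_]
    · simp [sgn]
    simp [linPsi, prod_psi_fn]
  φ_φ i j m n w := by
    rw [comm_mode_of_prod (x := 0) (isHom_linPhi _) (isHom_linPhi _) fun n => ?_]
    · simp [sgn]
    simp [linPhi, prod_phi_phi]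
  ψ_ψ i j m n w := by
    rw [comm_mode_of_prod (x := 0) (isHom_linPsi _) (isHom_linPsi _) fun n => ?_]
    · simp [sgn]
    simp [linPsi, prod_psi_psi]
  ψ_φ i j m n w := by
    rw [comm_mode_of_prod (x := if i = j then 1 else 0) (isHom_linPsi _) (isHom_linPhi _) fun n => ?_]
    · by_cases hij : i = j
      · simp [sgn, hij, mode_one]
      · simp [sgn, hij]
    have e := congrFun (congrFun hA i) j
    rw [Matrix.mul_apply, Matrix.one_apply] at e
    simp only [linPsi, linPhi, map_sum, LinearMap.sum_apply, prod_psi_phi]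
    by_cases hn : n = 0
    · simp only [hn, true_and, if_true]
      have e' := congrArg (fn (N := N) (M := M)) e
      rw [fn_sum] at e'
      rw [sum_comm]
      refine Eq.trans ?_ (e'.trans ?_)
      · exact sum_congr rfl fun q _ => by simp
      · split_ifs
        · exact fn_one
        · exact fn_zero
    · simp [hn]

open CoordChange

/-- The derivation `Σ v_k ∂_k`. -/
def lieDer (v : Fin N → Ohat N) : Derivation ℂ (Ohat N) (Ohat N) := ∑ k, v k • pd k

theorem lieD_eq (v : Fin N → Ohat N) (f : Ohat N) : lieD v f = lieDer v f := by
  have e := congrFun (map_sum (Derivation.coeFnAddMonoidHom (R := ℂ) (A := Ohat N) (M := Ohat N))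
    (fun k => v k • pd k) Finset.univ) f
  rw [Finset.sum_apply] at e
  exact e.symm

theorem map_mul_derivation {R S ι κ τ : Type*} [CommRing R] [CommRing S] [Algebra R S] [Fintype κ]
    (D : Derivation R S S) (X : Matrix ι κ S) (Y : Matrix κ τ S) :
    (X * Y).map D = X * Y.map D + X.map D * Y := by
  ext i j
  simp only [Matrix.map_apply, Matrix.mul_apply, Matrix.add_apply, map_sum, Derivation.leibniz,
    smul_eq_mul, sum_add_distrib]
  congr 1
  exact sum_congr rfl fun k _ => mul_comm _ _

theorem map_one_derivation {R S ι : Type*} [CommRing R] [CommRing S] [Algebra R S] [DecidableEq ι]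
    (D : Derivation R S S) : (1 : Matrix ι ι S).map D = 0 := by
  ext i j
  rw [Matrix.map_apply, Matrix.one_apply]
  split_ifs <;> simp

theorem map_inv_derivation {R S ι : Type*} [CommRing R] [CommRing S] [Algebra R S] [Fintype ι]
    [DecidableEq ι] (D : Derivation R S S) {X Y : Matrix ι ι S} (h : X * Y = 1) :
    X.map D = -(X * Y.map D * X) := by
  have h' : Y * X = 1 := mul_eq_one_comm.mp h
  have e := map_mul_derivation D X Y
  rw [h, map_one_derivation] at e
  have e2 := congrArg (· * X) e
  simp only [Matrix.zero_mul, Matrix.add_mul, Matrix.mul_assoc, h', Matrix.mul_one] at e2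
  rw [eq_neg_iff_add_eq_zero, Matrix.mul_assoc, add_comm]
  exact e2.symm

theorem inv_mul_jac (g : CoordChange N) : (jacGL g)⁻¹.1 * g.jac = 1 := (jacGL g).inv_mul
theorem jac_mul_inv (g : CoordChange N) : g.jac * (jacGL g)⁻¹.1 = 1 := (jacGL g).mul_inv

/-- The vector field `(∂g)⁻¹ ∂` is `g`-related to the coordinate vector field. -/
theorem lieD_pull (g : CoordChange N) (i : Fin N) (f : Ohat N) :
    lieD ((jacGL g)⁻¹.1 i) (g.pull f) = g.pull (pd i f) := by
  simp only [lieD, Subst.pd_pull, mul_sum]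
  rw [sum_comm]
  have e : ∀ j, ∑ k, (jacGL g)⁻¹.1 i k * (g.jac k j * g.pull (pd j f))
      = (1 : Mat N N) i j * g.pull (pd j f) := by
    intro j
    rw [← inv_mul_jac g, Matrix.mul_apply, sum_mul]
    exact sum_congr rfl fun k _ => by ring
  rw [sum_congr rfl fun j _ => e j]
  simp [Matrix.one_apply]

theorem pull_inv_pull (g : CoordChange N) (f : Ohat N) : g.pull (g⁻¹.pull f) = f := by
  rw [← pull_mul, mul_inv_cancel, pull_one]

theorem lieD_comm (g : CoordChange N) (i j : Fin N) (f : Ohat N) :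
    lieD ((jacGL g)⁻¹.1 i) (lieD ((jacGL g)⁻¹.1 j) f) = lieD ((jacGL g)⁻¹.1 j) (lieD ((jacGL g)⁻¹.1 i) f) := by
  rw [← pull_inv_pull g f]
  simp only [lieD_pull, pd_comm i j]

theorem lieD_coord (v : Fin N → Ohat N) (l : Fin N) : lieD v (coord l) = v l := by
  simp [lieD, pd_coord, Matrix.one_apply]

/-- The matrices `(A · ∂̃_i A⁻¹)ᵗ`, where `∂̃ = (∂g)⁻¹ ∂`. -/
def bunMat (x : HGroup N M) (i : Fin N) : Mat M N :=
  (x.left.1 * x.left⁻¹.1.map (lieD ((jacGL x.right)⁻¹.1 i)))ᵀ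

/-- `F` is an endomorphism of the form that defines admissible automorphisms. -/
structure IsForm (F : Fock N M →ₗ[ℂ] Fock N M) (x : HGroup N M) (h : Mat N N) :
    Prop where
  isVHom : IsVHom F
  map_fn : ∀ f : Ohat N, F (fn f) = fn (x.right.pull f)
  map_a : ∀ i : Fin N, F (a i) = current ((jacGL x.right)⁻¹.1 i) (bunMat x i) (fun j => h j i)
  map_phi : ∀ i : Fin M, F (phi i) = linPhi fun j => x.left.1 j i
  map_psi : ∀ i : Fin M, F (psi i) = linPsi fun j => x.left⁻¹.1 i j

theorem isForm_ext {F G : Fock N M →ₗ[ℂ] Fock N M} {x : HGroup N M} {h : Mat N N}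
    (hF : IsForm F x h) (hG : IsForm G x h) : F = G :=
  hF.isVHom.ext hG.isVHom (fun f => by rw [hF.map_fn, hG.map_fn])
    (fun i => by rw [hF.map_a, hG.map_a]) (fun i => by rw [hF.map_phi, hG.map_phi])
    (fun i => by rw [hF.map_psi, hG.map_psi])

theorem current_eq (x : HGroup N M) (h : Mat N N) (i : Fin N) :
    (current ((jacGL x.right)⁻¹.1 i) (bunMat x i) (fun j => h j i) : Fock N M)
      = ∑ j, a j * fn ((jacGL x.right)⁻¹.1ᵀ j i)
      - ∑ p, ∑ q, psi p * phi q *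
          fn (∑ s, ∑ k, x.left.1 q s * (jacGL x.right)⁻¹.1ᵀ k i * pd k (x.left⁻¹.1 s p))
      + ∑ j, b' j * fn (h j i) := by
  rw [current, curA, curP, curH]
  congr 2
  refine sum_congr rfl fun p _ => sum_congr rfl fun q _ => ?_
  rw [mul_assoc]
  have e : bunMat x i p q
      = ∑ s, ∑ k, x.left.1 q s * (jacGL x.right)⁻¹.1ᵀ k i * pd k (x.left⁻¹.1 s p) := by
    rw [bunMat, Matrix.transpose_apply, Matrix.mul_apply]
    refine sum_congr rfl fun s _ => ?_
    simp only [mul_assoc (x.left.1 q s)]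
    rw [← mul_sum]
    rfl
  rw [e]

theorem isForm_iff (F : vertexAut N M) (x : HGroup N M) (h : Mat N N) :
    IsForm F.1.toLinearMap x h ↔ HasForm F x h := by
  constructor
  · intro hF
    exact ⟨hF.map_fn, fun i => (hF.map_a i).trans (current_eq x h i), hF.map_phi, hF.map_psi⟩
  · intro hF
    exact ⟨⟨F.2.1, F.2.2.1, F.2.2.2⟩, hF.map_fn, fun i => (hF.map_a i).trans (current_eq x h i).symm,
      hF.map_phi, hF.map_psi⟩

/-- The condition that the currents have no pole of order two. -/
def PoleTwo (x : HGroup N M) (h : Mat N N) : Prop :=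
  ∀ i j, (∑ k, ((jacGL x.right)⁻¹.1 i k * h k j + h k i * (jacGL x.right)⁻¹.1 j k))
    - (∑ k, ∑ l, pd l ((jacGL x.right)⁻¹.1 i k) * pd k ((jacGL x.right)⁻¹.1 j l))
    + ∑ p, ∑ q, bunMat x i p q * bunMat x j q p = 0

/-- The condition that the currents have no simple pole. -/
def PoleOne (x : HGroup N M) (h : Mat N N) : Prop :=
  ∀ i j m, lieD ((jacGL x.right)⁻¹.1 i) (h m j) - lieD ((jacGL x.right)⁻¹.1 j) (h m i)
    + (∑ k, (pd m ((jacGL x.right)⁻¹.1 i k) * h k j + pd m (h k i) * (jacGL x.right)⁻¹.1 j k))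
    - (∑ k, ∑ l, pd m (pd l ((jacGL x.right)⁻¹.1 i k)) * pd k ((jacGL x.right)⁻¹.1 j l))
    + ∑ p, ∑ q, pd m (bunMat x i p q) * bunMat x j q p = 0

theorem lieD_bunMat (x : HGroup N M) (i j : Fin N) :
    (bunMat x j).map (lieD ((jacGL x.right)⁻¹.1 i)) - (bunMat x i).map (lieD ((jacGL x.right)⁻¹.1 j))
      = bunMat x i * bunMat x j - bunMat x j * bunMat x i := by
  have hl : ∀ v : Fin N → Ohat N, lieD v = lieDer v := fun v => funext (lieD_eq v)
  have hXY : x.left.1 * x.left⁻¹.1 = 1 := x.left.mul_inv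
  have hc : (x.left⁻¹.1.map (lieDer ((jacGL x.right)⁻¹.1 j))).map (lieDer ((jacGL x.right)⁻¹.1 i))
      = (x.left⁻¹.1.map (lieDer ((jacGL x.right)⁻¹.1 i))).map (lieDer ((jacGL x.right)⁻¹.1 j)) := by
    ext p q
    have := lieD_comm x.right i j (x.left⁻¹.1 p q)
    rwa [hl, hl] at this
  set D := fun k => lieDer ((jacGL x.right)⁻¹.1 k) with hD
  set C := fun k => x.left.1 * x.left⁻¹.1.map (D k) with hC
  have e : (C j).map (D i) - (C i).map (D j) = C j * C i - C i * C j := by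
    simp only [hC]
    rw [map_mul_derivation, map_mul_derivation, hc, map_inv_derivation _ hXY,
      map_inv_derivation (D j) hXY]
    simp only [Matrix.mul_assoc, neg_mul]
    abel
  have hb : ∀ k, bunMat x k = (C k)ᵀ := fun k => by rw [bunMat, hl]
  rw [hb, hb, hl, hl, ← Matrix.transpose_mul, ← Matrix.transpose_mul, ← Matrix.transpose_sub, ← e]
  rfl

/-- Existence of endomorphisms of the given form. -/
theorem exists_isForm {x : HGroup N M} {h : Mat N N} (h1 : PoleTwo x h)
    (h0 : PoleOne x h) : ∃ F : Fock N M →ₗ[ℂ] Fock N M, IsForm F x h := by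
  have hl : ∀ v : Fin N → Ohat N, lieD v = lieDer v := fun v => funext (lieD_eq v)
  have hYX : x.left⁻¹.1 * x.left.1 = 1 := x.left.inv_mul
  have hXY : x.left.1 * x.left⁻¹.1 = 1 := x.left.mul_inv
  obtain ⟨F, hF, hf, ha, hphi, hpsi⟩ := IsSystem.exists_isVHom
    (isSystem_current (M := M) (g := x.right.toSubst) (v := fun i => (jacGL x.right)⁻¹.1 i)
      (h := fun i j => h j i) (B := bunMat x) (A := x.left.1) (A' := x.left⁻¹.1)
      (fun i f => lieD_pull _ _ _)
      (fun i j l => by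
        have := lieD_comm x.right i j (coord l)
        rwa [lieD_coord, lieD_coord] at this)
      (fun i j => lieD_bunMat x i j)
      h1 h0 hYX
      (fun i q r => by
        have e := congrFun (congrFun (map_inv_derivation (lieDer ((jacGL x.right)⁻¹.1 i)) hXY) q) r
        rw [Matrix.neg_apply, Matrix.mul_apply, ← hl] at e
        rw [← eq_neg_iff_add_eq_zero]
        exact e)
      (fun i r p => by
        have e : (x.left⁻¹.1 * (bunMat x i)ᵀ) = x.left⁻¹.1.map (lieD ((jacGL x.right)⁻¹.1 i)) := by
          rw [bunMat, Matrix.transpose_transpose, ← Matrix.mul_assoc, hYX, Matrix.one_mul]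
        have e' := congrFun (congrFun e r) p
        rw [Matrix.mul_apply] at e'
        refine e'.symm.trans (sum_congr rfl fun q _ => mul_comm _ _)))
  exact ⟨F, hF, hf, ha, hphi, hpsi⟩

/-- The leading coefficients of a current vanish if the current vanishes. -/
theorem curH_eq_zero {h : Fin N → Ohat N} (hh : (curH h : Fock N M) = 0) (m : Fin N) : h m = 0 := by
  have e := congrArg (dB (M := M) m 1) hh
  rw [map_zero, curH, map_sum] at e
  simp only [dB_one_b'_mul, dB_one_fn, mul_zero, zero_add, Finset.sum_ite_eq', mem_univ, if_true] at e
  exact fn_injective (e.trans fn_zero.symm)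

theorem IsForm.prod_a {F : Fock N M →ₗ[ℂ] Fock N M} {x : HGroup N M}
    {h : Mat N N} (hF : IsForm F x h) : PoleTwo x h ∧ PoleOne x h := by
  have e : ∀ (n : ℕ) i j, mode n (F (a i)) (F (a j)) = 0 := by
    intro n i j
    rw [← hF.isVHom.map_mode, mode_a_natCast]
    have : dB i n (a j : Fock N M) = 0 := by
      have e1 := dB_a_mul (M := M) i j n 1
      rw [mul_one] at e1
      rw [e1, ← fn_one]
      cases n
      · rw [dB_zero_fn, Derivation.map_one_eq_zero, fn_zero, mul_zero]
      · rw [dB_succ_fn, mul_zero]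
    rw [this, map_zero]
  simp only [hF.map_a, prod_current_current] at e
  refine ⟨fun i j => ?_, fun i j m => ?_⟩
  · have := e 1 i j
    exact fn_injective (this.trans fn_zero.symm)
  · have e1 : (current (fun l => lieD ((jacGL x.right)⁻¹.1 i) ((jacGL x.right)⁻¹.1 j l)
        - lieD ((jacGL x.right)⁻¹.1 j) ((jacGL x.right)⁻¹.1 i l)) _ _ : Fock N M) = 0 := e 0 i j
    have ez : (fun l => lieD ((jacGL x.right)⁻¹.1 i) ((jacGL x.right)⁻¹.1 j l)
        - lieD ((jacGL x.right)⁻¹.1 j) ((jacGL x.right)⁻¹.1 i l)) = 0 := by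
      funext l
      have := lieD_comm x.right i j (coord l)
      rw [lieD_coord, lieD_coord] at this
      rw [this, sub_self]; rfl
    rw [ez, lieD_bunMat, sub_self, current, curA_zero, curP_zero, sub_zero, zero_add] at e1
    exact curH_eq_zero e1 m

/-! ### Endomorphisms over generators of the group -/

theorem jacGL_one : jacGL (1 : CoordChange N) = 1 := Units.ext jac_one

theorem bunMat_of_left {x : HGroup N M} (hx : ∀ k p q, pd k (x.left⁻¹.1 p q) = 0) (i : Fin N) :
    bunMat x i = 0 := by
  have : x.left⁻¹.1.map (lieD ((jacGL x.right)⁻¹.1 i)) = 0 := by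
    ext p q
    simp only [Matrix.map_apply, lieD, hx, mul_zero, sum_const_zero, Matrix.zero_apply]
  rw [bunMat, this, Matrix.mul_zero, Matrix.transpose_zero]

theorem pd_one_apply {ι : Type*} [DecidableEq ι] (k : Fin N) (p q : ι) :
    pd k ((1 : Matrix ι ι (Ohat N)) p q) = 0 := by
  rw [Matrix.one_apply]; split_ifs <;> simp

theorem sum_one_mul {ι : Type*} [Fintype ι] [DecidableEq ι] (i : ι) (F : ι → Ohat N) :
    ∑ k, (1 : Matrix ι ι (Ohat N)) i k * F k = F i := by simp [Matrix.one_apply]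
theorem sum_mul_one {ι : Type*} [Fintype ι] [DecidableEq ι] (i : ι) (F : ι → Ohat N) :
    ∑ k, F k * (1 : Matrix ι ι (Ohat N)) i k = F i := by simp [Matrix.one_apply]

theorem poleTwo_one_iff (h : Mat N N) :
    PoleTwo (1 : HGroup N M) h ↔ h ∈ Omega2 N := by
  have e : (jacGL (1 : HGroup N M).right)⁻¹.1 = 1 := by
    change (jacGL (1 : CoordChange N))⁻¹.1 = 1; rw [jacGL_one, inv_one]; rfl
  have e2 : ∀ i, bunMat (1 : HGroup N M) i = 0 := bunMat_of_left fun k p q => by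
    change pd k ((1 : GL (Fin M) (Ohat N))⁻¹.1 p q) = 0
    rw [inv_one]; exact pd_one_apply _ _ _
  simp only [PoleTwo, e, e2, pd_one_apply, map_zero, sum_add_distrib, sum_one_mul, sum_mul_one,
    Matrix.zero_apply, mul_zero, sum_const_zero, sub_zero, add_zero]
  exact ⟨fun H i j => eq_neg_of_add_eq_zero_left (H i j), fun H i j => by rw [H i j]; exact neg_add_cancel _⟩

theorem poleOne_one_iff {h : Mat N N} (hh : h ∈ Omega2 N) :
    PoleOne (1 : HGroup N M) h ↔ h ∈ Omega2cl N := by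
  have e : (jacGL (1 : HGroup N M).right)⁻¹.1 = 1 := by
    change (jacGL (1 : CoordChange N))⁻¹.1 = 1; rw [jacGL_one, inv_one]; rfl
  have e2 : ∀ i, bunMat (1 : HGroup N M) i = 0 := bunMat_of_left fun k p q => by
    change pd k ((1 : GL (Fin M) (Ohat N))⁻¹.1 p q) = 0
    rw [inv_one]; exact pd_one_apply _ _ _
  have hs : ∀ k i j, pd k (h i j) = -pd k (h j i) := fun k i j => by rw [hh i j, map_neg]
  simp only [PoleOne, e, e2, pd_one_apply, map_zero, sum_add_distrib, sum_one_mul, sum_mul_one,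
    Matrix.zero_apply, mul_zero, zero_mul, sum_const_zero, sub_zero, add_zero, zero_add, lieD]
  refine ⟨fun H => ⟨hh, fun i m j => ?_⟩, fun H i j m => ?_⟩
  · have := H i j m
    rw [extD2]
    linear_combination this + hs j i m
  · have := H.2 i m j
    rw [extD2] at this
    linear_combination this - hs j i m

theorem exists_isForm_one {h : Mat N N} (hh : h ∈ Omega2cl N) :
    ∃ F : Fock N M →ₗ[ℂ] Fock N M, IsForm F 1 h :=
  exists_isForm ((poleTwo_one_iff h).mpr hh.1) ((poleOne_one_iff hh.1).mpr hh)

theorem IsForm.mem_Omega2cl {F : Fock N M →ₗ[ℂ] Fock N M} {h : Mat N N}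
    (hF : IsForm F 1 h) : h ∈ Omega2cl N :=
  (poleOne_one_iff ((poleTwo_one_iff h).mp hF.prod_a.1)).mp hF.prod_a.2

/-- Linear coordinate changes and constant changes of frame. -/
theorem exists_isForm_of_const {x : HGroup N M} (hJ : ∀ k i j, pd k ((jacGL x.right)⁻¹.1 i j) = 0)
    (hA : ∀ k p q, pd k (x.left⁻¹.1 p q) = 0) : ∃ F : Fock N M →ₗ[ℂ] Fock N M, IsForm F x 0 := by
  refine exists_isForm (fun i j => ?_) (fun i j m => ?_)
  · simp only [hJ, bunMat_of_left hA, Matrix.zero_apply, mul_zero, zero_mul, sum_const_zero,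
      add_zero, sub_zero]
  · simp only [hJ, bunMat_of_left hA, lieD, Matrix.zero_apply, map_zero, mul_zero, zero_mul,
      sum_const_zero, add_zero, sub_zero]

section RankOne

variable {r : ℕ}

/-- The matrix that differs from the identity matrix by the column `w` in place `s`. -/
def colMat (w : Fin r → Ohat N) (s : Fin r) : Mat r N :=
  1 + Matrix.vecMulVec w (Pi.single s 1)

theorem colMat_apply (w : Fin r → Ohat N) (s i j : Fin r) :
    colMat w s i j = (1 : Mat r N) i j + if j = s then w i else 0 := by
  simp [colMat, Matrix.vecMulVec_apply, Pi.single_apply]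

variable {A : GL (Fin r) (Ohat N)} {w : Fin r → Ohat N} {s : Fin r}

/-- The inverse of a matrix that differs from the identity matrix in one column. -/
theorem inv_colMat (hA : A.1 = colMat w s) : ∃ x : Fin r → Ohat N,
    (1 + w s) * (1 - x s) = 1 ∧ (∀ i, w i = (1 + w s) * x i) ∧ ∀ i j,
      A⁻¹.1 i j = (1 : Mat r N) i j - if j = s then x i else 0 := by
  have hx : A⁻¹.1 * A.1 = 1 := A.inv_mul
  have hy : A.1 * A⁻¹.1 = 1 := A.mul_inv
  rw [hA] at hx hy
  have h2 : ∀ i j, A⁻¹.1 i j + (if j = s then ∑ k, A⁻¹.1 i k * w k else 0)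
      = (1 : Mat r N) i j := by
    intro i j
    have e := congrFun (congrFun hx i) j
    rw [Matrix.mul_apply] at e
    simp only [colMat_apply, mul_add, mul_ite, mul_zero, sum_add_distrib] at e
    rw [← e]
    congr 1
    · simp [Matrix.one_apply]
    · split_ifs <;> simp
  set x : Fin r → Ohat N := fun i => ∑ k, A⁻¹.1 i k * w k with hxdef
  have h3 : ∀ i j, A⁻¹.1 i j = (1 : Mat r N) i j - if j = s then x i else 0 :=
    fun i j => eq_sub_of_add_eq (h2 i j)
  have h4 : ∀ i, x i = w i - x i * w s := by
    intro i
    conv_lhs => rw [hxdef]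
    simp only [h3, sub_mul, sum_sub_distrib, ite_mul, zero_mul, Finset.sum_ite_eq',
      mem_univ, if_true, sum_one_mul]
  refine ⟨x, by linear_combination -h4 s, fun i => by linear_combination -h4 i, h3⟩

theorem leftForm_colMat (hA : A.1 = colMat w s) (i : Fin N) :
    leftForm A i = Matrix.vecMulVec (A⁻¹.1.mulVec fun p => pd i (w p)) (Pi.single s 1) := by
  have : A.1.map (pd i) = Matrix.vecMulVec (fun p => pd i (w p)) (Pi.single s 1) := by
    ext p q
    rw [Matrix.map_apply, hA, colMat_apply, map_add, pd_one_apply, Matrix.vecMulVec_apply, Pi.single_apply]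
    split_ifs <;> simp
  rw [leftForm, this, Matrix.mul_vecMulVec]

theorem csForm_colMat (hA : A.1 = colMat w s) (i j k : Fin N) : csForm A i j k = 0 := by
  simp only [csForm, leftForm_colMat hA, Matrix.vecMulVec_mul_vecMulVec, Matrix.mul_sub, Matrix.trace_sub,
    Matrix.mul_smul, Matrix.smul_mul, Matrix.trace_smul, Matrix.trace_vecMulVec, Matrix.vecMulVec_smul, smul_eq_mul]
  simp
  ring

theorem csForm_of_const {A : GL (Fin r) (Ohat N)} (hA : ∀ k p q, pd k (A.1 p q) = 0) (i j k : Fin N) :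
    csForm A i j k = 0 := by
  have : A.1.map (pd i) = 0 := by ext p q; simp [hA]
  rw [csForm, leftForm, this, Matrix.mul_zero, Matrix.zero_mul, Matrix.trace_zero]

end RankOne

/-- The coefficient matrix `h (∂g)ᵗ` of an endomorphism. -/
def mMat (x : HGroup N M) (h : Mat N N) : Mat N N :=
  h * x.right.jacᵀ

theorem exists_isForm_colMat_left {x : HGroup N M} {w : Fin M → Ohat N} {s : Fin M} (hx : x.right = 1)
    (hA : x.left.1 = colMat w s) : ∃ (F : Fock N M →ₗ[ℂ] Fock N M) (h : Mat N N),
      IsForm F x h ∧ (mMat x h)ᵀ = mMat x h := by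
  obtain ⟨y, hy1, hy2, hy⟩ := inv_colMat hA
  have eJ : (jacGL x.right)⁻¹.1 = 1 := by rw [hx, jacGL_one, inv_one]; rfl
  set l : Fin N → Ohat N := fun i => (1 + w s) * pd i (y s) with hl
  have hD : ∀ i f, lieD ((1 : Mat N N) i) f = pd i f := fun i f => by
    rw [lieD, sum_one_mul]
  have hB : ∀ i p q, bunMat x i p q = if p = s then -pd i (y q) - w q * pd i (y s) else 0 := by
    intro i p q
    rw [bunMat, eJ, Matrix.transpose_apply, Matrix.mul_apply, hA]
    simp only [colMat_apply, Matrix.map_apply, hD, hy, map_sub, pd_one_apply, zero_sub]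
    by_cases hp : p = s
    · simp only [hp, if_true, add_mul, sum_add_distrib, ite_mul, zero_mul, Finset.sum_ite_eq',
        mem_univ, sum_one_mul]
      ring
    · simp [hp]
  have hBs : ∀ i, bunMat x i s s = -l i := fun i => by rw [hB, if_pos rfl, hl]; ring
  have hBB : ∀ i j, ∑ p, ∑ q, bunMat x i p q * bunMat x j q p = l i * l j := by
    intro i j
    rw [sum_eq_single s (fun p _ hp => sum_eq_zero fun q _ => by
        rw [hB i p, if_neg hp, zero_mul]) (by simp),
      sum_eq_single s (fun q _ hq => by rw [hB j q, if_neg hq, mul_zero]) (by simp), hBs, hBs]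
    ring
  have hBB' : ∀ m i j, ∑ p, ∑ q, pd m (bunMat x i p q) * bunMat x j q p = pd m (l i) * l j := by
    intro m i j
    rw [sum_eq_single s (fun p _ hp => sum_eq_zero fun q _ => by
        rw [hB i p, if_neg hp, map_zero, zero_mul]) (by simp),
      sum_eq_single s (fun q _ hq => by rw [hB j q, if_neg hq, mul_zero]) (by simp), hBs, hBs, map_neg]
    ring
  have hy3 : ∀ i, pd i (1 + w s) = (1 + w s) * (1 + w s) * pd i (y s) := by
    intro i
    have e := congrArg (pd i) hy1
    rw [Derivation.leibniz, Derivation.map_one_eq_zero, smul_eq_mul, smul_eq_mul, map_sub,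
      Derivation.map_one_eq_zero] at e
    linear_combination (1 + w s) * e - pd i (1 + w s) * hy1
  have hlc : ∀ i j, pd i (l j) = pd j (l i) := by
    intro i j
    simp only [hl, Derivation.leibniz, smul_eq_mul, hy3, pd_comm i j]
    ring
  set h : Mat N N := Matrix.of fun m j => (-(1 / 2) : ℂ) • (l m * l j) with hh
  have hh' : ∀ m j, h m j = (-(1 / 2) : ℂ) • (l m * l j) := fun _ _ => rfl
  have h2 : ∀ f : Ohat N, (-(1 / 2) : ℂ) • f + (-(1 / 2) : ℂ) • f = -f := fun f => by
    rw [← add_smul]; norm_num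
  have hpole : PoleTwo x h := by
    intro i j
    simp only [eJ, hBB, pd_one_apply, map_zero, sum_add_distrib, sum_one_mul, sum_mul_one,
      mul_zero, sum_const_zero, sub_zero, hh', mul_comm (l j), h2, neg_add_cancel]
  have hpole1 : PoleOne x h := by
    intro i j m
    simp only [eJ, hBB', pd_one_apply, map_zero, sum_add_distrib, sum_one_mul, sum_mul_one,
      mul_zero, zero_mul, sum_const_zero, sub_zero, zero_add, hD, hh', Derivation.map_smul,
      Derivation.leibniz, smul_eq_mul]
    rw [hlc i j, hlc i m, hlc j m, ← smul_sub, ← smul_add]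
    have : l m * pd j (l i) + l j * pd m (l i) - (l m * pd j (l i) + l i * pd m (l j))
        + (l j * pd m (l i) + l i * pd m (l j)) = l j * pd m (l i) + l j * pd m (l i) := by ring
    rw [this, smul_add, h2]; ring
  obtain ⟨F, hF⟩ := exists_isForm hpole hpole1
  refine ⟨F, h, hF, ?_⟩
  have e1 : mMat x h = h := by
    rw [mMat, hx, jac_one, Matrix.transpose_one, Matrix.mul_one]
  rw [e1]
  ext i j
  rw [Matrix.transpose_apply, hh', hh', mul_comm]

theorem exists_isForm_colMat_right {x : HGroup N M} {w : Fin N → Ohat N} {s : Fin N} (hx : x.left = 1)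
    (hJ : x.right.jac = colMat w s) :
    ∃ (F : Fock N M →ₗ[ℂ] Fock N M) (h : Mat N N),
      IsForm F x h ∧ (mMat x h)ᵀ = mMat x h := by
  obtain ⟨y, hy1, hy2, hy⟩ := inv_colMat (A := jacGL x.right) hJ
  set v : Mat N N := (jacGL x.right)⁻¹.1 with hv
  have hw : ∀ i j, pd i (w j) = pd j (w i) := by
    intro i j
    have e := pd_jac x.right i s j
    simp only [hJ, colMat_apply, if_true, map_add, pd_one_apply, zero_add] at e
    exact e.symm
  have hB : ∀ i, bunMat x i = 0 := bunMat_of_left fun k p q => by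
    rw [hx, inv_one]; exact pd_one_apply _ _ _
  set u := 1 + w s with hu
  set l : Fin N → Ohat N := fun i => (1 - y s) * pd i u with hl
  have hpu : ∀ i, pd i u = pd s (w i) := fun i => by
    rw [hu, map_add, Derivation.map_one_eq_zero, zero_add, hw]
  have hpv : ∀ m i k, pd m (v i k) = if k = s then -pd m (y i) else 0 := by
    intro m i k
    rw [hy, map_sub, pd_one_apply, zero_sub]
    split_ifs <;> simp
  have hsv : ∀ i (f : Fin N → Ohat N), ∑ k, v i k * f k = f i - y i * f s := by
    intro i f
    simp only [hy, sub_mul, sum_sub_distrib, ite_mul, zero_mul, Finset.sum_ite_eq',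
      mem_univ, if_true, sum_one_mul]
  have hD : ∀ i f, lieD (v i) f = pd i f - y i * pd s f := fun i f => hsv i fun k => pd k f
  set L : Fin N → Ohat N := fun i => pd s (y i) with hL
  have hpyu : ∀ i, pd s (w i) = u * L i + y i * pd s u := by
    intro i
    have e := congrArg (pd s) (hy2 i)
    rw [Derivation.leibniz, smul_eq_mul, smul_eq_mul] at e
    exact e
  have hLl : ∀ i, L i = l i - y i * l s := by
    intro i
    have e := hpyu i
    rw [← hpu] at e
    simp only [hl]
    linear_combination L i * (-hy1) - (1 - y s) * e
  have hlc : ∀ i j, pd i (l j) = pd j (l i) := by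
    intro i j
    have hys : ∀ k, pd k (y s) = (1 - y s) * (1 - y s) * pd k u := by
      intro k
      have e := congrArg (pd k) hy1
      rw [Derivation.leibniz, Derivation.map_one_eq_zero, smul_eq_mul, smul_eq_mul, map_sub,
        Derivation.map_one_eq_zero] at e
      linear_combination (-(1 - y s)) * e - pd k (y s) * hy1
    simp only [hl, Derivation.leibniz, smul_eq_mul, map_sub, Derivation.map_one_eq_zero, hys, pd_comm i j u]
    ring
  have hLy : ∀ i, pd s (y i) = L i := fun i => rfl
  clear_value l L
  have hLc : ∀ i m, pd m (L i) = pd m (l i) - (y i * pd m (l s) + l s * pd m (y i)) := fun i m => by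
    rw [hLl, map_sub, Derivation.leibniz, smul_eq_mul, smul_eq_mul]
  have hdy : ∀ i j, pd i (y j) - y i * L j = pd j (y i) - y j * L i := by
    intro i j
    have e := lieD_comm x.right i j (coord s)
    rw [lieD_coord, lieD_coord, ← hv, hD, hD, hpv, hpv, hpv, hpv, hLy, hLy] at e
    simp only [if_true] at e
    linear_combination -e
  have hdL : ∀ i j, pd i (L j) - y i * pd s (L j) = pd j (L i) - y j * pd s (L i) := by
    intro i j
    rw [hLc, hLc, hLc, hLc, hLy, hLy]
    linear_combination hlc i j - l s * hdy i j - y i * hlc s j + y j * hlc s i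
  set H : Ohat N := algebraMap ℂ _ (1 / 2) with hH
  have hH2 : H + H = 1 := by rw [hH, ← map_add]; norm_num
  have hHd : ∀ m, pd m H = 0 := fun m => Derivation.map_algebraMap _ _
  clear_value H
  set h : Mat N N := Matrix.of fun m j => H * (l m * L j) with hh
  have hh' : ∀ m j, h m j = H * (l m * L j) := fun _ _ => rfl
  have hdh : ∀ i m j, pd i (h m j) = H * (l m * pd i (L j) + L j * pd i (l m)) := by
    intro i m j
    rw [hh', Derivation.leibniz, Derivation.leibniz, hHd, smul_zero, add_zero, smul_eq_mul, smul_eq_mul,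
      smul_eq_mul]
  have hsum : ∀ F G : Fin N → Ohat N, ∑ k, ∑ l', (if k = s then F l' else 0) * (if l' = s then G k else 0)
      = F s * G s := by
    intro F G
    rw [sum_eq_single s (fun k _ hk => by simp [hk]) (by simp)]
    simp
  have hvs : ∀ i (f : Fin N → Ohat N), ∑ k, f k * v i k = f i - y i * f s := fun i f =>
    (sum_congr rfl fun k _ => mul_comm _ _).trans (hsv i f)
  have hpole : PoleTwo x h := by
    intro i j
    rw [← hv, sum_add_distrib, hsv i fun k => h k j, hvs j fun k => h k i]
    have e : ∑ k, ∑ l', pd l' (v i k) * pd k (v j l') = L i * L j := by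
      simp only [hpv]
      rw [hsum (fun l' => -pd l' (y i)) fun k => -pd k (y j), hLy, hLy, neg_mul_neg]
    rw [e]
    simp only [hB, Matrix.zero_apply, mul_zero, sum_const_zero, add_zero]
    rw [hh', hh', hh', hh']
    linear_combination (-H * L j) * hLl i - H * L i * hLl j + L i * L j * hH2
  have hpole1 : PoleOne x h := by
    intro i j m
    have hpm : ∀ i k l', pd m (pd l' (v i k)) = if k = s then -pd m (pd l' (y i)) else 0 := by
      intro i k l'
      rw [hpv]; split_ifs <;> simp
    have hvh : ∑ k, pd m (v i k) * h k j = -pd m (y i) * h s j := by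
      simp only [hpv, ite_mul, zero_mul, Finset.sum_ite_eq', mem_univ, if_true]
    have e : ∑ k, ∑ l', pd m (pd l' (v i k)) * pd k (v j l') = pd m (L i) * L j := by
      simp only [hpm]
      simp only [hpv]
      rw [hsum (fun l' => -pd m (pd l' (y i))) fun k => -pd k (y j), hLy, hLy, neg_mul_neg]
    rw [← hv, sum_add_distrib, hvh, hvs j fun k => pd m (h k i), e, hD, hD]
    simp only [hB, Matrix.zero_apply, mul_zero, sum_const_zero, add_zero]
    simp only [hdh]
    rw [hh']
    linear_combination H * l m * hdL i j + H * L j * hlc i m - H * L j * y i * hlc s m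
      - H * L i * hlc j m + H * L i * y j * hlc s m - H * L j * hLc i m - H * pd m (L i) * hLl j
      + pd m (L i) * L j * hH2
  obtain ⟨F, hF⟩ := exists_isForm hpole hpole1
  refine ⟨F, h, hF, ?_⟩
  have e1 : ∀ k n, mMat x h k n = H * (l k * l n) := by
    intro k n
    rw [mMat, Matrix.mul_apply]
    simp only [Matrix.transpose_apply, hJ, colMat_apply, mul_add, sum_add_distrib, mul_ite, mul_zero,
      Finset.sum_ite_eq', mem_univ, if_true, hh', sum_mul_one]
    linear_combination H * l k * hLl n + H * l k * w n * hLl s + H * l k * l s * (1 - y s) * hy2 n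
      + H * l k * l s * y n * hy1
  ext i j
  rw [Matrix.transpose_apply, e1, e1, mul_comm (l j)]

/-! ### The composition law -/

theorem neg_one_current_fn (v h : Fin N → Ohat N) (B : Mat M N) (f : Ohat N) :
    mode (-1) (current v B h) (fn f : Fock N M) = current (fun k => v k * f) (B.map (· * f))
      (fun m => h m * f + ∑ k, pd m (v k) * pd k f) := by
  have hP : mode (-1) (curP B) (fn f : Fock N M) = curP (B.map (· * f)) := by
    simp only [curP, map_sum, LinearMap.sum_apply, Matrix.map_apply]
    refine sum_congr rfl fun p _ => sum_congr rfl fun q _ => ?_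
    rw [mode_psi_mul (fun m hm => ?_) (fun s => dL_fn _ _), dL_fn, map_zero, add_zero, neg_one_phi_fn]
    obtain ⟨k, rfl⟩ := Int.eq_ofNat_of_zero_le (show 0 ≤ m by omega)
    exact prod_phi_fn k q _ f
  have hH : mode (-1) (curH h) (fn f : Fock N M) = curH (fun m => h m * f) := by
    simp only [curH, map_sum, LinearMap.sum_apply]
    refine sum_congr rfl fun k _ => ?_
    rw [mode_b'_mul (fun m hm => mode_fn_natCast (fun i m => dA_fn i m f) (by omega)) (fun s => dA_fn _ _ _),
      dA_fn, map_zero, add_zero, mode_fn_neg_one (fun i m => dA_fn i m _), fn_mul]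
  rw [current, map_add, map_sub, LinearMap.add_apply, LinearMap.sub_apply, neg_one_curA_fn, hP, hH, current,
    show (fun m => h m * f + ∑ k, pd m (v k) * pd k f)
      = (fun m => h m * f) + fun m => ∑ k, pd m (v k) * pd k f from rfl, curH_add]
  abel

theorem sum_current {ι : Type*} [Fintype ι] (v h : ι → Fin N → Ohat N)
    (B : ι → Mat M N) : ∑ i, (current (v i) (B i) (h i) : Fock N M)
      = current (fun k => ∑ i, v i k) (∑ i, B i) (fun k => ∑ i, h i k) := by
  simp only [current, sum_add_distrib, sum_sub_distrib, curH_sum, curA, curP, Matrix.sum_apply,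
    fn_sum, mul_sum]
  congr 2
  · exact sum_comm
  · rw [sum_comm]
    exact sum_congr rfl fun p _ => sum_comm

namespace IsForm

variable {F G : Fock N M →ₗ[ℂ] Fock N M} {x y : HGroup N M} {h h' : Mat N N}

theorem map_curA (hF : IsForm F x h) (u : Fin N → Ohat N) : F (curA u) = current
    (fun l => ∑ k, (jacGL x.right)⁻¹.1 k l * x.right.pull (u k))
    (∑ k, (bunMat x k).map (· * x.right.pull (u k)))
    (fun m => ∑ k, (h m k * x.right.pull (u k)
      + ∑ l, pd m ((jacGL x.right)⁻¹.1 k l) * pd l (x.right.pull (u k)))) := by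
  rw [curA, map_sum, ← sum_current]
  refine sum_congr rfl fun k _ => ?_
  refine (hF.isVHom.map_gen_mul (Sum.inl (BosGen.a k 0)) (fn (u k))).trans ?_
  rw [hF.map_fn, ← neg_one_current_fn, ← hF.map_a]
  rfl

theorem map_curH (hF : IsForm F x h) (u : Fin N → Ohat N) :
    F (curH u) = curH fun m => ∑ k, x.right.jac m k * x.right.pull (u k) := by
  rw [curH_sum, curH, map_sum]
  refine sum_congr rfl fun k _ => ?_
  refine (hF.isVHom.map_gen_mul (Sum.inl (BosGen.b k 0)) (fn (u k))).trans ?_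
  have e : F (gen (Sum.inl (BosGen.b k 0))) = transl (fn (x.right.comp k)) := by
    have e1 := hF.isVHom.map_transl (fn (coord k))
    rw [transl_coord, hF.map_fn, Subst.pull_coord] at e1
    exact e1
  rw [e, hF.map_fn, mode_transl]
  norm_num
  rw [mode_fn_neg_two (fun i m => dA_fn i m _), transl_fn_mul]
  rfl

theorem map_phi_fn (hF : IsForm F x h) (q : Fin M) (f : Ohat N) :
    F (phi q * fn f) = linPhi fun s => x.left.1 s q * x.right.pull f := by
  refine (hF.isVHom.map_gen_mul (Sum.inr (FerGen.phi q 0)) (fn f)).trans ?_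
  have e : F (gen (Sum.inr (FerGen.phi q 0))) = linPhi fun j => x.left.1 j q := hF.map_phi q
  simp only [e, hF.map_fn, linPhi, map_sum, LinearMap.sum_apply, neg_one_phi_fn]

theorem map_psi_fn (hF : IsForm F x h) (p : Fin M) (f : Ohat N) :
    F (psi p * fn f) = linPsi fun r => x.left⁻¹.1 p r * x.right.pull f := by
  refine (hF.isVHom.map_gen_mul (Sum.inr (FerGen.psi p 0)) (fn f)).trans ?_
  have e : F (gen (Sum.inr (FerGen.psi p 0))) = linPsi fun j => x.left⁻¹.1 p j := hF.map_psi p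
  simp only [e, hF.map_fn, linPsi, map_sum, LinearMap.sum_apply, neg_one_psi_fn]

theorem map_psi_phi_fn (hF : IsForm F x h) (p q : Fin M) (f : Ohat N) : F (psi p * (phi q * fn f))
    = curP (Matrix.of fun r s => x.left⁻¹.1 p r * (x.left.1 s q * x.right.pull f))
      + curH fun m => ∑ r, pd m (x.left⁻¹.1 p r) * (x.left.1 r q * x.right.pull f) := by
  refine (hF.isVHom.map_gen_mul (Sum.inr (FerGen.psi p 0)) (phi q * fn f)).trans ?_
  have e : F (gen (Sum.inr (FerGen.psi p 0))) = linPsi fun j => x.left⁻¹.1 p j := hF.map_psi p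
  rw [hF.map_phi_fn, e, curH_sum]
  simp only [linPhi, linPsi, map_sum, LinearMap.sum_apply, neg_one_psi_phi_fn, sum_add_distrib,
    Finset.sum_ite_eq, Finset.sum_ite_eq', mem_univ, if_true, transl_fn_mul, curP, Matrix.of_apply]
  congr 1
  · exact sum_comm

theorem map_curP (hF : IsForm F x h) (C : Mat M N) : F (curP C)
    = curP (x.left⁻¹.1ᵀ * C.map x.right.pull * x.left.1ᵀ)
      + curH fun m => ∑ p, ∑ q, ∑ r, pd m (x.left⁻¹.1 p r) * (x.left.1 r q * x.right.pull (C p q)) := by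
  have e : ∀ D : Fin M → Fin M → Mat M N,
      (curP (∑ p, ∑ q, D p q) : Fock N M) = ∑ p, ∑ q, curP (D p q) := by
    have e0 : ∀ D : Fin M → Mat M N, (curP (∑ p, D p) : Fock N M) = ∑ p, curP (D p) :=
      fun D => map_sum (AddMonoidHom.mk' (curP (N := N)) curP_add) D Finset.univ
    intro D
    simp only [e0]
  rw [curP, map_sum, curH_sum]
  simp only [map_sum, hF.map_psi_phi_fn, curH_sum, sum_add_distrib]
  rw [← e]
  congr 2
  ext r s
  simp only [Matrix.sum_apply, Matrix.of_apply, Matrix.mul_apply, Matrix.transpose_apply, Matrix.map_apply,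
    sum_mul]
  rw [sum_comm]
  exact sum_congr rfl fun q _ => sum_congr rfl fun p _ => by ring

end IsForm

theorem inv_jac_mul (x y : CoordChange N) :
    (jacGL (x * y))⁻¹.1 = (jacGL y)⁻¹.1.map x.pull * (jacGL x)⁻¹.1 := by
  have e : jacGL (x * y) = jacGL x * pullGL N N x (jacGL y) := Units.ext (jac_mul x y)
  rw [e, mul_inv_rev, ← map_inv]
  rfl

theorem left_inv_mul (x y : HGroup N M) :
    (x * y).left⁻¹.1 = y.left⁻¹.1.map x.right.pull * x.left⁻¹.1 := by
  rw [SemidirectProduct.mul_left, mul_inv_rev, ← map_inv]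
  rfl

theorem bunMat_mul (x y : HGroup N M) (i : Fin N) : bunMat (x * y) i
    = x.left⁻¹.1ᵀ * (bunMat y i).map x.right.pull * x.left.1ᵀ
      + ∑ k, (bunMat x k).map (· * x.right.pull ((jacGL y.right)⁻¹.1 i k)) := by
  set w := (jacGL (x * y).right)⁻¹.1 i with hw
  have hD : ∀ f, lieD w f
      = ∑ k, x.right.pull ((jacGL y.right)⁻¹.1 i k) * lieD ((jacGL x.right)⁻¹.1 k) f := by
    intro f
    have e : ∀ l, w l = ∑ k, x.right.pull ((jacGL y.right)⁻¹.1 i k) * (jacGL x.right)⁻¹.1 k l := by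
      intro l
      rw [hw, SemidirectProduct.mul_right, inv_jac_mul, Matrix.mul_apply]
      rfl
    simp only [lieD, e, sum_mul, mul_sum]
    rw [sum_comm]
    exact sum_congr rfl fun k _ => sum_congr rfl fun l _ => by ring
  have hp : ∀ f, lieD w (x.right.pull f) = x.right.pull (lieD ((jacGL y.right)⁻¹.1 i) f) := by
    intro f
    simp only [hD, lieD_pull]
    simp only [lieD, map_sum, map_mul]
  have hB : (y.left.1.map x.right.pull) * (y.left⁻¹.1.map x.right.pull) = 1 := by
    rw [← Matrix.map_mul, y.left.mul_inv, Matrix.map_one _ (map_zero _) (map_one _)]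
  have e1 : (y.left⁻¹.1.map x.right.pull).map (lieD w)
      = (y.left⁻¹.1.map (lieD ((jacGL y.right)⁻¹.1 i))).map x.right.pull := by
    ext p q; exact hp _
  have e2 : (x.left.1 * x.left⁻¹.1.map (lieD w))
      = ∑ k, (x.left.1 * x.left⁻¹.1.map (lieD ((jacGL x.right)⁻¹.1 k))).map
          (· * x.right.pull ((jacGL y.right)⁻¹.1 i k)) := by
    ext p q
    simp only [Matrix.mul_apply, Matrix.map_apply, Matrix.sum_apply, hD, mul_sum, sum_mul]
    rw [sum_comm]
    exact sum_congr rfl fun k _ => sum_congr rfl fun l _ => by ring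
  have hl : lieD w = lieDer w := funext (lieD_eq w)
  rw [bunMat, left_inv_mul, ← hw, hl, map_mul_derivation, ← hl, e1, SemidirectProduct.mul_left]
  change ((x.left.1 * y.left.1.map x.right.pull) * _)ᵀ = _
  rw [Matrix.mul_add, Matrix.mul_assoc, ← Matrix.mul_assoc _ (y.left⁻¹.1.map x.right.pull), hB, Matrix.one_mul,
    e2]
  simp only [bunMat, Matrix.transpose_add, Matrix.transpose_mul, Matrix.map_mul, Matrix.transpose_sum,
    Matrix.transpose_map, Matrix.mul_assoc, Matrix.transpose_transpose]
  rw [add_comm]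
  congr 1
  exact sum_congr rfl fun k _ => by rw [← Matrix.transpose_mul, Matrix.transpose_map]

/-- The functions `h` of a composition. -/
def compH (x y : HGroup N M) (h h' : Mat N N) : Mat N N :=
  Matrix.of fun m i => (∑ k, (h m k * x.right.pull ((jacGL y.right)⁻¹.1 i k)
      + ∑ l, pd m ((jacGL x.right)⁻¹.1 k l) * pd l (x.right.pull ((jacGL y.right)⁻¹.1 i k))))
    - (∑ p, ∑ q, ∑ r, pd m (x.left⁻¹.1 p r) * (x.left.1 r q * x.right.pull (bunMat y i p q)))
    + ∑ k, x.right.jac m k * x.right.pull (h' k i)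

theorem IsForm.comp {F G : Fock N M →ₗ[ℂ] Fock N M} {x y : HGroup N M}
    {h h' : Mat N N} (hF : IsForm F x h) (hG : IsForm G y h') :
    IsForm (F ∘ₗ G) (x * y) (compH x y h h') where
  isVHom := hF.isVHom.comp hG.isVHom
  map_fn f := by
    rw [LinearMap.comp_apply, hG.map_fn, hF.map_fn]
    exact congrArg fn (pull_mul _ _ _).symm
  map_a i := by
    rw [LinearMap.comp_apply, hG.map_a, current, map_add, map_sub, hF.map_curA, hF.map_curP, hF.map_curH,
      bunMat_mul]
    simp only [current, curP_add]
    have e : (fun l => ∑ k, (jacGL x.right)⁻¹.1 k l * x.right.pull ((jacGL y.right)⁻¹.1 i k))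
        = (jacGL (x * y).right)⁻¹.1 i := by
      funext l
      rw [SemidirectProduct.mul_right, inv_jac_mul, Matrix.mul_apply]
      exact sum_congr rfl fun k _ => mul_comm _ _
    have e2 : (fun j => compH x y h h' j i) = (fun m => ∑ k, (h m k * x.right.pull ((jacGL y.right)⁻¹.1 i k)
          + ∑ l, pd m ((jacGL x.right)⁻¹.1 k l) * pd l (x.right.pull ((jacGL y.right)⁻¹.1 i k))))
        - (fun m => ∑ p, ∑ q, ∑ r, pd m (x.left⁻¹.1 p r) * (x.left.1 r q * x.right.pull (bunMat y i p q)))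
        + fun m => ∑ k, x.right.jac m k * x.right.pull (h' k i) := rfl
    rw [e, e2, curH_add, curH_sub]
    abel
  map_phi i := by
    rw [LinearMap.comp_apply, hG.map_phi, linPhi, map_sum]
    simp only [hF.map_phi_fn, linPhi]
    rw [sum_comm]
    refine sum_congr rfl fun s _ => ?_
    rw [← mul_sum, ← fn_sum]
    rfl
  map_psi i := by
    rw [LinearMap.comp_apply, hG.map_psi, linPsi, map_sum]
    simp only [hF.map_psi_fn, linPsi]
    rw [sum_comm]
    refine sum_congr rfl fun s _ => ?_
    rw [← mul_sum, ← fn_sum, left_inv_mul, Matrix.mul_apply]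
    congr 2
    exact sum_congr rfl fun k _ => mul_comm _ _

theorem map_pull_pd {r : ℕ} (g : CoordChange N) (B : Mat r N) (l : Fin N) :
    (B.map g.pull).map (pd l) = ∑ a, g.jac l a • (B.map (pd a)).map g.pull := by
  ext p q
  rw [Matrix.sum_apply]
  exact Subst.pd_pull _ _ _

theorem traceTensor_apply {r : ℕ} (ρ : CrossedHom N M r) (x y : HGroup N M) (m n : Fin N) :
    traceTensor ρ x y m n = -∑ p, x.right.jac n p * Matrix.trace ((ρ.toFun x)⁻¹.1.map (pd m)
      * ((ρ.toFun x).1 * (rightForm (ρ.toFun y) p).map x.right.pull)) := by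
  have e : leftForm (ρ.toFun x) m = -((ρ.toFun x)⁻¹.1.map (pd m) * (ρ.toFun x).1) := by
    rw [map_inv_derivation _ (ρ.toFun x).inv_mul, neg_mul, neg_neg, Matrix.mul_assoc, (ρ.toFun x).inv_mul,
      Matrix.mul_one]
    rfl
  rw [traceTensor, Matrix.of_apply, e, neg_mul, Matrix.trace_neg, mul_sum, Matrix.trace_sum]
  simp only [Matrix.mul_smul, Matrix.trace_smul, smul_eq_mul, Matrix.mul_assoc, sum_neg_distrib]

theorem sum_rotate {ι κ τ A : Type*} [AddCommMonoid A] [Fintype ι] [Fintype κ] [Fintype τ] (f : ι → κ → τ → A) :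
    ∑ i, ∑ k, ∑ l, f i k l = ∑ k, ∑ l, ∑ i, f i k l := by
  rw [sum_comm]
  exact sum_congr rfl fun k _ => sum_comm

theorem trace_mul_eq_sum {r : ℕ} (X Y : Mat r N) :
    Matrix.trace (X * Y) = ∑ k, ∑ l, X k l * Y l k := rfl

/-- The coefficient matrix of a composition. -/
theorem mMat_compH (x y : HGroup N M) (h h' : Mat N N) :
    mMat (x * y) (compH x y h h') = mMat x h + pull2 x.right (mMat y h')
      + traceTensor (tangentPart N M) x y - traceTensor (bundlePart N M) x y := by
  set J := x.right.jac with hJ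
  set V := (jacGL x.right)⁻¹.1 with hV
  set F := (jacGL y.right)⁻¹.1.map x.right.pull with hF
  set K := y.right.jac.map x.right.pull with hK
  have hKF : K * F = 1 := by
    rw [hK, hF, ← Matrix.map_mul, jac_mul_inv, Matrix.map_one _ (map_zero _) (map_one _)]
  have hJ2 : (x * y).right.jac = J * K := jac_mul x.right y.right
  set T : Mat N N := Matrix.of fun m i => ∑ k, ∑ l, pd m (V k l) * pd l (F i k) with hT
  set U : Mat N N := Matrix.of fun m i => ∑ p, ∑ q, ∑ r, pd m (x.left⁻¹.1 p r)
    * (x.left.1 r q * x.right.pull (bunMat y i p q)) with hU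
  have e : compH x y h h' = h * Fᵀ + T - U + J * h'.map x.right.pull := by
    ext m i
    simp only [compH, Matrix.of_apply, Matrix.add_apply, Matrix.sub_apply, Matrix.mul_apply, hT, hU,
      Matrix.transpose_apply, sum_add_distrib, hF, Matrix.map_apply, hV, hJ]
  have eT : T * (J * K)ᵀ = traceTensor (tangentPart N M) x y := by
    have hS : ∀ l k n, ∑ i, pd l (F i k) * (J * K) n i = -∑ p, J n p
        * (J * (rightForm (jacGL y.right) p).map x.right.pull) l k := by
      intro l k n
      have h1 : (J * K * F.map (pd l)) n k = -(J * (K.map (pd l) * F)) n k := by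
        have := map_mul_derivation (pd l) K F
        rw [hKF, map_one_derivation] at this
        rw [Matrix.mul_assoc, eq_neg_of_add_eq_zero_left this.symm, Matrix.mul_neg, Matrix.neg_apply]
      rw [sum_congr rfl fun i _ => mul_comm _ _]
      refine h1.trans (congrArg _ ((Matrix.mul_apply).trans (sum_congr rfl fun p _ => ?_)))
      congr 1
      rw [hK, map_pull_pd, sum_mul, Matrix.sum_apply, Matrix.mul_apply]
      refine sum_congr rfl fun a _ => ?_
      rw [Matrix.smul_mul, Matrix.smul_apply, smul_eq_mul, rightForm, Matrix.map_mul, Matrix.mul_apply,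
        Matrix.mul_apply]
      congr 1
      exact sum_congr rfl fun q _ => by
        simp only [Matrix.map_apply]; rw [pd_jac]; rfl
    ext m n
    rw [traceTensor_apply, Matrix.mul_apply]
    simp only [Matrix.transpose_apply, hT, Matrix.of_apply, sum_mul]
    simp only [trace_mul_eq_sum, mul_sum]
    refine (sum_rotate _).trans (Eq.trans ?_ (congrArg _ (sum_rotate _).symm))
    rw [← sum_neg_distrib]
    refine sum_congr rfl fun k _ => ?_
    rw [← sum_neg_distrib]
    refine sum_congr rfl fun l _ => ?_
    have := congrArg (pd m (V k l) * ·) (hS l k n)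
    simp only [mul_sum, mul_neg] at this
    simp only [mul_assoc]
    refine this.trans (congrArg _ (sum_congr rfl fun p _ => ?_))
    exact mul_left_comm _ _ _
  have eU : U * (J * K)ᵀ = traceTensor (bundlePart N M) x y := by
    have hW : ∀ n p q, ∑ i, x.right.pull (bunMat y i p q) * (J * K) n i
        = -∑ l, J n l * x.right.pull (rightForm y.left l q p) := by
      intro n p q
      have h1 : ∀ l, ∑ i, y.right.jac l i * bunMat y i p q = -rightForm y.left l q p := by
        intro l
        have h2 : ∀ f, ∑ i, y.right.jac l i * lieD ((jacGL y.right)⁻¹.1 i) f = pd l f := by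
          intro f
          simp only [lieD, mul_sum, ← mul_assoc]
          rw [sum_comm]
          simp only [← sum_mul]
          simp only [← Matrix.mul_apply, jac_mul_inv, sum_one_mul]
        have h3 : rightForm y.left l = -(y.left.1 * y.left⁻¹.1.map (pd l)) := by
          have := map_mul_derivation (pd l) y.left.1 y.left⁻¹.1
          rw [y.left.mul_inv, map_one_derivation] at this
          exact eq_neg_of_add_eq_zero_right this.symm
        rw [h3, Matrix.neg_apply, neg_neg]
        simp only [bunMat, Matrix.transpose_apply, Matrix.mul_apply, Matrix.map_apply, mul_sum]
        rw [sum_comm]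
        refine sum_congr rfl fun k _ => ?_
        rw [← h2, mul_sum]
        exact sum_congr rfl fun i _ => mul_left_comm _ _ _
      simp only [Matrix.mul_apply, mul_sum]
      rw [sum_comm, ← sum_neg_distrib]
      refine sum_congr rfl fun l _ => ?_
      rw [← mul_neg, ← map_neg, ← h1, map_sum, mul_sum]
      exact sum_congr rfl fun i _ => by rw [map_mul, hK, Matrix.map_apply]; ring
    ext m n
    rw [traceTensor_apply, Matrix.mul_apply]
    simp only [Matrix.transpose_apply, hU, Matrix.of_apply, sum_mul]
    simp only [trace_mul_eq_sum, mul_sum]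
    have hL : ∀ p q r, ∑ i, pd m (x.left⁻¹.1 p r) * (x.left.1 r q * x.right.pull (bunMat y i p q)) * (J * K) n i
        = -∑ l, J n l * (pd m (x.left⁻¹.1 p r) * (x.left.1 r q * x.right.pull (rightForm y.left l q p))) := by
      intro p q r
      have := congrArg (pd m (x.left⁻¹.1 p r) * x.left.1 r q * ·) (hW n p q)
      simp only [mul_sum, mul_neg] at this
      refine (sum_congr rfl fun i _ => ?_).trans
        (this.trans (congrArg _ (sum_congr rfl fun l _ => ?_))) <;> ring
    refine Finset.sum_comm.trans (Eq.trans ?_ (congrArg _ (sum_rotate _).symm))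
    rw [← sum_neg_distrib]
    refine sum_congr rfl fun p _ => ?_
    rw [sum_rotate, sum_comm, ← sum_neg_distrib]
    refine sum_congr rfl fun r _ => ?_
    rw [sum_congr rfl fun q _ => hL p q r, sum_neg_distrib, sum_comm]
    refine congrArg _ (sum_congr rfl fun l _ => ?_)
    rw [← mul_sum, ← mul_sum]
    rfl
  rw [mMat, hJ2, e, Matrix.add_mul, Matrix.sub_mul, Matrix.add_mul, eT, eU]
  have e1 : h * Fᵀ * (J * K)ᵀ = mMat x h := by
    rw [Matrix.mul_assoc, ← Matrix.transpose_mul, Matrix.mul_assoc, hKF, Matrix.mul_one]; rfl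
  have e2 : J * h'.map x.right.pull * (J * K)ᵀ = pull2 x.right (mMat y h') := by
    change _ = J * (h' * y.right.jacᵀ).map x.right.pull * Jᵀ
    rw [Matrix.map_mul, Matrix.transpose_mul]
    simp only [Matrix.mul_assoc]
    rfl
  rw [e1, e2]
  abel

/-! ### The trace cocycle -/

section TraceForm

variable {r : ℕ}

/-- The quadratic differential `tr (A⁻¹ dA ⊗ dB B⁻¹)`. -/
def traceForm (A B : GL (Fin r) (Ohat N)) : Mat N N :=
  Matrix.of fun m n => Matrix.trace (leftForm A m * rightForm B n)

theorem leftForm_mul (A B : GL (Fin r) (Ohat N)) (m : Fin N) :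
    leftForm (A * B) m = B⁻¹.1 * (leftForm A m + rightForm B m) * B.1 := by
  rw [leftForm, leftForm, rightForm, mul_inv_rev, Units.val_mul, Units.val_mul, map_mul_derivation]
  simp only [Matrix.mul_add, Matrix.add_mul, Matrix.mul_assoc, B.inv_mul, Matrix.mul_one]
  rw [← Matrix.mul_assoc A⁻¹.1, A.inv_mul, Matrix.one_mul, add_comm]

theorem leftForm_eq (B : GL (Fin r) (Ohat N)) (m : Fin N) : leftForm B m = B⁻¹.1 * rightForm B m * B.1 := by
  rw [leftForm, rightForm, Matrix.mul_assoc, Matrix.mul_assoc, B.inv_mul, Matrix.mul_one]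

theorem rightForm_mul (A B : GL (Fin r) (Ohat N)) (m : Fin N) :
    rightForm (A * B) m = rightForm A m + A.1 * rightForm B m * A⁻¹.1 := by
  rw [rightForm, rightForm, rightForm, mul_inv_rev, Units.val_mul, Units.val_mul, map_mul_derivation]
  simp only [Matrix.add_mul, Matrix.mul_assoc]
  rw [← Matrix.mul_assoc B.1, B.mul_inv, Matrix.one_mul, add_comm]

theorem inv_pullGL (g : CoordChange N) (B : GL (Fin r) (Ohat N)) :
    (pullGL N r g B)⁻¹.1 = B⁻¹.1.map g.pull := by rw [← map_inv]; rfl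

theorem rightForm_pullGL (g : CoordChange N) (B : GL (Fin r) (Ohat N)) (m : Fin N) :
    rightForm (pullGL N r g B) m = ∑ a, g.jac m a • (rightForm B a).map g.pull := by
  rw [rightForm, inv_pullGL]
  change (B.1.map g.pull).map (pd m) * _ = _
  rw [map_pull_pd, sum_mul]
  exact sum_congr rfl fun a _ => by rw [Matrix.smul_mul, rightForm, Matrix.map_mul]

theorem leftForm_pullGL (g : CoordChange N) (B : GL (Fin r) (Ohat N)) (m : Fin N) :
    leftForm (pullGL N r g B) m = ∑ a, g.jac m a • (leftForm B a).map g.pull := by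
  rw [leftForm, inv_pullGL]
  change _ * (B.1.map g.pull).map (pd m) = _
  rw [map_pull_pd, mul_sum]
  exact sum_congr rfl fun a _ => by rw [Matrix.mul_smul, leftForm, Matrix.map_mul]

theorem traceTensor_eq (ρ : CrossedHom N M r) (x y : HGroup N M) :
    traceTensor ρ x y = traceForm (ρ.toFun x) (pullGL N r x.right (ρ.toFun y)) := by
  ext m n
  rw [traceForm, Matrix.of_apply, rightForm_pullGL]
  rfl

theorem pull2_traceForm (g : CoordChange N) (A B : GL (Fin r) (Ohat N)) :
    pull2 g (traceForm A B) = traceForm (pullGL N r g A) (pullGL N r g B) := by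
  ext m n
  change _ = Matrix.trace (leftForm _ m * rightForm _ n)
  rw [pull2_apply, leftForm_pullGL, rightForm_pullGL, sum_mul,
    Matrix.trace_sum]
  refine sum_congr rfl fun p _ => ?_
  rw [mul_sum, Matrix.trace_sum]
  refine sum_congr rfl fun q _ => ?_
  rw [Matrix.smul_mul, Matrix.mul_smul, Matrix.trace_smul, Matrix.trace_smul, smul_eq_mul, smul_eq_mul,
    ← Matrix.map_mul, mul_assoc]
  simp only [traceForm, Matrix.of_apply, Matrix.trace, map_sum, Matrix.diag_apply, Matrix.map_apply]

theorem trace_conj (B : GL (Fin r) (Ohat N)) (X Y : Mat r N) :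
    Matrix.trace (B⁻¹.1 * X * B.1 * Y) = Matrix.trace (X * (B.1 * Y * B⁻¹.1)) := by
  rw [Matrix.mul_assoc, Matrix.mul_assoc, Matrix.trace_mul_comm]
  simp only [Matrix.mul_assoc]

theorem traceForm_cocycle (A B C : GL (Fin r) (Ohat N)) :
    traceForm (A * B) C + traceForm A B = traceForm B C + traceForm A (B * C) := by
  ext m n
  simp only [traceForm, Matrix.add_apply, Matrix.of_apply, leftForm_mul, leftForm_eq B, rightForm_mul, trace_conj,
    Matrix.add_mul, Matrix.mul_add, Matrix.trace_add]
  ring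

theorem traceTensor_cocycle (ρ : CrossedHom N M r) (x y z : HGroup N M) :
    traceTensor ρ (x * y) z + traceTensor ρ x y = pull2 x.right (traceTensor ρ y z) + traceTensor ρ x (y * z) := by
  simp only [traceTensor_eq, ρ.map_mul, pull2_traceForm, map_mul, SemidirectProduct.mul_right, MulAut.mul_apply]
  exact traceForm_cocycle _ _ _

theorem pd_trace_mul (i : Fin N) (X Y : Mat r N) :
    pd i (Matrix.trace (X * Y)) = Matrix.trace (X.map (pd i) * Y) + Matrix.trace (X * Y.map (pd i)) := by
  rw [← Matrix.trace_add, add_comm, ← map_mul_derivation]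
  simp only [Matrix.trace, map_sum, Matrix.diag_apply, Matrix.map_apply]

theorem map_pd_comm (B : Mat r N) (i j : Fin N) :
    (B.map (pd j)).map (pd i) = (B.map (pd i)).map (pd j) := by ext p q; exact pd_comm _ _ _

theorem pd_leftForm (A : GL (Fin r) (Ohat N)) (i j : Fin N) : (leftForm A j).map (pd i)
    = (leftForm A i).map (pd j) + (leftForm A j * leftForm A i - leftForm A i * leftForm A j) := by
  simp only [leftForm, map_mul_derivation, map_inv_derivation _ A.inv_mul, map_pd_comm A.1 i j, neg_mul,
    Matrix.mul_assoc]
  abel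

theorem pd_rightForm (A : GL (Fin r) (Ohat N)) (i j : Fin N) : (rightForm A j).map (pd i)
    = (rightForm A i).map (pd j) + (rightForm A i * rightForm A j - rightForm A j * rightForm A i) := by
  simp only [rightForm, map_mul_derivation, map_inv_derivation _ A.inv_mul, map_pd_comm A.1 i j, mul_neg,
    Matrix.mul_assoc]
  abel

theorem csForm_conj {A : GL (Fin r) (Ohat N)} (B : GL (Fin r) (Ohat N)) {X : Fin N → Mat r N}
    (h : ∀ i, leftForm A i = B⁻¹.1 * X i * B.1) (i j k : Fin N) :
    csForm A i j k = Matrix.trace (X i * (X j * X k - X k * X j)) := by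
  have e : ∀ j k, B⁻¹.1 * X j * B.1 * (B⁻¹.1 * X k * B.1) = B⁻¹.1 * (X j * X k) * B.1 := by
    intro j k
    rw [Matrix.mul_assoc, ← Matrix.mul_assoc B.1, ← Matrix.mul_assoc B.1, B.mul_inv, Matrix.one_mul]
    simp only [Matrix.mul_assoc]
  rw [csForm, h, h, h, e, e, trace_conj]
  congr 2
  rw [Matrix.mul_sub, Matrix.sub_mul]
  simp only [Matrix.mul_assoc, B.mul_inv, Matrix.mul_one]
  simp only [← Matrix.mul_assoc, B.mul_inv, Matrix.one_mul]

/-- The exterior derivative of the skew symmetrization of `tr (A⁻¹ dA ⊗ dB B⁻¹)`. -/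
theorem extD2_skew_traceForm (A B : GL (Fin r) (Ohat N)) (i j k : Fin N) :
    extD2 (skew (traceForm A B)) i j k = csForm B i j k - csForm (A * B) i j k + csForm A i j k := by
  rw [csForm_conj B (leftForm_eq B), csForm_conj B (leftForm_mul A B), csForm]
  simp only [extD2, skew, traceForm, Matrix.sub_apply, Matrix.of_apply, Matrix.transpose_apply, map_sub,
    pd_trace_mul]
  rw [pd_leftForm A i j, pd_leftForm A j k, pd_leftForm A k i, pd_rightForm B i j, pd_rightForm B j k,
    pd_rightForm B k i]
  generalize leftForm A i = a, leftForm A j = a', leftForm A k = a'', rightForm B i = b, rightForm B j = b',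
    rightForm B k = b''
  simp only [Matrix.mul_add, Matrix.add_mul, Matrix.mul_sub, Matrix.sub_mul, Matrix.trace_add, Matrix.trace_sub,
    ← Matrix.mul_assoc]
  have c : ∀ x y z : Mat r N, Matrix.trace (x * y * z) = Matrix.trace (y * z * x) :=
    fun x y z => by rw [Matrix.mul_assoc, Matrix.trace_mul_comm]
  simp only [c a' a b'', c a'' a' b, c a'' a b', c b a' a'', c b a'' a', c b b' a'', c b' a'' b, c b b'' a',
    c b'' a' b, c b a' b'', c b a'' b']
  ring

end TraceForm

/-! ### Generators of the group -/

theorem isUnit_of_eval0 {f : Ohat N} (h : eval0 f ≠ 0) : IsUnit f := by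
  obtain ⟨F, rfl⟩ := germ_surjective f
  rw [eval0_germ] at h
  have hF : AnalyticAt ℂ F.1 0 := F.2
  refine IsUnit.of_mul_eq_one (germ ⟨fun x => (F.1 x)⁻¹, hF.inv h⟩) ?_
  rw [← map_mul, ← map_one germ, germ_eq]
  filter_upwards [hF.continuousAt.eventually_ne h] with x hx
  exact mul_inv_cancel₀ hx

theorem isUnit_of_map_eval0 {r : ℕ} {X : Mat r N} (h : X.map eval0 = 1) : IsUnit X := by
  rw [Matrix.isUnit_iff_isUnit_det]
  refine isUnit_of_eval0 ?_
  have e := RingHom.map_det (eval0 (N := N)) X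
  rw [e, RingHom.mapMatrix_apply, h, Matrix.det_one]
  exact one_ne_zero

section Simple

variable {r : ℕ}

/-- The value of an invertible matrix at the origin. -/
def evGL : GL (Fin r) (Ohat N) →* GL (Fin r) ℂ := Matrix.GeneralLinearGroup.map eval0

/-- Constant invertible matrices. -/
def constGL : GL (Fin r) ℂ →* GL (Fin r) (Ohat N) := Matrix.GeneralLinearGroup.map (algebraMap ℂ (Ohat N))

theorem evGL_constGL (c : GL (Fin r) ℂ) : evGL (constGL c : GL (Fin r) (Ohat N)) = c :=
  Units.ext (by ext i j; rfl)

theorem pd_constGL (c : GL (Fin r) ℂ) (k : Fin N) (p q : Fin r) :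
    pd k ((constGL c : GL (Fin r) (Ohat N)).1 p q) = 0 := Derivation.map_algebraMap _ _

theorem pd_inv_constGL (c : GL (Fin r) ℂ) (k : Fin N) (p q : Fin r) :
    pd k ((constGL c : GL (Fin r) (Ohat N))⁻¹.1 p q) = 0 := by rw [← map_inv]; exact pd_constGL _ _ _ _

/-- Constant matrices and matrices that differ from the identity matrix in one column. -/
def IsSimple (A : GL (Fin r) (Ohat N)) : Prop := (∃ c, A = constGL c) ∨ ∃ w s, A.1 = colMat w s

theorem IsSimple.csForm_eq_zero {A : GL (Fin r) (Ohat N)} (h : IsSimple A) (g : CoordChange N) (i j k : Fin N) :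
    csForm (pullGL N r g A) i j k = 0 := by
  rcases h with ⟨c, rfl⟩ | ⟨w, s, h⟩
  · refine csForm_of_const (fun k p q => ?_) i j k
    change pd k (g.pull (algebraMap ℂ (Ohat N) (c.1 p q))) = 0
    rw [AlgHom.commutes, Derivation.map_algebraMap]
  · refine csForm_colMat (w := fun p => g.pull (w p)) (s := s) ?_ i j k
    ext p q
    change g.pull (A.1 p q) = _
    rw [h, colMat_apply, colMat_apply, map_add, Matrix.one_apply]
    split_ifs <;> simp

theorem isSimple_one : IsSimple (1 : GL (Fin r) (Ohat N)) := Or.inl ⟨1, (map_one _).symm⟩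

theorem eq_colMat {X : Mat r N} {s : Fin r}
    (h : ∀ i j, j ≠ s → X i j = (1 : Mat r N) i j) :
    X = colMat (fun i => X i s - (1 : Mat r N) i s) s := by
  ext i j
  rw [colMat_apply]
  by_cases hj : j = s
  · subst hj; simp
  · rw [h i j hj, if_neg hj, add_zero]

/-- Induction over the group of invertible matrices of germs. -/
theorem gl_induction {P : GL (Fin r) (Ohat N) → Prop} (hmul : ∀ A B, P A → P B → P (A * B))
    (hc : ∀ c, P (constGL c)) (hs : ∀ A w s, A.1 = colMat w s → P A) (A : GL (Fin r) (Ohat N)) : P A := by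
  set A' : GL (Fin r) (Ohat N) := (constGL (evGL A))⁻¹ * A with hA'
  have e0 : A'.1.map eval0 = 1 := by
    have : evGL A' = 1 := by rw [hA', map_mul, map_inv, evGL_constGL, inv_mul_cancel]
    exact congrArg Units.val this
  have key : ∀ S : Finset (Fin r), ∃ B : GL (Fin r) (Ohat N), P B ∧ ∀ i j,
      B.1 i j = if j ∈ S then A'.1 i j else (1 : Mat r N) i j := by
    intro S
    induction S using Finset.induction_on with
    | empty => exact ⟨1, by rw [← map_one constGL]; exact hc _, fun i j => by simp⟩
    | insert s S hs' ih =>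
      obtain ⟨B, hB, hBe⟩ := ih
      set X : Mat r N := Matrix.of fun i j =>
        if j ∈ insert s S then A'.1 i j else (1 : Mat r N) i j with hX
      have hX0 : X.map eval0 = 1 := by
        ext i j
        rw [Matrix.map_apply, hX, Matrix.of_apply]
        split_ifs
        · exact congrFun (congrFun e0 i) j
        · rw [Matrix.one_apply, Matrix.one_apply]; split_ifs <;> simp
      obtain ⟨B', hB'⟩ := isUnit_of_map_eval0 hX0
      refine ⟨B', ?_, fun i j => by rw [hB', hX, Matrix.of_apply]⟩
      have : B' = B * (B⁻¹ * B') := by group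
      rw [this]
      refine hmul _ _ hB (hs _ _ s (eq_colMat fun i j hj => ?_))
      have e : ∀ k, B'.1 k j = B.1 k j := fun k => by
        rw [hB', hX, Matrix.of_apply, hBe]
        simp [hj]
      rw [← B.inv_mul, Matrix.mul_apply, Units.val_mul, Matrix.mul_apply]
      exact sum_congr rfl fun k _ => by rw [e]
  obtain ⟨B, hB, hBe⟩ := key Finset.univ
  have : A = constGL (evGL A) * B := by
    have : B = A' := Units.ext (by ext i j; rw [hBe]; simp)
    rw [this, hA']; group
  rw [this]
  exact hmul _ _ (hc _) hB

/-- Linear coordinate changes. -/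
theorem exists_linear (c : GL (Fin N) ℂ) : ∃ g : CoordChange N, jacGL g = constGL c := by
  have hj : Subst.jac ⟨fun j => ∑ k, c.1 k j • coord k, fun j => by
      rw [map_sum]
      refine sum_eq_zero fun k _ => ?_
      rw [Algebra.smul_def, map_mul]
      exact mul_zero _⟩ = (constGL c : GL (Fin N) (Ohat N)).1 := by
    ext i j
    change pd i (∑ k, c.1 k j • coord k) = algebraMap ℂ (Ohat N) (c.1 i j)
    rw [map_sum]
    simp only [Derivation.map_smul, pd_coord, Matrix.one_apply]
    rw [sum_eq_single i (fun k _ hk => by simp [hk.symm]) (by simp), if_pos rfl, Algebra.smul_def, mul_one]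
  exact ⟨⟨_, by rw [hj]; exact (constGL c).isUnit⟩, Units.ext hj⟩

theorem evGL_jacGL_mul (g g' : CoordChange N) :
    evGL (jacGL (g * g')) = evGL (jacGL g) * evGL (jacGL g') := by
  apply Units.ext
  change (g * g').jac.map eval0 = g.jac.map eval0 * g'.jac.map eval0
  rw [jac_mul, Matrix.map_mul]
  congr 1
  ext i j
  exact Subst.eval0_pull g.toSubst (g'.jac i j)

theorem coordChange_induction {P : CoordChange N → Prop} (hmul : ∀ g g', P g → P g' → P (g * g'))
    (hc : ∀ g c, jacGL g = constGL c → P g) (hs : ∀ g w s, g.jac = colMat w s → P g) (g : CoordChange N) :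
    P g := by
  obtain ⟨g₀, h0⟩ := exists_linear (evGL (jacGL g))
  set g' := g₀⁻¹ * g with hg'
  have hg : g = g₀ * g' := by rw [hg']; group
  have e0 : g'.jac.map eval0 = 1 := by
    have := evGL_jacGL_mul g₀ g'
    rw [← hg, h0, evGL_constGL] at this
    exact congrArg Units.val (left_eq_mul.mp this)
  have key : ∀ S : Finset (Fin N), ∃ k : CoordChange N, P k ∧ ∀ i,
      k.comp i = if i ∈ S then g'.comp i else coord i := by
    intro S
    induction S using Finset.induction_on with
    | empty => exact ⟨1, hc 1 1 (by rw [map_one, jacGL_one]), fun i => by simp; rfl⟩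
    | insert s S hs' ih =>
      obtain ⟨k, hk, hke⟩ := ih
      set t : Subst N := ⟨fun i => if i ∈ insert s S then g'.comp i else coord i, fun i => by
        split_ifs
        · exact g'.zero i
        · rfl⟩ with ht
      have hX0 : t.jac.map eval0 = 1 := by
        ext i j
        change eval0 (pd i (if j ∈ insert s S then g'.comp j else coord j)) = _
        split_ifs
        · exact congrFun (congrFun e0 i) j
        · rw [pd_coord, Matrix.one_apply, Matrix.one_apply]; split_ifs <;> simp
      set k' : CoordChange N := ⟨t, isUnit_of_map_eval0 hX0⟩ with hk'
      refine ⟨k', ?_, fun i => rfl⟩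
      have : k' = k * (k⁻¹ * k') := by group
      rw [this]
      refine hmul _ _ hk (hs _ _ s (eq_colMat fun i j hj => ?_))
      change pd i ((k⁻¹ * k').comp j) = _
      have e : (k⁻¹ * k').comp j = coord j := by
        have e1 : k'.comp j = k.comp j := by
          rw [hke]
          change (if j ∈ insert s S then g'.comp j else coord j) = _
          simp [hj]
        rw [mul_comp, e1, ← mul_comp, inv_mul_cancel]
        rfl
      rw [e, pd_coord]
  obtain ⟨k, hk, hke⟩ := key Finset.univ
  have : k = g' := toSubst_injective (Subst.ext fun i => by rw [hke]; simp)
  rw [hg]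
  exact hmul _ _ (hc _ _ h0) (this ▸ hk)

end Simple

theorem skew_eq_zero {m : Mat N N} (h : mᵀ = m) : skew m = 0 := by
  rw [skew, h, sub_self]

theorem skew_add (m n : Mat N N) : skew (m + n) = skew m + skew n := by
  rw [skew, skew, skew, Matrix.transpose_add]; abel

theorem skew_sub (m n : Mat N N) : skew (m - n) = skew m - skew n := by
  rw [skew, skew, skew, Matrix.transpose_sub]; abel

theorem skew_pull2 (g : CoordChange N) (m : Mat N N) :
    skew (pull2 g m) = pull2 g (skew m) := by
  have : (pull2 g m)ᵀ = pull2 g mᵀ := by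
    change (g.jac * m.map g.pull * g.jacᵀ)ᵀ = g.jac * mᵀ.map g.pull * g.jacᵀ
    rw [Matrix.transpose_mul, Matrix.transpose_mul, Matrix.transpose_transpose, Matrix.transpose_map, Matrix.mul_assoc]
  rw [skew, skew, this, map_sub]

theorem extD2_add (ω ω' : Mat N N) (i j k : Fin N) :
    extD2 (ω + ω') i j k = extD2 ω i j k + extD2 ω' i j k := by
  simp only [extD2, Matrix.add_apply, map_add]; ring

theorem extD2_sub (ω ω' : Mat N N) (i j k : Fin N) :
    extD2 (ω - ω') i j k = extD2 ω i j k - extD2 ω' i j k := by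
  simp only [extD2, Matrix.sub_apply, map_sub]; ring

/-- The coefficients of a composition, as `2`-forms. -/
theorem skew_mMat_compH (x y : HGroup N M) (h h' : Mat N N) :
    skew (mMat (x * y) (compH x y h h')) = skew (mMat x h) + pull2 x.right (skew (mMat y h'))
      + skew (traceTensor (tangentPart N M) x y - traceTensor (bundlePart N M) x y) := by
  rw [mMat_compH, add_sub_assoc, skew_add, skew_add, skew_pull2]

/-- Every element of the group is the data of an endomorphism, and the exterior derivative of the skew symmetric
part of its coefficient matrix is the difference of the Chern-Simons forms. -/
theorem exists_isForm_all (x : HGroup N M) : ∃ (F : Fock N M →ₗ[ℂ] Fock N M) (h : Mat N N),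
    IsForm F x h ∧ ∀ i j k, extD2 (skew (mMat x h)) i j k = csForm x.left i j k - csForm (jacGL x.right) i j k := by
  set Q : HGroup N M → Prop := fun x => ∃ (F : Fock N M →ₗ[ℂ] Fock N M) (h : Mat N N),
    IsForm F x h ∧ ∀ i j k, extD2 (skew (mMat x h)) i j k = csForm x.left i j k - csForm (jacGL x.right) i j k with hQ
  have hgen : ∀ x y : HGroup N M, IsSimple y.left → IsSimple (jacGL y.right) →
      (∃ (F : Fock N M →ₗ[ℂ] Fock N M) (h : Mat N N), IsForm F y h ∧ (mMat y h)ᵀ = mMat y h) →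
      Q x → Q (x * y) := by
    rintro x y h1 h2 ⟨G, h', hG, hs⟩ ⟨F, h, hF, hd⟩
    refine ⟨_, _, hF.comp hG, fun i j k => ?_⟩
    rw [skew_mMat_compH, skew_eq_zero hs, map_zero, add_zero, extD2_add, hd, skew_sub, extD2_sub, traceTensor_eq,
      traceTensor_eq, extD2_skew_traceForm, extD2_skew_traceForm]
    change _ + (csForm (pullGL N N x.right (jacGL y.right)) i j k - csForm (jacGL x.right * _) i j k + _
      - (csForm (pullGL N M x.right y.left) i j k - csForm (x.left * _) i j k + _)) = _
    rw [h1.csForm_eq_zero, h2.csForm_eq_zero]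
    have : jacGL (x * y).right = jacGL x.right * pullGL N N x.right (jacGL y.right) :=
      Units.ext (jac_mul x.right y.right)
    rw [this, SemidirectProduct.mul_left]
    change csForm x.left i j k - csForm (jacGL x.right) i j k
      + (0 - csForm (jacGL x.right * pullGL N N x.right (jacGL y.right)) i j k + csForm (jacGL x.right) i j k
        - (0 - csForm (x.left * pullGL N M x.right y.left) i j k + csForm x.left i j k)) = _
    ring
  have h0 : ∀ m n, (mMat (m : HGroup N M) (n : Mat N N) = 0) → (mMat m n)ᵀ = mMat m n :=
    fun m n h => by rw [h, Matrix.transpose_zero]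
  have hl : ∀ A : GL (Fin M) (Ohat N), ∀ x, Q x → Q (x * SemidirectProduct.inl A) := by
    refine gl_induction (fun A B hA hB x hx => ?_) (fun c x => ?_) fun A w s hA x => ?_
    · rw [map_mul, ← mul_assoc]; exact hB _ (hA _ hx)
    · refine hgen _ _ (Or.inl ⟨c, rfl⟩) (by change IsSimple (jacGL 1); rw [jacGL_one]; exact isSimple_one) ?_
      obtain ⟨F, hF⟩ := exists_isForm_of_const (x := (SemidirectProduct.inl (constGL c) : HGroup N M))
        (fun k i j => by
          change pd k ((jacGL 1)⁻¹.1 i j) = 0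
          rw [jacGL_one, inv_one]; exact pd_one_apply _ _ _) (pd_inv_constGL c)
      exact ⟨F, 0, hF, h0 _ _ (Matrix.zero_mul _)⟩
    · refine hgen _ _ (Or.inr ⟨w, s, hA⟩) (by change IsSimple (jacGL 1); rw [jacGL_one]; exact isSimple_one) ?_
      exact exists_isForm_colMat_left rfl hA
  have hr : ∀ g : CoordChange N, ∀ x, Q x → Q (x * SemidirectProduct.inr g) := by
    refine coordChange_induction (fun A B hA hB x hx => ?_) (fun g c hg x => ?_) fun g w s hg x => ?_
    · rw [map_mul, ← mul_assoc]; exact hB _ (hA _ hx)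
    · refine hgen _ _ isSimple_one (Or.inl ⟨c, hg⟩) ?_
      obtain ⟨F, hF⟩ := exists_isForm_of_const (x := (SemidirectProduct.inr g : HGroup N M))
        (fun k i j => by
          change pd k ((jacGL g)⁻¹.1 i j) = 0
          rw [hg]; exact pd_inv_constGL c _ _ _)
        (fun k p q => by
          change pd k ((1 : GL (Fin M) (Ohat N))⁻¹.1 p q) = 0
          rw [inv_one]; exact pd_one_apply _ _ _)
      exact ⟨F, 0, hF, h0 _ _ (Matrix.zero_mul _)⟩
    · exact hgen _ _ isSimple_one (Or.inr ⟨w, s, hg⟩) (exists_isForm_colMat_right rfl hg)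
  have h1 : Q 1 := by
    obtain ⟨F, hF⟩ := exists_isForm_one (M := M) (zero_mem (Omega2cl N))
    refine ⟨F, 0, hF, fun i j k => ?_⟩
    change _ = csForm (1 : GL (Fin M) (Ohat N)) i j k - csForm (jacGL 1) i j k
    rw [jacGL_one, csForm_of_const (fun k p q => pd_one_apply k p q), csForm_of_const (fun k p q => pd_one_apply k p q),
      mMat, Matrix.zero_mul, skew_eq_zero Matrix.transpose_zero]
    simp [extD2]
  have := hr x.right _ (hl x.left _ h1)
  rwa [one_mul, SemidirectProduct.inl_left_mul_inr_right] at this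

/-! ### The group of admissible automorphisms -/

theorem leftForm_one {r : ℕ} (m : Fin N) : leftForm (1 : GL (Fin r) (Ohat N)) m = 0 := by
  change _ * (1 : Mat r N).map (pd m) = 0
  rw [map_one_derivation, Matrix.mul_zero]

theorem rightForm_one {r : ℕ} (m : Fin N) : rightForm (1 : GL (Fin r) (Ohat N)) m = 0 := by
  change (1 : Mat r N).map (pd m) * _ = 0
  rw [map_one_derivation, Matrix.zero_mul]

section Trace

variable {r : ℕ} (ρ : CrossedHom N M r) (x : HGroup N M) {y : HGroup N M}

theorem crossedHom_one : ρ.toFun 1 = 1 := by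
  have := ρ.map_mul 1 1
  rwa [mul_one, SemidirectProduct.one_right, map_one, MulAut.one_apply, left_eq_mul] at this

theorem traceTensor_eq_zero_left (hy : ρ.toFun y = 1) : traceTensor ρ y x = 0 := by
  ext m n
  rw [traceTensor_eq, hy]
  change Matrix.trace (leftForm 1 m * _) = 0
  rw [leftForm_one, Matrix.zero_mul, Matrix.trace_zero]

theorem traceTensor_eq_zero_right (hy : ρ.toFun y = 1) : traceTensor ρ x y = 0 := by
  ext m n
  rw [traceTensor_eq, hy, map_one]
  change Matrix.trace (_ * rightForm 1 n) = 0
  rw [rightForm_one, Matrix.mul_zero, Matrix.trace_zero]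

end Trace

theorem mMat_injective (x : HGroup N M) : Function.Injective (mMat x) := by
  intro h h' e
  have e2 := congrArg (· * (jacGL x.right)⁻¹.1ᵀ) e
  simp only [mMat, Matrix.mul_assoc, ← Matrix.transpose_mul, inv_mul_jac, Matrix.transpose_one, Matrix.mul_one] at e2
  exact e2

theorem mMat_one (h : Mat N N) : mMat (1 : HGroup N M) h = h := by
  change h * (1 : CoordChange N).jacᵀ = h
  rw [jac_one, Matrix.transpose_one, Matrix.mul_one]

theorem mMat_compH_one_left (x : HGroup N M) (h h' : Mat N N) :
    mMat (1 * x) (compH 1 x h h') = h + mMat x h' := by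
  rw [mMat_compH, traceTensor_eq_zero_left _ _ (crossedHom_one _), traceTensor_eq_zero_left _ _ (crossedHom_one _),
    mMat_one, SemidirectProduct.one_right, pull2_one, add_zero, sub_zero]

theorem mMat_compH_one_right (x : HGroup N M) (h h' : Mat N N) :
    mMat (x * 1) (compH x 1 h h') = mMat x h + pull2 x.right h' := by
  rw [mMat_compH, traceTensor_eq_zero_right _ _ (crossedHom_one _), traceTensor_eq_zero_right _ _ (crossedHom_one _),
    mMat_one, add_zero, sub_zero]

theorem compH_one (h h' : Mat N N) : compH (1 : HGroup N M) 1 h h' = h + h' := by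
  have := mMat_compH_one_left (1 : HGroup N M) h h'
  rwa [mMat_one, mul_one, mMat_one] at this

theorem isForm_id : IsForm (LinearMap.id : Fock N M →ₗ[ℂ] Fock N M) 1 0 where
  isVHom := IsVHom.id
  map_fn f := by rw [SemidirectProduct.one_right, pull_one]; rfl
  map_a i := by
    have e : bunMat (1 : HGroup N M) i = 0 := bunMat_of_left (fun k p q => by
      rw [SemidirectProduct.one_left, inv_one]; exact pd_one_apply _ _ _) i
    rw [e, SemidirectProduct.one_right, jacGL_one, inv_one]
    change a i = curA _ - curP 0 + curH 0
    rw [curP_zero, curH_zero, sub_zero, add_zero, curA, sum_eq_single i]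
    · change a i = a i * fn ((1 : Mat N N) i i)
      rw [Matrix.one_apply_eq, fn_one, mul_one]
    · intro k _ hk
      change a k * fn ((1 : Mat N N) i k) = 0
      rw [Matrix.one_apply_ne hk.symm, fn_zero, mul_zero]
    · simp
  map_phi i := by
    rw [linPhi, sum_eq_single i]
    · change phi i = phi i * fn ((1 : Mat M N) i i)
      rw [Matrix.one_apply_eq, fn_one, mul_one]
    · intro k _ hk
      change phi k * fn ((1 : Mat M N) k i) = 0
      rw [Matrix.one_apply_ne hk, fn_zero, mul_zero]
    · simp
  map_psi i := by
    rw [SemidirectProduct.one_left, inv_one, linPsi, sum_eq_single i]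
    · change psi i = psi i * fn ((1 : Mat M N) i i)
      rw [Matrix.one_apply_eq, fn_one, mul_one]
    · intro k _ hk
      change psi k * fn ((1 : Mat M N) i k) = 0
      rw [Matrix.one_apply_ne hk.symm, fn_zero, mul_zero]
    · simp

theorem exists_form_inv {F : Fock N M →ₗ[ℂ] Fock N M} {x : HGroup N M} (hx : x = 1)
    {h : Mat N N} (hF : IsForm F x h) :
    ∃ K : Fock N M →ₗ[ℂ] Fock N M, IsForm K 1 (-h) ∧ F ∘ₗ K = LinearMap.id ∧ K ∘ₗ F = LinearMap.id := by
  subst hx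
  obtain ⟨K, hK⟩ := exists_isForm_one (M := M) (neg_mem hF.mem_Omega2cl)
  refine ⟨K, hK, ?_, ?_⟩
  · have := hF.comp hK
    rw [compH_one, add_neg_cancel, mul_one] at this
    exact isForm_ext this isForm_id
  · have := hK.comp hF
    rw [compH_one, neg_add_cancel, mul_one] at this
    exact isForm_ext this isForm_id

theorem IsForm.bijective {F : Fock N M →ₗ[ℂ] Fock N M} {x : HGroup N M}
    {h : Mat N N} (hF : IsForm F x h) : Function.Bijective F := by
  obtain ⟨G, h', hG, -⟩ := exists_isForm_all x⁻¹
  obtain ⟨K, -, hK, -⟩ := exists_form_inv (mul_inv_cancel x) (hF.comp hG)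
  obtain ⟨K', -, -, hK'⟩ := exists_form_inv (inv_mul_cancel x) (hG.comp hF)
  refine ⟨fun u v e => ?_, fun u => ⟨G (K u), congrArg (· u) hK⟩⟩
  have e2 := congrArg (fun w => K' (G w)) e
  exact (congrArg (· u) hK').symm.trans (e2.trans (congrArg (· v) hK'))

theorem IsForm.exists_vertexAut {F : Fock N M →ₗ[ℂ] Fock N M} {x : HGroup N M}
    {h : Mat N N} (hF : IsForm F x h) : ∃ F' : vertexAut N M, HasForm F' x h := by
  refine ⟨⟨LinearEquiv.ofBijective F hF.bijective, hF.isVHom.map_one, hF.isVHom.map_parity, hF.isVHom.map_mode⟩,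
    (isForm_iff _ x h).mp ?_⟩
  exact hF

/-- Two endomorphisms over the same element differ by a closed form. -/
theorem IsForm.sub_mem {F F' : Fock N M →ₗ[ℂ] Fock N M} {x : HGroup N M}
    {h h' : Mat N N} (hF : IsForm F x h) (hF' : IsForm F' x h') :
    mMat x h - mMat x h' ∈ Omega2cl N := by
  obtain ⟨G, k, hG, -⟩ := exists_isForm_all x⁻¹
  have e : ∀ {x : HGroup N M} {F : Fock N M →ₗ[ℂ] Fock N M} {h : Mat N N},
      x = 1 → IsForm F x h → mMat x h ∈ Omega2cl N := by
    rintro x F h rfl hF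
    rw [mMat_one]; exact hF.mem_Omega2cl
  have e1 := Submodule.sub_mem _ (e (mul_inv_cancel x) (hF.comp hG)) (e (mul_inv_cancel x) (hF'.comp hG))
  rw [mMat_compH, mMat_compH] at e1
  convert e1 using 1
  abel

theorem linPhi_injective {A A' : Fin M → Ohat N} (h : (linPhi A : Fock N M) = linPhi A') : A = A' := by
  have e : ∀ (A : Fin M → Ohat N) j, dL (FerGen.phi j 0) (linPhi A : Fock N M) = fn (A j) := by
    intro A j
    simp only [linPhi, map_sum, dL_phi_phi_mul, dL_fn, mul_zero, neg_zero, zero_add]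
    simp
  funext j
  exact fn_injective (by rw [← e A j, h, e])

theorem _root_.ChiralDO.HasForm.unique {F : vertexAut N M} {x x' : HGroup N M} {h h' : Mat N N}
    (hF : HasForm F x h) (hF' : HasForm F x' h') : x = x' ∧ h = h' := by
  have hx : x = x' := by
    refine SemidirectProduct.ext (Units.ext ?_) (toSubst_injective (Subst.ext fun i => ?_))
    · ext i j
      exact congrFun (linPhi_injective (((hF.map_phi j).symm.trans (hF'.map_phi j) : _) :
        (linPhi (fun k => x.left.1 k j) : Fock N M) = linPhi fun k => x'.left.1 k j)) i
    · rw [← Subst.pull_coord, ← Subst.pull_coord]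
      exact fn_injective ((hF.map_fn (coord i)).symm.trans (hF'.map_fn (coord i)))
  subst hx
  refine ⟨rfl, ?_⟩
  ext m i
  have e := (((isForm_iff F x h).mpr hF).map_a i).symm.trans (((isForm_iff F x h').mpr hF').map_a i)
  rw [current, current, add_right_inj, ← sub_eq_zero, ← curH_sub] at e
  exact sub_eq_zero.mp (curH_eq_zero e m)

theorem _root_.ChiralDO.HasForm.mul {F G : vertexAut N M} {x y : HGroup N M} {h h' : Mat N N}
    (hF : HasForm F x h) (hG : HasForm G y h') : HasForm (F * G) (x * y) (compH x y h h') :=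
  (isForm_iff _ _ _).mp (((isForm_iff F x h).mpr hF).comp ((isForm_iff G y h').mpr hG))

theorem _root_.ChiralDO.HasForm.ext {F G : vertexAut N M} {x : HGroup N M} {h : Mat N N}
    (hF : HasForm F x h) (hG : HasForm G x h) : F = G := by
  have e := isForm_ext ((isForm_iff F x h).mpr hF) ((isForm_iff G x h).mpr hG)
  exact Subtype.ext (LinearEquiv.ext fun u => congrArg (· u) e)

theorem hasForm_one : HasForm (1 : vertexAut N M) 1 0 := (isForm_iff _ _ _).mp isForm_id

/-- The group of admissible automorphisms. -/
def admissible (N M : ℕ) : Subgroup (vertexAut N M) where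
  carrier := {F | IsAdmissible F}
  one_mem' := ⟨1, 0, hasForm_one⟩
  mul_mem' := fun ⟨_, _, hF⟩ ⟨_, _, hG⟩ => ⟨_, _, hF.mul hG⟩
  inv_mem' := by
    rintro F ⟨x, h, hF⟩
    obtain ⟨G₀, h', hG₀, -⟩ := exists_isForm_all x⁻¹
    obtain ⟨G, hG⟩ := hG₀.exists_vertexAut
    have h1 := hF.mul hG
    rw [mul_inv_cancel] at h1
    obtain ⟨K₀, hK₀, -⟩ := exists_form_inv rfl ((isForm_iff _ _ _).mpr h1)
    obtain ⟨K, hK⟩ := hK₀.exists_vertexAut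
    have h2 := h1.mul hK
    rw [compH_one, add_neg_cancel, mul_one] at h2
    rw [inv_eq_of_mul_eq_one_right (b := G * K) (by rw [← mul_assoc]; exact h2.ext hasForm_one)]
    exact ⟨_, _, hG.mul hK⟩

theorem mem_admissible {F : vertexAut N M} : F ∈ admissible N M ↔ IsAdmissible F := Iff.rfl

/-- The element of the group over which an admissible automorphism lies. -/
def baseOf (F : admissible N M) : HGroup N M := (mem_admissible.mp F.2).choose

/-- The functions `h` of an admissible automorphism. -/
def coeffOf (F : admissible N M) : Mat N N :=
  (mem_admissible.mp F.2).choose_spec.choose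

theorem hasForm_baseOf (F : admissible N M) : HasForm F.1 (baseOf F) (coeffOf F) :=
  (mem_admissible.mp F.2).choose_spec.choose_spec

theorem exists_inl (ω : Omega2cl N) : ∃ F : admissible N M, HasForm F.1 1 ((1 / 2 : ℂ) • ω.1) := by
  obtain ⟨F, hF⟩ := exists_isForm_one (M := M) ((Omega2cl N).smul_mem (1 / 2 : ℂ) ω.2)
  obtain ⟨F', hF'⟩ := hF.exists_vertexAut
  exact ⟨⟨F', mem_admissible.mpr ⟨_, _, hF'⟩⟩, hF'⟩

/-- The extension of the group by closed forms that is formed by the admissible automorphisms. -/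
def extension (N M : ℕ) : GroupExtension (Multiplicative (Omega2cl N)) (admissible N M) (HGroup N M) where
  inl := MonoidHom.mk' (fun ω => (exists_inl (M := M) ω.toAdd).choose) fun ω ω' => by
    have h := (exists_inl (M := M) ω.toAdd).choose_spec.mul (exists_inl (M := M) ω'.toAdd).choose_spec
    rw [compH_one, mul_one, ← smul_add] at h
    exact Subtype.ext ((exists_inl (M := M) (ω * ω').toAdd).choose_spec.ext h)
  rightHom := MonoidHom.mk' baseOf fun F G =>
    ((hasForm_baseOf (F * G)).unique ((hasForm_baseOf F).mul (hasForm_baseOf G))).1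
  inl_injective := fun ω ω' e => by
    have h := (exists_inl (M := M) ω.toAdd).choose_spec
    change (exists_inl (M := M) ω.toAdd).choose = (exists_inl (M := M) ω'.toAdd).choose at e
    rw [e] at h
    have h2 := (h.unique (exists_inl (M := M) ω'.toAdd).choose_spec).2
    exact Subtype.ext (smul_right_injective _ (by norm_num : (1 / 2 : ℂ) ≠ 0) h2)
  range_inl_eq_ker_rightHom := by
    ext F
    constructor
    · rintro ⟨ω, rfl⟩
      exact ((hasForm_baseOf _).unique (exists_inl (M := M) ω.toAdd).choose_spec).1
    · intro hF
      have h := hasForm_baseOf F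
      rw [show baseOf F = 1 from hF] at h
      refine ⟨Multiplicative.ofAdd ⟨(2 : ℂ) • coeffOf F,
        (Omega2cl N).smul_mem _ ((isForm_iff _ _ _).mpr h).mem_Omega2cl⟩, Subtype.ext ?_⟩
      refine HasForm.ext (exists_inl (M := M) _).choose_spec ?_
      rw [toAdd_ofAdd, smul_smul]
      norm_num
      exact h
  rightHom_surjective := fun x => by
    obtain ⟨F₀, h, hF₀, -⟩ := exists_isForm_all x
    obtain ⟨F, hF⟩ := hF₀.exists_vertexAut
    have hm : F ∈ admissible N M := ⟨x, h, hF⟩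
    exact ⟨⟨F, hm⟩, ((hasForm_baseOf ⟨F, hm⟩).unique hF).1⟩

theorem hasForm_inl (ω : Omega2cl N) :
    HasForm ((extension N M).inl (Multiplicative.ofAdd ω)).1 1 ((1 / 2 : ℂ) • ω.1) :=
  (exists_inl (M := M) ω).choose_spec

theorem rightHom_eq {F : admissible N M} {x : HGroup N M} {h : Mat N N}
    (hF : HasForm F.1 x h) : (extension N M).rightHom F = x := ((hasForm_baseOf F).unique hF).1

theorem admissible_ext {F G : admissible N M} {x : HGroup N M} {h h' : Mat N N}
    (hF : HasForm F.1 x h) (hG : HasForm G.1 x h') (e : mMat x h = mMat x h') : F = G :=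
  Subtype.ext (hF.ext (mMat_injective x e ▸ hG))

theorem conj_inl (F : admissible N M) (ω : Omega2cl N) : F * (extension N M).inl (Multiplicative.ofAdd ω) * F⁻¹
    = (extension N M).inl (Multiplicative.ofAdd (rho2cl N M ((extension N M).rightHom F) ω)) := by
  rw [mul_inv_eq_iff_eq_mul]
  set x := baseOf F
  have h1 := (hasForm_baseOf F).mul (hasForm_inl (M := M) ω)
  have h2 := (hasForm_inl (rho2cl N M ((extension N M).rightHom F) ω)).mul (hasForm_baseOf F)
  have e1 := mMat_compH_one_right (baseOf F) (coeffOf F) ((1 / 2 : ℂ) • ω.1)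
  have e2 := mMat_compH_one_left (baseOf F)
    ((1 / 2 : ℂ) • (rho2cl N M ((extension N M).rightHom F) ω).1) (coeffOf F)
  rw [mul_one] at h1 e1
  rw [one_mul] at h2 e2
  refine admissible_ext h1 h2 (e1.trans (Eq.trans ?_ e2.symm))
  rw [map_smul, add_comm]
  rfl

/-! ### The cohomology class of the extension -/

theorem skew_of_mem {ω : Mat N N} (h : ω ∈ Omega2 N) : skew ω = (2 : ℂ) • ω := by
  ext i j
  rw [skew, Matrix.sub_apply, Matrix.transpose_apply, h j i, sub_neg_eq_add, Matrix.smul_apply, two_smul]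

theorem skew_mem (m : Mat N N) : skew m ∈ Omega2 N := fun i j => by
  rw [skew, Matrix.sub_apply, Matrix.sub_apply, Matrix.transpose_apply, Matrix.transpose_apply, neg_sub]

/-- The group coboundary of a `1`-cochain. -/
def coboundary (κ : HGroup N M → Mat N N) (x y : HGroup N M) :
    Mat N N := pull2 x.right (κ y) - κ (x * y) + κ x

/-- The group cocycle condition. -/
def IsCocycle (f : HGroup N M → HGroup N M → Mat N N) : Prop :=
  ∀ x y z, f (x * y) z + f x y = pull2 x.right (f y z) + f x (y * z)

theorem isCocycle_coboundary (κ : HGroup N M → Mat N N) : IsCocycle (coboundary κ) := by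
  intro x y z
  simp only [coboundary, map_add, map_sub, mul_assoc, SemidirectProduct.mul_right, pull2_mul]
  abel

theorem IsCocycle.add {f f' : HGroup N M → HGroup N M → Mat N N} (h : IsCocycle f)
    (h' : IsCocycle f') : IsCocycle fun x y => f x y + f' x y := fun x y z => by
  rw [map_add, add_add_add_comm, h, h', add_add_add_comm]

theorem IsCocycle.smul {f : HGroup N M → HGroup N M → Mat N N} (h : IsCocycle f) (c : ℂ) :
    IsCocycle fun x y => c • f x y := fun x y z => by
  rw [map_smul, ← smul_add, h, smul_add]

theorem isCocycle_skew {r : ℕ} (ρ : CrossedHom N M r) : IsCocycle fun x y => skew (traceTensor ρ x y) :=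
  fun x y z => by rw [← skew_pull2, ← skew_add, ← skew_add, traceTensor_cocycle]

/-- The difference of the trace cocycles of the tangent part and of the bundle part. -/
def epsilon (x y : HGroup N M) : Mat N N :=
  skew (traceTensor (tangentPart N M) x y - traceTensor (bundlePart N M) x y)

theorem isCocycle_epsilon : IsCocycle (epsilon (N := N) (M := M)) := by
  have h := (isCocycle_skew (tangentPart N M)).add ((isCocycle_skew (bundlePart N M)).smul (-1))
  intro x y z
  have := h x y z
  simp only [epsilon, skew_sub]
  simpa only [sub_eq_add_neg, neg_one_smul] using this

/-- A cocycle with closed values. -/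
def mkCocycle (f : HGroup N M → HGroup N M → Mat N N) (hf : ∀ x y, f x y ∈ Omega2cl N)
    (h : IsCocycle f) : groupCohomology.cocycles₂ (Om2cl N M) :=
  ⟨fun p => ⟨f p.1 p.2, hf p.1 p.2⟩,
    (groupCohomology.mem_cocycles₂_iff _).mpr fun x y z => Subtype.ext (h x y z)⟩

theorem H2π_eq_of_coboundary {z z' : groupCohomology.cocycles₂ (Om2cl N M)} {β : HGroup N M → Omega2cl N}
    (h : ∀ x y, (z (x, y)).1 = (z' (x, y)).1 + coboundary (fun x => (β x).1) x y) :
    groupCohomology.H2π (Om2cl N M) z = groupCohomology.H2π (Om2cl N M) z' := by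
  rw [groupCohomology.H2π_eq_iff]
  refine ⟨β, funext fun p => Subtype.ext ?_⟩
  change _ = (z (p.1, p.2)).1 - (z' (p.1, p.2)).1
  rw [h, add_sub_cancel_left]
  rfl

/-- Comparison of an endomorphism with a composition. -/
theorem IsForm.closed {F G K : Fock N M →ₗ[ℂ] Fock N M} {x y : HGroup N M}
    {h h' k : Mat N N} (hF : IsForm F x h) (hG : IsForm G y h') (hK : IsForm K (x * y) k) :
    epsilon x y + (pull2 x.right (skew (mMat y h')) - skew (mMat (x * y) k) + skew (mMat x h))
      = (2 : ℂ) • (mMat (x * y) (compH x y h h') - mMat (x * y) k) := by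
  rw [← skew_of_mem ((hF.comp hG).sub_mem hK).1, skew_sub, skew_mMat_compH, epsilon]
  abel

theorem eq_coboundary_of_extD2 {κ κ' : HGroup N M → Omega2 N}
    (h : ∀ x i j k, extD2 (κ x).1 i j k = extD2 (κ' x).1 i j k) (x : HGroup N M) :
    (κ x).1 - (κ' x).1 ∈ Omega2cl N :=
  ⟨sub_mem (κ x).2 (κ' x).2, fun i j k => by rw [extD2_sub, h, sub_self]⟩

/-- The second Chern class is well defined. -/
theorem exists_chern2 {r : ℕ} (ρ : CrossedHom N M r) {κ : HGroup N M → Omega2 N}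
    (hκ : ∀ x i j k, extD2 (κ x).1 i j k = csForm (ρ.toFun x) i j k)
    (hcl : ∀ x y, skew (traceTensor ρ x y) - coboundary (fun x => (κ x).1) x y ∈ Omega2cl N) :
    ∃ z : groupCohomology.cocycles₂ (Om2cl N M),
      (∀ c, IsChern2 ρ c ↔ c = groupCohomology.H2π (Om2cl N M) z) ∧
      ∀ x y, (z (x, y)).1 = (1 / 2 : ℂ) • ((cup (chern1 ρ) (chern1 ρ) (x, y)).1 - skew (traceTensor ρ x y))
        + (1 / 2 : ℂ) • coboundary (fun x => (κ x).1) x y := by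
  have hc := (groupCohomology.mem_cocycles₂_iff _).mp (cup (chern1 ρ) (chern1 ρ)).2
  have hcup : IsCocycle fun x y => (cup (chern1 ρ) (chern1 ρ) (x, y)).1 :=
    fun x y z => congrArg Subtype.val (hc x y z)
  set f : HGroup N M → HGroup N M → Mat N N := fun x y =>
    (1 / 2 : ℂ) • ((cup (chern1 ρ) (chern1 ρ) (x, y)).1 - skew (traceTensor ρ x y))
        + (1 / 2 : ℂ) • coboundary (fun x => (κ x).1) x y with hf
  have h1 : IsCocycle f := by
    have h := ((hcup.add ((isCocycle_skew ρ).smul (-1))).smul (1 / 2)).add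
      ((isCocycle_coboundary fun x => (κ x).1).smul (1 / 2))
    intro x y z
    have := h x y z
    simpa only [hf, sub_eq_add_neg, neg_one_smul] using this
  have h2 : ∀ x y, f x y ∈ Omega2cl N := by
    intro x y
    have := Submodule.smul_mem _ (1 / 2 : ℂ) (Submodule.sub_mem _ (cup (chern1 ρ) (chern1 ρ) (x, y)).2 (hcl x y))
    rw [sub_sub_eq_add_sub, add_sub_right_comm, smul_add] at this
    exact this
  refine ⟨mkCocycle f h2 h1, fun c => ⟨?_, ?_⟩, fun x y => rfl⟩
  · rintro ⟨κ', z, hκ', hz, rfl⟩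
    refine H2π_eq_of_coboundary (β := fun x => ⟨(1 / 2 : ℂ) • ((κ' x).1 - (κ x).1), Submodule.smul_mem _ _
      (eq_coboundary_of_extD2 (fun x i j k => by rw [hκ, hκ']) x)⟩) fun x y => ?_
    rw [hz]
    change _ = (1 / 2 : ℂ) • (wedge (dlogDet (ρ.toFun x)) (pull1 x.right (dlogDet (ρ.toFun y))) - _) + _ + _
    simp only [coboundary, map_smul, map_sub, smul_sub, smul_add]
    abel
  · rintro rfl
    exact ⟨κ, mkCocycle f h2 h1, hκ, fun x y => rfl, rfl⟩

theorem exists_family : ∃ μ : HGroup N M → Omega2 N,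
    (∀ x i j k, extD2 (μ x).1 i j k = csForm x.left i j k - csForm (jacGL x.right) i j k) ∧
    ∀ x, ∃ (F : Fock N M →ₗ[ℂ] Fock N M) (h : Mat N N),
      IsForm F x h ∧ (μ x).1 = skew (mMat x h) := by
  choose F h hF hd using exists_isForm_all (N := N) (M := M)
  exact ⟨fun x => ⟨skew (mMat x (h x)), skew_mem _⟩, hd, fun x => ⟨F x, h x, hF x, rfl⟩⟩

end Fock

open Fock CoordChange

theorem map_sub_smul {V W : Type*} [AddCommGroup V] [Module ℂ V] [AddCommGroup W] [Module ℂ W] (L : V →ₗ[ℂ] W)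
    (u v u' v' : V) : L (u - (2 : ℂ) • v - (u' - (2 : ℂ) • v'))
      = L u - (2 : ℂ) • L v - (L u' - (2 : ℂ) • L v') := by
  simp only [map_sub, map_smul]

theorem exists_class (N M : ℕ) : ∃ γ c₂ c₂' : groupCohomology.H2 (Om2cl N M),
    (∀ c, IsChern2 (tangentPart N M) c ↔ c = c₂) ∧
    (∀ c, IsChern2 (bundlePart N M) c ↔ c = c₂') ∧
    IsExtensionClass (extension N M) γ ∧
    (∃ e : groupCohomology.cocycles₂ (Om2 N M),
      (∀ x y, (e (x, y)).1
        = skew (traceTensor (tangentPart N M) x y - traceTensor (bundlePart N M) x y)) ∧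
      H2incl N M γ = groupCohomology.H2π (Om2 N M) e) ∧
    γ = (chern1Sq (tangentPart N M) - (2 : ℂ) • c₂) - (chern1Sq (bundlePart N M) - (2 : ℂ) • c₂') := by
  obtain ⟨μ, hμ, hμF⟩ := exists_family (N := N) (M := M)
  have hcl : ∀ x y, epsilon x y + coboundary (fun x => (μ x).1) x y ∈ Omega2cl N := by
    intro x y
    obtain ⟨F, h, hF, e⟩ := hμF x
    obtain ⟨G, h', hG, e'⟩ := hμF y
    obtain ⟨K, k, hK, e''⟩ := hμF (x * y)
    rw [coboundary, e, e', e'', hF.closed hG hK]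
    exact Submodule.smul_mem _ _ ((hF.comp hG).sub_mem hK)
  set κ : HGroup N M → Omega2 N := fun x => -μ (SemidirectProduct.inr x.right) with hκ
  have hκd : ∀ x i j k, extD2 (κ x).1 i j k = csForm (jacGL x.right) i j k := by
    intro x i j k
    have e := hμ (SemidirectProduct.inr x.right) i j k
    change _ = csForm (1 : GL (Fin M) (Ohat N)) i j k - csForm (jacGL x.right) i j k at e
    rw [csForm_of_const (fun k p q => pd_one_apply k p q)] at e
    change extD2 (-(μ (SemidirectProduct.inr x.right)).1) i j k = _
    have e2 := extD2_sub 0 (μ (SemidirectProduct.inr x.right)).1 i j k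
    rw [zero_sub, e] at e2
    rw [e2]
    simp [extD2]
  have hκcl : ∀ x y, skew (traceTensor (tangentPart N M) x y) - coboundary (fun x => (κ x).1) x y ∈ Omega2cl N := by
    intro x y
    have e := hcl (SemidirectProduct.inr x.right) (SemidirectProduct.inr y.right)
    rw [epsilon, traceTensor_eq_zero_left (bundlePart N M) _ rfl, sub_zero] at e
    convert e using 1
    rw [sub_eq_add_neg, coboundary, coboundary, ← map_mul]
    change skew (traceTensor (tangentPart N M) x y) + -(pull2 x.right (-(μ (SemidirectProduct.inr y.right)).1)
      - -(μ (SemidirectProduct.inr (x.right * y.right))).1 + -(μ (SemidirectProduct.inr x.right)).1) = _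
    rw [map_neg]
    change _ = skew (traceTensor (tangentPart N M) x y) + (pull2 x.right (μ (SemidirectProduct.inr y.right)).1 - _ + _)
    abel
  obtain ⟨zt, hzt, hzt'⟩ := exists_chern2 (tangentPart N M) hκd hκcl
  have hb : ∀ x i j k, extD2 (μ x + κ x).1 i j k = csForm x.left i j k := by
    intro x i j k
    change extD2 ((μ x).1 + (κ x).1) i j k = _
    rw [extD2_add, hμ, hκd, sub_add_cancel]
  have hsum : ∀ x y, coboundary (fun x => (μ x + κ x).1) x y
      = coboundary (fun x => (μ x).1) x y + coboundary (fun x => (κ x).1) x y := by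
    intro x y
    simp only [coboundary, Submodule.coe_add, map_add]
    abel
  obtain ⟨zb, hzb, hzb'⟩ := exists_chern2 (bundlePart N M) hb fun x y => by
    have e := Submodule.sub_mem _ (hκcl x y) (hcl x y)
    convert e using 1
    rw [hsum, epsilon, skew_sub]
    abel
  set z := mkCocycle _ hcl (isCocycle_epsilon.add (isCocycle_coboundary fun x => (μ x).1)) with hz
  refine ⟨groupCohomology.H2π _ z, _, _, hzt, hzb, fun σ => ?_, ?_, ?_⟩
  · have hσ : ∀ x, HasForm (σ x).1 x (coeffOf (σ x)) := by
      intro x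
      have h := hasForm_baseOf (σ x)
      have e : baseOf (σ x) = x := σ.rightInverse_rightHom x
      rwa [e] at h
    have hσF := fun x => (isForm_iff _ _ _).mpr (hσ x)
    set ν : HGroup N M → Mat N N := fun x => skew (mMat x (coeffOf (σ x))) with hν
    have hf := fun x y => (hσF x).closed (hσF y) (hσF (x * y))
    have hfm : ∀ x y, epsilon x y + coboundary ν x y ∈ Omega2cl N := fun x y => by
      have := Submodule.smul_mem _ (2 : ℂ) (((hσF x).comp (hσF y)).sub_mem (hσF (x * y)))
      rw [← hf] at this
      exact this
    have hβ : ∀ x, ν x - (μ x).1 ∈ Omega2cl N := by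
      intro x
      obtain ⟨F, h, hF, e⟩ := hμF x
      have hm := (hσF x).sub_mem hF
      rw [e, hν, ← skew_sub, skew_of_mem hm.1]
      exact Submodule.smul_mem _ _ hm
    refine ⟨mkCocycle _ hfm (isCocycle_epsilon.add (isCocycle_coboundary ν)), fun x y => ?_, ?_⟩
    · have h1 := (hσ x).mul (hσ y)
      have h2 := (hasForm_inl (M := M) ⟨_, hfm x y⟩).mul (hσ (x * y))
      have e2 := mMat_compH_one_left (x * y) ((1 / 2 : ℂ) • (epsilon x y + coboundary ν x y)) (coeffOf (σ (x * y)))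
      rw [one_mul] at h2 e2
      refine admissible_ext h1 h2 (Eq.trans ?_ e2.symm)
      have e3 : epsilon x y + coboundary ν x y = _ := hf x y
      rw [e3, smul_smul]
      norm_num
    · refine H2π_eq_of_coboundary (β := fun x => ⟨_, hβ x⟩) fun x y => ?_
      change epsilon x y + coboundary ν x y = epsilon x y + coboundary (fun x => (μ x).1) x y + _
      simp only [coboundary, map_sub]
      abel
  · refine ⟨⟨fun p => ⟨epsilon p.1 p.2, skew_mem _⟩, (groupCohomology.mem_cocycles₂_iff _).mpr fun x y z =>
      Subtype.ext (isCocycle_epsilon x y z)⟩, fun x y => rfl, ?_⟩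
    rw [H2incl, groupCohomology.H2π_comp_map_apply, groupCohomology.H2π_eq_iff]
    refine ⟨μ, funext fun p => Subtype.ext ?_⟩
    change coboundary (fun x => (μ x).1) p.1 p.2 = (epsilon p.1 p.2 + coboundary (fun x => (μ x).1) p.1 p.2)
      - epsilon p.1 p.2
    rw [add_sub_cancel_left]
  · have e : z = (cup (chern1 (tangentPart N M)) (chern1 (tangentPart N M)) - (2 : ℂ) • zt)
        - (cup (chern1 (bundlePart N M)) (chern1 (bundlePart N M)) - (2 : ℂ) • zb) := by
      refine Subtype.ext (funext fun p => Subtype.ext ?_)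
      change epsilon p.1 p.2 + coboundary (fun x => (μ x).1) p.1 p.2
        = ((cup (chern1 (tangentPart N M)) (chern1 (tangentPart N M)) (p.1, p.2)).1 - (2 : ℂ) • (zt (p.1, p.2)).1)
        - ((cup (chern1 (bundlePart N M)) (chern1 (bundlePart N M)) (p.1, p.2)).1 - (2 : ℂ) • (zb (p.1, p.2)).1)
      rw [hzt', hzb', hsum, epsilon, skew_sub]
      simp only [smul_add, smul_sub, smul_smul]
      norm_num
      abel
    exact (congrArg _ e).trans (map_sub_smul (groupCohomology.H2π (Om2cl N M)).hom _ _ _ _)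

end ChiralDO

end

open ChiralDO in
theorem proposition7p3 (N M : ℕ) (hN : 1 ≤ N) :
    ∃ (Ht : Subgroup (vertexAut N M))
      (S : GroupExtension (Multiplicative (Omega2cl N)) Ht (HGroup N M))
      (γ c₂ c₂' : groupCohomology.H2 (Om2cl N M)),
      (∀ F : vertexAut N M, F ∈ Ht ↔ IsAdmissible F) ∧
      (∀ (F : Ht) (x : HGroup N M) (h : Matrix (Fin N) (Fin N) (Ohat N)),
        HasForm F.1 x h → S.rightHom F = x) ∧
      (∀ ω : Omega2cl N, HasForm (S.inl (Multiplicative.ofAdd ω)).1 1 ((1 / 2 : ℂ) • ω.1)) ∧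
      (∀ (F : Ht) (ω : Omega2cl N),
        F * S.inl (Multiplicative.ofAdd ω) * F⁻¹
          = S.inl (Multiplicative.ofAdd (rho2cl N M (S.rightHom F) ω))) ∧
      (∀ c, IsChern2 (tangentPart N M) c ↔ c = c₂) ∧
      (∀ c, IsChern2 (bundlePart N M) c ↔ c = c₂') ∧
      IsExtensionClass S γ ∧
      (∃ e : groupCohomology.cocycles₂ (Om2 N M),
        (∀ x y, (e (x, y)).1
          = skew (traceTensor (tangentPart N M) x y - traceTensor (bundlePart N M) x y)) ∧
        H2incl N M γ = groupCohomology.H2π (Om2 N M) e) ∧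
      γ = (chern1Sq (tangentPart N M) - (2 : ℂ) • c₂)
        - (chern1Sq (bundlePart N M) - (2 : ℂ) • c₂') := by
  obtain ⟨γ, c₂, c₂', h₁, h₂, h₃, h₄, h₅⟩ := exists_class N M
  exact ⟨Fock.admissible N M, Fock.extension N M, γ, c₂, c₂', fun _ => Fock.mem_admissible,
    fun _ _ _ => Fock.rightHom_eq, Fock.hasForm_inl, Fock.conj_inl, h₁, h₂, h₃, h₄, h₅⟩
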